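/- Let $\Sigma$ be a compact connected Riemann surface, $P\subset\Sigma$ a finite set of punctures and $\Sigma_0=\Sigma\setminus P$; assume that the universal covering of $\Sigma_0$ is the unit disk (i.e. $2g-2+n>0$). Let $\Sigma_0$ carry a projective structure (an atlas of complex coordinates, holomorphic for the complex structure, with Möbius transition functions) which is regular at every puncture: if $z$ is a complex coordinate of $\Sigma$ at $p\in P$ with $z(p)=0$ and $S$ denotes the Schwarzian derivative, then $T(z)=S(u,z)$, where $u$ is any projective coordinate, has a pole of order at most two at $z=0$. A projective disk is a map $u:D\to\Sigma_0$ of the open unit disk which is given locally by Möbius functions in projective coordinates, considered up to projective automorphisms of $D$. The set ${\cal D}_\Sigma$ of projective disks is ordered by $u_1\le u_2$ if $u_1=u_2\circ f$ for some Möbius map $f:D\to D$, and carries the quotient of the compact-open topology; ${\cal D}_\Sigma^{max}\subset{\cal D}_\Sigma$ is the subspace of maximal disks. Assume that every maximal disk $u$ extends to a continuous map $\overline u:\overline D\to\Sigma$. One says that $u$ leans on the punctures at the points of $\overline u^{-1}(P)\subset\partial D$; their number is the number of times that $u$ leans on the punctures. Then: (1) Every maximal disk leans on the punctures a finite number of times,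 at least twice. (2) There are a finite graph $G$ with a fat graph structure (a cyclic order of the ends of edges at each vertex) and a homeomorphism of $G$ onto ${\cal D}_\Sigma^{max}$ such that the vertices of $G$ correspond exactly to the maximal disks that lean on the punctures at least three times, and such that for each vertex, represented by $u$, there is a bijection from the ends of edges $d$ at that vertex to the points $a_d\in\overline u^{-1}(P)$ which carries the cyclic order of the ends of edges to the counterclockwise cyclic order of $\overline u^{-1}(P)$ on the unit circle. This bijection is the geometric one: if $d'$ is the end following $d$ in the cyclic order, then the disks on the edge end $d$, as they tend to the vertex, are represented by maps tending to $u$ that lean on the punctures at exactly two points, one tending to $a_d$ and the other to $a_{d'}$. (3) This fat graph structure is canonical: for any two fat graphs with homeomorphisms onto ${\cal D}_\Sigma^{max}$ as in (2) there is an isomorphism of the fat graphs (a bijection of the ends of edges that preserves the edges and the cyclic orders) such that corresponding ends of edges have the same image in ${\cal D}_\Sigma^{max}$ near the vertex. -/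

import Mathlib

open Filter Topology
open scoped Manifold ContDiff Complex.UnitDisc

noncomputable section

namespace ProjSurf

/-! ### Möbius relations and projective structures -/

/-- `w` is the finite value at `z` of the Möbius function
`z ↦ (a z + b) / (c z + d)` given by the invertible matrix `A = (a b; c d)`. -/
def MoebiusRel (A : GL (Fin 2) ℂ) (z w : ℂ) : Prop :=
  A 1 0 * z + A 1 1 ≠ 0 ∧ w = (A 0 0 * z + A 0 1) / (A 1 0 * z + A 1 1)

/-- A projective structure on the complement of a set `P` (the punctures) in a Riemann surface `S`,
inducing the given complex structure there: complex coordinates, holomorphic for the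
complex structure, whose domains cover the complement of `P`, with (locally) Möbius
transition functions. -/
structure ProjectiveStructure (S : Type*) [TopologicalSpace S] [ChartedSpace ℂ S] (P : Set S) where
  charts : Set (OpenPartialHomeomorph S ℂ)
  holomorphic : ∀ e ∈ charts, e ∈ IsManifold.maximalAtlas 𝓘(ℂ) ω S
  source_subset : ∀ e ∈ charts, e.source ⊆ Pᶜ
  cover : ∀ x ∈ Pᶜ, ∃ e ∈ charts, x ∈ e.source
  moebius : ∀ e ∈ charts, ∀ e' ∈ charts, ∀ x ∈ e.source ∩ e'.source,
    ∃ A : GL (Fin 2) ℂ, ∀ᶠ y in 𝓝 x, MoebiusRel A (e y) (e' y)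

/-- The Schwarzian derivative `f''' / f' - (3/2) (f'')² / (f')²`. -/
def schwarzian (f : ℂ → ℂ) (z : ℂ) : ℂ :=
  iteratedDeriv 3 f z / deriv f z - 3 / 2 * (iteratedDeriv 2 f z) ^ 2 / (deriv f z) ^ 2

/-- The complement of `P` in the Riemann surface `S` has the unit disk as its universal covering:
there is a holomorphic covering of it by the unit disk. (For a compact connected surface of
genus `g` with `n` punctures this says `2 g - 2 + n > 0`.) -/
def UniformizedByDisk (S : Type*) [TopologicalSpace S] [ChartedSpace ℂ S] (P : Set S) : Prop :=
  ∃ π : ℂ → S, MDifferentiableOn 𝓘(ℂ) 𝓘(ℂ) π (Metric.ball 0 1) ∧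
    Set.range (fun w : 𝔻 => π w) = Pᶜ ∧ IsCoveringMapOn (fun w : 𝔻 => π w) Pᶜ

/-- A self-map of the unit disk which is projective, i.e. given by a Möbius function. -/
def IsMoebius (f : 𝔻 → 𝔻) : Prop :=
  ∃ A : GL (Fin 2) ℂ, ∀ w : 𝔻, MoebiusRel A w (f w)

theorem IsMoebius.id : IsMoebius (fun w => w) :=
  ⟨1, fun w => by simp [MoebiusRel]⟩

theorem IsMoebius.comp {f g : 𝔻 → 𝔻} (hf : IsMoebius f) (hg : IsMoebius g) :
    IsMoebius (fun w => f (g w)) := by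
  obtain ⟨A, hA⟩ := hf
  obtain ⟨B, hB⟩ := hg
  refine ⟨A * B, fun w => ?_⟩
  obtain ⟨h1, h2⟩ := hB w
  obtain ⟨h3, h4⟩ := hA (g w)
  have e1 : (g w : ℂ) * (B 1 0 * w + B 1 1) = B 0 0 * w + B 0 1 := by
    rw [h2, div_mul_cancel₀ _ h1]
  have key : (A * B) 1 0 * (w : ℂ) + (A * B) 1 1
      = (A 1 0 * (g w : ℂ) + A 1 1) * (B 1 0 * w + B 1 1) := by
    simp only [Units.val_mul, Matrix.mul_apply, Fin.sum_univ_two]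
    linear_combination (-(A 1 0)) * e1
  have key2 : (A * B) 0 0 * (w : ℂ) + (A * B) 0 1
      = (A 0 0 * (g w : ℂ) + A 0 1) * (B 1 0 * w + B 1 1) := by
    simp only [Units.val_mul, Matrix.mul_apply, Fin.sum_univ_two]
    linear_combination (-(A 0 0)) * e1
  refine ⟨by rw [key]; exact mul_ne_zero h3 h1, ?_⟩
  rw [key, key2, h4, mul_div_mul_right _ _ h1]

namespace ProjectiveStructure

variable {S : Type*} [TopologicalSpace S] [ChartedSpace ℂ S] {P : Set S}

/-- Regularity at the punctures: in a complex coordinate `z` at a puncture `p`, the projective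
connection `T(z) = S(u, z)` (`u` any projective coordinate) has a pole of order at most two,
i.e. `T(z) = G(z) / (z - z(p))²` near `p` with `G` analytic at `z(p)`. -/
def IsRegular (Q : ProjectiveStructure S P) : Prop :=
  ∀ p ∈ P, ∃ G : ℂ → ℂ, AnalyticAt ℂ G (chartAt ℂ p p) ∧
    ∀ᶠ y in 𝓝[≠] p, ∀ e ∈ Q.charts, y ∈ e.source →
      schwarzian (fun z => e ((chartAt ℂ p).symm z)) (chartAt ℂ p y)
        = G (chartAt ℂ p y) / (chartAt ℂ p y - chartAt ℂ p p) ^ 2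

/-! ### Projective disks -/

/-- A continuous map of the unit disk is projective if it is locally given by Möbius functions
in projective coordinates. In particular it takes its values outside of the punctures. -/
def IsProjective (Q : ProjectiveStructure S P) (u : C(𝔻, S)) : Prop :=
  ∀ w : 𝔻, ∃ e ∈ Q.charts, u w ∈ e.source ∧
    ∃ A : GL (Fin 2) ℂ, ∀ᶠ w' : 𝔻 in 𝓝 w, MoebiusRel A w' (e (u w'))

/-- Projective maps of the unit disk to the surface, with the compact-open topology. -/
abbrev DiskMap (Q : ProjectiveStructure S P) : Type _ := {u : C(𝔻, S) // Q.IsProjective u}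

/-- Equality up to an automorphism (a projective bijection) of the unit disk. -/
instance diskSetoid (Q : ProjectiveStructure S P) : Setoid Q.DiskMap where
  r u v := ∃ f : 𝔻 ≃ 𝔻, IsMoebius f ∧ IsMoebius f.symm ∧ ∀ w, u.1 w = v.1 (f w)
  iseqv :=
    { refl := fun _ => ⟨Equiv.refl _, IsMoebius.id, IsMoebius.id, fun _ => rfl⟩
      symm := by
        rintro u v ⟨f, hf, hf', h⟩
        exact ⟨f.symm, hf', hf, fun w => by simp [h]⟩
      trans := by
        rintro u v x ⟨f, hf, hf', h⟩ ⟨g, hg, hg', k⟩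
        exact ⟨f.trans g, hg.comp hf, hf'.comp hg', fun w => by simp [h, k]⟩ }

/-- The space of projective disks: projective maps of the unit disk up to automorphisms of the
unit disk, with the quotient topology. -/
abbrev Disk (Q : ProjectiveStructure S P) : Type _ := Quotient Q.diskSetoid

/-- The disk represented by a projective map. -/
def toDisk (Q : ProjectiveStructure S P) (u : Q.DiskMap) : Q.Disk := Quotient.mk _ u

/-- The order on disks: `x ≤ y` if `x` factors through `y` by a projective map of the unit disk
to itself. -/
instance (Q : ProjectiveStructure S P) : LE Q.Disk where
  le x y := ∃ u v : Q.DiskMap, Q.toDisk u = x ∧ Q.toDisk v = y ∧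
    ∃ f : 𝔻 → 𝔻, IsMoebius f ∧ ∀ w, u.1 w = v.1 (f w)

/-- The space of maximal disks. -/
abbrev MaxDisk (Q : ProjectiveStructure S P) : Type _ :=
  {x : Q.Disk // ∀ y : Q.Disk, x ≤ y → y = x}

/-- The map extends continuously to the closed unit disk. -/
def ExtendsToClosedDisk {Q : ProjectiveStructure S P} (u : Q.DiskMap) : Prop :=
  ∃ ubar : ℂ → S, ContinuousOn ubar (Metric.closedBall 0 1) ∧ ∀ w : 𝔻, ubar w = u.1 w

/-- The points of the unit circle at which a disk leans on the punctures, i.e. at which the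
boundary value of the map is a puncture. -/
def leanPoints {Q : ProjectiveStructure S P} (u : Q.DiskMap) : Set Circle :=
  {ζ | ∃ p ∈ P, Tendsto u.1 (comap ((↑) : 𝔻 → ℂ) (𝓝 (ζ : ℂ))) (𝓝 p)}

end ProjectiveStructure

/-- `b` is the point of `L` which follows `a ∈ L` in the counterclockwise cyclic order of the
unit circle. -/
def IsNext (L : Set Circle) (a b : Circle) : Prop :=
  a ∈ L ∧ b ∈ L ∧ ∃ φ : ℝ, 0 < φ ∧ φ ≤ 2 * Real.pi ∧ b = a * Circle.exp φ ∧
    ∀ θ : ℝ, 0 < θ → θ < φ → a * Circle.exp θ ∉ L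

/-! ### Fat graphs -/

/-- A finite fat graph, given by its darts (oriented edges, or equivalently ends of edges): `rev`
reverses the orientation, and `next` is the cyclic order of the darts that begin at a vertex,
so that the vertices are the cycles of `next`. -/
structure FatGraph where
  Dart : Type
  finite : Finite Dart
  rev : Equiv.Perm Dart
  rev_rev : ∀ d, rev (rev d) = d
  rev_ne : ∀ d, rev d ≠ d
  next : Equiv.Perm Dart

namespace FatGraph

/-- The gluing of unit intervals, one for each dart: a dart is glued to its reverse, and all darts
of a vertex are glued at their beginnings. -/
inductive Glue (G : FatGraph) :
    (Σ _ : G.Dart, unitInterval) → (Σ _ : G.Dart, unitInterval) → Prop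
  | flip (d : G.Dart) (t : unitInterval) : Glue G ⟨d, t⟩ ⟨G.rev d, unitInterval.symm t⟩
  | vertex (d : G.Dart) : Glue G ⟨d, 0⟩ ⟨G.next d, 0⟩

/-- The underlying topological graph. -/
abbrev Realization (G : FatGraph) : Type := Quot G.Glue

/-- The point with parameter `t` on a dart; the dart begins at the vertex `G.point d 0`. -/
def point (G : FatGraph) (d : G.Dart) (t : unitInterval) : G.Realization :=
  Quot.mk _ ⟨d, t⟩

end FatGraph

/-- A homeomorphism `h` of (the topological graph of) `G` with the space of maximal disks is
compatible with the fat graph structure of the latter. -/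
structure IsDiskModel {S : Type*} [TopologicalSpace S] [ChartedSpace ℂ S] {P : Set S}
    (Q : ProjectiveStructure S P) (G : FatGraph) (h : G.Realization ≃ₜ Q.MaxDisk) : Prop where
  /-- The vertices are the maximal disks that lean on the punctures at least three times. -/
  vertices : ∀ (x : Q.MaxDisk) (u : Q.DiskMap), Q.toDisk u = x.1 →
    ((∃ d, h (G.point d 0) = x) ↔ 3 ≤ (Q.leanPoints u).encard)
  /-- At a vertex, represented by a map `u`, the darts correspond bijectively to the points of the
  unit circle at which `u` leans on the punctures, and the cyclic order of the darts is the
  counterclockwise cyclic order of these points. The correspondence is the geometric one: the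
  disks on the initial part of the dart `d` are represented by maps close to `u` which lean on
  the punctures exactly twice, near the points `a d` and `a (G.next d)`. -/
  cyclic : ∀ (x : Q.MaxDisk) (u : Q.DiskMap), Q.toDisk u = x.1 → (∃ d, h (G.point d 0) = x) →
    ∃ a : G.Dart → Circle,
      Set.BijOn a {d | h (G.point d 0) = x} (Q.leanPoints u) ∧
      (∀ d, h (G.point d 0) = x → IsNext (Q.leanPoints u) (a d) (a (G.next d))) ∧
      (∀ d, h (G.point d 0) = x →
        ∀ O ∈ 𝓝 u, ∀ U ∈ 𝓝 (a d), ∀ V ∈ 𝓝 (a (G.next d)),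
          ∀ᶠ t in 𝓝[>] (0 : unitInterval),
            ∃ v ∈ O, Q.toDisk v = (h (G.point d t)).1 ∧
              ∃ b ∈ U, ∃ c ∈ V, b ≠ c ∧ Q.leanPoints v = {b, c})

end ProjSurf

end

/-!
Projective disks are studied through their behaviour at the unit circle. Near a puncture the
projective coordinate is given by a Frobenius solution of the equation with Schwarzian `T`, so that
in the logarithm of the local coordinate it is `∫ exp (-α ζ) G (exp ζ) dζ` with `G 0 = 1`
(`exists_cuspModel`). If a projective disk leans on a puncture at a boundary point, then in strip
coordinates, in which the unit disk becomes `0 < Im s < π`, it is asymptotic to an affine function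
of this logarithm and therefore extends projectively to strips of every width
(`CuspModel.exists_extension`). At the boundary points which are not mapped to a puncture, the
disk extends by analytic continuation. Hence a maximal disk extends to a neighbourhood of
the closed disk with the leaning points removed, of a definite shape: a collar
(`exists_collar_extension`). By compactness of the circle there are finitely many leaning points,
and with at most one of them the collar would contain a larger disk (`Collar.two_le_encard`).
Conversely two leaning points make a disk maximal (`isMaximal_of_two_le`).

Every map near a maximal disk `u` is `u` extended to its collar and composed with a Möbius function
near the identity, and the leaning points of both maps correspond (`Collar.near`). The
automorphisms of the disk act properly on maximal disks (`exists_mob_of_tendsto`) and freely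
(`mob_eq_id_of_invariant`), so the space of maximal disks is Hausdorff. Normal families, lifted to
the unit disk that covers the surface, give compactness, and there are only finitely
many disks with at least three leaning points (`finite_vertices`): these are the vertices.

Let `u` lean on the punctures at `1` and `-1`. In strip coordinates it extends above the line
`Im s = π` up to the first puncture, at height `π + Θ` say, and the strips `θ < Im s < π + θ`,
`0 ≤ θ ≤ Θ`, form a path of maximal disks which lean on the punctures at exactly two points for
`0 < θ < Θ` if no leaning points of `u` lie between `1` and `-1` (`Flow`). The edges are the paths
from the pairs of a vertex and two consecutive leaning points (`DartSystem`); reversing a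
path gives another one (`DartSystem.exists_rev`), and every maximal disk lies on an edge, in an
essentially unique way (`DartSystem.edge_injective`, `DartSystem.edge_surjective`). As the graph is
compact and the space of maximal disks is Hausdorff, this bijection is a homeomorphism.

For uniqueness, a disk close to a vertex which leans on the punctures at exactly two points
determines the corner at which it lies, because automorphisms that relate two maps near `u` are near
the identity (`exists_nhds_toDisk_ne`). So darts at the same corner have the same germ, and
since an open edge is connected, the bijection of darts respects the reversal.
-/

noncomputable section

set_option linter.unusedSectionVars false

namespace ProjSurf

open ComplexConjugate ProjectiveStructure
open scoped Real
open Complex (exp exp_ne_zero re_le_norm add_re natCast_re one_re zero_re normSq normSq_pos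
  normSq_eq_norm_sq normSq_apply ofReal_re div_re sub_re sub_im add_im one_im sq_norm ofReal_im
  log slitPlane isOpen_slitPlane exp_add exp_log norm_exp continuous_re abs_im_le_norm log_exp
  exp_sub continuous_im neg_re I exp_neg tendsto_exp_nhds_zero_iff inv_re re_ofReal_mul mul_re
  exp_zero abs_re_le_norm exp_re exp_im log_one mul_im conj_re conj_im normSq_eq_conj_mul_self
  conj_conj norm_real mul_conj ofReal_div conj_ofReal exp_mul_I I_ne_zero I_re I_im log_im
  exp_pi_mul_I I_sq neg_pi_lt_arg arg_le_pi ofReal_one ofReal_sub real_smul)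
open Real (exp_lt_exp pi_gt_three exp_pos pi_pos cos sin sin_le norm_of_nonneg norm_eq_abs)
open Metric (ball isOpen_ball eventually_nhds_iff_ball mem_ball_self ball_mem_nhds closedBall
  mem_ball ball_subset_ball ball_subset_closedBall sphere)

variable {S : Type*} [TopologicalSpace S] [ChartedSpace ℂ S] {P : Set S}
  {Q : ProjectiveStructure S P}

local notation "𝔹" => ball (0 : ℂ) 1

/-! ### Möbius relations -/

/-- The invertible matrix `(a b; c d)`. -/
def mkGL (a b c d : ℂ) (h : a * d - b * c ≠ 0) : GL (Fin 2) ℂ :=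
  Matrix.GeneralLinearGroup.mkOfDetNeZero !![a, b; c, d] (by rwa [Matrix.det_fin_two_of])

lemma moebiusRel_mkGL {a b c d : ℂ} {h : a * d - b * c ≠ 0} {z w : ℂ} :
    MoebiusRel (mkGL a b c d h) z w ↔ c * z + d ≠ 0 ∧ w = (a * z + b) / (c * z + d) := by
  simp [MoebiusRel, mkGL, Matrix.GeneralLinearGroup.mkOfDetNeZero]

lemma det_ne_zero_of_GL (A : GL (Fin 2) ℂ) : A 0 0 * A 1 1 - A 0 1 * A 1 0 ≠ 0 := by
  have := A.det.ne_zero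
  rwa [Matrix.GeneralLinearGroup.val_det_apply, Matrix.det_fin_two] at this

lemma MoebiusRel.comp {A B : GL (Fin 2) ℂ} {z w v : ℂ} (h : MoebiusRel A z w)
    (h' : MoebiusRel B w v) : MoebiusRel (B * A) z v := by
  obtain ⟨h1, h2⟩ := h
  obtain ⟨h3, h4⟩ := h'
  have e1 : w * (A 1 0 * z + A 1 1) = A 0 0 * z + A 0 1 := by rw [h2, div_mul_cancel₀ _ h1]
  have key : (B * A) 1 0 * z + (B * A) 1 1 = (B 1 0 * w + B 1 1) * (A 1 0 * z + A 1 1) := by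
    simp only [Units.val_mul, Matrix.mul_apply, Fin.sum_univ_two]
    grind
  have key2 : (B * A) 0 0 * z + (B * A) 0 1 = (B 0 0 * w + B 0 1) * (A 1 0 * z + A 1 1) := by
    simp only [Units.val_mul, Matrix.mul_apply, Fin.sum_univ_two]
    grind
  refine ⟨by rw [key]; exact mul_ne_zero h3 h1, ?_⟩
  rw [key, key2, h4, mul_div_mul_right _ _ h1]

/-- The inverse of a matrix up to a scalar factor, which does not matter for Möbius functions. -/
def adj (A : GL (Fin 2) ℂ) : GL (Fin 2) ℂ := mkGL (A 1 1) (-A 0 1) (-A 1 0) (A 0 0) (by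
    have := det_ne_zero_of_GL A
    grind)

lemma MoebiusRel.inv {A : GL (Fin 2) ℂ} {z w : ℂ} (h : MoebiusRel A z w) :
    MoebiusRel (adj A) w z := by
  obtain ⟨h1, h2⟩ := h
  have hd := det_ne_zero_of_GL A
  have e1 : w * (A 1 0 * z + A 1 1) = A 0 0 * z + A 0 1 := by rw [h2, div_mul_cancel₀ _ h1]
  have key : (-A 1 0 * w + A 0 0) * (A 1 0 * z + A 1 1)
      = A 0 0 * A 1 1 - A 0 1 * A 1 0 := by linear_combination (-A 1 0) * e1
  have h3 : -A 1 0 * w + A 0 0 ≠ 0 := by grind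
  refine moebiusRel_mkGL.2 ⟨h3, ?_⟩
  grind

lemma MoebiusRel.left_unique {A : GL (Fin 2) ℂ} {z z' w : ℂ} (h : MoebiusRel A z w)
    (h' : MoebiusRel A z' w) : z = z' := h.inv.2.trans h'.inv.2.symm

/-- A function which is locally a Möbius function of `χ` is globally so on a connected set. -/
lemma exists_moebiusRel_of_locally {f χ : ℂ → ℂ} {W : Set ℂ} (hW : IsPreconnected W)
    (hne : W.Nonempty) (hχ : AnalyticOnNhd ℂ χ W) (hf : AnalyticOnNhd ℂ f W)
    (h : ∀ s ∈ W, ∃ A : GL (Fin 2) ℂ, ∀ᶠ s' in 𝓝 s, MoebiusRel A (χ s') (f s')) :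
    ∃ A : GL (Fin 2) ℂ, ∀ s ∈ W, MoebiusRel A (χ s) (f s) := by
  obtain ⟨s0, hs₀⟩ := hne
  obtain ⟨A, hA⟩ := h s0 hs₀
  refine ⟨A, fun s hs => ?_⟩
  have key : Set.EqOn (fun s => (A 1 0 * χ s + A 1 1) * f s - (A 0 0 * χ s + A 0 1)) 0 W := by
    refine AnalyticOnNhd.eqOn_zero_of_preconnected_of_eventuallyEq_zero (𝕜 := ℂ) ?_ hW hs₀ ?_
    · intro s hs
      have h1 := hχ s hs
      have h2 := hf s hs
      fun_prop
    · filter_upwards [hA] with s' hs'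
      simp only [Pi.zero_apply]
      rw [hs'.2, mul_div_cancel₀ _ hs'.1, sub_self]
  have h1 := key hs
  simp only [Pi.zero_apply] at h1
  have h2 : A 1 0 * χ s + A 1 1 ≠ 0 := fun h0 => by
    rw [h0, zero_mul, zero_sub, neg_eq_zero] at h1
    exact det_ne_zero_of_GL A (by grind)
  exact ⟨h2, by rw [eq_div_iff h2]; linear_combination h1⟩

lemma analyticAt_of_moebiusRel {A : GL (Fin 2) ℂ} {f χ : ℂ → ℂ} {s : ℂ}
    (h : ∀ᶠ s' in 𝓝 s, MoebiusRel A (χ s') (f s')) (hχ : AnalyticAt ℂ χ s) :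
    AnalyticAt ℂ f s := by
  have h1 : AnalyticAt ℂ (fun s' => (A 0 0 * χ s' + A 0 1) / (A 1 0 * χ s' + A 1 1)) s :=
    ((analyticAt_const.mul hχ).add analyticAt_const).fun_div
      ((analyticAt_const.mul hχ).add analyticAt_const) h.self_of_nhds.1
  exact h1.congr (by filter_upwards [h] with s' hs' using hs'.2.symm)

/-! ### Holomorphic and projective maps to the surface -/

section Maps

variable {S : Type*} [TopologicalSpace S] [ChartedSpace ℂ S] {P : Set S}

lemma analyticAt_transition {e e' : OpenPartialHomeomorph S ℂ}
    (he : e ∈ IsManifold.maximalAtlas 𝓘(ℂ) ω S) (he' : e' ∈ IsManifold.maximalAtlas 𝓘(ℂ) ω S)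
    {x : S} (hx : x ∈ e.source) (hx' : x ∈ e'.source) :
    AnalyticAt ℂ (fun z => e' (e.symm z)) (e x) := by
  have h := (contDiffGroupoid ω 𝓘(ℂ)).compatible_of_mem_maximalAtlas he he'
  rw [contDiffGroupoid, mem_groupoid_of_pregroupoid] at h
  have h2 : ContDiffOn ℂ ω (e.symm ≫ₕ e') (e.symm ≫ₕ e').source := by
    have := h.1
    simpa [contDiffPregroupoid] using this
  have hmem : e x ∈ (e.symm ≫ₕ e').source := by simp [e.map_source hx, e.left_inv hx, hx']
  exact ((h2 _ hmem).contDiffAt ((e.symm ≫ₕ e').open_source.mem_nhds hmem)).analyticAt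

/-- `U` is holomorphic, as a map to the surface, at the points of `W`. -/
def HolOn (U : ℂ → S) (W : Set ℂ) : Prop :=
  ∀ s ∈ W, ContinuousAt U s ∧ ∀ e ∈ IsManifold.maximalAtlas 𝓘(ℂ) ω S, U s ∈ e.source →
    AnalyticAt ℂ (fun s' => e (U s')) s

/-- Holomorphy can be checked in one chart. -/
lemma HolOn.of_chart {U : ℂ → S} {W : Set ℂ}
    (h : ∀ s ∈ W, ContinuousAt U s ∧ ∃ e ∈ IsManifold.maximalAtlas 𝓘(ℂ) ω S, U s ∈ e.source ∧
      AnalyticAt ℂ (fun s' => e (U s')) s) : HolOn U W := fun s hs => by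
  obtain ⟨hc, e, he, hse, ha⟩ := h s hs
  refine ⟨hc, fun e' he' hse' => ?_⟩
  have h1 : AnalyticAt ℂ (fun s' => e' (e.symm (e (U s')))) s :=
    (analyticAt_transition he he' hse hse').fun_comp (f := fun s' => e (U s')) ha
  refine h1.congr ?_
  filter_upwards [hc.eventually (e.open_source.mem_nhds hse)] with s' hs'
  simp [e.left_inv hs']

lemma HolOn.mono {U : ℂ → S} {W W' : Set ℂ} (h : HolOn U W) (hW : W' ⊆ W) : HolOn U W' :=
  fun s hs => h s (hW hs)

lemma HolOn.continuousOn {U : ℂ → S} {W : Set ℂ} (h : HolOn U W) : ContinuousOn U W :=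
  fun s hs => (h s hs).1.continuousWithinAt

lemma HolOn.comp {U : ℂ → S} {W W' : Set ℂ} (h : HolOn U W) {g : ℂ → ℂ}
    (hg : AnalyticOnNhd ℂ g W') (hm : Set.MapsTo g W' W) : HolOn (fun s => U (g s)) W' := by
  intro s hs
  have hgs := hg s hs
  obtain ⟨h1, h2⟩ := h (g s) (hm hs)
  exact ⟨ContinuousAt.comp' (f := g) h1 hgs.continuousAt, fun e he hse =>
    (h2 e he hse).fun_comp (f := g) hgs⟩

/-- Unique continuation. -/
lemma HolOn.eventuallyEq [T2Space S] [IsManifold 𝓘(ℂ) ω S] {U V : ℂ → S} {W : Set ℂ}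
    (hU : HolOn U W) (hV : HolOn V W) (hW : IsPreconnected W) {s0 : ℂ} (hs₀ : s0 ∈ W)
    (h : U =ᶠ[𝓝 s0] V) : ∀ s ∈ W, U =ᶠ[𝓝 s] V := by
  have ho : IsOpen {s | U =ᶠ[𝓝 s] V} := by
    rw [isOpen_iff_mem_nhds]
    intro s hs
    exact eventually_eventually_nhds.2 hs
  refine hW.subset_of_closure_inter_subset ho ⟨s0, hs₀, h⟩ ?_
  rintro s ⟨hsc, hsW⟩
  by_contra hsE
  have hf : ∃ᶠ s' in 𝓝 s, U =ᶠ[𝓝 s'] V := mem_closure_iff_frequently.1 hsc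
  have hf2 : ∃ᶠ s' in 𝓝[≠] s, U s' = V s' := by
    rw [frequently_nhdsWithin_iff]
    refine hf.mono fun s' hs' => ⟨hs'.self_of_nhds, ?_⟩
    rintro rfl
    exact hsE hs'
  obtain ⟨cU, aU⟩ := hU s hsW
  obtain ⟨cV, aV⟩ := hV s hsW
  have hval : U s = V s := by
    by_contra hne
    obtain ⟨A, B, hA, hB, hAs, hBs, hAB⟩ := t2_separation hne
    have := (cU.eventually (hA.mem_nhds hAs)).and (cV.eventually (hB.mem_nhds hBs))
    obtain ⟨s', hs', hs1, hs2⟩ := (hf.and_eventually this).exists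
    rw [hs'.self_of_nhds] at hs1
    exact Set.disjoint_left.1 hAB hs1 hs2
  set e := chartAt ℂ (U s)
  have hUs : U s ∈ e.source := mem_chart_source ℂ (U s)
  have hVs : V s ∈ e.source := hval ▸ hUs
  have he := IsManifold.chart_mem_maximalAtlas (I := 𝓘(ℂ)) (n := ω) (U s)
  have h3 := ((aU e he hUs).frequently_eq_iff_eventually_eq (aV e he hVs)).1
    (hf2.mono fun s' hs' => by rw [hs'])
  apply hsE
  filter_upwards [h3, cU.eventually (e.open_source.mem_nhds hUs),
    cV.eventually (e.open_source.mem_nhds hVs)] with s' h1 h2 h3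
  exact e.injOn h2 h3 h1

lemma HolOn.eqOn [T2Space S] [IsManifold 𝓘(ℂ) ω S] {U V : ℂ → S} {W : Set ℂ}
    (hU : HolOn U W) (hV : HolOn V W) (hW : IsPreconnected W) {s0 : ℂ} (hs₀ : s0 ∈ W)
    (h : U =ᶠ[𝓝 s0] V) : Set.EqOn U V W :=
  fun s hs => (hU.eventuallyEq hV hW hs₀ h s hs).self_of_nhds

namespace ProjectiveStructure

/-- Near every point of `W` the map `U` is a Möbius function of the function `χ` in projective
coordinates. For `χ = id` this means that `U` is projective; `χ = exp` occurs for projective maps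
in logarithmic coordinates. -/
def ProjOn (Q : ProjectiveStructure S P) (χ : ℂ → ℂ) (U : ℂ → S) (W : Set ℂ) : Prop :=
  ∀ s ∈ W, ContinuousAt U s ∧ ∃ e ∈ Q.charts, U s ∈ e.source ∧
    ∃ A : GL (Fin 2) ℂ, ∀ᶠ s' in 𝓝 s, MoebiusRel A (χ s') (e (U s'))

variable {Q : ProjectiveStructure S P} {χ : ℂ → ℂ} {U V : ℂ → S} {W W' : Set ℂ}

lemma ProjOn.mono (h : Q.ProjOn χ U W) (hW : W' ⊆ W) : Q.ProjOn χ U W' := fun s hs => h s (hW hs)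

lemma ProjOn.notMem (h : Q.ProjOn χ U W) {s : ℂ} (hs : s ∈ W) : U s ∉ P := by
  obtain ⟨-, e, he, hse, -⟩ := h s hs
  exact Q.source_subset e he hse

lemma ProjOn.holOn (h : Q.ProjOn χ U W) (hχ : AnalyticOnNhd ℂ χ W) : HolOn U W := by
  refine HolOn.of_chart fun s hs => ?_
  obtain ⟨hc, e, he, hse, A, hA⟩ := h s hs
  exact ⟨hc, e, Q.holomorphic e he, hse, analyticAt_of_moebiusRel hA (hχ s hs)⟩

lemma ProjOn.congr (h : Q.ProjOn χ U W) (hUV : ∀ s ∈ W, U =ᶠ[𝓝 s] V) : Q.ProjOn χ V W := by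
  intro s hs
  have h0 := hUV s hs
  obtain ⟨hc, e, he, hse, A, hA⟩ := h s hs
  refine ⟨hc.congr h0, e, he, h0.self_of_nhds ▸ hse, A, ?_⟩
  filter_upwards [h0, hA] with s' h1 h2
  grind

lemma ProjOn.comp (h : Q.ProjOn χ U W) {g : ℂ → ℂ} (hg : ∀ s ∈ W', ContinuousAt g s)
    (hm : Set.MapsTo g W' W) : Q.ProjOn (fun s => χ (g s)) (fun s => U (g s)) W' := fun s hs => by
  obtain ⟨hc, e, he, hse, A, hA⟩ := h (g s) (hm hs)
  exact ⟨ContinuousAt.comp' (f := g) hc (hg s hs), e, he, hse, A, (hg s hs).eventually hA⟩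

/-- Change of the coordinate by locally Möbius functions. -/
lemma ProjOn.change (h : Q.ProjOn χ U W) {χ' : ℂ → ℂ}
    (hχ : ∀ s ∈ W, ∃ B : GL (Fin 2) ℂ, ∀ᶠ s' in 𝓝 s, MoebiusRel B (χ' s') (χ s')) :
    Q.ProjOn χ' U W := fun s hs => by
  obtain ⟨hc, e, he, hse, A, hA⟩ := h s hs
  obtain ⟨B, hB⟩ := hχ s hs
  refine ⟨hc, e, he, hse, A * B, ?_⟩
  filter_upwards [hA, hB] with s' h1 h2 using h2.comp h1

lemma ProjOn.local_moebius (h : Q.ProjOn χ U W) {s : ℂ} (hs : s ∈ W)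
    {e : OpenPartialHomeomorph S ℂ} (he : e ∈ Q.charts) (hse : U s ∈ e.source) :
    ∃ A : GL (Fin 2) ℂ, ∀ᶠ s' in 𝓝 s, MoebiusRel A (χ s') (e (U s')) := by
  obtain ⟨hc, e', he', hse', A, hA⟩ := h s hs
  obtain ⟨B, hB⟩ := Q.moebius e' he' e he (U s) ⟨hse', hse⟩
  refine ⟨B * A, ?_⟩
  filter_upwards [hA, hc.eventually hB] with s' h1 h2 using h1.comp h2

lemma ProjOn.exists_moebius (h : Q.ProjOn χ U W) (hχ : AnalyticOnNhd ℂ χ W)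
    (hW : IsPreconnected W) (hne : W.Nonempty) {e : OpenPartialHomeomorph S ℂ}
    (he : e ∈ Q.charts) (hse : Set.MapsTo U W e.source) :
    ∃ A : GL (Fin 2) ℂ, ∀ s ∈ W, MoebiusRel A (χ s) (e (U s)) :=
  exists_moebiusRel_of_locally hW hne hχ
    (fun s hs => ((h.holOn hχ) s hs).2 e (Q.holomorphic e he) (hse hs))
    fun _ hs => h.local_moebius hs he (hse hs)

end ProjectiveStructure

/-- The extension of a map of the unit disk to the complex plane, by a constant. -/
def extend (u : C(𝔻, S)) (w : ℂ) : S := if h : ‖w‖ < 1 then u (.mk w h) else u 0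

lemma extend_of_lt (u : C(𝔻, S)) {w : ℂ} (h : ‖w‖ < 1) : extend u w = u (.mk w h) := dif_pos h

@[simp] lemma extend_coe (u : C(𝔻, S)) (w : 𝔻) : extend u w = u w := by
  rw [extend_of_lt u w.norm_lt_one]; simp

lemma range_coe_unitDisc : Set.range ((↑) : 𝔻 → ℂ) = 𝔹 := by
  ext w
  simp only [Set.mem_range, mem_ball_zero_iff]
  exact ⟨by rintro ⟨y, rfl⟩; exact y.norm_lt_one, fun h => ⟨.mk w h, rfl⟩⟩

lemma isOpenEmbedding_coe_unitDisc : IsOpenEmbedding ((↑) : 𝔻 → ℂ) :=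
  ⟨Complex.UnitDisc.isEmbedding_coe, by rw [range_coe_unitDisc]; exact isOpen_ball⟩

lemma eventually_nhds_coe {p : ℂ → Prop} {w : 𝔻} :
    (∀ᶠ w' : 𝔻 in 𝓝 w, p w') ↔ ∀ᶠ z in 𝓝 (w : ℂ), p z := by
  rw [← isOpenEmbedding_coe_unitDisc.map_nhds_eq w, eventually_map]

lemma continuousAt_extend (u : C(𝔻, S)) {w : ℂ} (h : ‖w‖ < 1) : ContinuousAt (extend u) w := by
  have h1 : ContinuousAt (extend u ∘ ((↑) : 𝔻 → ℂ)) (.mk w h) := by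
    have : (extend u ∘ ((↑) : 𝔻 → ℂ)) = u := by ext; simp
    rw [this]; exact u.continuous.continuousAt
  exact (isOpenEmbedding_coe_unitDisc.continuousAt_iff (x := .mk w h)).1 h1

lemma isProjective_iff {Q : ProjectiveStructure S P} {u : C(𝔻, S)} :
    Q.IsProjective u ↔ Q.ProjOn id (extend u) 𝔹 := by
  constructor
  · intro h w hw
    rw [mem_ball_zero_iff] at hw
    obtain ⟨e, he, hse, A, hA⟩ := h (.mk w hw)
    refine ⟨continuousAt_extend u hw, e, he, by rwa [extend_of_lt u hw], A, ?_⟩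
    refine (eventually_nhds_coe (w := .mk w hw)).1 ?_
    simp [*]
  · intro h w
    obtain ⟨-, e, he, hse, A, hA⟩ := h w (mem_ball_zero_iff.2 w.norm_lt_one)
    refine ⟨e, he, by simpa using hse, A, ?_⟩
    have := eventually_nhds_coe.2 hA
    simp_all

namespace ProjectiveStructure

variable {Q : ProjectiveStructure S P}

lemma DiskMap.projOn (u : Q.DiskMap) : Q.ProjOn id (extend u.1) 𝔹 := isProjective_iff.1 u.2

lemma DiskMap.holOn (u : Q.DiskMap) : HolOn (extend u.1) 𝔹 :=
  u.projOn.holOn fun _ _ => analyticAt_id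

lemma ProjOn.extend_restrict {U : ℂ → S} (h : Q.ProjOn id U 𝔹) : Continuous fun w : 𝔻 => U w :=
  continuous_iff_continuousAt.2 fun w =>
    ContinuousAt.comp' (f := fun w : 𝔻 => (w : ℂ)) (h w (mem_ball_zero_iff.2 w.norm_lt_one)).1
      Complex.UnitDisc.continuous_coe.continuousAt

/-- A projective map on the unit disk, as a point of the space of such maps. -/
def diskMap (Q : ProjectiveStructure S P) (U : ℂ → S) (h : Q.ProjOn id U 𝔹) : Q.DiskMap :=
  ⟨⟨fun w => U w, h.extend_restrict⟩, isProjective_iff.2 (h.congr fun s hs => by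
    filter_upwards [isOpen_ball.mem_nhds hs] with s' hs'
    rw [extend_of_lt _ (mem_ball_zero_iff.1 hs')]; rfl)⟩

lemma extend_diskMap {U : ℂ → S} (h : Q.ProjOn id U 𝔹) {w : ℂ} (hw : ‖w‖ < 1) :
    extend (Q.diskMap U h).1 w = U w := by
  rw [extend_of_lt _ hw]; rfl

lemma DiskMap.ext_of_extend {u v : Q.DiskMap}
    (h : ∀ w : ℂ, ‖w‖ < 1 → extend u.1 w = extend v.1 w) : u = v := by
  apply Subtype.ext
  ext w
  simpa using h w w.norm_lt_one

end ProjectiveStructure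

end Maps

/-! ### The Schwarzian derivative and linear differential equations -/

/-- The core of the fact that the Schwarzian derivative determines a function up to Möbius
functions: the difference `δ` of the pre-Schwarzians `f2 / f1` and `V2 / V1` satisfies a linear
equation, and `V1 / δ + V / 2` is constant. -/
lemma exists_moebiusRel_of_preSchwarzian {f f1 f2 V V1 V2 : ℂ → ℂ} {B : Set ℂ} (hB : IsOpen B)
    (hBc : IsPreconnected B) {x : ℂ} (hx : x ∈ B)
    (hf : ∀ z ∈ B, HasDerivAt f (f1 z) z) (hf1 : ∀ z ∈ B, HasDerivAt f1 (f2 z) z)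
    (hV : ∀ z ∈ B, HasDerivAt V (V1 z) z) (hV₁ : ∀ z ∈ B, HasDerivAt V1 (V2 z) z)
    (hf0 : ∀ z ∈ B, f1 z ≠ 0) (hV0 : ∀ z ∈ B, V1 z ≠ 0)
    (hd : ∀ z ∈ B, HasDerivAt (fun z => f2 z / f1 z - V2 z / V1 z)
      (((f2 z / f1 z) ^ 2 - (V2 z / V1 z) ^ 2) / 2) z)
    (hzero : (∀ z ∈ B, f2 z / f1 z - V2 z / V1 z = 0) ∨ ∀ z ∈ B, f2 z / f1 z - V2 z / V1 z ≠ 0) :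
    ∃ A : GL (Fin 2) ℂ, ∀ z ∈ B, MoebiusRel A (V z) (f z) := by
  have const : ∀ g : ℂ → ℂ, (∀ z ∈ B, HasDerivAt g 0 z) → ∀ z ∈ B, g z = g x := fun g hg z hz => by
    exact hB.is_const_of_deriv_eq_zero hBc
      (fun w hw => (hg w hw).differentiableAt.differentiableWithinAt)
      (fun w hw => (hg w hw).deriv) hz hx
  rcases hzero with h0 | h0
  · have h1 : ∀ z ∈ B, f1 z / V1 z = f1 x / V1 x := by
      refine const _ fun z hz => ?_
      refine ((hf1 z hz).fun_div (hV₁ z hz) (hV0 z hz)).congr_deriv ?_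
      grind
    set a := f1 x / V1 x
    have ha : a ≠ 0 := div_ne_zero (hf0 x hx) (hV0 x hx)
    have h2 : ∀ z ∈ B, f z - a * V z = f x - a * V x := by
      refine const _ fun z hz => ?_
      refine ((hf z hz).sub ((hV z hz).const_mul a)).congr_deriv ?_
      rw [← h1 z hz, div_mul_cancel₀ _ (hV0 z hz), sub_self]
    refine ⟨mkGL a (f x - a * V x) 0 1 (by simpa using ha), fun z hz => ?_⟩
    rw [moebiusRel_mkGL]
    refine ⟨by simp, ?_⟩
    have := h2 z hz
    linear_combination this
  · set δ : ℂ → ℂ := fun z => f2 z / f1 z - V2 z / V1 z with hδ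
    have h1 : ∀ z ∈ B, V1 z / δ z + V z / 2 = V1 x / δ x + V x / 2 := by
      refine const _ fun z hz => ?_
      refine (((hV₁ z hz).fun_div (hd z hz) (h0 z hz)).add ((hV z hz).div_const 2)).congr_deriv ?_
      have h3 : δ z ≠ 0 := h0 z hz
      have hV0z := hV0 z hz
      have h4 : (f2 z / f1 z) = δ z + V2 z / V1 z := by simp [hδ]
      rw [h4]
      field_simp
      ring
    set k := V1 x / δ x + V x / 2
    have hm : ∀ z ∈ B, k - V z / 2 = V1 z / δ z := fun z hz => by rw [← h1 z hz]; ring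
    have hm0 : ∀ z ∈ B, k - V z / 2 ≠ 0 := fun z hz => by
      rw [hm z hz]; exact div_ne_zero (hV0 z hz) (h0 z hz)
    have hmd : ∀ z ∈ B, HasDerivAt (fun z => k - V z / 2) (-(V1 z / 2)) z := fun z hz => by
      simpa using ((hV z hz).div_const 2).const_sub k
    have h2 : ∀ z ∈ B, f1 z * (k - V z / 2) ^ 2 / V1 z = f1 x * (k - V x / 2) ^ 2 / V1 x := by
      refine const _ fun z hz => ?_
      refine (((hf1 z hz).fun_mul ((hmd z hz).fun_pow 2)).fun_div (hV₁ z hz) (hV0 z hz)).congr_deriv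
        ?_
      have hV0z := hV0 z hz
      have hf0z := hf0 z hz
      have h4 : V2 z / V1 z = f2 z / f1 z - δ z := by simp [hδ]
      have h5 : V2 z = V1 z * (f2 z / f1 z - δ z) := by rw [← h4]; field_simp
      rw [hm z hz, h5]
      push_cast
      field_simp
      ring
    set C := f1 x * (k - V x / 2) ^ 2 / V1 x
    have hC : C ≠ 0 := div_ne_zero (mul_ne_zero (hf0 x hx) (pow_ne_zero 2 (hm0 x hx))) (hV0 x hx)
    have h3 : ∀ z ∈ B, f z - 2 * C / (k - V z / 2) = f x - 2 * C / (k - V x / 2) := by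
      refine const _ fun z hz => ?_
      refine ((hf z hz).sub (((hasDerivAt_const z (2 * C)).fun_div (hmd z hz) (hm0 z hz)))).congr_deriv
        ?_
      have h4 := hm0 z hz
      have hV0z := hV0 z hz
      rw [← h2 z hz]
      generalize k - V z / 2 = m at h4 ⊢
      field_simp
      ring
    set b := f x - 2 * C / (k - V x / 2)
    refine ⟨mkGL (-b / 2) (b * k + 2 * C) (-1 / 2) k ?_, fun z hz => ?_⟩
    · have : -b / 2 * k - (b * k + 2 * C) * (-1 / 2) = C := by ring
      rwa [this]
    · rw [moebiusRel_mkGL]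
      have h4 := hm0 z hz
      have h6 : -1 / 2 * V z + k ≠ 0 := by
        intro h; apply h4; linear_combination h
      refine ⟨h6, ?_⟩
      have h5 : f z = b + 2 * C / (k - V z / 2) := by linear_combination h3 z hz
      rw [h5, show k - V z / 2 = -1 / 2 * V z + k by ring, eq_div_iff h6, add_mul,
        div_mul_cancel₀ _ h6]
      ring

lemma schwarzian_eq {f : ℂ → ℂ} {z : ℂ} : schwarzian f z = deriv (deriv (deriv f)) z / deriv f z
      - 3 / 2 * (deriv (deriv f) z) ^ 2 / (deriv f z) ^ 2 := by
  rw [schwarzian, iteratedDeriv_eq_iterate, iteratedDeriv_eq_iterate]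
  rfl

lemma hasDerivAt_preSchwarzian {f : ℂ → ℂ} {z : ℂ} (hf : AnalyticAt ℂ f z) (h0 : deriv f z ≠ 0) :
    HasDerivAt (fun z => deriv (deriv f) z / deriv f z)
      (schwarzian f z + (deriv (deriv f) z / deriv f z) ^ 2 / 2) z := by
  have h1 := hf.deriv.differentiableAt.hasDerivAt
  have h2 := hf.deriv.deriv.differentiableAt.hasDerivAt
  refine (h2.fun_div h1 h0).congr_deriv ?_
  rw [schwarzian_eq]
  grind

/-- A solution of a homogeneous linear differential equation of first order with analytic
coefficient vanishes identically or nowhere. -/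
lemma eventually_zero_or_ne_zero {δ p : ℂ → ℂ} {x : ℂ}
    (hp : AnalyticAt ℂ p x) (h : ∀ᶠ z in 𝓝 x, HasDerivAt δ (p z * δ z) z) :
    (∀ᶠ z in 𝓝 x, δ z = 0) ∨ ∀ᶠ z in 𝓝 x, δ z ≠ 0 := by
  obtain ⟨r, hr, hball⟩ := eventually_nhds_iff_ball.1 (h.and hp.eventually_analyticAt)
  obtain ⟨g, hg⟩ := DifferentiableOn.isExactOn_ball (f := p) (c := x) (r := r)
    fun z hz => (hball z hz).2.differentiableAt.differentiableWithinAt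
  have key : ∀ z ∈ ball x r, δ z * exp (-g z) = δ x * exp (-g x) := fun z hz => by
    refine isOpen_ball.is_const_of_deriv_eq_zero (f := fun z => δ z * exp (-g z))
      (convex_ball x r).isPreconnected
      (fun w hw => ?_) (fun w hw => ?_) hz (mem_ball_self hr)
    · exact ((hball w hw).1.fun_mul (hg w hw).fun_neg.cexp).differentiableAt.differentiableWithinAt
    · refine (((hball w hw).1.fun_mul (hg w hw).fun_neg.cexp).congr_deriv ?_).deriv
      simp only [Pi.zero_apply]
      ring
  by_cases h0 : δ x = 0
  · left
    filter_upwards [ball_mem_nhds x hr] with z hz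
    simp_all
  · right
    filter_upwards [ball_mem_nhds x hr] with z hz h1
    have := key z hz
    simp_all

/-- Functions with the same Schwarzian derivative differ by a Möbius function. -/
lemma exists_moebiusRel_of_schwarzian_eq {f V : ℂ → ℂ} {x : ℂ} (hf : AnalyticAt ℂ f x)
    (hV : AnalyticAt ℂ V x) (hf0 : deriv f x ≠ 0) (hV0 : deriv V x ≠ 0)
    (h : ∀ᶠ z in 𝓝 x, schwarzian f z = schwarzian V z) :
    ∃ A : GL (Fin 2) ℂ, ∀ᶠ z in 𝓝 x, MoebiusRel A (V z) (f z) := by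
  have hd : ∀ᶠ z in 𝓝 x, HasDerivAt
      (fun z => deriv (deriv f) z / deriv f z - deriv (deriv V) z / deriv V z)
      (((deriv (deriv f) z / deriv f z) ^ 2 - (deriv (deriv V) z / deriv V z) ^ 2) / 2) z := by
    filter_upwards [h, hf.eventually_analyticAt, hV.eventually_analyticAt,
      hf.deriv.continuousAt.eventually_ne hf0, hV.deriv.continuousAt.eventually_ne hV0]
      with z h1 h2 h3 h4 h5
    refine ((hasDerivAt_preSchwarzian h2 h4).sub (hasDerivAt_preSchwarzian h3 h5)).congr_deriv ?_
    grind
  have hz := eventually_zero_or_ne_zero (x := x)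
    (δ := fun z => deriv (deriv f) z / deriv f z - deriv (deriv V) z / deriv V z)
    (p := fun z => (deriv (deriv f) z / deriv f z + deriv (deriv V) z / deriv V z) / 2)
    (by fun_prop)
    (by filter_upwards [hd] with z hz; exact hz.congr_deriv (by ring))
  have hall := hd.and ((hf.eventually_analyticAt.and hV.eventually_analyticAt).and
    ((hf.deriv.continuousAt.eventually_ne hf0).and (hV.deriv.continuousAt.eventually_ne hV0)))
  rcases hz with hz | hz
  · obtain ⟨r, hr, hball⟩ := eventually_nhds_iff_ball.1 (hall.and hz)
    obtain ⟨A, hA⟩ := exists_moebiusRel_of_preSchwarzian isOpen_ball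
      (convex_ball x r).isPreconnected (mem_ball_self hr)
      (fun z hz => (hball z hz).1.2.1.1.differentiableAt.hasDerivAt)
      (fun z hz => (hball z hz).1.2.1.1.deriv.differentiableAt.hasDerivAt)
      (fun z hz => (hball z hz).1.2.1.2.differentiableAt.hasDerivAt)
      (fun z hz => (hball z hz).1.2.1.2.deriv.differentiableAt.hasDerivAt)
      (fun z hz => (hball z hz).1.2.2.1) (fun z hz => (hball z hz).1.2.2.2)
      (fun z hz => (hball z hz).1.1) (Or.inl fun z hz => (hball z hz).2)
    exact ⟨A, eventually_of_mem (ball_mem_nhds x hr) hA⟩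
  · obtain ⟨r, hr, hball⟩ := eventually_nhds_iff_ball.1 (hall.and hz)
    obtain ⟨A, hA⟩ := exists_moebiusRel_of_preSchwarzian isOpen_ball
      (convex_ball x r).isPreconnected (mem_ball_self hr)
      (fun z hz => (hball z hz).1.2.1.1.differentiableAt.hasDerivAt)
      (fun z hz => (hball z hz).1.2.1.1.deriv.differentiableAt.hasDerivAt)
      (fun z hz => (hball z hz).1.2.1.2.differentiableAt.hasDerivAt)
      (fun z hz => (hball z hz).1.2.1.2.deriv.differentiableAt.hasDerivAt)
      (fun z hz => (hball z hz).1.2.2.1) (fun z hz => (hball z hz).1.2.2.2)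
      (fun z hz => (hball z hz).1.1) (Or.inr fun z hz => (hball z hz).2)
    exact ⟨A, eventually_of_mem (ball_mem_nhds x hr) hA⟩

/-- The coefficients of the power series solution of `z F'' + (α + 1) F' = h F`, where
`h = ∑ c n zⁿ`. -/
def frobeniusCoeff (α : ℂ) (c : ℕ → ℂ) : ℕ → ℂ
  | 0 => 1
  | n + 1 => (∑ i : Fin (n + 1), c i * frobeniusCoeff α c (n - i)) / ((n + 1) * (n + 1 + α))

lemma norm_frobeniusCoeff_le {α : ℂ} (hα : 0 ≤ α.re) {c : ℕ → ℂ} {C r : ℝ} (hr : 0 < r)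
    (hC : 0 < C) (hc : ∀ n, ‖c n‖ ≤ C * r ^ n) (n : ℕ) :
    ‖frobeniusCoeff α c n‖ ≤ (r + C) ^ n := by
  induction n using Nat.strong_induction_on with
  | _ n ih =>
    cases n with
    | zero => simp [frobeniusCoeff]
    | succ n =>
      rw [frobeniusCoeff, norm_div]
      have h1 : (1 : ℝ) ≤ ‖((n : ℂ) + 1) * (n + 1 + α)‖ := by
        rw [norm_mul]
        have h2 : (1 : ℝ) ≤ ‖(n : ℂ) + 1‖ := by
          refine le_trans ?_ (re_le_norm _)
          simp
        have h3 : (1 : ℝ) ≤ ‖(n : ℂ) + 1 + α‖ := by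
          refine le_trans ?_ (re_le_norm _)
          simp only [add_re, natCast_re, one_re]
          linarith
        nlinarith
      have h4 : ‖∑ i : Fin (n + 1), c i * frobeniusCoeff α c (n - i)‖
          ≤ ∑ i ∈ Finset.range (n + 1), C * r ^ i * (r + C) ^ (n - i) := by
        rw [← Fin.sum_univ_eq_sum_range (fun i => C * r ^ i * (r + C) ^ (n - i)) (n + 1)]
        refine (norm_sum_le _ _).trans (Finset.sum_le_sum fun i _ => ?_)
        rw [norm_mul]
        have := ih (n - i) (by omega)
        have h5 := hc i
        gcongr
      have h6 : ∑ i ∈ Finset.range (n + 1), C * r ^ i * (r + C) ^ (n - i)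
          = (r + C) ^ (n + 1) - r ^ (n + 1) := by
        have := (Commute.all (r + C) r).mul_geom_sum₂ (n + 1)
        rw [← this]
        rw [Finset.mul_sum, ← Finset.sum_range_reflect]
        refine Finset.sum_congr rfl fun i hi => ?_
        grind
      have h7 : 0 < r ^ (n + 1) := by positivity
      rw [div_le_iff₀ (by linarith)]
      have h8 : (0 : ℝ) ≤ (r + C) ^ (n + 1) := by positivity
      nlinarith

/-- The regular solution of the differential equation `z F'' + (α + 1) F' = h F`. -/
lemma exists_frobenius_solution {α : ℂ} (hα : 0 ≤ α.re) {h : ℂ → ℂ} (hh : AnalyticAt ℂ h 0) :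
    ∃ F : ℂ → ℂ, AnalyticAt ℂ F 0 ∧ F 0 = 1 ∧
      ∀ᶠ z in 𝓝 0, z * deriv (deriv F) z + (α + 1) * deriv F z = h z * F z := by
  have hp := hh.hasFPowerSeriesAt
  set c : ℕ → ℂ := fun n => iteratedDeriv n h 0 / n.factorial with hcdef
  obtain ⟨C, r, hC, hr, hb⟩ :=
    FormalMultilinearSeries.le_mul_pow_of_radius_pos _ hp.radius_pos
  have hc : ∀ n, ‖c n‖ ≤ C * r ^ n := fun n => by
    simp_all
  set a := frobeniusCoeff α c with ha
  have hab := norm_frobeniusCoeff_le hα hr hC hc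
  set p := FormalMultilinearSeries.ofScalars ℂ a with hpdef
  have hrad : 0 < p.radius := by
    have := p.le_radius_of_bound 1 (r := Real.toNNReal (r + C)⁻¹) (fun n => by
      rw [FormalMultilinearSeries.ofScalars_norm, Real.coe_toNNReal _ (by positivity),
        inv_pow, ← div_eq_mul_inv, div_le_one (by positivity)]
      grind)
    refine lt_of_lt_of_le ?_ this
    positivity
  set F := p.sum with hF
  have hFp : HasFPowerSeriesAt F p 0 := (p.hasFPowerSeriesOnBall hrad).hasFPowerSeriesAt
  have hFa : AnalyticAt ℂ F 0 := hFp.analyticAt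
  have hcoef : ∀ n, iteratedDeriv n F 0 = n.factorial * a n := fun n => by
    have h1 := hFp.eq_formalMultilinearSeries hFa.hasFPowerSeriesAt
    rw [FormalMultilinearSeries.ofScalars_series_eq_iff] at h1
    have h3 : (n.factorial : ℂ) ≠ 0 := by exact_mod_cast n.factorial_ne_zero
    grind
  refine ⟨F, hFa, ?_, ?_⟩
  · have := hcoef 0
    simpa [ha, frobeniusCoeff] using this
  · set D : ℂ → ℂ := fun z => z * deriv (deriv F) z + (α + 1) * deriv F z - h z * F z with hD
    have hDa : AnalyticAt ℂ D 0 := by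
      have h1 := hFa.deriv
      fun_prop
    have hDn : ∀ n, iteratedDeriv n D 0 = 0 := fun n => by
      have h1 : ContDiffAt ℂ n (fun z : ℂ => z) 0 := contDiffAt_id
      have h2 : ContDiffAt ℂ n (deriv (deriv F)) 0 := hFa.deriv.deriv.contDiffAt
      have h3 : ContDiffAt ℂ n (deriv F) 0 := hFa.deriv.contDiffAt
      have h4 : ContDiffAt ℂ n F 0 := hFa.contDiffAt
      have h5 : ContDiffAt ℂ n h 0 := hh.contDiffAt
      have e1 : iteratedDeriv n ((fun z : ℂ => z) * deriv (deriv F)) 0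
          = n * iteratedDeriv (n + 1) F 0 := by
        rw [iteratedDeriv_mul h1 h2]
        cases n with
        | zero => simp
        | succ n =>
          rw [Finset.sum_eq_single 1]
          · have : iteratedDeriv 1 (fun z : ℂ => z) 0 = 1 := by simp
            rw [this, ← iteratedDeriv_succ', ← iteratedDeriv_succ']
            simp
          · intro i hi hi1
            cases i with
            | zero => simp
            | succ i =>
              cases i with
              | zero => exact absurd rfl hi1
              | succ i =>
                have : iteratedDeriv (i + 1 + 1) (fun z : ℂ => z) 0 = 0 := by
                  rw [iteratedDeriv_succ', iteratedDeriv_succ']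
                  simp
                rw [this]; simp
          · intro h; exact absurd (Finset.mem_range.2 (by omega)) h
      have e2 : iteratedDeriv n (h * F) 0
          = n.factorial * ∑ i : Fin (n + 1), c i * a (n - i) := by
        rw [iteratedDeriv_mul h5 h4, Finset.mul_sum,
          Fin.sum_univ_eq_sum_range (fun i => (n.factorial : ℂ) * (c i * a (n - i))) (n + 1)]
        refine Finset.sum_congr rfl fun i hi => ?_
        have hi' : i ≤ n := by have := Finset.mem_range.1 hi; omega
        rw [hcoef, hcdef]
        have : ((n.choose i : ℕ) : ℂ) * i.factorial * (n - i).factorial = n.factorial := by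
          exact_mod_cast Nat.choose_mul_factorial_mul_factorial hi'
        rw [← this]
        have : (i.factorial : ℂ) ≠ 0 := by exact_mod_cast i.factorial_ne_zero
        field_simp
      have hDeq : D = (fun z : ℂ => z) * deriv (deriv F) + (fun z => (α + 1) * deriv F z)
          - h * F := by
        ext z; simp [hD]
      have h6 : ContDiffAt ℂ n ((fun z : ℂ => z) * deriv (deriv F)) 0 := h1.mul h2
      have h7 : ContDiffAt ℂ n (fun z => (α + 1) * deriv F z) 0 := contDiffAt_const.mul h3
      have h8 : ContDiffAt ℂ n (h * F) 0 := h5.mul h4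
      have h9 : ContDiffAt ℂ n
          ((fun z : ℂ => z) * deriv (deriv F) + fun z => (α + 1) * deriv F z) 0 := h6.add h7
      rw [hDeq, iteratedDeriv_sub h9 h8, iteratedDeriv_add h6 h7, e1, e2,
        iteratedDeriv_const_mul_field, ← iteratedDeriv_succ', hcoef, ha, frobeniusCoeff]
      rw [← ha, Nat.factorial_succ]
      have h7 : (n : ℂ) + 1 + α ≠ 0 := fun h0 => by
        have := congrArg Complex.re h0
        simp only [add_re, natCast_re, one_re, zero_re] at this
        linarith
      push_cast
      field_simp
      ring
    have hz : ∀ᶠ z in 𝓝 0, D z = 0 := by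
      have h1 := hDa.hasFPowerSeriesAt
      have h2 : (FormalMultilinearSeries.ofScalars ℂ fun n => iteratedDeriv n D 0 / n.factorial)
          = 0 := by
        ext n; simp [hDn]
      rw [h2] at h1
      exact h1.eventually_eq_zero
    filter_upwards [hz] with z hz
    exact sub_eq_zero.1 hz

/-! ### The local normal form at a puncture -/

section Cusp

/-- A half-plane is biholomorphic to the disk, in which holomorphic functions have primitives. -/
lemma exists_primitive_halfPlane {f : ℂ → ℂ} {R : ℝ} (hf : DifferentiableOn ℂ f {ζ | ζ.re < R}) :
    ∃ V : ℂ → ℂ, ∀ ζ : ℂ, ζ.re < R → HasDerivAt V (f ζ) ζ := by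
  have hne : ∀ w : ℂ, w ∈ 𝔹 → w + 1 ≠ 0 := fun w hw h => by
    rw [mem_ball_zero_iff, eq_neg_of_add_eq_zero_left h] at hw
    simp at hw
  have hre : ∀ w : ℂ, w ∈ 𝔹 → ((R : ℂ) + (w - 1) / (w + 1)).re < R := fun w hw => by
    have h1 := hne w hw
    have h2 : 0 < normSq (w + 1) := normSq_pos.2 h1
    rw [mem_ball_zero_iff] at hw
    have h3 : normSq w < 1 := by rw [normSq_eq_norm_sq]; nlinarith [norm_nonneg w]
    rw [normSq_apply] at h3
    rw [add_re, ofReal_re, div_re, ← add_div]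
    have : ((w - 1).re * (w + 1).re + (w - 1).im * (w + 1).im) / normSq (w + 1) < 0 := by
      apply div_neg_of_neg_of_pos _ h2
      simp only [sub_re, add_re, one_re, sub_im, add_im, one_im, sub_zero, add_zero]
      nlinarith
    linarith
  have hφ : ∀ w ∈ 𝔹,
      HasDerivAt (fun w : ℂ => (R : ℂ) + (w - 1) / (w + 1)) (2 / (w + 1) ^ 2) w := fun w hw => by
    refine ((((hasDerivAt_id w).sub_const 1).fun_div ((hasDerivAt_id w).add_const 1)
      (hne w hw)).const_add (R : ℂ)).congr_deriv ?_
    norm_num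
  obtain ⟨W, hW⟩ := DifferentiableOn.isExactOn_ball (c := (0 : ℂ)) (r := 1)
    (f := fun w => f ((R : ℂ) + (w - 1) / (w + 1)) * (2 / (w + 1) ^ 2)) (by
      refine DifferentiableOn.mul ?_ ?_
      · exact hf.comp (fun w hw => (hφ w hw).differentiableAt.differentiableWithinAt)
          fun w hw => hre w hw
      · refine DifferentiableOn.div (by fun_prop) (by fun_prop) fun w hw => pow_ne_zero 2 (hne w hw))
  refine ⟨fun ζ => W ((1 + (ζ - R)) / (1 - (ζ - R))), fun ζ hζ => ?_⟩
  have h1 : 1 - (ζ - R) ≠ 0 := fun h => by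
    have := congrArg Complex.re h
    simp only [sub_re, one_re, ofReal_re, zero_re] at this
    linarith
  have h2 : (1 + (ζ - R)) / (1 - (ζ - R)) ∈ 𝔹 := by
    rw [mem_ball_zero_iff, norm_div, div_lt_one (norm_pos_iff.2 h1)]
    rw [← sq_lt_sq₀ (norm_nonneg _) (norm_nonneg _), sq_norm, sq_norm, normSq_apply, normSq_apply]
    simp only [add_re, sub_re, one_re, ofReal_re, add_im, sub_im, one_im, ofReal_im]
    nlinarith
  have h3 : HasDerivAt (fun ζ : ℂ => (1 + (ζ - R)) / (1 - (ζ - R))) (2 / (1 - (ζ - R)) ^ 2) ζ := by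
    refine ((((hasDerivAt_id ζ).sub_const (R : ℂ)).const_add 1).fun_div
      (((hasDerivAt_id ζ).sub_const (R : ℂ)).const_sub 1) h1).congr_deriv ?_
    simp only [id]
    congr 1
    ring
  refine ((hW _ h2).comp ζ h3).congr_deriv ?_
  have h4 : (1 + (ζ - R)) / (1 - (ζ - R)) + 1 = 2 / (1 - (ζ - R)) := by field_simp; ring
  have h5 : (R : ℂ) + ((1 + (ζ - R)) / (1 - (ζ - R)) - 1) / ((1 + (ζ - R)) / (1 - (ζ - R)) + 1)
      = ζ := by
    rw [h4]; field_simp; ring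
  simp only
  rw [h5, h4]
  field_simp

/-- A local branch of a function of `log (w - z0)`, and its Schwarzian derivative. -/
lemma schwarzian_frobenius {α ζ1 z0 : ℂ} {F V G0 h : ℂ → ℂ} (hα : α ^ 2 = 1 - 2 * G0 z0)
    (hV : ∀ᶠ ζ in 𝓝 ζ1, HasDerivAt V (exp (-α * ζ) * (F (exp ζ) ^ 2)⁻¹) ζ)
    (hF : AnalyticAt ℂ F (exp ζ1)) (hF0 : F (exp ζ1) ≠ 0)
    (hode : ∀ᶠ z in 𝓝 (exp ζ1), z * deriv (deriv F) z + (α + 1) * deriv F z = h z * F z)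
    (hh : ∀ z, G0 (z0 + z) - G0 z0 = -2 * (z * h z)) :
    let V1 : ℂ → ℂ := fun w => V (ζ1 + log ((w - z0) / exp ζ1))
    AnalyticAt ℂ V1 (z0 + exp ζ1) ∧ deriv V1 (z0 + exp ζ1) ≠ 0 ∧
      ∀ᶠ w in 𝓝 (z0 + exp ζ1), schwarzian V1 w = G0 w / (w - z0) ^ 2 := by
  intro V1
  set z1 := exp ζ1 with hz₁
  have hz₁0 : z1 ≠ 0 := exp_ne_zero _
  set ℓ : ℂ → ℂ := fun w => ζ1 + log ((w - z0) / z1) with hℓ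
  set χ : ℂ → ℂ := fun w => -(α + 1) / (w - z0) - 2 * deriv F (w - z0) / F (w - z0) with hχ
  set m : ℂ → ℂ := fun w => exp (-α * ℓ w) * (F (w - z0) ^ 2)⁻¹ / (w - z0) with hm
  have hsub : Tendsto (fun w : ℂ => w - z0) (𝓝 (z0 + z1)) (𝓝 z1) := by
    have : ContinuousAt (fun w : ℂ => w - z0) (z0 + z1) := by fun_prop
    simpa [ContinuousAt] using this
  have hlog : ∀ᶠ w in 𝓝 (z0 + z1), (w - z0) / z1 ∈ slitPlane := by
    have : Tendsto (fun w : ℂ => (w - z0) / z1) (𝓝 (z0 + z1)) (𝓝 1) := by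
      simpa [hz₁0] using hsub.div_const z1
    exact this.eventually (isOpen_slitPlane.mem_nhds (by simp))
  have hne : ∀ᶠ w in 𝓝 (z0 + z1), w - z0 ≠ 0 := hsub.eventually_ne hz₁0
  have hℓd : ∀ᶠ w in 𝓝 (z0 + z1), HasDerivAt ℓ (1 / (w - z0)) w := by
    filter_upwards [hlog, hne] with w hw hw0
    refine (((((hasDerivAt_id w).sub_const z0).div_const z1).clog hw).const_add ζ1).congr_deriv ?_
    grind
  have hℓe : ∀ᶠ w in 𝓝 (z0 + z1), exp (ℓ w) = w - z0 := by
    filter_upwards [hne] with w hw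
    rw [hℓ]; simp only
    rw [exp_add, exp_log (div_ne_zero hw hz₁0), ← hz₁]
    grind
  have hℓt : Tendsto ℓ (𝓝 (z0 + z1)) (𝓝 ζ1) := by
    have h1 := hℓd.self_of_nhds.continuousAt
    have : ℓ (z0 + z1) = ζ1 := by simp [hℓ, hz₁0]
    rwa [ContinuousAt, this] at h1
  have hVd : ∀ᶠ w in 𝓝 (z0 + z1), HasDerivAt V1 (m w) w := by
    filter_upwards [hℓt.eventually hV, hℓd, hℓe] with w h1 h2 h3
    refine (h1.comp w h2).congr_deriv ?_
    grind
  have hFan : ∀ᶠ w in 𝓝 (z0 + z1), AnalyticAt ℂ F (w - z0) :=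
    hsub.eventually hF.eventually_analyticAt
  have hFne : ∀ᶠ w in 𝓝 (z0 + z1), F (w - z0) ≠ 0 :=
    hsub.eventually (hF.continuousAt.eventually_ne hF0)
  have hsd : ∀ w : ℂ, HasDerivAt (fun w : ℂ => w - z0) 1 w := fun w =>
    (hasDerivAt_id w).sub_const z0
  have hFd : ∀ᶠ w in 𝓝 (z0 + z1), HasDerivAt (fun w => F (w - z0)) (deriv F (w - z0)) w := by
    filter_upwards [hFan] with w h1
    exact h1.differentiableAt.hasDerivAt.comp_sub_const w z0
  have hFdd : ∀ᶠ w in 𝓝 (z0 + z1),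
      HasDerivAt (fun w => deriv F (w - z0)) (deriv (deriv F) (w - z0)) w := by
    filter_upwards [hFan] with w h1
    exact h1.deriv.differentiableAt.hasDerivAt.comp_sub_const w z0
  have hmd : ∀ᶠ w in 𝓝 (z0 + z1), HasDerivAt m (m w * χ w) w := by
    filter_upwards [hℓd, hFd, hFne, hne] with w h1 h2 h3 h4
    refine ((((h1.const_mul (-α)).cexp.fun_mul
      ((h2.fun_pow 2).fun_inv (pow_ne_zero 2 h3)))).fun_div (hsd w) h4).congr_deriv ?_
    simp only [hm, hχ]
    push_cast
    field_simp
    ring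
  have hm0 : ∀ᶠ w in 𝓝 (z0 + z1), m w ≠ 0 := by
    filter_upwards [hFne, hne] with w h3 h4
    simp only [hm]
    exact div_ne_zero (mul_ne_zero (exp_ne_zero _) (inv_ne_zero (pow_ne_zero 2 h3))) h4
  have hVan : ∀ᶠ w in 𝓝 (z0 + z1), AnalyticAt ℂ V1 w := by
    filter_upwards [hVd.eventually_nhds] with w hw
    rw [Complex.analyticAt_iff_eventually_differentiableAt]
    exact hw.mono fun y hy => hy.differentiableAt
  refine ⟨hVan.self_of_nhds, by rw [hVd.self_of_nhds.deriv]; exact hm0.self_of_nhds, ?_⟩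
  have hd1 : ∀ᶠ w in 𝓝 (z0 + z1), deriv V1 w = m w := hVd.mono fun w hw => hw.deriv
  have hd2 : ∀ᶠ w in 𝓝 (z0 + z1), deriv (deriv V1) w = m w * χ w := by
    filter_upwards [hd1.eventually_nhds, hmd] with w h1 h2
    rw [Filter.EventuallyEq.deriv_eq h1, h2.deriv]
  have hpsi : ∀ᶠ w in 𝓝 (z0 + z1), deriv (deriv V1) w / deriv V1 w = χ w := by
    filter_upwards [hd1, hd2, hm0] with w h1 h2 h3
    rw [h1, h2]; field_simp
  have hode' := hsub.eventually hode
  filter_upwards [hpsi.eventually_nhds, hVan, hd1, hm0, hFd, hFdd, hFne, hne, hode']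
    with w h1 h2 h3 h4 h5 h6 h7 h8 h9
  have e1 := hasDerivAt_preSchwarzian h2 (by rw [h3]; exact h4)
  rw [h1.self_of_nhds] at e1
  have e2 := e1.congr_of_eventuallyEq (f₁ := χ) (by filter_upwards [h1] with y hy using hy.symm)
  have e3 : HasDerivAt χ ((α + 1) / (w - z0) ^ 2
      - 2 * (deriv (deriv F) (w - z0) * F (w - z0) - deriv F (w - z0) ^ 2) / F (w - z0) ^ 2) w := by
    refine (((hasDerivAt_const w (-(α + 1))).fun_div (hsd w) h8).fun_sub
      ((h6.const_mul 2).fun_div h5 h7)).congr_deriv ?_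
    field_simp
    ring
  have e4 := e2.unique e3
  have e5 : schwarzian V1 w = (α + 1) / (w - z0) ^ 2
      - 2 * (deriv (deriv F) (w - z0) * F (w - z0) - deriv F (w - z0) ^ 2) / F (w - z0) ^ 2
      - χ w ^ 2 / 2 := by linear_combination e4
  rw [e5]
  have e6 : G0 w = G0 z0 - 2 * ((w - z0) * h (w - z0)) := by
    have := hh (w - z0)
    rw [add_sub_cancel] at this
    linear_combination this
  rw [e6, hχ]
  simp only
  generalize w - z0 = x at *
  field_simp
  linear_combination (-4 * x * F x) * h9 - (F x ^ 2) * hα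

variable {S : Type*} [TopologicalSpace S] [ChartedSpace ℂ S] {P : Set S}

/-- The normal form of a projective structure near a puncture `p`. In the logarithm `ζ` of the
complex coordinate at `p`, on a left half-plane, the projective coordinates are the Möbius
functions of a function `V` with `V' = exp (-α ζ) G (exp ζ)`, where `0 ≤ Re α`, and `G` is analytic
with `G 0 = 1`. In particular the local monodromy is affine in the coordinate `V`. -/
structure CuspModel (Q : ProjectiveStructure S P) (p : S) where
  α : ℂ
  R : ℝ
  G : ℂ → ℂ
  V : ℂ → ℂ
  re_nonneg : 0 ≤ α.re
  G_zero : G 0 = 1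
  G_analytic : ∀ z : ℂ, ‖z‖ < Real.exp R → AnalyticAt ℂ G z
  V_deriv : ∀ ζ : ℂ, ζ.re < R → HasDerivAt V (exp (-α * ζ) * G (exp ζ)) ζ
  mem_target : ∀ z : ℂ, ‖z‖ < Real.exp R → chartAt ℂ p p + z ∈ (chartAt ℂ p).target
  notMem : ∀ ζ : ℂ, ζ.re < R → (chartAt ℂ p).symm (chartAt ℂ p p + exp ζ) ∉ P
  proj : ∀ ζ : ℂ, ζ.re < R → ∀ e ∈ Q.charts, (chartAt ℂ p).symm (chartAt ℂ p p + exp ζ) ∈ e.source →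
      ∃ A : GL (Fin 2) ℂ, ∀ᶠ ζ' in 𝓝 ζ,
        MoebiusRel A (V ζ') (e ((chartAt ℂ p).symm (chartAt ℂ p p + exp ζ')))

/-- The coordinate change between charts of the maximal atlas has a nonzero derivative. -/
lemma deriv_transition_ne_zero {e e' : OpenPartialHomeomorph S ℂ}
    (he : e ∈ IsManifold.maximalAtlas 𝓘(ℂ) ω S) (he' : e' ∈ IsManifold.maximalAtlas 𝓘(ℂ) ω S)
    {x : S} (hx : x ∈ e.source) (hx' : x ∈ e'.source) :
    deriv (fun z => e' (e.symm z)) (e x) ≠ 0 := by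
  have h1 := (analyticAt_transition he he' hx hx').differentiableAt.hasDerivAt
  have h2 := (analyticAt_transition he' he hx' hx).differentiableAt.hasDerivAt
  have hxx : e' (e.symm (e x)) = e' x := by rw [e.left_inv hx]
  rw [← hxx] at h2
  have h3 := h2.comp (e x) h1
  have h4 : ((fun z => e (e'.symm z)) ∘ fun z => e' (e.symm z)) =ᶠ[𝓝 (e x)] id := by
    have h5 : ∀ᶠ z in 𝓝 (e x), e.symm z ∈ e'.source := by
      refine (e.continuousAt_symm (e.map_source hx)).eventually (e'.open_source.mem_nhds ?_)
      simp [*]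
    filter_upwards [h5, e.open_target.mem_nhds (e.map_source hx)] with z h6 h7
    simp [*]
  have h6 := h3.congr_of_eventuallyEq h4.symm
  have h7 := h6.unique (hasDerivAt_id (e x))
  grind

/-- Regularity gives `S(u, z) = (1 - α ^ 2) / (2 z ^ 2) + ⋯`. The Frobenius series of
exponent `α` yields a function of the logarithm of the coordinate with this Schwarzian derivative,
which differs from every projective coordinate by a Möbius function. -/
lemma exists_cuspModel [T2Space S] [IsManifold 𝓘(ℂ) ω S] (hP : P.Finite)
    {Q : ProjectiveStructure S P} (hreg : Q.IsRegular) {p : S} (hp : p ∈ P) :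
    Nonempty (CuspModel Q p) := by
  obtain ⟨G0, hG₀, hT⟩ := hreg p hp
  set c := chartAt ℂ p with hc
  set z0 := c p with hz₀
  have hps : p ∈ c.source := mem_chart_source ℂ p
  have hca : c ∈ IsManifold.maximalAtlas 𝓘(ℂ) ω S := IsManifold.chart_mem_maximalAtlas p
  -- the exponent
  obtain ⟨α, hα, hαre⟩ : ∃ α : ℂ, α ^ 2 = 1 - 2 * G0 z0 ∧ 0 ≤ α.re := by
    obtain ⟨β, hβ⟩ := IsAlgClosed.exists_pow_nat_eq (1 - 2 * G0 z0) two_pos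
    rcases le_total 0 β.re with h | h
    · grind
    · exact ⟨-β, by rw [neg_sq]; exact hβ, by simpa using h⟩
  -- the right hand side of the differential equation
  have hadd : AnalyticAt ℂ (fun z : ℂ => z0 + z) 0 := by fun_prop
  have hG1 : AnalyticAt ℂ (fun z => G0 (z0 + z)) 0 := by
    refine AnalyticAt.fun_comp (g := G0) (f := fun z : ℂ => z0 + z) ?_ hadd
    grind
  set h : ℂ → ℂ := fun z => -(1 / 2) * dslope (fun z => G0 (z0 + z)) 0 z with hh
  have hha : AnalyticAt ℂ h 0 := by
    obtain ⟨q, hq⟩ := hG1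
    exact analyticAt_const.mul hq.has_fpower_series_dslope_fslope.analyticAt
  have hhG : ∀ z, G0 (z0 + z) - G0 z0 = -2 * (z * h z) := fun z => by
    have := sub_smul_dslope (fun z => G0 (z0 + z)) 0 z
    simp only [sub_zero, smul_eq_mul, add_zero] at this
    grind
  obtain ⟨F, hFa, hF1, hode⟩ := exists_frobenius_solution hαre hha
  -- everything holds on a small punctured ball
  have hsymm : Tendsto (fun z => c.symm (z0 + z)) (𝓝 0) (𝓝 p) := by
    have h1 : ContinuousAt c.symm (z0 + 0) := by
      rw [add_zero]; exact c.continuousAt_symm (c.map_source hps)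
    have h2 : ContinuousAt (fun z => c.symm (z0 + z)) 0 :=
      ContinuousAt.comp' (f := fun z => z0 + z) h1 hadd.continuousAt
    rw [ContinuousAt, add_zero, c.left_inv hps] at h2
    exact h2
  have htarget : ∀ᶠ z in 𝓝 (0 : ℂ), z0 + z ∈ c.target := by
    have : Tendsto (fun z : ℂ => z0 + z) (𝓝 0) (𝓝 z0) := by
      simpa [ContinuousAt] using hadd.continuousAt
    exact this.eventually (c.open_target.mem_nhds (c.map_source hps))
  have hT' : ∀ᶠ y in 𝓝 p, y ≠ p → y ∉ P ∧ ∀ e ∈ Q.charts, y ∈ e.source →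
      schwarzian (fun z => e (c.symm z)) (c y) = G0 (c y) / (c y - z0) ^ 2 := by
    have h1 : ∀ᶠ y in 𝓝 p, y ≠ p → y ∉ P := by
      have h2 : (P \ {p})ᶜ ∈ 𝓝 p :=
        (hP.subset Set.sdiff_subset).isClosed.isOpen_compl.mem_nhds (by simp)
      filter_upwards [h2] with y hy hyp hyP using hy ⟨hyP, hyp⟩
    have h3 := eventually_nhdsWithin_iff.1 hT
    filter_upwards [h1, h3] with y h4 h5 h6 using ⟨h4 h6, h5 h6⟩
  have hall := (hsymm.eventually hT').and (htarget.and (hode.and (hFa.eventually_analyticAt.and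
    (hFa.continuousAt.eventually_ne (hF1 ▸ one_ne_zero)))))
  obtain ⟨r, hr, hball⟩ := eventually_nhds_iff_ball.1 hall
  have hexpR : Real.exp (Real.log r) = r := Real.exp_log hr
  have hexp : ∀ ζ : ℂ, ζ.re < Real.log r → exp ζ ∈ ball (0 : ℂ) r := fun ζ hζ => by
    rw [mem_ball_zero_iff, norm_exp, ← hexpR]
    exact exp_lt_exp.2 hζ
  have hho : IsOpen {ζ : ℂ | ζ.re < Real.log r} := isOpen_lt continuous_re continuous_const
  obtain ⟨V, hV⟩ := exists_primitive_halfPlane (R := Real.log r)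
    (f := fun ζ => exp (-α * ζ) * (F (exp ζ) ^ 2)⁻¹) (by
      intro ζ hζ
      obtain ⟨-, -, -, h4, h5⟩ := hball _ (hexp ζ hζ)
      have h6 : DifferentiableAt ℂ (fun ζ => F (exp ζ)) ζ :=
        h4.differentiableAt.fun_comp' ζ Complex.differentiableAt_exp
      refine DifferentiableAt.differentiableWithinAt ?_
      exact (by fun_prop : DifferentiableAt ℂ (fun ζ => exp (-α * ζ)) ζ).fun_mul
        ((h6.fun_pow 2).fun_inv (pow_ne_zero 2 h5)))
  refine ⟨⟨α, Real.log r, fun z => (F z ^ 2)⁻¹, V, hαre, by simp [hF1], ?_, hV, ?_, ?_, ?_⟩⟩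
  · intro z hz
    rw [hexpR] at hz
    obtain ⟨-, -, -, h4, h5⟩ := hball z (mem_ball_zero_iff.2 hz)
    exact (h4.fun_pow 2).fun_inv (pow_ne_zero 2 h5)
  · intro z hz
    rw [hexpR] at hz
    exact (hball z (mem_ball_zero_iff.2 hz)).2.1
  · intro ζ hζ
    obtain ⟨h1, h2, -⟩ := hball _ (hexp ζ hζ)
    refine (h1 fun h3 => ?_).1
    have := congrArg c h3
    rw [c.right_inv h2] at this
    exact exp_ne_zero ζ (add_eq_left.1 this)
  · intro ζ hζ e he hse
    have hyne : ∀ ζ : ℂ, ζ.re < Real.log r → c.symm (z0 + exp ζ) ≠ p := fun ζ hζ h3 => by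
      have := congrArg c h3
      rw [c.right_inv (hball _ (hexp ζ hζ)).2.1] at this
      exact exp_ne_zero ζ (add_eq_left.1 this)
    obtain ⟨h1, h2, h3, h4, h5⟩ := hball _ (hexp ζ hζ)
    have hexpn : ∀ᶠ z in 𝓝 (exp ζ), z ∈ ball (0 : ℂ) r := isOpen_ball.mem_nhds (hexp ζ hζ)
    obtain ⟨hV1, hV2, hV3⟩ := schwarzian_frobenius (z0 := z0) hα
      (eventually_of_mem (hho.mem_nhds hζ) hV)
      h4 h5 (hexpn.mono fun z hz => (hball z hz).2.2.1) hhG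
    have hcs : c.symm (z0 + exp ζ) ∈ c.source := c.map_target h2
    have hcc : c (c.symm (z0 + exp ζ)) = z0 + exp ζ := c.right_inv h2
    have hfa := analyticAt_transition hca (Q.holomorphic e he) hcs hse
    have hfd := deriv_transition_ne_zero hca (Q.holomorphic e he) hcs hse
    rw [hcc] at hfa hfd
    obtain ⟨A, hA⟩ := exists_moebiusRel_of_schwarzian_eq hfa hV1 hfd hV2 (by
      have e1 : Tendsto (fun w : ℂ => w - z0) (𝓝 (z0 + exp ζ)) (𝓝 (exp ζ)) := by
        have : ContinuousAt (fun w : ℂ => w - z0) (z0 + exp ζ) := by fun_prop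
        simpa [ContinuousAt] using this
      have e2 : ∀ᶠ w in 𝓝 (z0 + exp ζ), c.symm w ∈ e.source :=
        (c.continuousAt_symm h2).eventually (e.open_source.mem_nhds hse)
      filter_upwards [hV3, e1.eventually hexpn, e1.eventually_ne (exp_ne_zero ζ), e2]
        with w h6 h7 h8 h9
      obtain ⟨k1, k2, -⟩ := hball _ h7
      rw [add_sub_cancel] at k1 k2
      have h10 := (k1 fun h11 => by
        have := congrArg c h11
        rw [c.right_inv k2] at this
        exact h8 (sub_eq_zero.2 this)).2 e he h9
      rw [c.right_inv k2] at h10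
      rw [h6, h10])
    refine ⟨A, ?_⟩
    have e3 : Tendsto (fun ζ' => z0 + exp ζ') (𝓝 ζ) (𝓝 (z0 + exp ζ)) := by
      have : ContinuousAt (fun ζ' => z0 + exp ζ') ζ := by fun_prop
      exact this
    have e4 : ∀ᶠ ζ' in 𝓝 ζ, ζ + log (exp (ζ' - ζ)) = ζ' := by
      have : ∀ᶠ ζ' in 𝓝 ζ, ‖ζ' - ζ‖ < 1 := by
        filter_upwards [ball_mem_nhds ζ one_pos] with ζ' h using by simpa [dist_eq_norm] using h
      filter_upwards [this] with ζ' h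
      have h6 := (abs_im_le_norm (ζ' - ζ)).trans_lt h
      rw [abs_lt] at h6
      have h7 := pi_gt_three
      rw [log_exp (by linarith) (by linarith)]
      ring
    filter_upwards [e3.eventually hA, e4] with ζ' h6 h7
    rw [add_sub_cancel_left, ← exp_sub, h7] at h6
    exact h6

end Cusp

/-! ### Asymptotics in half-strips -/

section Strips

/-- The half-strip `Re s > R`, `a < Im s < b`. -/
def halfStrip (R a b : ℝ) : Set ℂ := {s | R < s.re ∧ a < s.im ∧ s.im < b}

/-- The filter of the ends `Re s → ∞` of the strip `a < Im s < b`. -/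
def stripEnd (a b : ℝ) : Filter ℂ := comap Complex.re atTop ⊓ 𝓟 {s | a < s.im ∧ s.im < b}

lemma eventually_stripEnd {a b : ℝ} {p : ℂ → Prop} :
    (∀ᶠ s in stripEnd a b, p s) ↔ ∃ R, ∀ s ∈ halfStrip R a b, p s := by
  rw [stripEnd, eventually_inf_principal, eventually_comap, eventually_atTop]
  constructor
  · rintro ⟨R, hR⟩
    exact ⟨R, fun s hs => hR s.re hs.1.le s rfl hs.2⟩
  · rintro ⟨R, hR⟩
    exact ⟨R + 1, fun x hx s hs h => hR s ⟨by linarith, h⟩⟩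

lemma eventually_mem_halfStrip (R a b : ℝ) : ∀ᶠ s in stripEnd a b, s ∈ halfStrip R a b :=
  eventually_stripEnd.2 ⟨R, fun _ hs => hs⟩

lemma tendsto_re_stripEnd (a b : ℝ) : Tendsto Complex.re (stripEnd a b) atTop :=
  tendsto_comap.mono_left inf_le_left

lemma isOpen_halfStrip (R a b : ℝ) : IsOpen (halfStrip R a b) :=
  (isOpen_lt continuous_const continuous_re).inter ((isOpen_lt continuous_const continuous_im).inter
      (isOpen_lt continuous_im continuous_const))

lemma convex_halfStrip (R a b : ℝ) : Convex ℝ (halfStrip R a b) := by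
  exact (convex_halfSpace_re_gt R).inter ((convex_halfSpace_im_gt a).inter
    (convex_halfSpace_im_lt b))

lemma halfStrip_mono {R R' a b : ℝ} (h : R ≤ R') : halfStrip R' a b ⊆ halfStrip R a b :=
  fun _ hs => ⟨h.trans_lt hs.1, hs.2⟩

instance stripEnd_neBot {a b : ℝ} [h : Fact (a < b)] : (stripEnd a b).NeBot := by
  rw [neBot_iff]
  intro h0
  have h1 : ∀ᶠ s in stripEnd a b, False := by rw [h0]; exact eventually_bot
  obtain ⟨R, hR⟩ := eventually_stripEnd.1 h1
  refine hR ⟨R + 1, (a + b) / 2⟩ ⟨?_, ?_, ?_⟩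
  · simp
  · simp only; linarith [h.out]
  · simp only; linarith [h.out]

lemma tendsto_exp_neg_stripEnd (a b : ℝ) :
    Tendsto (fun s : ℂ => exp (-s)) (stripEnd a b) (𝓝 0) := by
  rw [tendsto_zero_iff_norm_tendsto_zero]
  simp only [norm_exp, neg_re]
  exact (Real.tendsto_exp_neg_atTop_nhds_zero).comp (tendsto_re_stripEnd a b)

variable {R a b : ℝ} {E E' : ℂ → ℂ}

/-- `B` is a primitive of the bound on `E'`, so that improper integrals are not needed. -/
lemma norm_sub_le_horizontal (hE : ∀ s ∈ halfStrip R a b, HasDerivAt E (E' s) s) {B B' : ℝ → ℝ}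
    (hB : ∀ x, HasDerivAt B (B' x) x) (hEB : ∀ s ∈ halfStrip R a b, ‖E' s‖ ≤ B' s.re)
    {x1 x2 y : ℝ} (h₁ : (⟨x1, y⟩ : ℂ) ∈ halfStrip R a b) (h : x1 ≤ x2) :
    ‖E ⟨x2, y⟩ - E ⟨x1, y⟩‖ ≤ B x2 - B x1 := by
  have hmem : ∀ x, x1 ≤ x → (⟨x, y⟩ : ℂ) ∈ halfStrip R a b := fun x hx =>
    ⟨lt_of_lt_of_le h₁.1 hx, h₁.2⟩
  have heq : ∀ x : ℝ, (⟨x, y⟩ : ℂ) = (x : ℂ) + y * I := fun x => Complex.mk_eq_add_mul_I x y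
  have hd : ∀ x, x1 ≤ x → HasDerivAt (fun x : ℝ => E ⟨x, y⟩ - E ⟨x1, y⟩) (E' ⟨x, y⟩) x := by
    intro x hx
    have h1 := hE _ (hmem x hx)
    rw [heq] at h1
    have h2 := (h1.comp_add_const (x : ℂ) (y * I)).comp_ofReal
    simp [*]
  refine image_norm_le_of_norm_deriv_right_le_deriv_boundary (a := x1) (b := x2)
    (f := fun x : ℝ => E ⟨x, y⟩ - E ⟨x1, y⟩) (f' := fun x => E' ⟨x, y⟩)
    (B := fun x => B x - B x1) (B' := B')
    (fun x hx => (hd x hx.1).continuousAt.continuousWithinAt)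
    (fun x hx => (hd x hx.1).hasDerivWithinAt) (by simp) (fun x => (hB x).sub_const _)
    (fun x hx => hEB _ (hmem x hx.1)) (Set.right_mem_Icc.2 h)

lemma norm_sub_le_vertical (hE : ∀ s ∈ halfStrip R a b, HasDerivAt E (E' s) s) {B' : ℝ → ℝ}
    (hEB : ∀ s ∈ halfStrip R a b, ‖E' s‖ ≤ B' s.re)
    {x y1 y2 : ℝ} (h₁ : (⟨x, y1⟩ : ℂ) ∈ halfStrip R a b) (h₂ : (⟨x, y2⟩ : ℂ) ∈ halfStrip R a b) :
    ‖E ⟨x, y2⟩ - E ⟨x, y1⟩‖ ≤ B' x * (b - a) := by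
  have hB0 : 0 ≤ B' x := (norm_nonneg _).trans (hEB _ h₁)
  have hc : Convex ℝ (halfStrip R a b ∩ {s | s.re = x}) := by
    refine (convex_halfStrip R a b).inter ?_
    exact convex_hyperplane Complex.reLm.isLinear x
  have h3 := hc.norm_image_sub_le_of_norm_hasDerivWithin_le (f := E) (f' := E') (C := B' x)
    (fun s hs => (hE s hs.1).hasDerivWithinAt) (fun s hs => by grind) ⟨h₁, rfl⟩ ⟨h₂, rfl⟩
  refine h3.trans (mul_le_mul_of_nonneg_left ?_ hB0)
  refine (Complex.norm_le_abs_re_add_abs_im _).trans ?_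
  simp only [sub_re, sub_self, abs_zero, sub_im, zero_add]
  have := h₁.2; have := h₂.2
  grind

/-- Integration of `E' = o(exp s)` along horizontal segments gives `E = o(exp s)`. -/
lemma tendsto_mul_exp_neg_of_deriv (hE : ∀ s ∈ halfStrip R a b, HasDerivAt E (E' s) s)
    (h : Tendsto (fun s => E' s * exp (-s)) (stripEnd a b) (𝓝 0)) :
    Tendsto (fun s => E s * exp (-s)) (stripEnd a b) (𝓝 0) := by
  by_cases hab : a < b
  swap
  · have : stripEnd a b = ⊥ := by
      rw [← eventually_false_iff_eq_bot, eventually_stripEnd]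
      exact ⟨0, fun s hs => hab (hs.2.1.trans hs.2.2)⟩
    simp [*]
  rw [Metric.tendsto_nhds] at h ⊢
  intro ε hε
  obtain ⟨R1, hR1⟩ := eventually_stripEnd.1 (h (ε / 4) (by positivity))
  set R2 := max R R1 with hR2
  have hE2 : ∀ s ∈ halfStrip R2 a b, HasDerivAt E (E' s) s := fun s hs =>
    hE s (halfStrip_mono (le_max_left _ _) hs)
  have hEB : ∀ s ∈ halfStrip R2 a b, ‖E' s‖ ≤ (ε / 4) * Real.exp s.re := fun s hs => by
    have h1 := hR1 s (halfStrip_mono (le_max_right _ _) hs)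
    rw [dist_zero_right, norm_mul, norm_exp, neg_re, Real.exp_neg] at h1
    rw [← div_eq_mul_inv, div_lt_iff₀ (exp_pos _)] at h1
    exact h1.le
  set y0 := (a + b) / 2
  have hy₀ : a < y0 ∧ y0 < b := by constructor <;> simp only [y0] <;> linarith
  set C := ‖E ⟨R2 + 1, y0⟩‖ + ε / 4 * Real.exp (R2 + 1) * (b - a) with hC
  have hbd : ∀ s ∈ halfStrip (R2 + 1) a b, ‖E s‖ ≤ C + ε / 4 * Real.exp s.re := fun s hs => by
    have h1 : (⟨R2 + 1, s.im⟩ : ℂ) ∈ halfStrip R2 a b := ⟨by simp, hs.2⟩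
    have h2 : (⟨R2 + 1, y0⟩ : ℂ) ∈ halfStrip R2 a b := ⟨by simp, hy₀⟩
    have h3 := norm_sub_le_vertical (B' := fun x => ε / 4 * Real.exp x) hE2 hEB h2 h1
    have h4 := norm_sub_le_horizontal hE2 (B := fun x => ε / 4 * Real.exp x)
      (fun x => (Real.hasDerivAt_exp x).const_mul (ε / 4)) hEB h1 hs.1.le
    have h5 : ‖E s‖ ≤ ‖E ⟨s.re, s.im⟩ - E ⟨R2 + 1, s.im⟩‖
        + ‖E ⟨R2 + 1, s.im⟩ - E ⟨R2 + 1, y0⟩‖ + ‖E ⟨R2 + 1, y0⟩‖ := by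
      have : E s = (E ⟨s.re, s.im⟩ - E ⟨R2 + 1, s.im⟩)
        + (E ⟨R2 + 1, s.im⟩ - E ⟨R2 + 1, y0⟩) + E ⟨R2 + 1, y0⟩ := by
        simp
      exact (congrArg norm this).le.trans norm_add₃_le
    have h6 : 0 < ε / 4 * Real.exp (R2 + 1) := by positivity
    linarith
  have hC0 : Tendsto (fun s : ℂ => C * ‖exp (-s)‖) (stripEnd a b) (𝓝 0) := by
    simpa using (tendsto_exp_neg_stripEnd a b).norm.const_mul C
  filter_upwards [(hC0.eventually (gt_mem_nhds (half_pos hε))),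
    eventually_mem_halfStrip (R2 + 1) a b] with s hs1 hs2
  rw [dist_zero_right, norm_mul]
  have h7 := hbd s hs2
  have h8 : ‖exp (-s)‖ * Real.exp s.re = 1 := by rw [norm_exp, ← Real.exp_add]; simp
  have h9 : 0 < ‖exp (-s)‖ := norm_pos_iff.2 (exp_ne_zero _)
  nlinarith

/-- If `E' = o(exp (-s))`, integration from the end of the strip gives `E = ℓ + o(exp (-s))`. -/
lemma exists_tendsto_of_deriv (hab : a < b) (hE : ∀ s ∈ halfStrip R a b, HasDerivAt E (E' s) s)
    (h : Tendsto (fun s => E' s * exp s) (stripEnd a b) (𝓝 0)) :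
    ∃ ℓ, Tendsto E (stripEnd a b) (𝓝 ℓ) ∧
      Tendsto (fun s => (E s - ℓ) * exp s) (stripEnd a b) (𝓝 0) := by
  have : Fact (a < b) := ⟨hab⟩
  have key : ∀ ε > 0, ∃ R1, ∀ s ∈ halfStrip R1 a b, ∀ s' ∈ halfStrip R1 a b, s.re ≤ s'.re →
      ‖E s' - E s‖ ≤ ε * Real.exp (-s.re) := fun ε hε => by
    have hba : 0 < 1 + (b - a) := by linarith
    set ε' := ε / (1 + (b - a)) with hε'
    have hε'0 : 0 < ε' := div_pos hε hba
    obtain ⟨R1, hR1⟩ := eventually_stripEnd.1 (Metric.tendsto_nhds.1 h ε' hε'0)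
    refine ⟨max R R1, fun s hs s' hs' hss => ?_⟩
    have hE2 : ∀ s ∈ halfStrip (max R R1) a b, HasDerivAt E (E' s) s := fun s hs =>
      hE s (halfStrip_mono (le_max_left _ _) hs)
    have hEB : ∀ s ∈ halfStrip (max R R1) a b, ‖E' s‖ ≤ ε' * Real.exp (-s.re) := fun s hs => by
      have h1 := hR1 s (halfStrip_mono (le_max_right _ _) hs)
      rw [dist_zero_right, norm_mul, norm_exp] at h1
      rw [Real.exp_neg, ← div_eq_mul_inv, le_div_iff₀ (exp_pos _)]
      exact h1.le
    have h1 : (⟨s.re, s'.im⟩ : ℂ) ∈ halfStrip (max R R1) a b := ⟨hs.1, hs'.2⟩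
    have h3 := norm_sub_le_vertical (B' := fun x => ε' * Real.exp (-x)) hE2 hEB
      (x := s.re) (y1 := s.im) (y2 := s'.im) hs h1
    have h4 := norm_sub_le_horizontal hE2 (B := fun x => -(ε' * Real.exp (-x)))
      (B' := fun x => ε' * Real.exp (-x))
      (fun x => by
        have := (((hasDerivAt_neg x).exp).const_mul ε').fun_neg
        grind) hEB h1 hss
    have h5 : ‖E s' - E s‖ ≤ ‖E ⟨s'.re, s'.im⟩ - E ⟨s.re, s'.im⟩‖
        + ‖E ⟨s.re, s'.im⟩ - E ⟨s.re, s.im⟩‖ := by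
      have : E s' - E s = (E ⟨s'.re, s'.im⟩ - E ⟨s.re, s'.im⟩)
        + (E ⟨s.re, s'.im⟩ - E ⟨s.re, s.im⟩) := by simp
      rw [this]; exact norm_add_le _ _
    have h6 : 0 < ε' * Real.exp (-s'.re) := by positivity
    have h7 : ε = ε' * (1 + (b - a)) := by rw [hε']; field_simp
    rw [h7]
    nlinarith
  have hcauchy : Cauchy (map E (stripEnd a b)) := by
    rw [Metric.cauchy_iff]
    refine ⟨inferInstance, fun ε hε => ?_⟩
    obtain ⟨R1, hR1⟩ := key (ε / 2) (by positivity)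
    refine ⟨E '' halfStrip (max R1 0) a b, image_mem_map (eventually_mem_halfStrip _ _ _), ?_⟩
    have : ∀ s ∈ halfStrip (max R1 0) a b, ∀ s' ∈ halfStrip (max R1 0) a b, s.re ≤ s'.re →
        dist (E s') (E s) < ε := fun s hs s' hs' hss => by
      have h1 := hR1 s (halfStrip_mono (le_max_left _ _) hs) s'
        (halfStrip_mono (le_max_left _ _) hs') hss
      have h2 : Real.exp (-s.re) ≤ 1 := Real.exp_le_one_iff.2 (by
        have := (le_max_right R1 0).trans_lt hs.1; linarith)
      rw [dist_eq_norm]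
      nlinarith
    rintro _ ⟨s, hs, rfl⟩ _ ⟨s', hs', rfl⟩
    rcases le_total s.re s'.re with hss | hss
    · rw [dist_comm]; exact this s hs s' hs' hss
    · exact this s' hs' s hs hss
  obtain ⟨ℓ, hℓ⟩ := CompleteSpace.complete hcauchy
  refine ⟨ℓ, hℓ, ?_⟩
  rw [Metric.tendsto_nhds]
  intro ε hε
  obtain ⟨R1, hR1⟩ := key (ε / 2) (by positivity)
  filter_upwards [eventually_mem_halfStrip R1 a b] with s hs
  have h1 : ‖ℓ - E s‖ ≤ ε / 2 * Real.exp (-s.re) := by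
    have hℓ' : Tendsto E (stripEnd a b) (𝓝 ℓ) := hℓ
    refine le_of_tendsto (hℓ'.sub_const (E s)).norm ?_
    filter_upwards [eventually_mem_halfStrip R1 a b,
      (tendsto_re_stripEnd a b).eventually_ge_atTop s.re] with s' h2 h3
    exact hR1 s hs s' h2 h3
  rw [dist_zero_right, norm_mul, norm_exp, norm_sub_rev]
  rw [Real.exp_neg, ← div_eq_mul_inv, le_div_iff₀ (exp_pos _)] at h1
  linarith

/-- A branch of the logarithm of a function with a nonzero limit has a limit. -/
lemma exists_tendsto_of_exp {L : ℂ → ℂ} {lam : ℂ} (hab : a < b) (hlam : lam ≠ 0)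
    (hL : ContinuousOn L (halfStrip R a b))
    (h : Tendsto (fun s => exp (L s)) (stripEnd a b) (𝓝 lam)) :
    ∃ κ, Tendsto L (stripEnd a b) (𝓝 κ) ∧ exp κ = lam := by
  have : Fact (a < b) := ⟨hab⟩
  have h1 : Tendsto (fun s => exp (L s) / lam) (stripEnd a b) (𝓝 1) := by
    simpa [hlam] using h.div_const lam
  obtain ⟨R1, hR1⟩ := eventually_stripEnd.1
    (h1.eventually (isOpen_slitPlane.mem_nhds (by simp : (1 : ℂ) ∈ slitPlane)))
  set X := halfStrip (max R R1) a b with hX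
  have hmem : (⟨max R R1 + 1, (a + b) / 2⟩ : ℂ) ∈ X := by
    refine ⟨?_, ?_, ?_⟩ <;> simp only <;> linarith
  set s₁ : ℂ := ⟨max R R1 + 1, (a + b) / 2⟩
  set κ := L s₁ - log (exp (L s₁) / lam) with hκ
  have hκe : exp κ = lam := by
    rw [hκ, exp_sub, exp_log (div_ne_zero (exp_ne_zero _) hlam)]
    simp
  refine ⟨κ, ?_, hκe⟩
  have hslit : ∀ s ∈ X, exp (L s) / lam ∈ slitPlane := fun s hs =>
    hR1 s (halfStrip_mono (le_max_right _ _) hs)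
  have hLX : ContinuousOn L X := hL.mono (halfStrip_mono (le_max_left _ _))
  have heq : Set.EqOn L (fun s => κ + log (exp (L s) / lam)) X := by
    refine Complex.isCoveringMap_exp.eqOn_of_comp_eqOn
      (convex_halfStrip _ a b).isPreconnected hLX ?_ ?_ hmem ?_
    · exact continuousOn_const.add (((Complex.continuous_exp.comp_continuousOn hLX).div_const _).clog
        hslit)
    · intro s hs
      simp only [Function.comp_apply, Subtype.mk.injEq]
      rw [exp_add, hκe, exp_log (div_ne_zero (exp_ne_zero _) hlam)]
      grind
    · simp [hκ]
  have h2 : Tendsto (fun s => κ + log (exp (L s) / lam)) (stripEnd a b) (𝓝 κ) := by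
    have h3 : Tendsto log (𝓝 1) (𝓝 (log 1)) := (continuousAt_clog (by simp)).tendsto
    simpa using (h3.comp h1).const_add κ
  refine h2.congr' ?_
  filter_upwards [eventually_mem_halfStrip (max R R1) a b] with s hs
  grind

end Strips

/-! ### Disks near a puncture -/

section Lift

variable {p : S} {U : ℂ → S} {W : Set ℂ}

/-- A continuous logarithm of an analytic function is analytic. -/
lemma analyticAt_of_exp {ζ F : ℂ → ℂ} {s : ℂ} (hF : AnalyticAt ℂ F s) (hζ : ContinuousAt ζ s)
    (h : ∀ᶠ s' in 𝓝 s, exp (ζ s') = F s') : AnalyticAt ℂ ζ s := by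
  have h0 : F s ≠ 0 := h.self_of_nhds ▸ exp_ne_zero _
  have h1 : AnalyticAt ℂ (fun s' => ζ s + log (F s' / F s)) s := by
    refine analyticAt_const.fun_add (AnalyticAt.clog (hF.fun_div analyticAt_const h0) ?_)
    simp [*]
  refine h1.congr ?_
  have h2 : Tendsto (fun s' => |(ζ s' - ζ s).im|) (𝓝 s) (𝓝 0) := by
    have : Tendsto (fun s' => ζ s' - ζ s) (𝓝 s) (𝓝 0) := by simpa using hζ.tendsto.sub_const (ζ s)
    have h3 := (continuous_im.tendsto 0).comp this
    have h4 := h3.abs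
    simp_all
  filter_upwards [h, h2.eventually (gt_mem_nhds pi_pos)] with s' h3 h4
  rw [← h3, ← h.self_of_nhds, ← exp_sub, log_exp (abs_lt.1 h4).1 (abs_lt.1 h4).2.le]
  ring

lemma CuspModel.exists_lift (K : CuspModel Q p) (hp : p ∈ P) (hW : Convex ℝ W) (hWo : IsOpen W)
    [IsManifold 𝓘(ℂ) ω S]
    (hne : W.Nonempty) (hU : Q.ProjOn exp U W)
    (hUb : ∀ s ∈ W, U s ∈ (chartAt ℂ p).source ∧
      ‖chartAt ℂ p (U s) - chartAt ℂ p p‖ < Real.exp K.R) :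
    ∃ (ζ : ℂ → ℂ) (B : GL (Fin 2) ℂ), AnalyticOnNhd ℂ ζ W ∧ ∀ s ∈ W, (ζ s).re < K.R ∧
      exp (ζ s) = chartAt ℂ p (U s) - chartAt ℂ p p ∧
      U s = (chartAt ℂ p).symm (chartAt ℂ p p + exp (ζ s)) ∧
      MoebiusRel B (exp s) (K.V (ζ s)) := by
  set c := chartAt ℂ p
  have hexp : AnalyticOnNhd ℂ exp W := fun s _ => analyticAt_cexp
  have hhol := hU.holOn hexp
  have hF : AnalyticOnNhd ℂ (fun s => c (U s) - c p) W := fun s hs =>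
    ((hhol s hs).2 c (IsManifold.chart_mem_maximalAtlas p) (hUb s hs).1).fun_sub analyticAt_const
  have hF0 : ∀ s ∈ W, c (U s) - c p ≠ 0 := fun s hs h => by
    have := c.injOn (hUb s hs).1 (mem_chart_source ℂ p) (sub_eq_zero.1 h)
    exact hU.notMem hs (this ▸ hp)
  obtain ⟨ζ, hζ, hζe⟩ : ∃ ζ : ℂ → ℂ, ContinuousOn ζ W ∧ ∀ s ∈ W, exp (ζ s) = c (U s) - c p := by
    have := hW.contractibleSpace hne
    have hsc : IsSimplyConnected W := show SimplyConnectedSpace W from inferInstance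
    refine Complex.exists_continuousOn_eqOn_exp_comp hsc hWo hF.continuousOn ?_
    grind
  have hev : ∀ s ∈ W, ∀ᶠ s' in 𝓝 s, exp (ζ s') = c (U s') - c p := fun s hs =>
    Filter.mem_of_superset (hWo.mem_nhds hs) hζe
  have hζa : AnalyticOnNhd ℂ ζ W := fun s hs =>
    analyticAt_of_exp (hF s hs) (hζ.continuousAt (hWo.mem_nhds hs)) (hev s hs)
  have hre : ∀ s ∈ W, (ζ s).re < K.R := fun s hs => by
    have := (hUb s hs).2
    rw [← hζe s hs, norm_exp] at this
    simp_all
  have hsymm : ∀ s ∈ W, U s = c.symm (c p + exp (ζ s)) := fun s hs => by simp [*]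
  obtain ⟨B, hB⟩ := exists_moebiusRel_of_locally (f := fun s => K.V (ζ s)) hW.isPreconnected hne
    hexp (fun s hs => by
      have h1 : AnalyticAt ℂ K.V (ζ s) := by
        have : DifferentiableOn ℂ K.V {ζ | ζ.re < K.R} := fun z hz =>
          (K.V_deriv z hz).differentiableAt.differentiableWithinAt
        exact this.analyticAt ((isOpen_lt continuous_re continuous_const).mem_nhds (hre s hs))
      exact h1.fun_comp (hζa s hs)) (fun s hs => by
      obtain ⟨_, e, he, hse, A, hA⟩ := hU s hs
      obtain ⟨A', hA'⟩ := K.proj (ζ s) (hre s hs) e he (by rw [← hsymm s hs]; exact hse)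
      refine ⟨adj A' * A, ?_⟩
      filter_upwards [hA, (hζ.continuousAt (hWo.mem_nhds hs)).eventually hA',
        hWo.mem_nhds hs] with s' h1 h2 h3
      rw [← hsymm s' h3] at h2
      exact h1.comp h2.inv)
  exact ⟨ζ, B, hζa, fun s hs => ⟨hre s hs, hζe s hs, hsymm s hs, hB s hs⟩⟩

lemma tendsto_re_atBot_of_tendsto [T2Space S] {F : Filter ℂ} (hU : Tendsto U F (𝓝 p)) {ζ : ℂ → ℂ}
    (h : ∀ᶠ s in F, exp (ζ s) = chartAt ℂ p (U s) - chartAt ℂ p p) :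
    Tendsto (fun s => (ζ s).re) F atBot := by
  have h1 : Tendsto (fun s => chartAt ℂ p (U s) - chartAt ℂ p p) F (𝓝 0) := by
    have := ((chartAt ℂ p).continuousAt (mem_chart_source ℂ p)).tendsto.comp hU
    simpa using this.sub_const (chartAt ℂ p p)
  have h2 : Tendsto (fun s => Real.exp (ζ s).re) F (𝓝 0) := by
    have h3 := h1.norm
    rw [norm_zero] at h3
    refine h3.congr' ?_
    filter_upwards [h] with s hs
    rw [← hs, norm_exp]
  simp_all

end Lift

section Asymptotics

variable {p : S} {R a b : ℝ} {ζ : ℂ → ℂ} {B : GL (Fin 2) ℂ}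

lemma tendsto_exp_inv_moebius {c d : ℂ} (hc : c ≠ 0) :
    Tendsto (fun s => exp s ^ 2 / (c * exp s + d) ^ 2) (stripEnd a b) (𝓝 (1 / c ^ 2)) := by
  have h1 : Tendsto (fun s => 1 / (c + d * exp (-s)) ^ 2) (stripEnd a b)
      (𝓝 (1 / (c + d * 0) ^ 2)) :=
    (tendsto_const_nhds.div ((((tendsto_exp_neg_stripEnd a b).const_mul d).const_add c).pow 2)
      (by simpa using hc))
  rw [mul_zero, add_zero] at h1
  refine h1.congr fun s => ?_
  rw [exp_neg]
  have := exp_ne_zero s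
  grind

/-- The derivative of the logarithm `ζ` of a projective map near a puncture. -/
lemma CuspModel.hasDerivAt_lift (K : CuspModel Q p) {W : Set ℂ} (hW : IsOpen W)
    (hζ : AnalyticOnNhd ℂ ζ W) (hre : ∀ s ∈ W, (ζ s).re < K.R)
    (hB : ∀ s ∈ W, MoebiusRel B (exp s) (K.V (ζ s))) {s : ℂ} (hs : s ∈ W) :
    HasDerivAt ζ (deriv ζ s) s ∧
    exp (-K.α * ζ s) * K.G (exp (ζ s)) * deriv ζ s =
      (B 0 0 * B 1 1 - B 0 1 * B 1 0) * exp s / (B 1 0 * exp s + B 1 1) ^ 2 := by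
  have h1 := (hζ s hs).differentiableAt.hasDerivAt
  have h2 := (K.V_deriv _ (hre s hs)).comp s h1
  have h0 := (hB s hs).1
  have h3 := (((Complex.hasDerivAt_exp s).const_mul (B 0 0)).add_const (B 0 1)).fun_div
    (((Complex.hasDerivAt_exp s).const_mul (B 1 0)).add_const (B 1 1)) h0
  have h4 : (K.V ∘ ζ) =ᶠ[𝓝 s] fun s => (B 0 0 * exp s + B 0 1) / (B 1 0 * exp s + B 1 1) := by
    filter_upwards [hW.mem_nhds hs] with s' hs' using (hB s' hs').2
  rw [(h2.congr_of_eventuallyEq h4.symm).unique h3]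
  grind

lemma CuspModel.tendsto_G (K : CuspModel Q p)
    (hbot : Tendsto (fun s => (ζ s).re) (stripEnd a b) atBot) :
    Tendsto (fun s => K.G (exp (ζ s))) (stripEnd a b) (𝓝 1) := by
  have h1 : Tendsto (fun s => exp (ζ s)) (stripEnd a b) (𝓝 0) := tendsto_exp_nhds_zero_iff.2 hbot
  have h2 := (K.G_analytic 0 (by simpa using exp_pos K.R)).continuousAt.tendsto.comp h1
  rwa [K.G_zero] at h2

lemma not_tendsto_atBot_of_tendsto (hab : a < b) {f : ℂ → ℝ} {x : ℝ}
    (h : Tendsto f (stripEnd a b) (𝓝 x)) : ¬ Tendsto f (stripEnd a b) atBot := by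
  have : Fact (a < b) := ⟨hab⟩
  exact not_tendsto_atBot_of_tendsto_nhds h

/-- A function of the form `s / α` plus a bounded term whose real part tends to `-∞` at the end
of a strip only exists for `Re α < 0`. -/
lemma re_pos_of_tendsto (hab : a < b) {α κ : ℂ} {σ : ℝ} (hσ : σ = 1 ∨ σ = -1)
    (h : Tendsto (fun s => α * ζ s - σ * s) (stripEnd a b) (𝓝 κ))
    (hbot : Tendsto (fun s => (ζ s).re) (stripEnd a b) atBot) (hα : α ≠ 0) :
    σ * α.re < 0 := by
  -- `ζ = (σ s + κ + o(1)) / α`, and `Im s` is bounded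
  have h1 : Tendsto (fun s => ((α * ζ s - σ * s) / α).re) (stripEnd a b) (𝓝 (κ / α).re) :=
    (continuous_re.tendsto _).comp (h.div_const α)
  by_contra hcon
  push Not at hcon
  have h2 : 0 ≤ σ * (α⁻¹).re := by
    rw [inv_re, ← mul_div_assoc]; exact div_nonneg hcon (Complex.normSq_nonneg _)
  obtain ⟨R1, hR1⟩ := eventually_stripEnd.1 (h1.eventually (lt_mem_nhds (sub_one_lt (κ / α).re)))
  set C := |a| + |b|
  obtain ⟨R2, hR2⟩ := eventually_stripEnd.1
    (hbot.eventually (eventually_lt_atBot ((κ / α).re - 1 - |(α⁻¹).im| * C)))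
  set s : ℂ := ⟨max (max R1 R2) 0 + 1, (a + b) / 2⟩ with hs
  have him : |s.im| ≤ C := by grind
  have hm : ∀ r ≤ max (max R1 R2) 0, s ∈ halfStrip r a b := fun r hr =>
    ⟨by simp only [hs]; linarith, by simp only [hs]; linarith, by simp only [hs]; linarith⟩
  have h3 := hR1 s (hm _ ((le_max_left _ _).trans (le_max_left _ _)))
  have h4 := hR2 s (hm _ ((le_max_right _ _).trans (le_max_left _ _)))
  have h5 : 0 < s.re := by simp only [hs]; linarith [le_max_right (max R1 R2) 0]
  have h6 : ((α * ζ s - σ * s) / α).re = (ζ s).re - σ * (s.re * (α⁻¹).re - s.im * (α⁻¹).im) := by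
    rw [sub_div, mul_div_cancel_left₀ _ hα, sub_re, mul_div_assoc, re_ofReal_mul,
      div_eq_mul_inv, mul_re]
  have h7 : |σ * (s.im * (α⁻¹).im)| ≤ |(α⁻¹).im| * C := by
    rw [abs_mul, abs_mul]
    have : |σ| = 1 := by rcases hσ with h | h <;> simp [h]
    rw [this, one_mul, mul_comm]
    exact mul_le_mul_of_nonneg_left him (abs_nonneg _)
  have h8 := (abs_le.1 h7).2
  nlinarith

/-- The asymptotics of the logarithm of a projective map that tends to a puncture at the end of
a strip. The Möbius function `B` fixes `∞`, and the map is asymptotically affine. -/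
lemma CuspModel.lift_asymptotics (K : CuspModel Q p) (hab : a < b)
    (hζ : AnalyticOnNhd ℂ ζ (halfStrip R a b))
    (hre : ∀ s ∈ halfStrip R a b, (ζ s).re < K.R)
    (hB : ∀ s ∈ halfStrip R a b, MoebiusRel B (exp s) (K.V (ζ s)))
    (hbot : Tendsto (fun s => (ζ s).re) (stripEnd a b) atBot) :
    B 1 0 = 0 ∧ (K.α ≠ 0 → 0 < K.α.re ∧ ∃ κ, Tendsto (fun s => -K.α * ζ s - s) (stripEnd a b) (𝓝 κ)
      ∧ exp κ = -K.α * (B 0 0 / B 1 1)) := by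
  have hG := K.tendsto_G hbot
  have hGi : Tendsto (fun s => (K.G (exp (ζ s)))⁻¹) (stripEnd a b) (𝓝 1) := by
    simpa using hG.inv₀ one_ne_zero
  have hder := fun s hs => K.hasDerivAt_lift (isOpen_halfStrip R a b) hζ hre hB (s := s) hs
  set α := K.α with hα
  set D := B 0 0 * B 1 1 - B 0 1 * B 1 0 with hD
  have hD0 : D ≠ 0 := det_ne_zero_of_GL B
  set c := B 1 0 with hc
  set d := B 1 1 with hd
  have hGne : ∀ᶠ s in stripEnd a b, K.G (exp (ζ s)) ≠ 0 := hG.eventually_ne one_ne_zero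
  -- the derivative of `exp (-α ζ)`
  set E : ℂ → ℂ := fun s => exp (-α * ζ s) with hE
  have hEd : ∀ s ∈ halfStrip R a b, HasDerivAt E (E s * (-α * deriv ζ s)) s := fun s hs =>
    (((hder s hs).1.const_mul (-α)).cexp)
  have hEe : ∀ᶠ s in stripEnd a b, E s * (-α * deriv ζ s) =
      -α * D * (exp s / (c * exp s + d) ^ 2) * (K.G (exp (ζ s)))⁻¹ := by
    filter_upwards [eventually_mem_halfStrip R a b, hGne] with s hs h0
    grind
  have hζe : α = 0 → ∀ᶠ s in stripEnd a b, deriv ζ s =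
      D * (exp s / (c * exp s + d) ^ 2) * (K.G (exp (ζ s)))⁻¹ := fun h => by
    filter_upwards [eventually_mem_halfStrip R a b, hGne] with s hs h0
    have := (hder s hs).2
    rw [h, neg_zero, zero_mul, exp_zero, mul_div_assoc] at this
    rw [← this]
    field_simp
  have hzero : c = 0 := by
    by_contra hc0
    have hlim : ∀ μ : ℂ, Tendsto (fun s => (μ * (exp s / (c * exp s + d) ^ 2) *
        (K.G (exp (ζ s)))⁻¹) * exp s) (stripEnd a b) (𝓝 (μ / c ^ 2)) := fun μ => by
      have := ((tendsto_exp_inv_moebius (a := a) (b := b) (d := d) hc0).const_mul μ).mul hGi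
      rw [mul_one, mul_one_div] at this
      refine this.congr fun s => ?_
      ring
    have hexpd : ∀ s : ℂ, HasDerivAt (fun s : ℂ => exp (-s)) (-exp (-s)) s := fun s => by
      simpa using (hasDerivAt_neg s).cexp
    have hee : ∀ s : ℂ, exp (-s) * exp s = 1 := fun s => by rw [← exp_add]; simp
    by_cases hα0 : α = 0
    · -- here `ζ` itself converges
      obtain ⟨ℓ, hℓ, -⟩ := exists_tendsto_of_deriv (E := fun s => ζ s + D / c ^ 2 * exp (-s))
        hab (fun s hs => (hder s hs).1.add ((hexpd s).const_mul (D / c ^ 2))) (by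
          have := (hlim D).sub_const (D / c ^ 2)
          rw [sub_self] at this
          refine this.congr' ?_
          filter_upwards [hζe hα0] with s hs
          rw [hs]
          linear_combination (D / c ^ 2) * hee s)
      have h1 : Tendsto ζ (stripEnd a b) (𝓝 ℓ) := by
        have := hℓ.sub ((tendsto_exp_neg_stripEnd a b).const_mul (D / c ^ 2))
        simpa using this
      exact not_tendsto_atBot_of_tendsto hab ((continuous_re.tendsto _).comp h1) hbot
    · set μ := -α * D / c ^ 2 with hμ
      have hμ0 : μ ≠ 0 := div_ne_zero (mul_ne_zero (neg_ne_zero.2 hα0) hD0) (pow_ne_zero 2 hc0)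
      obtain ⟨ℓ, hℓ, hℓ'⟩ := exists_tendsto_of_deriv (E := fun s => E s + μ * exp (-s))
        hab (fun s hs => (hEd s hs).add ((hexpd s).const_mul μ)) (by
          have := (hlim (-α * D)).sub_const μ
          rw [sub_self] at this
          refine this.congr' ?_
          filter_upwards [hEe] with s hs
          rw [hs]
          linear_combination μ * hee s)
      by_cases hℓ0 : ℓ = 0
      · have h1 : Tendsto (fun s => exp (-α * ζ s + s)) (stripEnd a b) (𝓝 (-μ)) := by
          have := hℓ'.sub_const μ
          rw [zero_sub] at this
          refine this.congr fun s => ?_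
          rw [hℓ0, exp_add]
          linear_combination μ * hee s
        obtain ⟨κ, hκ, -⟩ := exists_tendsto_of_exp (R := R) hab (neg_ne_zero.2 hμ0) (by
            refine ContinuousOn.add (continuousOn_const.mul ?_) continuousOn_id
            exact hζ.continuousOn) h1
        have h2 := re_pos_of_tendsto (α := α) (κ := -κ) (σ := 1) hab (Or.inl rfl) (by
          refine hκ.neg.congr fun s => ?_
          push_cast; ring) hbot hα0
        have := K.re_nonneg
        linarith
      · have h1 : Tendsto E (stripEnd a b) (𝓝 ℓ) := by
          have := hℓ.sub ((tendsto_exp_neg_stripEnd a b).const_mul μ)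
          simpa using this
        obtain ⟨κ, hκ, -⟩ := exists_tendsto_of_exp (R := R) (L := fun s => -α * ζ s) hab hℓ0
          (continuousOn_const.mul hζ.continuousOn) h1
        have h2 : Tendsto ζ (stripEnd a b) (𝓝 (κ / -α)) := by
          refine (hκ.div_const (-α)).congr fun s => ?_
          rw [mul_div_cancel_left₀ _ (neg_ne_zero.2 hα0)]
        exact not_tendsto_atBot_of_tendsto hab ((continuous_re.tendsto _).comp h2) hbot
  refine ⟨hzero, fun hα0 => ?_⟩
  have hd0 : d ≠ 0 := by
    rintro h
    apply hD0
    rw [hD, h, hzero]; ring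
  set μ := -α * D / d ^ 2 with hμ
  have hμ0 : μ ≠ 0 := div_ne_zero (mul_ne_zero (neg_ne_zero.2 hα0) hD0) (pow_ne_zero 2 hd0)
  have h1 := tendsto_mul_exp_neg_of_deriv (E := fun s => E s - μ * exp s)
    (fun s hs => (hEd s hs).sub ((Complex.hasDerivAt_exp s).const_mul μ)) (by
      have := (hGi.sub_const 1).const_mul μ
      rw [sub_self, mul_zero] at this
      refine this.congr' ?_
      filter_upwards [hEe] with s hs
      rw [hs, hzero, zero_mul, hμ]
      have h5 : exp s * exp (-s) = 1 := by rw [← exp_add]; simp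
      linear_combination (-(-α * D / d ^ 2 * ((K.G (exp (ζ s)))⁻¹ - 1))) * h5)
  have h2 : Tendsto (fun s => exp (-α * ζ s - s)) (stripEnd a b) (𝓝 μ) := by
    have := h1.add_const μ
    rw [zero_add] at this
    refine this.congr fun s => ?_
    rw [exp_sub, exp_neg]
    simp only [hE]
    field_simp
    ring
  obtain ⟨κ, hκ, hκe⟩ := exists_tendsto_of_exp (R := R) (L := fun s => -α * ζ s - s) hab hμ0
    ((continuousOn_const.mul hζ.continuousOn).sub continuousOn_id) h2
  have h3 := re_pos_of_tendsto (α := α) (κ := -κ) (σ := -1) hab (Or.inr rfl) (by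
    refine hκ.neg.congr fun s => ?_
    push_cast; ring) hbot hα0
  refine ⟨by linarith, κ, hκ, ?_⟩
  rw [hκe, hμ, hD, hzero]
  field_simp
  ring

end Asymptotics

/-! ### Extension at a puncture -/

/-- A function that is asymptotic to the identity at the end of a strip, together with its
derivative, has an inverse at the end of a smaller strip. -/
lemma exists_inverse_near_identity {R a b δ : ℝ} {f f' : ℂ → ℂ} (hδ : 0 < δ)
    (hf : ∀ s ∈ halfStrip R a b, HasDerivAt f (f' s) s)
    (hf' : Tendsto f' (stripEnd a b) (𝓝 1))
    (hid : Tendsto (fun s => f s - s) (stripEnd a b) (𝓝 0)) :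
    ∃ (R1 R2 : ℝ) (g : ℂ → ℂ), R ≤ R2 ∧ R2 + δ ≤ R1 ∧ ContinuousOn g (halfStrip R1 (a + δ) (b - δ)) ∧
      (∀ s ∈ halfStrip R1 (a + δ) (b - δ), g s ∈ halfStrip R2 a b ∧ f (g s) = s ∧ ‖g s - s‖ ≤ δ) ∧
      ∀ τ ∈ halfStrip R2 a b, f τ ∈ halfStrip R1 (a + δ) (b - δ) → g (f τ) = τ := by
  obtain ⟨R3, hR3⟩ := eventually_stripEnd.1 ((Metric.tendsto_nhds.1 hf' (1 / 2) (by norm_num)).and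
    (Metric.tendsto_nhds.1 hid (δ / 4) (by positivity)))
  set R2 := max R R3 with hR2
  have h1 : ∀ s ∈ halfStrip R2 a b, ‖f' s - 1‖ ≤ 1 / 2 := fun s hs => by
    rw [← dist_eq_norm]; exact (hR3 s (halfStrip_mono (le_max_right _ _) hs)).1.le
  have h2 : ∀ s ∈ halfStrip R2 a b, ‖f s - s‖ ≤ δ / 4 := fun s hs => by
    have := (hR3 s (halfStrip_mono (le_max_right _ _) hs)).2.le
    simp_all
  have hlip : ∀ s ∈ halfStrip R2 a b, ∀ s' ∈ halfStrip R2 a b,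
      ‖(f s' - s') - (f s - s)‖ ≤ 1 / 2 * ‖s' - s‖ := fun s hs s' hs' =>
    (convex_halfStrip R2 a b).norm_image_sub_le_of_norm_hasDerivWithin_le
      (f := fun s => f s - s) (f' := fun s => f' s - 1)
      (fun s hs => ((hf s (halfStrip_mono (le_max_left _ _) hs)).sub (hasDerivAt_id s)).hasDerivWithinAt)
      h1 hs hs'
  have hinj : ∀ s ∈ halfStrip R2 a b, ∀ s' ∈ halfStrip R2 a b, ‖s' - s‖ ≤ 2 * ‖f s' - f s‖ := by
    intro s hs s' hs'
    have h3 := hlip s hs s' hs'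
    have h4 : s' - s = (f s' - f s) - ((f s' - s') - (f s - s)) := by ring
    have h5 := norm_sub_le (f s' - f s) ((f s' - s') - (f s - s))
    rw [← h4] at h5
    linarith
  have hball : ∀ s ∈ halfStrip (R2 + δ) (a + δ) (b - δ),
      closedBall s (δ / 2) ⊆ halfStrip R2 a b := fun s hs τ hτ => by
    rw [mem_closedBall_iff_norm] at hτ
    have h3 := abs_le.1 ((abs_re_le_norm _).trans hτ)
    have h4 := abs_le.1 ((abs_im_le_norm _).trans hτ)
    rw [sub_re] at h3
    rw [sub_im] at h4
    obtain ⟨h5, h6, h7⟩ := hs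
    exact ⟨by linarith, by linarith, by linarith⟩
  have hex : ∀ s ∈ halfStrip (R2 + δ) (a + δ) (b - δ),
      ∃ τ ∈ closedBall s (δ / 2), f τ = s := fun s hs => by
    have hm : Set.MapsTo (fun τ => s - (f τ - τ)) (closedBall s (δ / 2))
        (closedBall s (δ / 2)) := fun τ hτ => by
      have := h2 τ (hball s hs hτ)
      rw [mem_closedBall_iff_norm, sub_sub_cancel_left, norm_neg]
      linarith
    have hc : ContractingWith (1 / 2) (hm.restrict _ _ _) := by
      refine ⟨by rw [← NNReal.coe_lt_coe]; norm_num, LipschitzWith.of_dist_le_mul ?_⟩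
      rintro ⟨x, hx⟩ ⟨y, hy⟩
      rw [Subtype.dist_eq, Subtype.dist_eq, dist_eq_norm, dist_eq_norm]
      simp only [Set.MapsTo.val_restrict_apply]
      rw [norm_sub_rev]
      rw [norm_sub_rev]
      have := hlip x (hball s hs hx) y (hball s hs hy)
      rw [norm_sub_rev x y]
      simpa using this
    obtain ⟨τ, hτ, hfix, -⟩ := hc.exists_fixedPoint' Metric.isClosed_closedBall.isComplete hm
      (Metric.mem_closedBall_self (by positivity : (0 : ℝ) ≤ δ / 2)) (edist_ne_top _ _)
    refine ⟨τ, hτ, ?_⟩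
    have : s - (f τ - τ) = τ := hfix
    linear_combination -this
  choose! g hg hfg using hex
  refine ⟨R2 + δ, R2, g, le_max_left _ _, le_rfl, ?_, fun s hs => ⟨hball s hs (hg s hs), hfg s hs, ?_⟩, ?_⟩
  · refine (LipschitzOnWith.of_dist_le_mul (K := 2) fun s hs s' hs' => ?_).continuousOn
    have := hinj _ (hball s' hs' (hg s' hs')) _ (hball s hs (hg s hs))
    rw [hfg s hs, hfg s' hs'] at this
    rw [dist_eq_norm, dist_eq_norm]
    exact_mod_cast this
  · have := mem_closedBall_iff_norm.1 (hg s hs)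
    linarith
  · intro τ hτ hs
    have := hinj _ hτ _ (hball _ hs (hg _ hs))
    rw [hfg _ hs, sub_self, norm_zero, mul_zero] at this
    exact sub_eq_zero.1 (norm_le_zero_iff.1 this)

section CuspExtension

variable {p : S} {R a b : ℝ} {ζ : ℂ → ℂ} {B : GL (Fin 2) ℂ}

/-- A projective map that tends to a puncture at the end of a strip of width `π` excludes the
exponent `0`, because a function asymptotic to `β exp s` has no real part tending to `-∞` there. -/
lemma CuspModel.exponent_ne_zero (K : CuspModel Q p) (hζ : AnalyticOnNhd ℂ ζ (halfStrip R 0 π))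
    (hre : ∀ s ∈ halfStrip R 0 π, (ζ s).re < K.R)
    (hB : ∀ s ∈ halfStrip R 0 π, MoebiusRel B (exp s) (K.V (ζ s)))
    (hbot : Tendsto (fun s => (ζ s).re) (stripEnd 0 π) atBot) : K.α ≠ 0 := fun hα => by
  have hc : B 1 0 = 0 := (K.lift_asymptotics pi_pos hζ hre hB hbot).1
  obtain ⟨N, hN⟩ := DifferentiableOn.isExactOn_ball (c := (0 : ℂ)) (r := Real.exp K.R)
    (f := dslope K.G 0) (by
      rw [Complex.differentiableOn_dslope (ball_mem_nhds _ (exp_pos _))]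
      intro z hz
      exact (K.G_analytic z (by simpa using hz)).differentiableAt.differentiableWithinAt)
  have hmem : ∀ z : ℂ, z.re < K.R → exp z ∈ ball (0 : ℂ) (Real.exp K.R) := fun z hz => by
    rw [mem_ball_zero_iff, norm_exp]
    simp [*]
  have hopen : IsOpen {z : ℂ | z.re < K.R} := isOpen_lt continuous_re continuous_const
  -- `V` differs from `ζ + N (exp ζ)` by a constant
  have hd : ∀ z : ℂ, z.re < K.R →
      HasDerivAt (fun z => K.V z - (z + N (exp z))) 0 z := fun z hz => by
    have h1 := K.V_deriv z hz
    have h2 := (hN _ (hmem z hz)).comp z (Complex.hasDerivAt_exp z)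
    refine (h1.fun_sub ((hasDerivAt_id z).fun_add h2)).congr_deriv ?_
    rw [hα, neg_zero, zero_mul, exp_zero, dslope_of_ne _ (exp_ne_zero z),
      slope_def_field, K.G_zero, sub_zero, div_mul_cancel₀ _ (exp_ne_zero z)]
    ring
  obtain ⟨γ, hγ⟩ : ∃ γ, ∀ z : ℂ, z.re < K.R → K.V z - (z + N (exp z)) = γ := by
    refine ⟨_, fun z hz => IsOpen.is_const_of_deriv_eq_zero hopen
      (convex_halfSpace_re_lt K.R).isPreconnected
      (fun z hz => (hd z hz).differentiableAt.differentiableWithinAt)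
      (fun z hz => (hd z hz).deriv) hz (show ((K.R - 1 : ℝ) : ℂ).re < K.R by simp)⟩
  set β := B 0 0 / B 1 1 with hβ
  set γ' := B 0 1 / B 1 1 - γ with hγ'
  have hkey : ∀ s ∈ halfStrip R 0 π, ζ s = β * exp s + γ' - N (exp (ζ s)) := fun s hs => by
    have h1 := (hB s hs).2
    grind
  have hNt : Tendsto (fun s => (γ' - N (exp (ζ s))).re) (stripEnd 0 π) (𝓝 (γ' - N 0).re) := by
    have h1 : Tendsto (fun s => exp (ζ s)) (stripEnd 0 π) (𝓝 0) := tendsto_exp_nhds_zero_iff.2 hbot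
    have h2 := (hN 0 (by simpa using exp_pos _)).continuousAt.tendsto.comp h1
    exact (continuous_re.tendsto _).comp (h2.const_sub γ')
  obtain ⟨R1, hR1⟩ := eventually_stripEnd.1 ((hNt.eventually (lt_mem_nhds
    (sub_one_lt (γ' - N 0).re))).and ((hbot.eventually
      (eventually_lt_atBot ((γ' - N 0).re - 1 - |β.im|))).and (eventually_mem_halfStrip R _ _)))
  -- on the curves `Im s = exp (-Re s)` and `Im s = π - exp (-Re s)`, one of the two real parts of
  -- `β exp s` is bounded below
  set x := max R1 0 + 1 with hx
  have hx0 : 0 < x := by linarith [le_max_right R1 0]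
  have hxR : R1 < x := by linarith [le_max_left R1 0]
  have he1 : Real.exp (-x) < 1 := by rw [Real.exp_lt_one_iff]; linarith
  have he0 := exp_pos (-x)
  have hpi := pi_gt_three
  have hee : Real.exp x * Real.exp (-x) = 1 := by rw [← Real.exp_add]; simp
  set y := Real.exp (-x) with hy
  have hcos : 0 ≤ cos y := Real.cos_nonneg_of_neg_pi_div_two_le_of_le (by linarith) (by linarith)
  have hsin0 : 0 ≤ sin y := Real.sin_nonneg_of_nonneg_of_le_pi he0.le (by linarith)
  have hsin : sin y ≤ y := sin_le he0.le
  have hlow : ∀ s : ℂ, s.re = x → 0 < s.im → s.im < π →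
      -|β.im| ≤ (β * exp s).re → False := fun s h1 h2 h3 h4 => by
    obtain ⟨h5, h6, h7⟩ := hR1 s ⟨by rw [h1]; exact hxR, h2, h3⟩
    have h8 := congrArg Complex.re (hkey s h7)
    rw [add_sub_assoc, add_re] at h8
    linarith
  have hb1 : Real.exp x * (|β.im| * sin y) ≤ |β.im| := by
    calc Real.exp x * (|β.im| * sin y) ≤ Real.exp x * (|β.im| * y) := by gcongr
      _ = |β.im| * (Real.exp x * y) := by ring
      _ = |β.im| := by rw [hee, mul_one]
  have hb2 : Real.exp x * (β.im * sin y) ≤ Real.exp x * (|β.im| * sin y) := by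
    gcongr; exact le_abs_self _
  rcases le_total 0 β.re with hβ0 | hβ0
  · refine hlow ⟨x, y⟩ rfl he0 (by simp only; linarith) ?_
    rw [mul_re, exp_re, exp_im]
    have : 0 ≤ β.re * (Real.exp x * cos y) := by positivity
    nlinarith
  · refine hlow ⟨x, π - y⟩ rfl (by simp only; linarith) (by simp only; linarith) ?_
    rw [mul_re, exp_re, exp_im]
    simp only [Real.cos_pi_sub, Real.sin_pi_sub]
    have : 0 ≤ -β.re * (Real.exp x * cos y) := mul_nonneg (by linarith) (by positivity)
    nlinarith

lemma moebiusRel_of_coeff_zero (hc : B 1 0 = 0) {z w : ℂ} (h : MoebiusRel B z w) :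
    w = B 0 0 / B 1 1 * z + B 0 1 / B 1 1 := by
  have h1 := h.2
  grind

lemma CuspModel.eventually_chart_ball (K : CuspModel Q p) :
    ∀ᶠ x in 𝓝 p, x ∈ (chartAt ℂ p).source ∧ ‖chartAt ℂ p x - chartAt ℂ p p‖ < Real.exp K.R := by
  refine Eventually.and ((chartAt ℂ p).open_source.mem_nhds (mem_chart_source ℂ p)) ?_
  have h1 := ((chartAt ℂ p).continuousAt (mem_chart_source ℂ p)).tendsto
  have h2 := (h1.sub_const (chartAt ℂ p p)).norm
  rw [sub_self, norm_zero] at h2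
  exact h2.eventually (gt_mem_nhds (exp_pos _))

/-- There is no projective map of a strip to a neighbourhood of a puncture which tends to the
puncture at both ends: its Möbius function would fix `∞` and map `0` to `∞`. -/
lemma CuspModel.not_tendsto_both_ends [T2Space S] [IsManifold 𝓘(ℂ) ω S] (K : CuspModel Q p)
    (hp : p ∈ P) (hab : a < b)
    {U : ℂ → S} (hU : Q.ProjOn exp U {s | a < s.im ∧ s.im < b})
    (hUb : ∀ s : ℂ, a < s.im → s.im < b → U s ∈ (chartAt ℂ p).source ∧
      ‖chartAt ℂ p (U s) - chartAt ℂ p p‖ < Real.exp K.R)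
    (h1 : Tendsto U (stripEnd a b) (𝓝 p))
    (h2 : Tendsto (fun s => U (-s)) (stripEnd (-b) (-a)) (𝓝 p)) : False := by
  have hW : Convex ℝ {s : ℂ | a < s.im ∧ s.im < b} :=
    (convex_halfSpace_im_gt a).inter (convex_halfSpace_im_lt b)
  have hWo : IsOpen {s : ℂ | a < s.im ∧ s.im < b} :=
    (isOpen_lt continuous_const continuous_im).inter (isOpen_lt continuous_im continuous_const)
  obtain ⟨ζ, B, hζ, hB⟩ := K.exists_lift hp hW hWo
    ⟨⟨0, (a + b) / 2⟩, by simp only [Set.mem_ofPred_eq]; constructor <;> linarith⟩ hU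
    fun s hs => hUb s hs.1 hs.2
  have hneg : ∀ s ∈ halfStrip 0 (-b) (-a), a < (-s).im ∧ (-s).im < b := fun s hs => by
    rw [Complex.neg_im]
    exact ⟨by linarith [hs.2.2], by linarith [hs.2.1]⟩
  have e1 : B 1 0 = 0 := by
    refine (K.lift_asymptotics (R := 0) hab (hζ.mono fun s hs => hs.2) (fun s hs => (hB s hs.2).1)
      (fun s hs => (hB s hs.2).2.2.2) (tendsto_re_atBot_of_tendsto h1 ?_)).1
    filter_upwards [eventually_mem_halfStrip 0 a b] with s hs using (hB s hs.2).2.1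
  have e2 : B 1 1 = 0 := by
    have hdet : B 0 1 * B 1 0 - B 0 0 * B 1 1 ≠ 0 := by
      rw [← neg_ne_zero, neg_sub]; exact det_ne_zero_of_GL B
    have := (K.lift_asymptotics (R := 0) (a := -b) (b := -a) (ζ := fun s => ζ (-s))
      (B := mkGL (B 0 1) (B 0 0) (B 1 1) (B 1 0) hdet) (by linarith)
      (fun s hs => AnalyticAt.fun_comp (hζ (-s) (hneg s hs)) analyticAt_id.fun_neg)
      (fun s hs => (hB (-s) (hneg s hs)).1)
      (fun s hs => by
        obtain ⟨h3, h4⟩ := (hB (-s) (hneg s hs)).2.2.2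
        rw [moebiusRel_mkGL]
        have h7 : B 0 1 * exp s + B 0 0 = (B 0 0 * exp (-s) + B 0 1) * exp s := by
          rw [exp_neg]; field_simp; ring
        grind)
      (tendsto_re_atBot_of_tendsto h2 (by
        filter_upwards [eventually_mem_halfStrip 0 (-b) (-a)] with s hs
        exact (hB (-s) (hneg s hs)).2.1))).1
    simpa [mkGL] using this
  apply det_ne_zero_of_GL B
  rw [e1, e2]; ring

/-- A projective map of a half-strip of width `π` that tends to a puncture at the end extends to
half-strips of any width, and still tends to the puncture there. -/
lemma CuspModel.exists_extension [T2Space S] [IsManifold 𝓘(ℂ) ω S] (K : CuspModel Q p)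
    (hp : p ∈ P) {R0 : ℝ} {U : ℂ → S} (hU : Q.ProjOn exp U (halfStrip R0 0 π))
    (hlim : Tendsto U (stripEnd 0 π) (𝓝 p)) {M : ℝ} (hM : π ≤ M) :
    ∃ (R1 : ℝ) (UP : ℂ → S), Q.ProjOn exp UP (halfStrip R1 (-M) M) ∧
      Tendsto UP (stripEnd (-M) M) (𝓝 p) ∧ ∀ s ∈ halfStrip R1 0 π, UP s = U s := by
  set c := chartAt ℂ p with hc
  have hpi := pi_pos
  obtain ⟨R2, hR2⟩ := eventually_stripEnd.1 (hlim.eventually K.eventually_chart_ball)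
  set R := max R0 R2
  obtain ⟨ζ, B, hζ, hB⟩ := K.exists_lift hp (convex_halfStrip R 0 π) (isOpen_halfStrip R 0 π)
    ⟨⟨R + 1, π / 2⟩, by simp, by simp only; linarith, by simp only; linarith⟩
    (hU.mono (halfStrip_mono (le_max_left _ _)))
    fun s hs => hR2 s (halfStrip_mono (le_max_right _ _) hs)
  have hbot := tendsto_re_atBot_of_tendsto hlim (by
    filter_upwards [eventually_mem_halfStrip R 0 π] with s hs using (hB s hs).2.1)
  have hα := K.exponent_ne_zero hζ (fun s hs => (hB s hs).1) (fun s hs => (hB s hs).2.2.2) hbot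
  obtain ⟨hc0, hα'⟩ := K.lift_asymptotics pi_pos hζ (fun s hs => (hB s hs).1)
    (fun s hs => (hB s hs).2.2.2) hbot
  obtain ⟨hαre, κ, hκ, hκe⟩ := hα' hα
  set α := K.α
  set β := B 0 0 / B 1 1 with hβ
  set γ := B 0 1 / B 1 1
  have hβ0 : β ≠ 0 := fun h => by
    rw [h] at hκe
    simp_all
  -- in the variable `τ` with `ζ = Z τ` the normalized primitive `w` is asymptotic to `exp τ`
  set Z : ℂ → ℂ := fun τ => -((τ + κ) / α) with hZ
  set w : ℂ → ℂ := fun τ => (K.V (Z τ) - γ) / β with hw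
  have hZbot : Tendsto (fun τ => (Z τ).re) (stripEnd (-(M + 2)) (M + 2)) atBot := by
    have hσ : 0 < (α⁻¹).re := by rw [inv_re]; exact div_pos hαre (normSq_pos.2 hα)
    have h1 : ∀ τ : ℂ, (Z τ).re = -((α⁻¹).re * τ.re) + (α⁻¹).im * τ.im - (κ * α⁻¹).re := fun τ => by
      simp only [hZ]
      rw [add_div, div_eq_mul_inv, neg_re, add_re, mul_re]
      ring_nf
    have h2 : Tendsto (fun τ : ℂ => -((α⁻¹).re * τ.re) + (|(α⁻¹).im| * (M + 2) - (κ * α⁻¹).re))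
        (stripEnd (-(M + 2)) (M + 2)) atBot :=
      tendsto_atBot_add_const_right _ _
        (tendsto_neg_atTop_atBot.comp ((tendsto_re_stripEnd _ _).const_mul_atTop hσ))
    refine tendsto_atBot_mono' _ ?_ h2
    filter_upwards [eventually_mem_halfStrip 0 (-(M + 2)) (M + 2)] with τ hτ
    rw [h1]
    have h3 : (α⁻¹).im * τ.im ≤ |(α⁻¹).im| * (M + 2) := by
      refine (le_abs_self _).trans ?_
      rw [abs_mul]
      exact mul_le_mul_of_nonneg_left (abs_le.2 ⟨hτ.2.1.le, hτ.2.2.le⟩) (abs_nonneg _)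
    linarith
  obtain ⟨R3, hR3⟩ := eventually_stripEnd.1 (hZbot.eventually (eventually_lt_atBot K.R))
  have hwd : ∀ τ ∈ halfStrip R3 (-(M + 2)) (M + 2),
      HasDerivAt w (exp τ * K.G (exp (Z τ))) τ := fun τ hτ => by
    have h1 : HasDerivAt Z (-(1 / α)) τ := (((hasDerivAt_id τ).add_const κ).div_const α).neg
    have h2 := (((K.V_deriv _ (hR3 τ hτ)).comp τ h1).sub_const γ).div_const β
    refine h2.congr_deriv ?_
    have h3 : exp (-K.α * Z τ) = exp τ * (-α * β) := by
      rw [← hκe, ← exp_add]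
      congr 1
      change -α * -((τ + κ) / α) = τ + κ
      field_simp
    rw [h3]
    field_simp
  have hGZ : Tendsto (fun τ => K.G (exp (Z τ))) (stripEnd (-(M + 2)) (M + 2)) (𝓝 1) :=
    K.tendsto_G hZbot
  have hwe : Tendsto (fun τ => w τ * exp (-τ)) (stripEnd (-(M + 2)) (M + 2)) (𝓝 1) := by
    have h1 := tendsto_mul_exp_neg_of_deriv (E := fun τ => w τ - exp τ)
      (fun τ hτ => (hwd τ hτ).sub (Complex.hasDerivAt_exp τ)) (by
        have := hGZ.sub_const 1
        rw [sub_self] at this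
        refine this.congr fun τ => ?_
        have h5 : exp τ * exp (-τ) = 1 := by rw [← exp_add]; simp
        linear_combination (-(K.G (exp (Z τ)) - 1)) * h5)
    have h2 := h1.add_const 1
    rw [zero_add] at h2
    refine h2.congr fun τ => ?_
    have h5 : exp τ * exp (-τ) = 1 := by rw [← exp_add]; simp
    linear_combination (-1 : ℂ) * h5
  obtain ⟨R4, hR4⟩ := eventually_stripEnd.1 (hwe.eventually (isOpen_slitPlane.mem_nhds
    (by simp : (1 : ℂ) ∈ slitPlane)))
  set f : ℂ → ℂ := fun τ => τ + log (w τ * exp (-τ)) with hf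
  set R5 := max R3 R4
  have hfexp : ∀ τ ∈ halfStrip R5 (-(M + 2)) (M + 2), exp (f τ) = w τ := fun τ hτ => by
    have h1 := Complex.slitPlane_ne_zero (hR4 τ (halfStrip_mono (le_max_right _ _) hτ))
    rw [exp_add, exp_log h1, mul_comm (w τ), ← mul_assoc, ← exp_add]
    simp
  have hfid : Tendsto (fun τ => f τ - τ) (stripEnd (-(M + 2)) (M + 2)) (𝓝 0) := by
    have h3 : Tendsto log (𝓝 1) (𝓝 (log 1)) := (continuousAt_clog (by simp)).tendsto
    rw [log_one] at h3
    simp only [hf, add_sub_cancel_left]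
    exact h3.comp hwe
  have hfd : ∀ τ ∈ halfStrip R5 (-(M + 2)) (M + 2),
      HasDerivAt f (K.G (exp (Z τ)) / (w τ * exp (-τ))) τ := fun τ hτ => by
    have h0 := hR4 τ (halfStrip_mono (le_max_right _ _) hτ)
    have h1 := ((hwd τ (halfStrip_mono (le_max_left _ _) hτ)).fun_mul
      (hasDerivAt_neg τ).cexp).clog h0
    refine ((hasDerivAt_id τ).add h1).congr_deriv ?_
    have h2 := Complex.slitPlane_ne_zero h0
    rw [eq_div_iff h2, add_mul, div_mul_cancel₀ _ h2]
    have h5 : exp τ * exp (-τ) = 1 := by rw [← exp_add]; simp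
    linear_combination (K.G (exp (Z τ))) * h5
  obtain ⟨R6, R7, g, hR57, hR6, hgc, hg, hgf⟩ := exists_inverse_near_identity (δ := 1) one_pos hfd
    (by
      have := hGZ.div hwe one_ne_zero
      rw [div_one] at this
      exact this) hfid
  set UP : ℂ → S := fun s => c.symm (c p + exp (Z (g s))) with hUP
  have hsub : ∀ {R' : ℝ}, R6 ≤ R' → halfStrip R' (-M) M ⊆ halfStrip R6 (-(M + 2) + 1) (M + 2 - 1) := by
    intro R' hR' s hs
    exact ⟨hR'.trans_lt hs.1, by linarith [hs.2.1], by linarith [hs.2.2]⟩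
  -- the construction recovers `U`
  have hτ : Tendsto (fun s => f (-α * ζ s - κ) - s) (stripEnd 0 π) (𝓝 0) ∧
      ∀ᶠ s in stripEnd 0 π, -α * ζ s - κ ∈ halfStrip R7 (-(M + 2)) (M + 2) := by
    have h1 : Tendsto (fun s => -α * ζ s - κ - s) (stripEnd 0 π) (𝓝 0) := by
      have := hκ.sub_const κ
      rw [sub_self] at this
      exact this.congr fun s => by ring
    have h2 : ∀ r : ℝ, ∀ᶠ s in stripEnd 0 π, -α * ζ s - κ ∈ halfStrip r (-(M + 2)) (M + 2) := by
      intro r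
      filter_upwards [Metric.tendsto_nhds.1 h1 1 one_pos,
        eventually_mem_halfStrip (r + 1) 0 π] with s h3 h4
      rw [dist_zero_right] at h3
      have h5 := abs_lt.1 ((abs_re_le_norm _).trans_lt h3)
      have h6 := abs_lt.1 ((abs_im_le_norm _).trans_lt h3)
      rw [sub_re] at h5
      rw [sub_im] at h6
      exact ⟨by linarith [h4.1], by linarith [h4.2.1], by linarith [h4.2.2]⟩
    have h3 : Tendsto (fun s => -α * ζ s - κ) (stripEnd 0 π) (stripEnd (-(M + 2)) (M + 2)) := by
      intro X hX
      obtain ⟨r, hr⟩ := eventually_stripEnd.1 hX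
      filter_upwards [h2 r] with s hs using hr _ hs
    refine ⟨?_, h2 R7⟩
    have := (hfid.comp h3).add h1
    rw [add_zero] at this
    exact this.congr fun s => by simp
  obtain ⟨R8, hR8⟩ := eventually_stripEnd.1 ((Metric.tendsto_nhds.1 hτ.1 1 one_pos).and hτ.2)
  set R1 := max (max R6 R8) R with hR1
  refine ⟨R1, UP, ?_, ?_, ?_⟩
  · intro s hs
    have hs6 := hsub ((le_max_left _ _).trans (le_max_left _ _)) hs
    obtain ⟨hg1, hg2, hg3⟩ := hg s hs6
    have hg5 := halfStrip_mono hR57 hg1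
    have hgR := hR3 _ (halfStrip_mono (le_max_left _ _) hg5)
    have hgcs : ContinuousAt g s := hgc.continuousAt ((isOpen_halfStrip _ _ _).mem_nhds hs6)
    have hZg : ContinuousAt (fun s => Z (g s)) s := by
      fun_prop
    have hnot := K.notMem _ hgR
    obtain ⟨e, he, hse⟩ := Q.cover _ hnot
    have htar : c p + exp (Z (g s)) ∈ c.target := K.mem_target _ (by
      rw [norm_exp]; exact exp_lt_exp.2 hgR)
    have hcont : ContinuousAt UP s := by
      have h1 : ContinuousAt c.symm (c p + exp (Z (g s))) := c.continuousAt_symm htar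
      exact ContinuousAt.comp' (f := fun s => c p + exp (Z (g s))) h1
        (continuousAt_const.add hZg.cexp)
    refine ⟨hcont, e, he, hse, ?_⟩
    obtain ⟨A, hA⟩ := K.proj _ hgR e he hse
    refine ⟨A * mkGL β γ 0 1 (by simpa using hβ0), ?_⟩
    filter_upwards [hZg.eventually hA, (isOpen_halfStrip _ _ _).mem_nhds hs6] with s' h1 h2
    refine MoebiusRel.comp ?_ h1
    rw [moebiusRel_mkGL]
    refine ⟨by simp, ?_⟩
    have h3 := hfexp _ (halfStrip_mono hR57 (hg s' h2).1)
    rw [(hg s' h2).2.1] at h3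
    have h4 : w (g s') * β = K.V (Z (g s')) - γ := div_mul_cancel₀ _ hβ0
    rw [h3, zero_mul, zero_add]
    linear_combination -h4
  · have h1 : Tendsto g (stripEnd (-M) M) (stripEnd (-(M + 2)) (M + 2)) := fun X hX => by
      obtain ⟨r, hr⟩ := eventually_stripEnd.1 hX
      rw [mem_map]
      filter_upwards [eventually_mem_halfStrip (max R6 (r + 1)) (-M) M] with s hs
      obtain ⟨hg1, hg2, hg3⟩ := hg s (hsub (le_max_left _ _) hs)
      refine hr _ ⟨?_, hg1.2⟩
      have h5 := abs_le.1 ((abs_re_le_norm _).trans hg3)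
      rw [sub_re] at h5
      have := (le_max_right _ _).trans_lt hs.1
      linarith
    have h2 : Tendsto (fun s => c p + exp (Z (g s))) (stripEnd (-M) M) (𝓝 (c p)) := by
      have : Tendsto (fun s => exp (Z (g s))) (stripEnd (-M) M) (𝓝 0) :=
        tendsto_exp_nhds_zero_iff.2 (hZbot.comp h1)
      simpa using this.const_add (c p)
    have h3 := (c.continuousAt_symm (mem_chart_target ℂ p)).tendsto.comp h2
    rw [c.left_inv (mem_chart_source ℂ p)] at h3
    exact h3
  · intro s hs
    have hsR : s ∈ halfStrip R 0 π := halfStrip_mono (le_max_right _ _) hs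
    obtain ⟨h1, h2⟩ := hR8 s (halfStrip_mono ((le_max_right _ _).trans (le_max_left _ _)) hs)
    have hs6 : s ∈ halfStrip R6 (-(M + 2) + 1) (M + 2 - 1) :=
      hsub (R' := R6) le_rfl ⟨((le_max_left _ _).trans (le_max_left _ _)).trans_lt hs.1,
        by linarith [hs.2.1], by linarith [hs.2.2]⟩
    have hZs : Z (-α * ζ s - κ) = ζ s := by simp only [hZ]; field_simp; ring
    have h3 : exp (f (-α * ζ s - κ)) = exp s := by
      rw [hfexp _ (halfStrip_mono hR57 h2)]
      simp only [hw]
      rw [hZs, moebiusRel_of_coeff_zero hc0 (hB s hsR).2.2.2]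
      rw [add_sub_cancel_right, mul_div_cancel_left₀ _ hβ0]
    have h4 : f (-α * ζ s - κ) = s := by
      have h5 : exp (f (-α * ζ s - κ) - s) = 1 := by rw [exp_sub, h3, div_self (exp_ne_zero _)]
      rw [dist_zero_right] at h1
      have h6 := abs_lt.1 ((abs_im_le_norm _).trans_lt h1)
      have h7 := log_exp (x := f (-α * ζ s - κ) - s) (by linarith [pi_gt_three])
        (by linarith [pi_gt_three])
      rw [h5, log_one] at h7
      exact (sub_eq_zero.1 h7.symm)
    have h5 : g s = -α * ζ s - κ := by
      have := hgf _ h2 (by rw [h4]; exact hs6)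
      rwa [h4] at this
    simp only [hUP]
    rw [h5, hZs]
    exact (hB s hsR).2.2.1.symm

end CuspExtension

/-! ### Automorphisms of the unit disk -/

section Automorphisms

/-- The automorphism `w ↦ (l w + q) / (1 + q̄ l w)` of the unit disk, for `‖l‖ = 1` and
`‖q‖ < 1`. -/
def mob (l q w : ℂ) : ℂ := (l * w + q) / (1 + conj q * l * w)

variable {l q : ℂ}

lemma mob_denom_ne_zero (hl : ‖l‖ = 1) (hq : ‖q‖ < 1) {w : ℂ} (hw : ‖w‖ ≤ 1) :
    1 + conj q * l * w ≠ 0 := fun h => by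
  have h1 : ‖conj q * l * w‖ = 1 := by rw [eq_neg_of_add_eq_zero_right h, norm_neg, norm_one]
  rw [norm_mul, norm_mul, RCLike.norm_conj, hl, mul_one] at h1
  nlinarith [norm_nonneg q, norm_nonneg w]

lemma normSq_mob_aux (hl : ‖l‖ = 1) (w : ℂ) :
    ‖1 + conj q * l * w‖ ^ 2 - ‖l * w + q‖ ^ 2 = (1 - ‖q‖ ^ 2) * (1 - ‖w‖ ^ 2) := by
  have hl2 : l.re * l.re + l.im * l.im = 1 := by rw [← normSq_apply, normSq_eq_norm_sq, hl, one_pow]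
  simp only [sq_norm, normSq_apply, add_re, add_im, mul_re,
    mul_im, conj_re, conj_im, one_re, one_im]
  nlinarith

lemma norm_mob_sq (hl : ‖l‖ = 1) (hq : ‖q‖ < 1) {w : ℂ} (hw : ‖w‖ ≤ 1) :
    (1 - ‖mob l q w‖ ^ 2) * ‖1 + conj q * l * w‖ ^ 2 = (1 - ‖q‖ ^ 2) * (1 - ‖w‖ ^ 2) := by
  have h0 := norm_pos_iff.2 (mob_denom_ne_zero hl hq hw)
  rw [← normSq_mob_aux hl, mob, norm_div, div_pow, sub_mul, one_mul,
    div_mul_cancel₀ _ (pow_ne_zero 2 h0.ne')]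

lemma norm_mob_lt_one (hl : ‖l‖ = 1) (hq : ‖q‖ < 1) {w : ℂ} (hw : ‖w‖ < 1) : ‖mob l q w‖ < 1 := by
  have h0 := norm_pos_iff.2 (mob_denom_ne_zero hl hq hw.le)
  have h1 := norm_mob_sq hl hq hw.le
  have h2 : 0 < (1 - ‖q‖ ^ 2) * (1 - ‖w‖ ^ 2) := by simp [*]
  rw [← h1] at h2
  have h3 := pos_of_mul_pos_left h2 (by positivity)
  nlinarith

lemma norm_mob_eq_one (hl : ‖l‖ = 1) (hq : ‖q‖ < 1) {w : ℂ} (hw : ‖w‖ = 1) : ‖mob l q w‖ = 1 := by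
  have h0 := norm_pos_iff.2 (mob_denom_ne_zero hl hq hw.le)
  have h1 := norm_mob_sq hl hq hw.le
  rw [hw, one_pow, sub_self, mul_zero] at h1
  have h2 := (mul_eq_zero.1 h1).resolve_right (by positivity)
  have h3 : ‖mob l q w‖ ^ 2 = 1 := by linarith
  exact (pow_eq_one_iff_of_nonneg (norm_nonneg _) two_ne_zero).1 h3

lemma norm_conj_eq_one (hl : ‖l‖ = 1) : ‖conj l‖ = 1 := by rwa [RCLike.norm_conj]

lemma norm_inv_center (hl : ‖l‖ = 1) (hq : ‖q‖ < 1) : ‖-(conj l * q)‖ < 1 := by simp [*]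

lemma conj_mul_self_of_norm (hl : ‖l‖ = 1) : conj l * l = 1 := by
  rw [← normSq_eq_conj_mul_self, normSq_eq_norm_sq, hl]; simp

lemma one_sub_conj_mul_ne_zero (hq : ‖q‖ < 1) : 1 - conj q * q ≠ 0 := by
  rw [← normSq_eq_conj_mul_self, normSq_eq_norm_sq]
  intro h
  have h2 : (1 : ℝ) - ‖q‖ ^ 2 = 0 := by exact_mod_cast h
  nlinarith [norm_nonneg q]

lemma mob_inv (hl : ‖l‖ = 1) (hq : ‖q‖ < 1) {w : ℂ} (hw : ‖w‖ ≤ 1) :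
    mob (conj l) (-(conj l * q)) (mob l q w) = w := by
  have h0 := mob_denom_ne_zero hl hq hw
  have hl1 := conj_mul_self_of_norm hl
  have e : conj (-(conj l * q)) * conj l = -conj q := by
    rw [map_neg, map_mul, conj_conj]
    grind
  have hm : mob l q w * (1 + conj q * l * w) = l * w + q := div_mul_cancel₀ _ h0
  have hmn : ‖mob l q w‖ ≤ 1 := by
    have h1 := norm_mob_sq hl hq hw
    have h2 : 0 ≤ (1 - ‖q‖ ^ 2) * (1 - ‖w‖ ^ 2) := by simp [*]
    rw [← h1] at h2
    have h3 := nonneg_of_mul_nonneg_left h2 (by positivity)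
    nlinarith
  have h1 := mob_denom_ne_zero (norm_conj_eq_one hl) (norm_inv_center hl hq) hmn
  generalize mob l q w = m at *
  rw [mob, div_eq_iff h1, e]
  grind

lemma mob_inv' (hl : ‖l‖ = 1) (hq : ‖q‖ < 1) {w : ℂ} (hw : ‖w‖ ≤ 1) :
    mob l q (mob (conj l) (-(conj l * q)) w) = w := by
  have h := mob_inv (norm_conj_eq_one hl) (norm_inv_center hl hq) hw
  have e : -(conj (conj l) * -(conj l * q)) = q := by
    rw [conj_conj]
    linear_combination q * conj_mul_self_of_norm hl
  simp_all

lemma mob_zero (l q : ℂ) : mob l q 0 = q := by simp [mob]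

lemma mob_sub_mob (hl : ‖l‖ = 1) (hq : ‖q‖ < 1) {z w : ℂ} (hz : ‖z‖ ≤ 1) (hw : ‖w‖ ≤ 1) :
    mob l q z - mob l q w = l * (1 - conj q * q) * (z - w) /
      ((1 + conj q * l * z) * (1 + conj q * l * w)) := by
  have h1 := mob_denom_ne_zero hl hq hz
  have h2 := mob_denom_ne_zero hl hq hw
  rw [mob, mob, div_sub_div _ _ h1 h2]
  grind

lemma mob_det_ne_zero (hl : ‖l‖ = 1) (hq : ‖q‖ < 1) : l * 1 - q * (conj q * l) ≠ 0 := by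
  have : l ≠ 0 := by rintro rfl; simp at hl
  have h := mul_ne_zero this (one_sub_conj_mul_ne_zero hq)
  grind

/-- The matrix of an automorphism of the unit disk. -/
def mobGL (hl : ‖l‖ = 1) (hq : ‖q‖ < 1) : GL (Fin 2) ℂ :=
  mkGL l q (conj q * l) 1 (mob_det_ne_zero hl hq)

lemma moebiusRel_mob (hl : ‖l‖ = 1) (hq : ‖q‖ < 1) {w : ℂ} (hw : ‖w‖ ≤ 1) :
    MoebiusRel (mobGL hl hq) w (mob l q w) := by
  rw [mobGL, moebiusRel_mkGL, add_comm _ (1 : ℂ)]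
  exact ⟨mob_denom_ne_zero hl hq hw, rfl⟩

lemma analyticAt_mob (hl : ‖l‖ = 1) (hq : ‖q‖ < 1) {w : ℂ} (hw : ‖w‖ ≤ 1) :
    AnalyticAt ℂ (mob l q) w := by
  have := mob_denom_ne_zero hl hq hw
  unfold mob
  fun_prop

/-- The automorphism `mob l q` as a bijection of the unit disk. -/
def mobEquiv (hl : ‖l‖ = 1) (hq : ‖q‖ < 1) : 𝔻 ≃ 𝔻 where
  toFun w := .mk (mob l q w) (norm_mob_lt_one hl hq w.norm_lt_one)
  invFun w := .mk (mob (conj l) (-(conj l * q)) w)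
    (norm_mob_lt_one (norm_conj_eq_one hl) (norm_inv_center hl hq) w.norm_lt_one)
  left_inv w := Complex.UnitDisc.coe_injective (by simpa using mob_inv hl hq w.norm_lt_one.le)
  right_inv w := Complex.UnitDisc.coe_injective (by simpa using mob_inv' hl hq w.norm_lt_one.le)

lemma isMoebius_mobEquiv (hl : ‖l‖ = 1) (hq : ‖q‖ < 1) : IsMoebius (mobEquiv hl hq) :=
  ⟨mobGL hl hq, fun w => moebiusRel_mob hl hq w.norm_lt_one.le⟩

lemma isMoebius_mobEquiv_symm (hl : ‖l‖ = 1) (hq : ‖q‖ < 1) : IsMoebius (mobEquiv hl hq).symm :=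
  ⟨_, fun w => moebiusRel_mob (norm_conj_eq_one hl) (norm_inv_center hl hq) w.norm_lt_one.le⟩

/-- The Hermitian form whose positivity at `w` says that the Möbius function maps `w` to the
unit disk. -/
def herm (A : GL (Fin 2) ℂ) (w : ℂ) : ℝ := ‖A 1 0 * w + A 1 1‖ ^ 2 - ‖A 0 0 * w + A 0 1‖ ^ 2

lemma herm_eq (A : GL (Fin 2) ℂ) (w : ℂ) : herm A w = (‖A 1 1‖ ^ 2 - ‖A 0 1‖ ^ 2) +
      2 * ((conj (A 1 1) * A 1 0 - conj (A 0 1) * A 0 0) * w).re +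
        (‖A 1 0‖ ^ 2 - ‖A 0 0‖ ^ 2) * ‖w‖ ^ 2 := by
  simp only [herm, sq_norm, normSq_apply, add_re, add_im, mul_re, mul_im, conj_re, conj_im, sub_re,
    sub_im]
  ring

lemma herm_pos_iff {A : GL (Fin 2) ℂ} {w v : ℂ} (h : MoebiusRel A w v) :
    0 < herm A w ↔ ‖v‖ < 1 := by
  have h0 := norm_pos_iff.2 h.1
  rw [herm, h.2, norm_div, div_lt_one h0, sub_pos,
    pow_lt_pow_iff_left₀ (norm_nonneg _) (norm_nonneg _) two_ne_zero]

lemma herm_eq_zero_iff {A : GL (Fin 2) ℂ} {w v : ℂ} (h : MoebiusRel A w v) :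
    herm A w = 0 ↔ ‖v‖ = 1 := by
  have h0 := norm_pos_iff.2 h.1
  rw [herm, h.2, norm_div, div_eq_one_iff_eq h0.ne', sub_eq_zero,
    pow_left_inj₀ (norm_nonneg _) (norm_nonneg _) two_ne_zero, eq_comm]

lemma continuous_herm (A : GL (Fin 2) ℂ) : Continuous (herm A) := by unfold herm; fun_prop

/-- A point at which the Hermitian form is positive is mapped into the unit disk. -/
lemma moebiusRel_of_herm_pos {A : GL (Fin 2) ℂ} {w : ℂ} (h : 0 < herm A w) :
    MoebiusRel A w ((A 0 0 * w + A 0 1) / (A 1 0 * w + A 1 1)) := by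
  refine ⟨fun h0 => ?_, rfl⟩
  rw [herm, h0, norm_zero] at h
  nlinarith

/-- A Möbius function whose Hermitian form is a positive multiple of `1 - ‖w‖²` is an
automorphism of the disk. -/
lemma exists_mob_of_herm {A : GL (Fin 2) ℂ} {z : ℝ} (hz : 0 < z)
    (h0 : ‖A 1 1‖ ^ 2 - ‖A 0 1‖ ^ 2 = z) (h1 : ‖A 1 0‖ ^ 2 - ‖A 0 0‖ ^ 2 = -z)
    (h2 : conj (A 1 1) * A 1 0 = conj (A 0 1) * A 0 0) :
    ∃ l q, ‖l‖ = 1 ∧ ‖q‖ < 1 ∧ ∀ w v, MoebiusRel A w v → v = mob l q w := by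
  have hd : A 1 1 ≠ 0 := fun h => by
    rw [h, norm_zero] at h0
    nlinarith
  have hdn := norm_pos_iff.2 hd
  have h3 : ‖A 1 1‖ * ‖A 1 0‖ = ‖A 0 1‖ * ‖A 0 0‖ := by
    have := congrArg norm h2
    simpa only [norm_mul, RCLike.norm_conj] using this
  have h4 : ‖A 0 0‖ = ‖A 1 1‖ := by
    have h5 : ‖A 1 1‖ ^ 2 * ‖A 1 0‖ ^ 2 = ‖A 0 1‖ ^ 2 * ‖A 0 0‖ ^ 2 := by grind
    have h6 : z * (‖A 0 0‖ ^ 2 - ‖A 1 1‖ ^ 2) = 0 := by nlinarith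
    have h7 : ‖A 0 0‖ ^ 2 = ‖A 1 1‖ ^ 2 := by nlinarith
    simp_all
  refine ⟨A 0 0 / A 1 1, A 0 1 / A 1 1, ?_, ?_, fun w v hv => ?_⟩
  · simp [*]
  · rw [norm_div, div_lt_one hdn]
    nlinarith [norm_nonneg (A 0 1)]
  · have hcd : conj (A 1 1) ≠ 0 := (map_ne_zero _).2 hd
    have h5 : conj (A 0 1 / A 1 1) * (A 0 0 / A 1 1) = A 1 0 / A 1 1 := by
      rw [map_div₀]
      field_simp
      linear_combination -h2
    rw [hv.2, mob, h5]
    have h6 := hv.1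
    have h7 : 1 + A 1 0 / A 1 1 * w = (A 1 0 * w + A 1 1) / A 1 1 := by field_simp; ring
    rw [h7]
    field_simp

/-- A Möbius function that maps the disk to itself and two points of the unit circle to the unit
circle is an automorphism of the disk. -/
lemma exists_mob_of_two_points {A : GL (Fin 2) ℂ} (hA : ∀ w : ℂ, ‖w‖ < 1 → 0 < herm A w)
    (h1 : herm A 1 = 0) (h2 : herm A (-1) = 0) :
    ∃ l q, ‖l‖ = 1 ∧ ‖q‖ < 1 ∧ ∀ w v, MoebiusRel A w v → v = mob l q w := by
  set y := conj (A 1 1) * A 1 0 - conj (A 0 1) * A 0 0 with hy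
  have h3 := hA 0 (by simp)
  rw [herm_eq, ← hy] at h1 h2 h3
  simp only [mul_one, norm_one, one_pow, mul_neg, norm_neg, neg_re, mul_zero,
    zero_re, norm_zero, add_zero, ne_eq, OfNat.ofNat_ne_zero, not_false_eq_true, zero_pow] at h1 h2 h3
  have hcl : ∀ w : ℂ, ‖w‖ ≤ 1 → 0 ≤ herm A w := fun w hw => by
    have h4 : w ∈ closure 𝔹 := by rw [closure_ball _ one_ne_zero]; simpa using hw
    exact closure_minimal (fun v hv => (hA v (by simpa using hv)).le)
      (isClosed_le continuous_const (continuous_herm A)) h4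
  have hy0 : y = 0 := by
    by_contra hne
    have hn := norm_pos_iff.2 hne
    have h4 := hcl (-(conj y / ‖y‖)) (by
      rw [norm_neg, norm_div, RCLike.norm_conj, norm_real, norm_norm, div_self hn.ne'])
    rw [herm_eq, ← hy, norm_neg, norm_div, RCLike.norm_conj, norm_real, norm_norm,
      div_self hn.ne', mul_neg, neg_re, ← mul_div_assoc, mul_conj,
      normSq_eq_norm_sq] at h4
    have h5 : (((‖y‖ ^ 2 : ℝ) : ℂ) / (‖y‖ : ℂ)).re = ‖y‖ := by
      rw [← ofReal_div, ofReal_re, sq, mul_div_assoc, div_self hn.ne', mul_one]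
    rw [h5] at h4
    linarith
  exact exists_mob_of_herm h3 rfl (by linarith) (sub_eq_zero.1 hy0)

/-- Every automorphism of the unit disk has the form `mob l q`. -/
lemma exists_mob_of_equiv {f : 𝔻 ≃ 𝔻} (hf : IsMoebius f) :
    ∃ l q, ‖l‖ = 1 ∧ ‖q‖ < 1 ∧ ∀ w : 𝔻, (f w : ℂ) = mob l q w := by
  obtain ⟨A, hA⟩ := hf
  have hpos : ∀ w : ℂ, ‖w‖ < 1 → 0 < herm A w := fun w hw =>
    (herm_pos_iff (hA (.mk w hw))).2 (f _).norm_lt_one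
  have hz : ∀ w : ℂ, ‖w‖ = 1 → herm A w = 0 := fun w hw => by
    by_contra hne
    have h4 : w ∈ closure 𝔹 := by rw [closure_ball _ one_ne_zero]; simp [hw]
    have h5 : 0 ≤ herm A w := closure_minimal (fun v hv => (hpos v (by simpa using hv)).le)
      (isClosed_le continuous_const (continuous_herm A)) h4
    have h6 := lt_of_le_of_ne h5 (Ne.symm hne)
    have h7 := moebiusRel_of_herm_pos h6
    have h8 := (herm_pos_iff h7).1 h6
    have h9 := hA (f.symm (.mk _ h8))
    rw [f.apply_symm_apply] at h9
    have h10 := h7.left_unique h9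
    have := (f.symm (.mk _ h8)).norm_lt_one
    grind
  obtain ⟨l, q, hl, hq, h⟩ := exists_mob_of_two_points hpos (hz 1 (by simp)) (hz (-1) (by simp))
  grind

/-- The automorphism with `1 ↦ a`, `-1 ↦ b`. -/
lemma exists_mob_pair {a b : ℂ} (ha : ‖a‖ = 1) (hb : ‖b‖ = 1) (hab : a ≠ b) :
    ∃ l q, ‖l‖ = 1 ∧ ‖q‖ < 1 ∧ mob l q 1 = a ∧ mob l q (-1) = b := by
  -- `0` is mapped to the midpoint of the geodesic from `b` to `a`
  set m := ‖a - b‖ with hm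
  have hm0 : 0 < m := norm_pos_iff.2 (sub_ne_zero.2 hab)
  have hl : ‖(a - b) / m‖ = 1 := by rw [norm_div, norm_real, norm_norm, div_self hm0.ne']
  have hpar : ‖a + b‖ ^ 2 = (2 - m) * (2 + m) := by
    have := parallelogram_law_with_norm ℝ a b
    nlinarith
  have hq : ‖(a + b) / (2 + m)‖ < 1 := by
    have h2 : ‖(2 + m : ℂ)‖ = 2 + m := by
      rw [show (2 + m : ℂ) = ((2 + m : ℝ) : ℂ) by push_cast; ring, norm_real,
        norm_of_nonneg (by positivity)]
    rw [norm_div, h2, div_lt_one (by positivity)]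
    nlinarith
  have hmm : (m : ℂ) * m = (a - b) * (conj a - conj b) := by
    rw [← map_sub, mul_conj, normSq_eq_norm_sq, ← hm]; push_cast; ring
  have haa := conj_mul_self_of_norm ha
  have hbb := conj_mul_self_of_norm hb
  have hmc : (m : ℂ) ≠ 0 := by exact_mod_cast hm0.ne'
  have h2m : (2 + m : ℂ) ≠ 0 := by
    have : (2 + m : ℝ) ≠ 0 := by positivity
    exact_mod_cast this
  have key : ∀ x : ℂ, 1 + conj ((a + b) / (2 + m)) * ((a - b) / m) * x =
      (m * (2 + m) + (conj a + conj b) * (a - b) * x) / (m * (2 + m)) := fun x => by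
    rw [map_div₀, map_add, map_add, conj_ofReal, Complex.conj_ofNat 2]
    field_simp
  have key' : ∀ x : ℂ, (a - b) / m * x + (a + b) / (2 + m) =
      ((a - b) * (2 + m) * x + (a + b) * m) / (m * (2 + m)) := fun x => by
    field_simp
  refine ⟨(a - b) / m, (a + b) / (2 + m), hl, hq, ?_, ?_⟩
  · have h0 := mob_denom_ne_zero hl hq (w := 1) (by simp)
    rw [mob, div_eq_iff h0, key, key', mul_div_assoc']
    congr 1
    linear_combination (-a) * hmm - 2 * (a - b) * haa
  · have h0 := mob_denom_ne_zero hl hq (w := -1) (by simp)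
    rw [mob, div_eq_iff h0, key, key', mul_div_assoc']
    congr 1
    linear_combination (-b) * hmm + 2 * (a - b) * hbb

end Automorphisms

/-! ### The strip as a model of the disk -/

/-- The projective bijection `s ↦ (exp s - i) / (exp s + i)` of the strip `0 < Im s < π` with the
unit disk. The end `Re s → ∞` corresponds to `1`, the end `Re s → -∞` to `-1`, the line
`Im s = π` to the upper half circle. -/
def cay (s : ℂ) : ℂ := (exp s - I) / (exp s + I)

/-- The inverse of `cay`; the branch has imaginary part in `(-π / 2, 3 π / 2)`. -/
def stripLog (w : ℂ) : ℂ := log ((1 + w) / (1 - w)) + π / 2 * I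

lemma exp_pi_half : exp (π / 2 * I) = I := by simp

lemma exp_add_I_ne_zero {s : ℂ} (h1 : -(π / 2) < s.im) (h2 : s.im < 3 * π / 2) :
    exp s + I ≠ 0 := fun h => by
  have h3 : exp (s - π / 2 * I) = -1 := by
    rw [exp_sub, exp_pi_half, eq_neg_of_add_eq_zero_left h, neg_div, div_self I_ne_zero]
  have him : (s - π / 2 * I).im = s.im - π / 2 := by simp [sub_im]
  have h4 := log_exp (x := s - π / 2 * I) (by rw [him]; linarith) (by rw [him]; linarith)
  rw [h3, Complex.log_neg_one] at h4
  have h5 := congrArg Complex.im h4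
  rw [him] at h5
  simp at h5
  linarith

/-- The bounds on `Im s` are those of the principal branch of the logarithm, so that the inverse
is also defined beyond the strip `0 < Im s < π`, on both sides. -/
lemma stripLog_cay {s : ℂ} (h1 : -(π / 2) < s.im) (h2 : s.im < 3 * π / 2) :
    stripLog (cay s) = s := by
  have h0 := exp_add_I_ne_zero h1 h2
  have h3 : (1 + cay s) / (1 - cay s) = exp (s - π / 2 * I) := by
    have e1 : 1 + cay s = 2 * exp s / (exp s + I) := by rw [cay]; field_simp; ring
    have e2 : 1 - cay s = 2 * I / (exp s + I) := by rw [cay]; field_simp; ring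
    rw [e1, e2, div_div_div_cancel_right₀ h0, mul_div_mul_left _ _ two_ne_zero, exp_sub,
      exp_pi_half]
  have him : (s - π / 2 * I).im = s.im - π / 2 := by simp [sub_im]
  rw [stripLog, h3, log_exp (by rw [him]; linarith) (by rw [him]; linarith)]
  ring

lemma exp_stripLog {w : ℂ} (h1 : w ≠ 1) (h2 : w ≠ -1) :
    exp (stripLog w) = I * ((1 + w) / (1 - w)) := by
  have e1 : 1 - w ≠ 0 := sub_ne_zero.2 h1.symm
  have e2 : 1 + w ≠ 0 := fun h => h2 (eq_neg_of_add_eq_zero_right h)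
  rw [stripLog, exp_add, exp_pi_half, exp_log (div_ne_zero e2 e1), mul_comm]

lemma cay_stripLog {w : ℂ} (h1 : w ≠ 1) (h2 : w ≠ -1) : cay (stripLog w) = w := by
  have e1 : 1 - w ≠ 0 := sub_ne_zero.2 h1.symm
  rw [cay, exp_stripLog h1 h2]
  have e3 : I * ((1 + w) / (1 - w)) - I = 2 * I * w / (1 - w) := by field_simp; ring
  have e4 : I * ((1 + w) / (1 - w)) + I = 2 * I / (1 - w) := by field_simp; ring
  rw [e3, e4, div_div_div_cancel_right₀ e1]
  simp

lemma cay_normSq_aux (s : ℂ) : ‖exp s + I‖ ^ 2 - ‖exp s - I‖ ^ 2 =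
    4 * (Real.exp s.re * sin s.im) := by
  simp only [sq_norm, normSq_apply, add_re, add_im, sub_re, sub_im, I_re, I_im, ← exp_im]
  ring

lemma norm_cay_lt_one {s : ℂ} (h1 : 0 < s.im) (h2 : s.im < π) : ‖cay s‖ < 1 := by
  have h0 := norm_pos_iff.2 (exp_add_I_ne_zero (s := s) (by linarith) (by linarith))
  rw [cay, norm_div, div_lt_one h0]
  have h3 := cay_normSq_aux s
  have h4 := mul_pos (exp_pos s.re) (Real.sin_pos_of_pos_of_lt_pi h1 h2)
  nlinarith

lemma norm_cay_eq_one {s : ℂ} (h : sin s.im = 0) (h1 : -(π / 2) < s.im)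
    (h2 : s.im < 3 * π / 2) : ‖cay s‖ = 1 := by
  have h0 := norm_pos_iff.2 (exp_add_I_ne_zero h1 h2)
  rw [cay, norm_div, div_eq_one_iff_eq h0.ne']
  have h3 := cay_normSq_aux s
  rw [h] at h3
  nlinarith [norm_nonneg (exp s - I)]

lemma re_pos_of_norm_lt_one {w : ℂ} (hw : ‖w‖ < 1) : 0 < ((1 + w) / (1 - w)).re := by
  have h1 : 1 - w ≠ 0 := fun h => by
    rw [← sub_eq_zero.1 h] at hw
    simp at hw
  have h2 := normSq_pos.2 h1
  rw [div_re, ← add_div]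
  apply div_pos _ h2
  have h3 : normSq w < 1 := by rw [normSq_eq_norm_sq]; nlinarith [norm_nonneg w]
  rw [normSq_apply] at h3
  simp only [add_re, sub_re, add_im, sub_im, one_re, one_im]
  nlinarith

lemma ne_of_norm_lt_one {w : ℂ} (hw : ‖w‖ < 1) : w ≠ 1 ∧ w ≠ -1 :=
  ⟨by rintro rfl; simp at hw, by rintro rfl; simp at hw⟩

lemma im_stripLog {w : ℂ} (hw : ‖w‖ < 1) : 0 < (stripLog w).im ∧ (stripLog w).im < π := by
  have h1 : (stripLog w).im = ((1 + w) / (1 - w)).arg + π / 2 := by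
    rw [stripLog, add_im, log_im]; simp
  have h2 := Complex.abs_arg_lt_pi_div_two_iff.2 (Or.inl (re_pos_of_norm_lt_one hw))
  grind

lemma analyticAt_stripLog {w : ℂ} (h1 : w ≠ 1) (h : (1 + w) / (1 - w) ∈ slitPlane) :
    AnalyticAt ℂ stripLog w := by
  have e1 : 1 - w ≠ 0 := sub_ne_zero.2 h1.symm
  unfold stripLog
  fun_prop

lemma analyticAt_stripLog_of_lt {w : ℂ} (hw : ‖w‖ < 1) : AnalyticAt ℂ stripLog w :=
  analyticAt_stripLog (ne_of_norm_lt_one hw).1 (Or.inl (re_pos_of_norm_lt_one hw))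

lemma analyticAt_cay {s : ℂ} (h1 : -(π / 2) < s.im) (h2 : s.im < 3 * π / 2) :
    AnalyticAt ℂ cay s := by
  have := exp_add_I_ne_zero h1 h2
  unfold cay
  fun_prop

lemma cay_pi_sub (s : ℂ) : cay (π * I - s) = -cay s := by
  have h1 : exp (π * I - s) = -(exp s)⁻¹ := by rw [exp_sub, exp_pi_mul_I, neg_div, one_div]
  rw [cay, cay, h1]
  have h2 := exp_ne_zero s
  have e1 : -(exp s)⁻¹ - I = (-I / exp s) * (exp s - I) := by
    field_simp
    linear_combination -I_sq
  grind

/-- Translations of the strip are the hyperbolic automorphisms of the disk that fix `1` and `-1`;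
they take `0` to `tanh (r / 2)`. -/
lemma cay_add_real {s : ℂ} (h1 : -(π / 2) < s.im) (h2 : s.im < 3 * π / 2) (r : ℝ) :
    cay (s + r) = mob 1 (((Real.exp r - 1) / (Real.exp r + 1) : ℝ) : ℂ) (cay s) := by
  have h0 := exp_add_I_ne_zero h1 h2
  have h3 := exp_add_I_ne_zero (s := s + r) (by simpa using h1) (by simpa using h2)
  have h4 : (exp r + 1) ≠ 0 := by rw [← Complex.ofReal_exp]; norm_cast; positivity
  rw [mob, conj_ofReal, cay, cay]
  push_cast
  rw [exp_add] at h3 ⊢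
  grind

lemma abs_tanh_lt_one (r : ℝ) : ‖(((Real.exp r - 1) / (Real.exp r + 1) : ℝ) : ℂ)‖ < 1 := by
  have := exp_pos r
  rw [norm_real, norm_eq_abs, abs_div, abs_of_pos (by linarith : 0 < Real.exp r + 1),
    div_lt_one (by linarith), abs_lt]
  grind

/-- The matrix of the Möbius function with `cay s` the image of `exp s`. -/
def cayGL : GL (Fin 2) ℂ := mkGL 1 (-I) 1 I (by simp)

lemma moebiusRel_cay {s : ℂ} (h1 : -(π / 2) < s.im) (h2 : s.im < 3 * π / 2) :
    MoebiusRel cayGL (exp s) (cay s) := by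
  rw [cayGL, moebiusRel_mkGL, one_mul, ← sub_eq_add_neg]
  exact ⟨exp_add_I_ne_zero h1 h2, rfl⟩

lemma tendsto_cay_atTop : Tendsto cay (comap Complex.re atTop) (𝓝 1) := by
  have h1 : Tendsto (fun s : ℂ => exp (-s)) (comap Complex.re atTop) (𝓝 0) := by
    rw [tendsto_exp_nhds_zero_iff]
    simp only [neg_re]
    exact tendsto_neg_atTop_atBot.comp tendsto_comap
  have h2 : Tendsto (fun s : ℂ => (1 - I * exp (-s)) / (1 + I * exp (-s))) (comap Complex.re atTop)
      (𝓝 ((1 - I * 0) / (1 + I * 0))) :=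
    ((h1.const_mul _).const_sub 1).div ((h1.const_mul _).const_add 1) (by simp)
  simp only [mul_zero, sub_zero, add_zero, div_one] at h2
  refine h2.congr fun s => ?_
  rw [cay, exp_neg]
  have := exp_ne_zero s
  grind

lemma tendsto_re_stripLog : Tendsto (fun w => (stripLog w).re) (𝓝[≠] 1) atTop := by
  have h1 : ∀ w, (stripLog w).re = Real.log ‖(1 + w) / (1 - w)‖ := fun w => by
    rw [stripLog, add_re, Complex.log_re]; simp
  simp only [h1, norm_div]
  refine Real.tendsto_log_atTop.comp ?_
  have h2 : Tendsto (fun w : ℂ => ‖1 - w‖) (𝓝[≠] 1) (𝓝[>] 0) := by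
    rw [tendsto_nhdsWithin_iff]
    refine ⟨?_, ?_⟩
    · have : Tendsto (fun w : ℂ => ‖1 - w‖) (𝓝 1) (𝓝 ‖(1 : ℂ) - 1‖) :=
        (continuous_const.sub continuous_id).norm.tendsto 1
      rw [sub_self, norm_zero] at this
      exact this.mono_left nhdsWithin_le_nhds
    · filter_upwards [self_mem_nhdsWithin] with w hw
      exact norm_pos_iff.2 (sub_ne_zero.2 (Ne.symm hw))
  have h3 : Tendsto (fun w : ℂ => ‖1 + w‖) (𝓝[≠] 1) (𝓝 ‖(1 : ℂ) + 1‖) :=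
    ((continuous_const.add continuous_id).norm.tendsto 1).mono_left nhdsWithin_le_nhds
  have h4 : 0 < ‖(1 : ℂ) + 1‖ := by norm_num
  simp only [div_eq_mul_inv]
  exact h3.pos_mul_atTop h4 (tendsto_inv_nhdsGT_zero.comp h2)

/-- The open strip `0 < Im s < b`. -/
def strip (b : ℝ) : Set ℂ := {s | 0 < s.im ∧ s.im < b}

lemma isOpen_strip (b : ℝ) : IsOpen (strip b) := (isOpen_lt continuous_const continuous_im).inter
    (isOpen_lt continuous_im continuous_const)

lemma convex_strip (b : ℝ) : Convex ℝ (strip b) :=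
  (convex_halfSpace_im_gt 0).inter (convex_halfSpace_im_lt b)

lemma tendsto_cay_stripEnd : Tendsto cay (stripEnd 0 π) (𝓝[𝔹] 1) := by
  rw [tendsto_nhdsWithin_iff]
  refine ⟨tendsto_cay_atTop.mono_left inf_le_left, ?_⟩
  filter_upwards [eventually_mem_halfStrip 0 0 π] with s hs
  rw [mem_ball_zero_iff]
  exact norm_cay_lt_one hs.2.1 hs.2.2

lemma tendsto_stripLog : Tendsto stripLog (𝓝[𝔹] 1) (stripEnd 0 π) := by
  have hle : 𝓝[𝔹] 1 ≤ 𝓝[≠] 1 := nhdsWithin_mono _ fun w hw =>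
    (ne_of_norm_lt_one (mem_ball_zero_iff.1 hw)).1
  rw [stripEnd, tendsto_inf, tendsto_comap_iff, tendsto_principal]
  refine ⟨tendsto_re_stripLog.mono_left hle, ?_⟩
  filter_upwards [self_mem_nhdsWithin] with w hw
  exact im_stripLog (mem_ball_zero_iff.1 hw)

/-! ### Leaning on punctures -/

section Leaning

variable {l q : ℂ}

lemma neBot_nhdsWithin_ball {ζ : ℂ} (hζ : ‖ζ‖ ≤ 1) : (𝓝[𝔹] ζ).NeBot := by
  rw [← mem_closure_iff_nhdsWithin_neBot, closure_ball _ one_ne_zero]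
  simp [*]

/-- The map `u` has the boundary value `p` at `ζ`. -/
def LeansAt (u : Q.DiskMap) (ζ : ℂ) (p : S) : Prop := Tendsto (extend u.1) (𝓝[𝔹] ζ) (𝓝 p)

lemma tendsto_comap_coe_iff {X : Type*} {f : ℂ → X} {ζ : ℂ} {F : Filter X} :
    Tendsto (fun w : 𝔻 => f w) (comap ((↑) : 𝔻 → ℂ) (𝓝 ζ)) F ↔ Tendsto f (𝓝[𝔹] ζ) F := by
  rw [show (fun w : 𝔻 => f w) = f ∘ ((↑) : 𝔻 → ℂ) from rfl, ← tendsto_map'_iff, map_comap,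
    range_coe_unitDisc]
  rfl

lemma mem_leanPoints_iff {u : Q.DiskMap} {ζ : Circle} :
    ζ ∈ Q.leanPoints u ↔ ∃ p ∈ P, LeansAt u (ζ : ℂ) p := by
  simp only [ProjectiveStructure.leanPoints, Set.mem_ofPred_eq, LeansAt, ← tendsto_comap_coe_iff,
    extend_coe]

lemma LeansAt.unique [T2Space S] {u : Q.DiskMap} {ζ : ℂ} {p p' : S} (hζ : ‖ζ‖ ≤ 1)
    (h : LeansAt u ζ p) (h' : LeansAt u ζ p') : p = p' :=
  have := neBot_nhdsWithin_ball hζ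
  tendsto_nhds_unique h h'

/-- If a map agrees along a curve that tends to `ζ` with a map that is continuous in the limit,
then `u` does not lean on a puncture at `ζ`. -/
lemma LeansAt.not_of_curve [T2Space S] {u : Q.DiskMap} {ζ : ℂ} {p : S} (hp : p ∈ P)
    (h : LeansAt u ζ p)
    {X : Type*} {F : Filter X} [F.NeBot] {γ : X → ℂ} (hγ : Tendsto γ F (𝓝[𝔹] ζ))
    {x : S} (hx : x ∉ P) (hlim : Tendsto (fun t => extend u.1 (γ t)) F (𝓝 x)) : False :=
  hx (tendsto_nhds_unique hlim (h.comp hγ) ▸ hp)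

/-- The composition of a projective map with the automorphism `mob l q`. -/
def ProjectiveStructure.DiskMap.mob (u : Q.DiskMap) (hl : ‖l‖ = 1) (hq : ‖q‖ < 1) : Q.DiskMap :=
  Q.diskMap (fun w => extend u.1 (ProjSurf.mob l q w)) (by
    have h1 := ProjectiveStructure.ProjOn.comp (DiskMap.projOn u) (g := ProjSurf.mob l q) (W' := 𝔹)
      (fun s hs => (analyticAt_mob hl hq (mem_ball_zero_iff.1 hs).le).continuousAt)
      fun s hs => by
        rw [mem_ball_zero_iff] at hs ⊢
        exact norm_mob_lt_one hl hq hs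
    refine h1.change fun s hs => ⟨mobGL hl hq, ?_⟩
    filter_upwards [isOpen_ball.mem_nhds hs] with s' hs'
    exact moebiusRel_mob hl hq (mem_ball_zero_iff.1 hs').le)

lemma extend_mob (u : Q.DiskMap) (hl : ‖l‖ = 1) (hq : ‖q‖ < 1) {w : ℂ} (hw : ‖w‖ < 1) :
    extend (u.mob hl hq).1 w = extend u.1 (mob l q w) := extend_diskMap _ hw

lemma mob_apply (u : Q.DiskMap) (hl : ‖l‖ = 1) (hq : ‖q‖ < 1) (w : 𝔻) :
    (u.mob hl hq).1 w = u.1 (mobEquiv hl hq w) := by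
  rw [← extend_coe, extend_mob _ _ _ w.norm_lt_one, ← extend_coe]
  rfl

lemma toDisk_mob (u : Q.DiskMap) (hl : ‖l‖ = 1) (hq : ‖q‖ < 1) :
    Q.toDisk (u.mob hl hq) = Q.toDisk u :=
  Quotient.sound ⟨mobEquiv hl hq, isMoebius_mobEquiv hl hq, isMoebius_mobEquiv_symm hl hq,
    fun w => mob_apply u hl hq w⟩

lemma exists_eq_mob_of_toDisk_eq {u v : Q.DiskMap} (h : Q.toDisk u = Q.toDisk v) :
    ∃ (l q : ℂ) (hl : ‖l‖ = 1) (hq : ‖q‖ < 1), u = v.mob hl hq := by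
  obtain ⟨f, hf, -, hfu⟩ := Quotient.exact h
  obtain ⟨l, q, hl, hq, hlq⟩ := exists_mob_of_equiv hf
  refine ⟨l, q, hl, hq, DiskMap.ext_of_extend fun w hw => ?_⟩
  have h1 := hlq (.mk w hw)
  rw [Complex.UnitDisc.coe_mk] at h1
  rw [extend_mob _ _ _ hw, ← h1, extend_coe, extend_of_lt _ hw]
  exact hfu _

lemma tendsto_mob_nhdsWithin (hl : ‖l‖ = 1) (hq : ‖q‖ < 1) {ζ : ℂ} (hζ : ‖ζ‖ ≤ 1) :
    Tendsto (mob l q) (𝓝[𝔹] ζ) (𝓝[𝔹] (mob l q ζ)) := by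
  rw [tendsto_nhdsWithin_iff]
  refine ⟨(analyticAt_mob hl hq hζ).continuousAt.tendsto.mono_left nhdsWithin_le_nhds, ?_⟩
  filter_upwards [self_mem_nhdsWithin] with w hw
  rw [mem_ball_zero_iff] at hw ⊢
  exact norm_mob_lt_one hl hq hw

lemma LeansAt.mob {u : Q.DiskMap} {ζ : ℂ} {p : S} (hl : ‖l‖ = 1) (hq : ‖q‖ < 1) (hζ : ‖ζ‖ ≤ 1)
    (h : LeansAt u (ProjSurf.mob l q ζ) p) : LeansAt (u.mob hl hq) ζ p := by
  refine (h.comp (tendsto_mob_nhdsWithin hl hq hζ)).congr' ?_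
  filter_upwards [self_mem_nhdsWithin] with w hw
  exact (extend_mob u hl hq (mem_ball_zero_iff.1 hw)).symm

lemma norm_mob_le_one (hl : ‖l‖ = 1) (hq : ‖q‖ < 1) {ζ : ℂ} (hζ : ‖ζ‖ ≤ 1) : ‖mob l q ζ‖ ≤ 1 := by
  rcases hζ.lt_or_eq with h | h
  · exact (norm_mob_lt_one hl hq h).le
  · exact (norm_mob_eq_one hl hq h).le

lemma leansAt_mob_iff {u : Q.DiskMap} {ζ : ℂ} {p : S} (hl : ‖l‖ = 1) (hq : ‖q‖ < 1)
    (hζ : ‖ζ‖ ≤ 1) : LeansAt (u.mob hl hq) ζ p ↔ LeansAt u (mob l q ζ) p := by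
  refine ⟨fun h => ?_, fun h => h.mob hl hq hζ⟩
  have hl' := norm_conj_eq_one hl
  have hq' := norm_inv_center hl hq
  have h1 : Tendsto (fun w => extend (u.mob hl hq).1 (ProjSurf.mob (conj l) (-(conj l * q)) w))
      (𝓝[𝔹] (ProjSurf.mob l q ζ)) (𝓝 p) := by
    have h2 := tendsto_mob_nhdsWithin hl' hq' (norm_mob_le_one hl hq hζ)
    rw [mob_inv hl hq hζ] at h2
    exact Tendsto.comp h h2
  refine h1.congr' ?_
  filter_upwards [self_mem_nhdsWithin] with w hw
  rw [mem_ball_zero_iff] at hw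
  rw [extend_mob _ _ _ (norm_mob_lt_one hl' hq' hw), mob_inv' hl hq hw.le]

/-- The action of the automorphism `mob l q` on the unit circle. -/
def mobCircle (hl : ‖l‖ = 1) (hq : ‖q‖ < 1) : Circle ≃ Circle where
  toFun ζ := ⟨mob l q ζ, mem_sphere_zero_iff_norm.2 (norm_mob_eq_one hl hq ζ.norm_coe)⟩
  invFun ζ := ⟨mob (conj l) (-(conj l * q)) ζ, mem_sphere_zero_iff_norm.2
    (norm_mob_eq_one (norm_conj_eq_one hl) (norm_inv_center hl hq) ζ.norm_coe)⟩
  left_inv ζ := Circle.ext (mob_inv hl hq ζ.norm_coe.le)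
  right_inv ζ := Circle.ext (mob_inv' hl hq ζ.norm_coe.le)

lemma coe_mobCircle (hl : ‖l‖ = 1) (hq : ‖q‖ < 1) (ζ : Circle) :
    (mobCircle hl hq ζ : ℂ) = mob l q ζ := rfl

lemma leanPoints_mob (u : Q.DiskMap) (hl : ‖l‖ = 1) (hq : ‖q‖ < 1) :
    Q.leanPoints (u.mob hl hq) = mobCircle hl hq ⁻¹' Q.leanPoints u := by
  ext ζ
  rw [Set.mem_preimage, mem_leanPoints_iff, mem_leanPoints_iff]
  simp only [leansAt_mob_iff hl hq ζ.norm_coe.le, coe_mobCircle]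

lemma encard_leanPoints_mob (u : Q.DiskMap) (hl : ‖l‖ = 1) (hq : ‖q‖ < 1) :
    (Q.leanPoints (u.mob hl hq)).encard = (Q.leanPoints u).encard := by
  rw [leanPoints_mob, Set.encard_preimage_of_bijective (mobCircle hl hq).bijective]

lemma encard_leanPoints_congr {u v : Q.DiskMap} (h : Q.toDisk u = Q.toDisk v) :
    (Q.leanPoints u).encard = (Q.leanPoints v).encard := by
  obtain ⟨l, q, hl, hq, rfl⟩ := exists_eq_mob_of_toDisk_eq h
  exact encard_leanPoints_mob v hl hq

/-- The projective map of the disk given by an `exp`-projective map of the strip. -/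
def ProjectiveStructure.ofStrip (Q : ProjectiveStructure S P) (U : ℂ → S)
    (hU : Q.ProjOn exp U (strip π)) : Q.DiskMap :=
  Q.diskMap (fun w => U (stripLog w)) (by
    have h1 := hU.comp (g := stripLog) (W' := 𝔹)
      (fun s hs => (analyticAt_stripLog_of_lt (mem_ball_zero_iff.1 hs)).continuousAt)
      fun s hs => im_stripLog (mem_ball_zero_iff.1 hs)
    refine h1.change fun s hs => ⟨adj cayGL, ?_⟩
    filter_upwards [isOpen_ball.mem_nhds hs] with s' hs'
    rw [mem_ball_zero_iff] at hs'
    obtain ⟨h2, h3⟩ := im_stripLog hs'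
    have h4 := moebiusRel_cay (s := stripLog s') (by linarith [pi_pos]) (by linarith [pi_pos])
    rw [cay_stripLog (ne_of_norm_lt_one hs').1 (ne_of_norm_lt_one hs').2] at h4
    exact h4.inv)

lemma extend_ofStrip {U : ℂ → S} (hU : Q.ProjOn exp U (strip π)) {w : ℂ}
    (hw : ‖w‖ < 1) : extend (Q.ofStrip U hU).1 w = U (stripLog w) := extend_diskMap _ hw

lemma extend_ofStrip_cay {U : ℂ → S} (hU : Q.ProjOn exp U (strip π)) {s : ℂ}
    (hs : s ∈ strip π) : extend (Q.ofStrip U hU).1 (cay s) = U s := by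
  have hpi := pi_pos
  rw [extend_ofStrip hU (norm_cay_lt_one hs.1 hs.2),
    stripLog_cay (by linarith [hs.1]) (by linarith [hs.2])]

lemma projOn_strip (u : Q.DiskMap) : Q.ProjOn exp (fun s => extend u.1 (cay s)) (strip π) := by
  have hpi := pi_pos
  have him : ∀ s ∈ strip π, -(π / 2) < s.im ∧ s.im < 3 * π / 2 := fun s hs =>
    ⟨by linarith [hs.1], by linarith [hs.2]⟩
  have h1 := (DiskMap.projOn u).comp (g := cay) (W' := strip π)
    (fun s hs => (analyticAt_cay (him s hs).1 (him s hs).2).continuousAt)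
    fun s hs => mem_ball_zero_iff.2 (norm_cay_lt_one hs.1 hs.2)
  refine h1.change fun s hs => ⟨cayGL, ?_⟩
  filter_upwards [(isOpen_strip _).mem_nhds hs] with s' hs'
  exact moebiusRel_cay (him s' hs').1 (him s' hs').2

/-- Leaning at `1` in the coordinate of the strip. -/
lemma leansAt_one_iff {u : Q.DiskMap} {p : S} :
    LeansAt u 1 p ↔ Tendsto (fun s => extend u.1 (cay s)) (stripEnd 0 π) (𝓝 p) := by
  refine ⟨fun h => h.comp tendsto_cay_stripEnd, fun h => ?_⟩
  refine (h.comp tendsto_stripLog).congr' ?_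
  filter_upwards [self_mem_nhdsWithin] with w hw
  obtain ⟨h1, h2⟩ := ne_of_norm_lt_one (mem_ball_zero_iff.1 hw)
  rw [Function.comp_apply, cay_stripLog h1 h2]

lemma norm_neg_one : ‖(-1 : ℂ)‖ = 1 := by simp

lemma mob_neg_one_zero (w : ℂ) : mob (-1) 0 w = -w := by simp [mob]

/-- Leaning at `-1` in the coordinate of the strip. -/
lemma leansAt_neg_one_iff {u : Q.DiskMap} {p : S} : LeansAt u (-1) p ↔
      Tendsto (fun s => extend u.1 (cay (π * I - s))) (stripEnd 0 π) (𝓝 p) := by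
  have h0 : ‖(0 : ℂ)‖ < 1 := by simp
  have h1 := leansAt_mob_iff (u := u) (ζ := 1) (p := p) norm_neg_one h0 (by simp)
  rw [mob_neg_one_zero] at h1
  rw [← h1, leansAt_one_iff]
  refine tendsto_congr' ?_
  filter_upwards [eventually_mem_halfStrip 0 0 π] with s hs
  rw [extend_mob _ _ _ (norm_cay_lt_one hs.2.1 hs.2.2), mob_neg_one_zero, cay_pi_sub]

/-- A projective map is not constant near any point. -/
lemma ProjectiveStructure.ProjOn.eventually_ne {χ : ℂ → ℂ} {U : ℂ → S} {W : Set ℂ}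
    (h : Q.ProjOn χ U W) {s : ℂ} (hs : s ∈ W) :
    ∃ N ∈ 𝓝 s, ∀ s₁ ∈ N, ∀ s₂ ∈ N, U s₁ = U s₂ → χ s₁ = χ s₂ := by
  obtain ⟨-, e, -, -, A, hA⟩ := h s hs
  refine ⟨_, hA, fun s₁ h1 s₂ h2 h3 => ?_⟩
  have h4 : MoebiusRel A (χ s₁) (e (U s₁)) := h1
  have h5 : MoebiusRel A (χ s₂) (e (U s₂)) := h2
  rw [← h3] at h5
  exact h4.left_unique h5

lemma not_const_diskMap (u : Q.DiskMap) {x : S} (h : ∀ w : ℂ, ‖w‖ < 1 → extend u.1 w = x) :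
    False := by
  obtain ⟨N, hN, hinj⟩ := (DiskMap.projOn u).eventually_ne (s := 0) (by simp)
  have h1 : ∀ᶠ w in 𝓝[≠] (0 : ℂ), w ∈ N ∧ ‖w‖ < 1 := by
    refine Eventually.filter_mono nhdsWithin_le_nhds (Eventually.and hN ?_)
    have := ball_mem_nhds (0 : ℂ) one_pos
    filter_upwards [this] with w hw using mem_ball_zero_iff.1 hw
  obtain ⟨w, ⟨hw, hw1⟩, hw0⟩ := (h1.and self_mem_nhdsWithin).exists
  exact hw0 (hinj w hw 0 (mem_of_mem_nhds hN) (by rw [h w hw1, h 0 (by simp)]))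

end Leaning

/-! ### Extension of a disk beyond its boundary -/

lemma im_stripLog_of_slitPlane {w : ℂ} (h : (1 + w) / (1 - w) ∈ slitPlane) :
    -(π / 2) < (stripLog w).im ∧ (stripLog w).im < 3 * π / 2 := by
  have h1 : (stripLog w).im = ((1 + w) / (1 - w)).arg + π / 2 := by
    rw [stripLog, add_im, log_im]; simp
  have h2 := neg_pi_lt_arg ((1 + w) / (1 - w))
  have h3 := lt_of_le_of_ne (arg_le_pi ((1 + w) / (1 - w))) (Complex.mem_slitPlane_iff_arg.1 h).1
  grind

/-- The outward ray that starts at the point `a` of the unit circle. -/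
def ray (a : ℂ) : Set ℂ := {w | ∃ t : ℝ, 1 ≤ t ∧ w = t * a}

lemma notMem_ray {a w : ℂ} (ha : ‖a‖ = 1) (hw : ‖w‖ < 1) : w ∉ ray a := by
  rintro ⟨t, ht, rfl⟩
  rw [norm_mul, ha, mul_one, norm_real, norm_of_nonneg (by linarith)] at hw
  linarith

lemma mem_slitPlane_of_notMem_ray {w : ℂ} (hw : w ∉ ray 1) (hw1 : ‖w - 1‖ < 1) :
    (1 + w) / (1 - w) ∈ slitPlane := by
  by_contra hcon
  rw [Complex.mem_slitPlane_iff, not_or, not_lt, not_ne_iff] at hcon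
  obtain ⟨hre, him⟩ := hcon
  set x := ((1 + w) / (1 - w)).re with hx
  have hxw : (1 + w) / (1 - w) = (x : ℂ) := Complex.ext (by simp [hx]) (by simpa using him)
  have hw1' : 1 - w ≠ 0 := fun h => by
    refine hw ⟨1, le_rfl, ?_⟩
    push_cast
    grind
  rw [div_eq_iff hw1'] at hxw
  have hx1 : (x : ℂ) + 1 ≠ 0 := fun h => by grind
  have hx1' : x + 1 ≠ 0 := by exact_mod_cast hx1
  have hwx : w = (((x - 1) / (x + 1) : ℝ) : ℂ) := by
    push_cast
    grind
  rcases lt_or_gt_of_ne hx1' with h | h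
  · refine hw ⟨(x - 1) / (x + 1), ?_, by rw [mul_one]; exact hwx⟩
    rw [le_div_iff_of_neg h]; linarith
  · have h2 : (x - 1) / (x + 1) ≤ -1 := by rw [div_le_iff₀ h]; linarith
    rw [hwx, ← ofReal_one, ← ofReal_sub, norm_real, norm_eq_abs, abs_lt] at hw1
    linarith

lemma exists_extension_at_one [T2Space S] [IsManifold 𝓘(ℂ) ω S] {u : Q.DiskMap} {p : S}
    (hp : p ∈ P) (K : CuspModel Q p) (h : LeansAt u 1 p) :
    ∃ ρ > 0, ∃ V : ℂ → S, Q.ProjOn id V (ball 1 ρ \ ray 1) ∧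
      (∀ w ∈ ball (1 : ℂ) ρ, ‖w‖ < 1 → V w = extend u.1 w) ∧
      Tendsto V (𝓝[(ray 1)ᶜ] 1) (𝓝 p) := by
  have hpi := pi_pos
  obtain ⟨R1, UP, hUP, hlim, heq⟩ := K.exists_extension hp (R0 := 0)
    ((projOn_strip u).mono fun s hs => hs.2) (leansAt_one_iff.1 h) (M := 2 * π) (by linarith)
  obtain ⟨ρ0, hρ₀, hre⟩ := Metric.mem_nhdsWithin_iff.1
    (tendsto_re_stripLog.eventually (eventually_gt_atTop R1))
  have hne : ∀ {w : ℂ}, w ∉ ray 1 → w ≠ 1 := by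
    rintro w hw rfl
    exact hw ⟨1, le_rfl, by simp⟩
  have hmem : ∀ w ∈ ball (1 : ℂ) (min ρ0 1) \ ray 1, stripLog w ∈ halfStrip R1 (-(2 * π)) (2 * π) ∧
      (1 + w) / (1 - w) ∈ slitPlane := by
    rintro w ⟨hw, hwr⟩
    have h1 := mem_slitPlane_of_notMem_ray hwr (by
      rw [← dist_eq_norm]; exact (mem_ball.1 hw).trans_le (min_le_right _ _))
    obtain ⟨h2, h3⟩ := im_stripLog_of_slitPlane h1
    refine ⟨⟨hre ⟨ball_subset_ball (min_le_left _ _) hw, hne hwr⟩, ?_, ?_⟩, h1⟩ <;> linarith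
  have hray : IsClosed (ray 1) := by
    have : ray 1 = Complex.ofReal '' Set.Ici 1 := by
      ext w
      simp only [ray, mul_one, Set.mem_ofPred_eq, Set.mem_image, Set.mem_Ici]
      grind
    rw [this]
    exact Complex.isometry_ofReal.isClosedEmbedding.isClosedMap _ isClosed_Ici
  have hopen : IsOpen (ball (1 : ℂ) (min ρ0 1) \ ray 1) := isOpen_ball.sdiff hray
  refine ⟨min ρ0 1, lt_min hρ₀ one_pos, fun w => UP (stripLog w), ?_, ?_, ?_⟩
  · have h1 := hUP.comp (g := stripLog) (W' := ball (1 : ℂ) (min ρ0 1) \ ray 1)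
      (fun w hw => (analyticAt_stripLog (hne hw.2) (hmem w hw).2).continuousAt)
      fun w hw => (hmem w hw).1
    refine h1.change fun w hw => ⟨adj cayGL, ?_⟩
    filter_upwards [hopen.mem_nhds hw] with w' hw'
    obtain ⟨h2, h3⟩ := im_stripLog_of_slitPlane (hmem w' hw').2
    have h4 := moebiusRel_cay h2 h3
    have h5 : w' ≠ -1 := by
      rintro rfl
      have := (mem_ball.1 hw'.1).trans_le (min_le_right _ _)
      rw [dist_eq_norm] at this
      norm_num at this
    rw [cay_stripLog (hne hw'.2) h5] at h4
    exact h4.inv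
  · intro w hw hw1
    obtain ⟨h1, h2⟩ := ne_of_norm_lt_one hw1
    have h3 := (hmem w ⟨hw, notMem_ray (by simp) hw1⟩).1.1
    change UP (stripLog w) = _
    rw [heq _ ⟨h3, im_stripLog hw1⟩, cay_stripLog h1 h2]
  · refine hlim.comp ?_
    intro X hX
    obtain ⟨r, hr⟩ := eventually_stripEnd.1 hX
    rw [mem_map]
    have h1 : ∀ᶠ w in 𝓝[(ray 1)ᶜ] (1 : ℂ), r < (stripLog w).re :=
      (tendsto_re_stripLog.mono_left (nhdsWithin_mono _ fun w hw => hne hw)).eventually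
        (eventually_gt_atTop r)
    have h2 : ∀ᶠ w in 𝓝[(ray 1)ᶜ] (1 : ℂ), w ∈ ball (1 : ℂ) (min ρ0 1) :=
      nhdsWithin_le_nhds (ball_mem_nhds _ (lt_min hρ₀ one_pos))
    filter_upwards [h1, h2, self_mem_nhdsWithin] with w h3 h4 h5
    exact hr _ ⟨h3, (hmem w ⟨h4, h5⟩).1.2⟩

/-- Near a point of the unit circle at which it leans on a puncture, a disk extends to a slit
neighbourhood. -/
lemma exists_extension_of_leansAt [T2Space S] [IsManifold 𝓘(ℂ) ω S] {u : Q.DiskMap} {p : S}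
    (hp : p ∈ P) (K : CuspModel Q p) {a : ℂ} (ha : ‖a‖ = 1) (h : LeansAt u a p) :
    ∃ ρ > 0, ∃ V : ℂ → S, Q.ProjOn id V (ball a ρ \ ray a) ∧
      (∀ w ∈ ball a ρ, ‖w‖ < 1 → V w = extend u.1 w) ∧
      Tendsto V (𝓝[(ray a)ᶜ] a) (𝓝 p) := by
  have h0 : ‖(0 : ℂ)‖ < 1 := by simp
  have hrot : ∀ w, mob a 0 w = a * w := fun w => by simp [mob]
  have ha0 : a ≠ 0 := by rintro rfl; simp at ha
  obtain ⟨ρ, hρ, V, hV, hVe, hVl⟩ := exists_extension_at_one (u := u.mob ha h0) hp K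
    (LeansAt.mob ha h0 (by simp) (by rwa [hrot, mul_one]))
  have hball : ∀ w, w ∈ ball a ρ ↔ w / a ∈ ball (1 : ℂ) ρ := fun w => by
    rw [mem_ball, mem_ball, dist_eq_norm, dist_eq_norm, div_sub_one ha0, norm_div, ha, div_one]
  have hray : ∀ w, w ∈ ray a ↔ w / a ∈ ray 1 := fun w => by
    refine exists_congr fun t => and_congr_right fun _ => ?_
    grind
  refine ⟨ρ, hρ, fun w => V (w / a), ?_, ?_, ?_⟩
  · have h1 := hV.comp (g := fun w => w / a) (W' := ball a ρ \ ray a)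
      (fun w _ => (continuous_id.div_const a).continuousAt)
      fun w hw => ⟨(hball w).1 hw.1, fun h => hw.2 ((hray w).2 h)⟩
    refine h1.change fun w hw => ⟨mkGL 1 0 0 a (by simpa using ha0), Eventually.of_forall fun w' => ?_⟩
    rw [moebiusRel_mkGL]
    simp [ha0]
  · intro w hw hw1
    have h2 : ‖w / a‖ < 1 := by rwa [norm_div, ha, div_one]
    change V (w / a) = _
    rw [hVe _ ((hball w).1 hw) h2, extend_mob _ _ _ h2, hrot, mul_div_cancel₀ _ ha0]
  · refine hVl.comp ?_
    rw [tendsto_nhdsWithin_iff]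
    refine ⟨?_, ?_⟩
    · have : Tendsto (fun w => w / a) (𝓝 a) (𝓝 (a / a)) := (continuous_id.div_const a).tendsto a
      rw [div_self ha0] at this
      exact this.mono_left nhdsWithin_le_nhds
    · filter_upwards [self_mem_nhdsWithin] with w hw
      exact fun h => hw ((hray w).2 h)

/-- Near a point of the unit circle at which its boundary value is not a puncture, a disk extends
to a neighbourhood. -/
lemma exists_extension_of_notMem [IsManifold 𝓘(ℂ) ω S] {u : Q.DiskMap} {x : S}
    (hx : x ∉ P) {a : ℂ} (ha : ‖a‖ = 1) (h : LeansAt u a x) :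
    ∃ ρ > 0, ∃ V : ℂ → S, Q.ProjOn id V (ball a ρ) ∧
      ∀ w ∈ ball a ρ, ‖w‖ < 1 → V w = extend u.1 w := by
  have hnb := neBot_nhdsWithin_ball ha.le
  obtain ⟨e, he, hxe⟩ := Q.cover x hx
  obtain ⟨ρ0, hρ₀, hsrc⟩ := Metric.mem_nhdsWithin_iff.1 (h.eventually (e.open_source.mem_nhds hxe))
  have hne : (ball a ρ0 ∩ 𝔹).Nonempty := by
    have h1 : ∀ᶠ w in 𝓝[𝔹] a, w ∈ ball a ρ0 := nhdsWithin_le_nhds (ball_mem_nhds _ hρ₀)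
    exact (h1.and self_mem_nhdsWithin).exists
  obtain ⟨A, hA⟩ := ((DiskMap.projOn u).mono (Set.inter_subset_right (s := ball a ρ0))).exists_moebius
    (fun _ _ => analyticAt_id) ((convex_ball _ _).inter (convex_ball _ _)).isPreconnected hne he hsrc
  simp only [id] at hA
  have hev : ∀ᶠ w in 𝓝[𝔹] a, MoebiusRel A w (e (extend u.1 w)) := by
    have h1 : ∀ᶠ w in 𝓝[𝔹] a, w ∈ ball a ρ0 := nhdsWithin_le_nhds (ball_mem_nhds _ hρ₀)
    filter_upwards [h1, self_mem_nhdsWithin] with w h2 h3 using hA w ⟨h2, h3⟩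
  have hlim : Tendsto (fun w => e (extend u.1 w)) (𝓝[𝔹] a) (𝓝 (e x)) :=
    (e.continuousAt hxe).tendsto.comp h
  have hc : ∀ y z : ℂ, Tendsto (fun w : ℂ => y * w + z) (𝓝[𝔹] a) (𝓝 (y * a + z)) :=
    fun y z => (((continuous_const.mul continuous_id).add continuous_const).tendsto a).mono_left
      nhdsWithin_le_nhds
  have hmul : e x * (A 1 0 * a + A 1 1) = A 0 0 * a + A 0 1 := by
    refine tendsto_nhds_unique ((hlim.mul (hc (A 1 0) (A 1 1))).congr' ?_) (hc (A 0 0) (A 0 1))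
    filter_upwards [hev] with w hw
    rw [hw.2, div_mul_cancel₀ _ hw.1]
  have hden : A 1 0 * a + A 1 1 ≠ 0 := fun h0 => by
    rw [h0, mul_zero] at hmul
    apply det_ne_zero_of_GL A
    linear_combination A 0 0 * h0 + A 1 0 * hmul
  set m : ℂ → ℂ := fun w => (A 0 0 * w + A 0 1) / (A 1 0 * w + A 1 1) with hm
  have hma : m a = e x := by rw [hm]; simp only; rw [← hmul, mul_div_cancel_right₀ _ hden]
  have hmc : ∀ w, A 1 0 * w + A 1 1 ≠ 0 → ContinuousAt m w := fun w hw => by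
    simp only [hm]
    fun_prop (disch := assumption)
  have hgood : ∀ᶠ w in 𝓝 a, A 1 0 * w + A 1 1 ≠ 0 ∧ m w ∈ e.target := by
    refine Eventually.and ?_ ?_
    · have : Continuous fun w : ℂ => A 1 0 * w + A 1 1 := by fun_prop
      exact this.continuousAt.eventually_ne hden
    · exact (hmc a hden).eventually (e.open_target.mem_nhds (hma ▸ e.map_source hxe))
  obtain ⟨ρ1, hρ1, hball⟩ := Metric.mem_nhds_iff.1 hgood
  refine ⟨min ρ0 ρ1, lt_min hρ₀ hρ1, fun w => e.symm (m w), fun w hw => ?_, fun w hw hw1 => ?_⟩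
  · obtain ⟨h1, h2⟩ := hball (ball_subset_ball (min_le_right _ _) hw)
    refine ⟨ContinuousAt.comp' (f := m) (e.continuousAt_symm h2) (hmc w h1), e, he,
      e.map_target h2, A, ?_⟩
    filter_upwards [isOpen_ball.mem_nhds hw] with w' hw'
    obtain ⟨h3, h4⟩ := hball (ball_subset_ball (min_le_right _ _) hw')
    rw [e.right_inv h4]
    exact ⟨h3, rfl⟩
  · have h1 : w ∈ ball a ρ0 ∩ 𝔹 := ⟨ball_subset_ball (min_le_left _ _) hw, mem_ball_zero_iff.2 hw1⟩
    change e.symm (m w) = _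
    rw [hm]; simp only
    rw [← (hA w h1).2, e.left_inv (hsrc h1)]

/-- The points of the unit circle at which `u` leans on the punctures, as complex numbers. -/
def leanSet (u : Q.DiskMap) : Set ℂ := {a | ‖a‖ = 1 ∧ ∃ p ∈ P, LeansAt u a p}

lemma coe_mem_leanSet {u : Q.DiskMap} {ζ : Circle} : (ζ : ℂ) ∈ leanSet u ↔ ζ ∈ Q.leanPoints u := by
  rw [mem_leanPoints_iff]
  exact and_iff_right ζ.norm_coe

lemma leanSet_eq (u : Q.DiskMap) : leanSet u = (fun ζ : Circle => (ζ : ℂ)) '' Q.leanPoints u := by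
  ext a
  constructor
  · intro ha
    exact ⟨⟨a, mem_sphere_zero_iff_norm.2 ha.1⟩, coe_mem_leanSet.1 ha, rfl⟩
  · rintro ⟨ζ, hζ, rfl⟩
    exact coe_mem_leanSet.2 hζ

lemma exists_leansAt_of_extends {u : Q.DiskMap} (hext : Q.ExtendsToClosedDisk u) {a : ℂ}
    (ha : ‖a‖ ≤ 1) : ∃ x, LeansAt u a x := by
  obtain ⟨ubar, hc, hu⟩ := hext
  refine ⟨ubar a, ?_⟩
  have h1 := (hc a (by simpa using ha)).mono ball_subset_closedBall
  refine h1.tendsto.congr' ?_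
  filter_upwards [self_mem_nhdsWithin] with w hw
  rw [mem_ball_zero_iff] at hw
  rw [extend_of_lt _ hw, ← hu]; rfl

/-- The part near the point `ξ` of the circle of the collar `collar L c`. -/
def petal (L : Set ℂ) (c : ℝ) (ξ : ℂ) : Set ℂ := {w | ‖w - ξ‖ < c ∧ ∀ a ∈ L, ‖w - ξ‖ < c * ‖ξ - a‖}

/-- The neighbourhood of the complement of `L` in the closed unit disk, which touches the points
of `L` with an opening angle that depends on `c`. -/
def collar (L : Set ℂ) (c : ℝ) : Set ℂ := {w | ‖w‖ < 1 ∨ ∃ ξ, ‖ξ‖ = 1 ∧ w ∈ petal L c ξ}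

lemma petal_eq (L : Set ℂ) (c : ℝ) (ξ : ℂ) :
    petal L c ξ = ball ξ c ∩ ⋂ a ∈ L, ball ξ (c * ‖ξ - a‖) := by
  ext w; simp [petal, dist_eq_norm]

lemma convex_petal (L : Set ℂ) (c : ℝ) (ξ : ℂ) : Convex ℝ (petal L c ξ) := by
  rw [petal_eq]
  exact (convex_ball _ _).inter (convex_iInter₂ fun _ _ => convex_ball _ _)

lemma isOpen_petal {L : Set ℂ} (hL : L.Finite) (c : ℝ) (ξ : ℂ) : IsOpen (petal L c ξ) := by
  rw [petal_eq]
  exact isOpen_ball.inter (hL.isOpen_biInter fun _ _ => isOpen_ball)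

/-- The radial projection to the unit circle decreases the distance to points of the circle. -/
lemma norm_radial_sub_le {w ξ : ℂ} (hξ : ‖ξ‖ = 1) (hw : 1 ≤ ‖w‖) : ‖w / ‖w‖ - ξ‖ ≤ ‖w - ξ‖ := by
  have hn : (0 : ℝ) < ‖w‖ := by linarith
  have hnc : (‖w‖ : ℂ) ≠ 0 := by exact_mod_cast hn.ne'
  set v := w / ‖w‖ with hv
  have hv1 : ‖v‖ = 1 := by rw [hv, norm_div, norm_real, norm_norm, div_self hn.ne']
  have hwv : w = (‖w‖ : ℝ) • v := by rw [real_smul, hv]; field_simp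
  rw [← sq_le_sq₀ (norm_nonneg _) (norm_nonneg _)]
  have h1 : ‖w - ξ‖ ^ 2 = ‖w‖ ^ 2 - 2 * (‖w‖ * inner ℝ v ξ) + 1 := by
    conv_lhs => rw [hwv]
    rw [norm_sub_sq_real, norm_smul, norm_of_nonneg hn.le, hv1, hξ, real_inner_smul_left]
    ring
  have h2 : ‖v - ξ‖ ^ 2 = 2 - 2 * inner ℝ v ξ := by rw [norm_sub_sq_real, hv1, hξ]; ring
  nlinarith

lemma radial_mem_petal {L : Set ℂ} {c : ℝ} {w ξ : ℂ} (hξ : ‖ξ‖ = 1) (hw : 1 ≤ ‖w‖)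
    (h : w ∈ petal L c ξ) : w / ‖w‖ ∈ petal L c ξ :=
  ⟨(norm_radial_sub_le hξ hw).trans_lt h.1, fun a ha => (norm_radial_sub_le hξ hw).trans_lt (h.2 a ha)⟩

lemma exists_norm_lt_one_mem {X : Set ℂ} (hX : IsOpen X) {v : ℂ} (hv : ‖v‖ ≤ 1) (h : v ∈ X) :
    ∃ s ∈ X, ‖s‖ < 1 := by
  have hnb := neBot_nhdsWithin_ball hv
  have h1 : ∀ᶠ w in 𝓝[𝔹] v, w ∈ X := nhdsWithin_le_nhds (hX.mem_nhds h)
  obtain ⟨s, hs, hs1⟩ := (h1.and self_mem_nhdsWithin).exists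
  exact ⟨s, hs, mem_ball_zero_iff.1 hs1⟩

lemma disjoint_ray_of_petal {L : Set ℂ} {c : ℝ} (hc : c ≤ 1 / 2) {w ξ a : ℂ} (ha : a ∈ L)
    (hξ : ‖ξ‖ = 1) (ha1 : ‖a‖ = 1) (h : w ∈ petal L c ξ) : w ∉ ray a := by
  rintro ⟨t, ht, rfl⟩
  have h1 := h.2 a ha
  have h2 : ‖(t : ℂ) * a - a‖ = t - 1 := by
    rw [← sub_one_mul, norm_mul, ha1, mul_one, ← ofReal_one, ← ofReal_sub,
      norm_real, norm_of_nonneg (by linarith)]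
  have h3 : ‖(t : ℂ) * a‖ = t := by
    rw [norm_mul, ha1, mul_one, norm_real, norm_of_nonneg (by linarith)]
  have h4 := norm_le_norm_add_norm_sub ξ ((t : ℂ) * a)
  have h5 : ‖ξ - a‖ ≤ ‖(t : ℂ) * a - ξ‖ + ‖(t : ℂ) * a - a‖ := by
    have := norm_sub_le ((t : ℂ) * a - a) ((t : ℂ) * a - ξ)
    rw [sub_sub_sub_cancel_left] at this
    linarith
  rw [h3, hξ] at h4
  rw [norm_sub_rev] at h4
  have h6 : ‖ξ - (t : ℂ) * a‖ = ‖(t : ℂ) * a - ξ‖ := norm_sub_rev _ _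
  nlinarith [norm_nonneg (ξ - a)]

/-! ### Extension to a collar -/

/-- A local extension of `u` around a point `a` of the unit circle: to a neighbourhood of `a`, or
to a slit neighbourhood if `u` leans on a puncture at `a`. -/
lemma exists_local_extension [T2Space S] [IsManifold 𝓘(ℂ) ω S]
    (hcusp : ∀ p ∈ P, Nonempty (CuspModel Q p)) {u : Q.DiskMap} (hext : Q.ExtendsToClosedDisk u)
    {a : ℂ} (ha : ‖a‖ = 1) :
    ∃ ρ > 0, ∃ V : ℂ → S, Q.ProjOn id V (ball a ρ \ {w | a ∈ leanSet u ∧ w ∈ ray a}) ∧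
      (∀ w ∈ ball a ρ, ‖w‖ < 1 → V w = extend u.1 w) ∧
      ∀ p ∈ P, LeansAt u a p → Tendsto V (𝓝[(ray a)ᶜ] a) (𝓝 p) := by
  obtain ⟨x, hx⟩ := exists_leansAt_of_extends hext ha.le
  by_cases hxP : x ∈ P
  · obtain ⟨K⟩ := hcusp x hxP
    obtain ⟨ρ, hρ, V, h1, h2, h3⟩ := exists_extension_of_leansAt hxP K ha hx
    refine ⟨ρ, hρ, V, h1.mono ?_, h2, fun p hp hpl => ?_⟩
    · rintro w ⟨hw, hwr⟩
      exact ⟨hw, fun h => hwr ⟨⟨ha, x, hxP, hx⟩, h⟩⟩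
    · rwa [hpl.unique ha.le hx]
  · obtain ⟨ρ, hρ, V, h1, h2⟩ := exists_extension_of_notMem hxP ha hx
    exact ⟨ρ, hρ, V, h1.mono Set.sdiff_subset, h2, fun p hp hpl =>
      absurd (hpl.unique ha.le hx ▸ hp) hxP⟩

/-- The boundary value of a map that extends projectively across `ζ` is not a puncture. -/
lemma not_leansAt_of_extension [T2Space S] {u : Q.DiskMap} {V : ℂ → S} {X : Set ℂ}
    {ζ : ℂ} (hX : X ∈ 𝓝 ζ) (hζ : ‖ζ‖ ≤ 1) (hV : Q.ProjOn id V X)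
    (hVu : ∀ w ∈ X, ‖w‖ < 1 → V w = extend u.1 w) {p : S} (hp : p ∈ P) : ¬ LeansAt u ζ p := by
  intro h
  have hnb := neBot_nhdsWithin_ball hζ
  have h1 := (hV ζ (mem_of_mem_nhds hX)).1.tendsto.mono_left (nhdsWithin_le_nhds (s := 𝔹))
  refine h.not_of_curve hp (F := 𝓝[𝔹] ζ) (γ := fun w => w) tendsto_id
    (hV.notMem (mem_of_mem_nhds hX)) (h1.congr' ?_)
  filter_upwards [nhdsWithin_le_nhds hX, self_mem_nhdsWithin] with w h2 h3
  simp_all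

lemma notMem_ray_of_ne {a ζ : ℂ} (ha : ‖a‖ = 1) (hζ : ‖ζ‖ = 1) (h : ζ ≠ a) : ζ ∉ ray a := by
  rintro ⟨t, ht, rfl⟩
  rw [norm_mul, ha, mul_one, norm_real, norm_of_nonneg (by linarith)] at hζ
  simp_all

/-- A disk that extends continuously to the closed disk leans on the punctures at finitely many
points, and it extends projectively to a collar. -/
lemma exists_collar_extension [T2Space S] [IsManifold 𝓘(ℂ) ω S]
    (hcusp : ∀ p ∈ P, Nonempty (CuspModel Q p)) {u : Q.DiskMap} (hext : Q.ExtendsToClosedDisk u) :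
    (leanSet u).Finite ∧ ∃ c : ℝ, 0 < c ∧ c ≤ 1 / 2 ∧ ∃ V : ℂ → S,
      Q.ProjOn id V (collar (leanSet u) c) ∧ (∀ w : ℂ, ‖w‖ < 1 → V w = extend u.1 w) ∧
      ∀ a : ℂ, ‖a‖ = 1 → ∀ p ∈ P, LeansAt u a p → Tendsto V (𝓝[collar (leanSet u) c] a) (𝓝 p) := by
  have hloc := fun (a : ℂ) (ha : ‖a‖ = 1) => exists_local_extension hcusp hext ha
  have hS : Nonempty S := ⟨extend u.1 0⟩
  choose! ρ hρ V hV hVu hVl using hloc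
  set L := leanSet u with hL
  have hcomp : IsCompact (sphere (0 : ℂ) 1) := isCompact_sphere _ _
  have hrayc : ∀ a : ℂ, IsClosed (ray a) := fun a => by
    have : ray a = (fun t : ℝ => (t : ℂ) * a) '' Set.Ici 1 := by
      ext w
      simp only [ray, Set.mem_ofPred_eq, Set.mem_image, Set.mem_Ici]
      grind
    rw [this]
    by_cases ha : a = 0
    · simp [*]
    · have h1 : Topology.IsClosedEmbedding (fun t : ℝ => (t : ℂ) * a) :=
        (Homeomorph.mulRight₀ a ha).isClosedEmbedding.comp Complex.isometry_ofReal.isClosedEmbedding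
      exact h1.isClosedMap _ isClosed_Ici
  -- a neighbourhood on which there is a local extension contains no other leaning point
  have honly : ∀ a, ‖a‖ = 1 → ∀ ζ ∈ L, ζ ∈ ball a (ρ a) → ζ = a := fun a ha ζ hζ hζa => by
    by_contra hne
    obtain ⟨hζ1, p, hp, hζp⟩ := hζ
    refine not_leansAt_of_extension (X := ball a (ρ a) \ ray a) ?_ hζ1.le
      ((hV a ha).mono ?_) (fun w hw hw1 => hVu a ha w hw.1 hw1) hp hζp
    · exact (isOpen_ball.sdiff (hrayc a)).mem_nhds ⟨hζa, notMem_ray_of_ne ha hζ1 hne⟩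
    · grind
  have hfin : L.Finite := by
    obtain ⟨t, ht, htc⟩ := hcomp.elim_nhds_subcover (fun a => ball a (ρ a)) fun a ha =>
      ball_mem_nhds a (hρ a (mem_sphere_zero_iff_norm.1 ha))
    refine t.finite_toSet.subset fun ζ hζ => ?_
    obtain ⟨a, hat, hζa⟩ := Set.mem_iUnion₂.1 (htc (mem_sphere_zero_iff_norm.2 hζ.1))
    rw [honly a (mem_sphere_zero_iff_norm.1 (ht a hat)) ζ hζ hζa]
    exact hat
  obtain ⟨δ, hδ, hleb⟩ := lebesgue_number_lemma_of_metric hcomp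
    (c := fun a : sphere (0 : ℂ) 1 => ball (a : ℂ) (ρ a))
    (fun a => isOpen_ball) fun a ha => Set.mem_iUnion.2 ⟨⟨a, ha⟩,
      mem_ball_self (hρ a (mem_sphere_zero_iff_norm.1 ha))⟩
  set c := min δ (1 / 2) with hc
  have hc0 : 0 < c := lt_min hδ (by norm_num)
  have hc2 : c ≤ 1 / 2 := min_le_right _ _
  -- the local extensions to the petals
  have hpet : ∀ ξ : ℂ, ‖ξ‖ = 1 → ∃ W : ℂ → S, Q.ProjOn id W (petal L c ξ) ∧
      ∀ w ∈ petal L c ξ, ‖w‖ < 1 → W w = extend u.1 w := fun ξ hξ => by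
    obtain ⟨⟨a, ha⟩, hball⟩ := hleb ξ (mem_sphere_zero_iff_norm.2 hξ)
    have ha1 := mem_sphere_zero_iff_norm.1 ha
    have hsub : ∀ w ∈ petal L c ξ, w ∈ ball a (ρ a) := fun w hw =>
      hball (mem_ball_iff_norm.2 (hw.1.trans_le (min_le_left _ _)))
    refine ⟨V a, (hV a ha1).mono fun w hw => ⟨hsub w hw, ?_⟩, fun w hw => hVu a ha1 w (hsub w hw)⟩
    rintro ⟨haL, hwr⟩
    exact disjoint_ray_of_petal hc2 haL hξ ha1 hw hwr
  choose! W hW hWu using hpet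
  have hid : ∀ X : Set ℂ, AnalyticOnNhd ℂ id X := fun _ _ _ => analyticAt_id
  -- two extensions to a convex open set agree if they agree inside the disk
  have hagree : ∀ (X : Set ℂ), IsOpen X → Convex ℝ X → ∀ V1 V2 : ℂ → S, Q.ProjOn id V1 X →
      Q.ProjOn id V2 X → (∀ w ∈ X, ‖w‖ < 1 → V1 w = extend u.1 w) →
      (∀ w ∈ X, ‖w‖ < 1 → V2 w = extend u.1 w) → ∀ v ∈ X, ‖v‖ ≤ 1 → Set.EqOn V1 V2 X := by
    intro X hXo hXc V1 V2 h1 h2 h3 h4 v hv hv1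
    obtain ⟨s, hsX, hs1⟩ := exists_norm_lt_one_mem hXo hv1 hv
    refine (h1.holOn (hid X)).eqOn (h2.holOn (hid X)) hXc.isPreconnected hsX ?_
    filter_upwards [hXo.mem_nhds hsX, isOpen_ball.mem_nhds (mem_ball_zero_iff.2 hs1)] with w hw hw1
    rw [h3 w hw (mem_ball_zero_iff.1 hw1), h4 w hw (mem_ball_zero_iff.1 hw1)]
  have hnorm : ∀ {w : ℂ}, 1 ≤ ‖w‖ → ‖w / ‖w‖‖ ≤ 1 := by
    intro w hw
    rw [norm_div, norm_real, norm_norm, div_self (by linarith)]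
  classical
  set Vt : ℂ → S := fun w => if ‖w‖ < 1 then extend u.1 w else
    if h : ∃ ξ, ‖ξ‖ = 1 ∧ w ∈ petal L c ξ then W h.choose w else extend u.1 0 with hVt
  have hVtu : ∀ w : ℂ, ‖w‖ < 1 → Vt w = extend u.1 w := fun w hw => by simp only [hVt]; rw [if_pos hw]
  have hVtW : ∀ ξ : ℂ, ‖ξ‖ = 1 → ∀ w ∈ petal L c ξ, Vt w = W ξ w := fun ξ hξ w hw => by
    by_cases hw1 : ‖w‖ < 1
    · rw [hVtu w hw1, hWu ξ hξ w hw hw1]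
    · have hex : ∃ ξ, ‖ξ‖ = 1 ∧ w ∈ petal L c ξ := ⟨ξ, hξ, hw⟩
      have h1 : Vt w = W hex.choose w := by simp only [hVt]; rw [if_neg hw1, dif_pos hex]
      obtain ⟨h2, h3⟩ := hex.choose_spec
      rw [h1]
      refine hagree (petal L c hex.choose ∩ petal L c ξ)
        ((isOpen_petal hfin _ _).inter (isOpen_petal hfin _ _))
        ((convex_petal _ _ _).inter (convex_petal _ _ _)) _ _
        ((hW _ h2).mono Set.inter_subset_left) ((hW _ hξ).mono Set.inter_subset_right)
        (fun w hw => hWu _ h2 w hw.1) (fun w hw => hWu _ hξ w hw.2) (w / ‖w‖) ?_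
        (hnorm (not_lt.1 hw1)) ⟨h3, hw⟩
      exact ⟨radial_mem_petal h2 (not_lt.1 hw1) h3, radial_mem_petal hξ (not_lt.1 hw1) hw⟩
  refine ⟨hfin, c, hc0, hc2, Vt, ?_, hVtu, ?_⟩
  · rintro w (hw | ⟨ξ, hξ, hw⟩)
    · refine ((DiskMap.projOn u).congr fun s hs => ?_) w (mem_ball_zero_iff.2 hw)
      filter_upwards [isOpen_ball.mem_nhds hs] with s' hs'
      exact (hVtu s' (mem_ball_zero_iff.1 hs')).symm
    · refine ((hW ξ hξ).congr fun s hs => ?_) w hw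
      filter_upwards [(isOpen_petal hfin c ξ).mem_nhds hs] with s' hs'
      exact (hVtW ξ hξ s' hs').symm
  · intro a ha p hp hap
    have haL : a ∈ L := ⟨ha, p, hp, hap⟩
    have key : ∀ w ∈ collar L c, w ∈ ball a (ρ a / 4) → w ∉ ray a ∧ Vt w = V a w := by
      rintro w (hw | ⟨ξ, hξ, hw⟩) hwa
      · exact ⟨notMem_ray ha hw, by
          rw [hVtu w hw, hVu a ha w (ball_subset_ball (by linarith [hρ a ha]) hwa) hw]⟩
      · refine ⟨disjoint_ray_of_petal hc2 haL hξ ha hw, ?_⟩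
        rw [mem_ball_iff_norm] at hwa
        have h1 : ∀ w' ∈ petal L c ξ, ‖w' - ξ‖ ≤ ‖ξ - a‖ / 2 := fun w' hw' => by
          have := hw'.2 a haL
          nlinarith [norm_nonneg (ξ - a)]
        have h2 : ‖ξ - a‖ ≤ ‖w - ξ‖ + ‖w - a‖ := by
          have := norm_sub_le (w - a) (w - ξ)
          rw [sub_sub_sub_cancel_left] at this
          linarith
        have h3 : ‖ξ - a‖ ≤ 2 * ‖w - a‖ := by linarith [h1 w hw]
        have hXa : ∀ w' ∈ petal L c ξ, w' ∈ ball a (ρ a) := fun w' hw' => by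
          rw [mem_ball_iff_norm]
          have h4 := norm_add_le (w' - ξ) (ξ - a)
          rw [sub_add_sub_cancel] at h4
          have h5 := hw'.2 a haL
          have h6 := hw.2 a haL
          have h7 : ‖w' - a‖ < (3 / 2) * ‖ξ - a‖ := by nlinarith [norm_nonneg (ξ - a)]
          have h8 := hρ a ha
          linarith
        rw [hVtW ξ hξ w hw]
        by_cases hw1 : ‖w‖ < 1
        · rw [hWu ξ hξ w hw hw1, hVu a ha w (hXa w hw) hw1]
        · refine hagree (petal L c ξ) (isOpen_petal hfin _ _) (convex_petal _ _ _) _ _ (hW ξ hξ)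
            ((hV a ha).mono fun w' hw' => ⟨hXa w' hw', fun h =>
              disjoint_ray_of_petal hc2 haL hξ ha hw' h.2⟩) (hWu ξ hξ)
            (fun w' hw' => hVu a ha w' (hXa w' hw')) (w / ‖w‖)
            (radial_mem_petal hξ (not_lt.1 hw1) hw) (hnorm (not_lt.1 hw1)) hw
    have hb : ∀ᶠ w in 𝓝[collar L c] a, w ∈ collar L c ∧ w ∈ ball a (ρ a / 4) := by
      refine Eventually.and self_mem_nhdsWithin ?_
      exact nhdsWithin_le_nhds (ball_mem_nhds _ (by linarith [hρ a ha]))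
    have ht : Tendsto (fun w => w) (𝓝[collar L c] a) (𝓝[(ray a)ᶜ] a) := by
      rw [tendsto_nhdsWithin_iff]
      refine ⟨tendsto_id.mono_left nhdsWithin_le_nhds, ?_⟩
      filter_upwards [hb] with w hw using (key w hw.1 hw.2).1
    refine ((hVl a ha p hp hap).comp ht).congr' ?_
    filter_upwards [hb] with w hw using (key w hw.1 hw.2).2.symm

/-! ### Maximal disks -/

/-- The Schwarz–Pick lemma. -/
lemma exists_eq_mob_map_zero {F : ℂ → ℂ} (hF : DifferentiableOn ℂ F 𝔹)
    (hm : Set.MapsTo F 𝔹 𝔹) {w : ℂ} (hw : ‖w‖ < 1) :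
    ∃ y : ℂ, ‖y‖ ≤ ‖w‖ ∧ F w = mob 1 (F 0) y := by
  have h0 : ‖F 0‖ < 1 := mem_ball_zero_iff.1 (hm (by simp))
  have h1 : ‖(1 : ℂ)‖ = 1 := norm_one
  have h0' : ‖-F 0‖ < 1 := by rwa [norm_neg]
  set G : ℂ → ℂ := fun w => mob 1 (-F 0) (F w) with hG
  have hGm : Set.MapsTo G 𝔹 𝔹 := fun z hz =>
    mem_ball_zero_iff.2 (norm_mob_lt_one h1 h0' (mem_ball_zero_iff.1 (hm hz)))
  have hGd : DifferentiableOn ℂ G 𝔹 := fun z hz =>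
    ((analyticAt_mob h1 h0' (mem_ball_zero_iff.1 (hm hz)).le).differentiableAt.comp_differentiableWithinAt
      z (hF z hz))
  have hG0 : G 0 = 0 := by simp [hG, mob]
  refine ⟨G w, Complex.norm_le_norm_of_mapsTo_ball hGd (by
    simpa only [hG0] using hGm.mono_right ball_subset_closedBall) hG0 hw, ?_⟩
  have := mob_inv h1 h0' (w := F w) (mem_ball_zero_iff.1 (hm (mem_ball_zero_iff.2 hw))).le
  grind

/-- The Schwarz–Pick inequality, in a form which shows that `F w - F 0` is small if `F 0` is near
the unit circle. -/
lemma norm_sub_map_zero_le {F : ℂ → ℂ} (hF : DifferentiableOn ℂ F 𝔹)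
    (hm : Set.MapsTo F 𝔹 𝔹) {w : ℂ} (hw : ‖w‖ < 1) :
    ‖F w - F 0‖ ≤ (1 - ‖F 0‖ ^ 2) * ‖w‖ / (1 - ‖w‖) := by
  have h0 : ‖F 0‖ < 1 := mem_ball_zero_iff.1 (hm (by simp))
  have h1 : ‖(1 : ℂ)‖ = 1 := norm_one
  obtain ⟨y, hGw, hFy⟩ := exists_eq_mob_map_zero hF hm hw
  have hGw1 : ‖y‖ < 1 := hGw.trans_lt hw
  have h2 : F w - F 0 = (1 - conj (F 0) * F 0) * y / (1 + conj (F 0) * y) := by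
    have h3 := mob_sub_mob h1 h0 (z := y) (w := 0) hGw1.le (by simp)
    rw [← hFy, mob_zero] at h3
    grind
  have h4 : ‖(1 - conj (F 0) * F 0)‖ = 1 - ‖F 0‖ ^ 2 := by
    rw [← normSq_eq_conj_mul_self, normSq_eq_norm_sq, ← ofReal_one,
      ← ofReal_sub, norm_real, norm_of_nonneg]
    nlinarith [norm_nonneg (F 0)]
  have h5 : 1 - ‖w‖ ≤ ‖1 + conj (F 0) * y‖ := by
    have h6 := norm_sub_norm_le (1 : ℂ) (-(conj (F 0) * y))
    rw [norm_neg, norm_one, sub_neg_eq_add, norm_mul, RCLike.norm_conj] at h6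
    have : ‖F 0‖ * ‖y‖ ≤ 1 * ‖w‖ := mul_le_mul h0.le hGw (norm_nonneg _) zero_le_one
    linarith
  rw [h2, norm_div, norm_mul, h4]
  have h7 : 0 ≤ 1 - ‖F 0‖ ^ 2 := by nlinarith [norm_nonneg (F 0)]
  have h8 : 0 < 1 - ‖w‖ := by linarith
  gcongr

lemma tendsto_of_tendsto_map_zero {X : Type*} {l : Filter X} {F : X → ℂ → ℂ}
    (hF : ∀ n, DifferentiableOn ℂ (F n) 𝔹)
    (hm : ∀ n, Set.MapsTo (F n) 𝔹 𝔹) {ζ : ℂ} (hζ : ‖ζ‖ = 1)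
    (h : Tendsto (fun n => F n 0) l (𝓝 ζ)) {w : ℂ} (hw : ‖w‖ < 1) :
    Tendsto (fun n => F n w) l (𝓝[𝔹] ζ) := by
  rw [tendsto_nhdsWithin_iff]
  refine ⟨?_, Eventually.of_forall fun n => hm n (mem_ball_zero_iff.2 hw)⟩
  have h1 : Tendsto (fun n => (1 - ‖F n 0‖ ^ 2) * ‖w‖ / (1 - ‖w‖)) l (𝓝 0) := by
    have := ((((h.norm).pow 2).const_sub 1).mul_const ‖w‖).div_const (1 - ‖w‖)
    grind
  have h2 : Tendsto (fun n => F n w - F n 0) l (𝓝 0) :=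
    squeeze_zero_norm (fun n => norm_sub_map_zero_le (hF n) (hm n) hw) h1
  simpa using h2.add h

/-- A self-map of the disk that preserves the map `u` has finite order: otherwise an orbit either
accumulates in the disk, where `u` is locally injective, or the iterates tend to a constant on
the boundary, and `u` is constant. -/
lemma exists_iterate_eq_id [T2Space S] {u : Q.DiskMap} (hext : Q.ExtendsToClosedDisk u)
    {h : ℂ → ℂ} (hd : DifferentiableOn ℂ h 𝔹)
    (hm : Set.MapsTo h 𝔹 𝔹)
    (hu : ∀ w : ℂ, ‖w‖ < 1 → extend u.1 (h w) = extend u.1 w) :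
    ∃ k, 1 ≤ k ∧ ∀ w : ℂ, ‖w‖ < 1 → h^[k] w = w := by
  have hdn : ∀ n, DifferentiableOn ℂ (h^[n]) 𝔹 := fun n => by fun_prop
  have hun : ∀ n, ∀ w : ℂ, ‖w‖ < 1 → extend u.1 (h^[n] w) = extend u.1 w := fun n w hw => by
    induction n with
    | zero => rfl
    | succ n ih => rw [Function.iterate_succ_apply', hu _ (mem_ball_zero_iff.1
        (hm.iterate n (mem_ball_zero_iff.2 hw))), ih]
  have h00 : (0 : ℂ) ∈ 𝔹 := by simp
  obtain ⟨ζ, hζ, φ, hφ, hlim⟩ := (isCompact_closedBall (0 : ℂ) 1).tendsto_subseq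
    (x := fun n => h^[n] 0) fun n => ball_subset_closedBall (hm.iterate n h00)
  rw [mem_closedBall_zero_iff] at hζ
  rcases hζ.lt_or_eq with hζ1 | hζ1
  · obtain ⟨N, hN, hinj⟩ := (DiskMap.projOn u).eventually_ne (mem_ball_zero_iff.2 hζ1)
    obtain ⟨n, hn⟩ := eventually_atTop.1 (hlim.eventually hN)
    have h1 : h^[φ n] 0 = h^[φ (n + 1)] 0 := by
      refine hinj _ (hn n le_rfl) _ (hn (n + 1) (by omega)) ?_
      simp [*]
    have h2 : φ n < φ (n + 1) := hφ (by omega)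
    set y := h^[φ n] 0 with hy
    have hyb : y ∈ 𝔹 := hm.iterate _ h00
    refine ⟨φ (n + 1) - φ n, by omega, ?_⟩
    set k := φ (n + 1) - φ n with hk
    have hfix : h^[k] y = y := by
      rw [hy, ← Function.iterate_add_apply, hk, Nat.sub_add_cancel h2.le, ← h1]
    obtain ⟨N', hN', hinj'⟩ := (DiskMap.projOn u).eventually_ne hyb
    have hcont : ContinuousAt (h^[k]) y :=
      ((hdn k).differentiableAt (isOpen_ball.mem_nhds hyb)).continuousAt
    have hev : h^[k] =ᶠ[𝓝 y] id := by
      have h3 : ∀ᶠ w in 𝓝 y, h^[k] w ∈ N' := hcont (by rw [hfix]; exact hN')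
      filter_upwards [h3, hN', isOpen_ball.mem_nhds hyb] with w h4 h5 h6
      exact hinj' _ h4 _ h5 (hun k w (mem_ball_zero_iff.1 h6))
    intro w hw
    exact ((hdn k).analyticOnNhd isOpen_ball).eqOn_of_preconnected_of_eventuallyEq
      (fun _ _ => analyticAt_id) (convex_ball _ _).isPreconnected hyb hev (mem_ball_zero_iff.2 hw)
  · obtain ⟨x, hx⟩ := exists_leansAt_of_extends hext hζ
    refine (not_const_diskMap u (x := x) fun w hw => ?_).elim
    have h1 := tendsto_of_tendsto_map_zero (F := fun n => h^[φ n]) (l := atTop)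
      (fun n => hdn _) (fun n => hm.iterate _) hζ1 hlim hw
    have h2 := Tendsto.comp hx h1
    refine tendsto_nhds_unique (tendsto_const_nhds.congr fun n => ?_) h2
    exact (hun _ w hw).symm

/-- A collar extension of a disk. -/
structure Collar (u : Q.DiskMap) where
  c : ℝ
  V : ℂ → S
  finite : (leanSet u).Finite
  c_pos : 0 < c
  c_le : c ≤ 1 / 2
  proj : Q.ProjOn id V (collar (leanSet u) c)
  eq : ∀ w : ℂ, ‖w‖ < 1 → V w = extend u.1 w
  tendsto : ∀ a : ℂ, ‖a‖ = 1 → ∀ p ∈ P, LeansAt u a p → Tendsto V (𝓝[collar (leanSet u) c] a) (𝓝 p)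

lemma exists_collar [T2Space S] [IsManifold 𝓘(ℂ) ω S]
    (hcusp : ∀ p ∈ P, Nonempty (CuspModel Q p)) {u : Q.DiskMap} (hext : Q.ExtendsToClosedDisk u) :
    Nonempty (Collar u) := by
  obtain ⟨h1, c, h2, h3, V, h4, h5, h6⟩ := exists_collar_extension hcusp hext
  exact ⟨⟨c, V, h1, h2, h3, h4, h5, h6⟩⟩

/-- The disk is maximal. -/
def IsMaximal (u : Q.DiskMap) : Prop := ∀ y : Q.Disk, Q.toDisk u ≤ y → y = Q.toDisk u

/-- If a disk leans on the punctures at most at the point `a`, then it is contained in a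
larger disk which is tangent to the unit circle at `a`. -/
lemma Collar.two_le_encard [T2Space S] {u : Q.DiskMap} (C : Collar u)
    (hext : Q.ExtendsToClosedDisk u) (hmax : IsMaximal u) : 2 ≤ (Q.leanPoints u).encard := by
  by_contra hcon
  have hle : (Q.leanPoints u).encard ≤ 1 := by simp_all
  obtain ⟨a, ha, hLa⟩ : ∃ a : ℂ, ‖a‖ = 1 ∧ leanSet u ⊆ {a} := by
    rw [leanSet_eq]
    rcases Set.encard_le_one_iff_eq.1 hle with h | ⟨ζ, h⟩
    · exact ⟨1, by simp, by simp [h]⟩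
    · exact ⟨ζ, ζ.norm_coe, by simp [h]⟩
  set ε := C.c / 8 with hε
  have hε0 : 0 < ε := by have := C.c_pos; positivity
  have hεc : (1 + ε : ℂ) ≠ 0 := by
    have : (1 + ε : ℝ) ≠ 0 := by positivity
    exact_mod_cast this
  have hεn : ‖(1 + ε : ℂ)‖ = 1 + ε := by
    rw [← ofReal_one, ← Complex.ofReal_add, norm_real, norm_of_nonneg (by positivity)]
  set k : ℂ → ℂ := fun w => a + (1 + ε) * (w - a) with hk
  set f : ℂ → ℂ := fun w => (w + ε * a) / (1 + ε) with hf
  have hkf : ∀ w, k (f w) = w := by intro w; simp only [hk, hf]; field_simp; ring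
  have hfn : ∀ w : ℂ, ‖w‖ < 1 → ‖f w‖ < 1 := fun w hw => by
    simp only [hf]
    rw [norm_div, hεn, div_lt_one (by positivity)]
    refine (norm_add_le _ _).trans_lt ?_
    rw [norm_mul, ha, norm_real, norm_of_nonneg hε0.le]
    linarith
  have hkcol : ∀ w : ℂ, ‖w‖ < 1 → k w ∈ collar (leanSet u) C.c := fun w hw => by
    by_cases hw1 : ‖k w‖ < 1
    · exact Or.inl hw1
    rw [not_lt] at hw1
    set r := ‖k w‖ with hr
    have hr0 : 0 < r := by linarith
    set ξ := k w / (r : ℂ) with hξ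
    have hrc : (r : ℂ) ≠ 0 := by exact_mod_cast hr0.ne'
    have hξ1 : ‖ξ‖ = 1 := by
      rw [hξ, norm_div, norm_real, norm_of_nonneg hr0.le, ← hr, div_self hr0.ne']
    have hkξ : k w = (r : ℝ) • ξ := by rw [real_smul, hξ]; field_simp
    have h1 : ‖k w - ξ‖ = r - 1 := by
      rw [hkξ, show r • ξ - ξ = (r - 1) • ξ by rw [sub_smul, one_smul], norm_smul, hξ1, mul_one,
        norm_of_nonneg (by linarith)]
    -- the circle through `a` bounding the larger disk is close to the unit circle near `a`
    have h2 : ‖r • ξ + ε • a‖ < 1 + ε := by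
      have h3 : r • ξ + ε • a = (1 + ε) * w := by rw [← hkξ, real_smul]; simp only [hk]; ring
      rw [h3, norm_mul, hεn]
      nlinarith
    have h4 : ‖r • ξ + ε • a‖ ^ 2 = r ^ 2 + 2 * (r * ε * inner ℝ ξ a) + ε ^ 2 := by
      rw [norm_add_sq_real, norm_smul, norm_smul, hξ1, ha, real_inner_smul_left,
        real_inner_smul_right, norm_of_nonneg hr0.le, norm_of_nonneg hε0.le]
      ring
    have h5 : ‖ξ - a‖ ^ 2 = 2 - 2 * inner ℝ ξ a := by rw [norm_sub_sq_real, hξ1, ha]; ring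
    have h6 : ‖ξ - a‖ ≤ 2 := by
      refine (norm_sub_le _ _).trans ?_
      rw [hξ1, ha]; norm_num
    have h7 : ‖r • ξ + ε • a‖ ^ 2 < (1 + ε) ^ 2 := by nlinarith [norm_nonneg (r • ξ + ε • a)]
    have h8 : (r - 1) * (r + 1) < ε * r * ‖ξ - a‖ ^ 2 := by rw [h5]; nlinarith
    have h9 : r - 1 < ε * ‖ξ - a‖ ^ 2 := by
      by_contra hc
      rw [not_lt] at hc
      have : ε * ‖ξ - a‖ ^ 2 * (r + 1) ≤ (r - 1) * (r + 1) := by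
        apply mul_le_mul_of_nonneg_right hc; linarith
      nlinarith [mul_nonneg hε0.le (sq_nonneg ‖ξ - a‖)]
    have h10 : 0 < ‖ξ - a‖ := by
      rcases (norm_nonneg (ξ - a)).eq_or_lt with h | h
      · rw [← h] at h9; nlinarith
      · exact h
    have h11 : r - 1 < C.c * ‖ξ - a‖ := by
      rw [show C.c = 8 * ε by rw [hε]; ring]
      nlinarith [mul_pos hε0 h10]
    refine Or.inr ⟨ξ, hξ1, ?_, ?_⟩
    · rw [h1, show C.c = 8 * ε by rw [hε]; ring]
      nlinarith [mul_pos hε0 h10]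
    · intro b hb
      rw [Set.mem_singleton_iff.1 (hLa hb), h1]
      exact h11
  have hv : Q.ProjOn id (fun w => C.V (k w)) 𝔹 := by
    have h1 := C.proj.comp (g := k) (W' := 𝔹)
      (fun w _ => by simp only [hk]; fun_prop) fun w hw => hkcol w (mem_ball_zero_iff.1 hw)
    refine h1.change fun w hw => ⟨mkGL (1 + ε) (a - (1 + ε) * a) 0 1 (by simpa using hεc),
      Eventually.of_forall fun w' => ?_⟩
    rw [moebiusRel_mkGL]
    refine ⟨by simp, ?_⟩
    simp only [hk, id]; ring
  set v := Q.diskMap (fun w => C.V (k w)) hv with hvdef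
  have huv : ∀ w : ℂ, ‖w‖ < 1 → extend u.1 w = extend v.1 (f w) := fun w hw => by
    rw [hvdef, extend_diskMap _ (hfn w hw), hkf, C.eq w hw]
  have hle' : Q.toDisk u ≤ Q.toDisk v := by
    refine ⟨u, v, rfl, rfl, fun w => .mk (f w) (hfn w w.norm_lt_one), ?_, fun w => ?_⟩
    · refine ⟨mkGL 1 (ε * a) 0 (1 + ε) (by simpa using hεc), fun w => ?_⟩
      rw [moebiusRel_mkGL]
      refine ⟨by simpa using hεc, ?_⟩
      simp [hf]
    · rw [← extend_coe, huv w w.norm_lt_one, ← extend_coe]; rfl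
  obtain ⟨l, q, hl, hq, hvu⟩ := exists_eq_mob_of_toDisk_eq (hmax _ hle')
  obtain ⟨n, hn, hid⟩ := exists_iterate_eq_id hext (h := fun w => mob l q (f w)) (by
      intro w hw
      have h1 := (analyticAt_mob hl hq (hfn w (mem_ball_zero_iff.1 hw)).le).differentiableAt
      refine (DifferentiableAt.comp (f := f) w h1 ?_).differentiableWithinAt
      simp only [hf]; fun_prop)
    (fun w hw => mem_ball_zero_iff.2 (norm_mob_lt_one hl hq (hfn w (mem_ball_zero_iff.1 hw))))
    (fun w hw => by
      have h1 := huv w hw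
      rw [hvu, extend_mob _ _ _ (hfn w hw)] at h1
      exact h1.symm)
  -- an iterate of a map that is not surjective is not the identity
  set y : ℂ := -a / (1 + ε) with hy
  have hyn : ‖y‖ < 1 := by
    rw [hy, norm_div, norm_neg, ha, hεn, div_lt_one (by positivity)]; linarith
  have hmaps : Set.MapsTo (fun w => mob l q (f w)) 𝔹 𝔹 :=
    fun w hw => mem_ball_zero_iff.2 (norm_mob_lt_one hl hq (hfn w (mem_ball_zero_iff.1 hw)))
  obtain ⟨m, rfl⟩ : ∃ m, n = m + 1 := ⟨n - 1, by omega⟩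
  have h1 := hid (mob l q y) (norm_mob_lt_one hl hq hyn)
  rw [Function.iterate_succ_apply'] at h1
  set z := (fun w => mob l q (f w))^[m] (mob l q y) with hz
  have hzn : ‖z‖ < 1 := mem_ball_zero_iff.1
    (hmaps.iterate m (mem_ball_zero_iff.2 (norm_mob_lt_one hl hq hyn)))
  have h2 : f z = y := by rw [← mob_inv hl hq (hfn z hzn).le, h1, mob_inv hl hq hyn.le]
  have h3 : z = -(1 + ε) * a := by
    have := hkf z
    rw [h2] at this
    rw [← this, hk, hy]; simp only; field_simp; ring
  rw [h3, norm_mul, norm_neg, hεn, ha] at hzn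
  linarith

/-- A criterion for maximality: whenever the map factors through another one by a Möbius function,
the latter maps `1` and `-1` to the unit circle. -/
lemma isMaximal_of_herm {u : Q.DiskMap} (h : ∀ (v : Q.DiskMap) (B : GL (Fin 2) ℂ),
    (∀ w : ℂ, ‖w‖ < 1 → 0 < herm B w) →
    (∀ w : ℂ, ‖w‖ < 1 → ∃ y : ℂ, MoebiusRel B w y ∧ extend u.1 w = extend v.1 y) →
    herm B 1 = 0 ∧ herm B (-1) = 0) : IsMaximal u := by
  rintro y ⟨u0, v, hu0, rfl, f, ⟨A, hA⟩, hf⟩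
  obtain ⟨l', q', hl', hq', hu'⟩ := exists_eq_mob_of_toDisk_eq hu0.symm
  set B := A * mobGL hl' hq' with hB
  have hfB : ∀ w : 𝔻, MoebiusRel B w (f (mobEquiv hl' hq' w)) := fun w =>
    (moebiusRel_mob hl' hq' w.norm_lt_one.le).comp (hA (mobEquiv hl' hq' w))
  have huv : ∀ w : 𝔻, u.1 w = v.1 (f (mobEquiv hl' hq' w)) := fun w => by
    rw [hu', mob_apply]
    exact hf _
  have hpos : ∀ w : ℂ, ‖w‖ < 1 → 0 < herm B w := fun w hw =>
    (herm_pos_iff (hfB (.mk w hw))).2 (f _).norm_lt_one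
  obtain ⟨hb1, hb2⟩ := h v B hpos fun w hw => ⟨_, hfB (.mk w hw), by
    rw [extend_of_lt _ hw, huv, extend_coe]⟩
  obtain ⟨l1, q1, hl₁, hq₁, h₁⟩ := exists_mob_of_two_points hpos hb1 hb2
  have h2 : u = v.mob hl₁ hq₁ := by
    refine DiskMap.ext_of_extend fun w hw => ?_
    have h3 := h₁ _ _ (hfB (.mk w hw))
    rw [Complex.UnitDisc.coe_mk] at h3
    rw [extend_mob v hl₁ hq₁ hw, ← h3, extend_coe, extend_of_lt _ hw, huv]
  rw [← toDisk_mob v hl₁ hq₁, ← h2]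

/-- A disk that leans on the punctures at two points is maximal. -/
lemma isMaximal_of_two_le [T2Space S] {u : Q.DiskMap} (h : 2 ≤ (Q.leanPoints u).encard) :
    IsMaximal u := by
  have h : 1 < (Q.leanPoints u).encard := lt_of_lt_of_le (by norm_num) h
  rw [Set.one_lt_encard_iff] at h
  obtain ⟨a, b, ha, hb, hab⟩ := h
  -- after composition with an automorphism the disk leans on the punctures at `1` and `-1`
  obtain ⟨l, q, hl, hq, hlq1, hlq2⟩ := exists_mob_pair a.norm_coe b.norm_coe
    (fun h => hab (Circle.ext h))
  suffices hmax : IsMaximal (u.mob hl hq) by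
    intro y hy
    rw [← toDisk_mob u hl hq] at hy ⊢
    exact hmax y hy
  set u' := u.mob hl hq
  refine isMaximal_of_herm fun v B hpos huv => ?_
  have hbd : ∀ ζ : ℂ, ‖ζ‖ = 1 → (∃ p ∈ P, LeansAt u' ζ p) → herm B ζ = 0 := by
    rintro ζ hζ ⟨p, hp, hζp⟩
    have hnb := neBot_nhdsWithin_ball hζ.le
    have hnn : 0 ≤ herm B ζ := by
      refine ge_of_tendsto (((continuous_herm B).tendsto ζ).mono_left
        (nhdsWithin_le_nhds (s := 𝔹))) ?_
      filter_upwards [self_mem_nhdsWithin] with w hw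
      exact (hpos w (mem_ball_zero_iff.1 hw)).le
    by_contra hne
    have h1 := lt_of_le_of_ne hnn (Ne.symm hne)
    have h2 := moebiusRel_of_herm_pos h1
    have h3 := (herm_pos_iff h2).1 h1
    set F : ℂ → ℂ := fun w => (B 0 0 * w + B 0 1) / (B 1 0 * w + B 1 1) with hF
    have hFc : ContinuousAt F ζ := by
      have := h2.1
      fun_prop
    have hFv : ContinuousAt (fun w => extend v.1 (F w)) ζ :=
      ContinuousAt.comp' (f := F) (continuousAt_extend v.1 h3) hFc
    refine hζp.not_of_curve hp (F := 𝓝[𝔹] ζ) (γ := fun w => w) tendsto_id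
      ((DiskMap.projOn v).notMem (mem_ball_zero_iff.2 h3))
      ((hFv.tendsto.mono_left nhdsWithin_le_nhds).congr' ?_)
    filter_upwards [self_mem_nhdsWithin] with w hw
    obtain ⟨y, h4, h5⟩ := huv w (mem_ball_zero_iff.1 hw)
    rw [h5, h4.2]
  refine ⟨hbd 1 (by simp) ?_, hbd (-1) (by simp) ?_⟩
  · obtain ⟨p, hp, h⟩ := mem_leanPoints_iff.1 ha
    exact ⟨p, hp, LeansAt.mob hl hq (by simp) (by rwa [hlq1])⟩
  · obtain ⟨p, hp, h⟩ := mem_leanPoints_iff.1 hb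
    exact ⟨p, hp, LeansAt.mob hl hq (by simp) (by rwa [hlq2])⟩

/-! ### Automorphisms that fix a disk -/

/-- The action of an automorphism of the disk with a fixed point `z` on the unit circle is affine
in the coordinate `1 / (w - z)`, with a positive factor. -/
lemma exists_affine_of_mob_fixed {l q z : ℂ} (hl : ‖l‖ = 1) (hq : ‖q‖ < 1) (hz : ‖z‖ = 1)
    (h : mob l q z = z) (hq0 : q ≠ 0) : ∃ μ : ℝ, 0 < μ ∧ ∃ β : ℂ, β ≠ 0 ∧
      ∀ w : ℂ, ‖w‖ < 1 → 1 / (mob l q w - z) = μ * (1 / (w - z)) + β := by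
  have hl0 : l ≠ 0 := norm_ne_zero_iff.1 (by rw [hl]; norm_num)
  have hz0 : z ≠ 0 := norm_ne_zero_iff.1 (by rw [hz]; norm_num)
  have hD := mob_denom_ne_zero hl hq hz.le
  set D := 1 + conj q * l * z with hDdef
  have h1 : l * z + q = z * D := by
    have := h; rw [mob, div_eq_iff hD] at this; exact this
  have hcl := conj_mul_self_of_norm hl
  have hcz := conj_mul_self_of_norm hz
  have h2 : l * conj D = D := by
    have h3 : conj D * (l * z) = D * z := by
      rw [hDdef] at h1 ⊢
      simp only [map_add, map_one, map_mul, conj_conj]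
      grind
    grind
  have hqq : (1 - conj q * q : ℂ) = ((1 - ‖q‖ ^ 2 : ℝ) : ℂ) := by
    rw [← normSq_eq_conj_mul_self, normSq_eq_norm_sq]; push_cast; ring
  have hq1 := one_sub_conj_mul_ne_zero hq
  have hpos : 0 < 1 - ‖q‖ ^ 2 := by nlinarith [norm_nonneg q]
  refine ⟨‖D‖ ^ 2 / (1 - ‖q‖ ^ 2), div_pos (by positivity) hpos, conj q * D / (1 - conj q * q),
    div_ne_zero (mul_ne_zero (by simpa using hq0) hD) hq1, fun w hw => ?_⟩
  have hwz : w - z ≠ 0 := by grind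
  have hDw := mob_denom_ne_zero hl hq hw.le
  have h4 := mob_sub_mob hl hq hw.le hz.le
  rw [h] at h4
  rw [h4, one_div_div]
  have h5 : ((‖D‖ ^ 2 / (1 - ‖q‖ ^ 2) : ℝ) : ℂ) = D * conj D / (1 - conj q * q) := by
    rw [hqq, ofReal_div, mul_conj, normSq_eq_norm_sq]
  rw [h5, ← hDdef]
  have h6 : (1 + conj q * l * w) * D / (l * (1 - conj q * q) * (w - z))
      = (D * conj D + conj q * D * (w - z)) / ((1 - conj q * q) * (w - z)) := by
    rw [div_eq_div_iff (by positivity) (by positivity)]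
    linear_combination (norm := skip) (-(1 - conj q * q) * (w - z) * D) * h2
    rw [hDdef]; ring
  rw [h6]
  field_simp

lemma exists_mob_fixed {l q : ℂ} (hl : ‖l‖ = 1) (hq : ‖q‖ < 1) :
    ∃ z : ℂ, ‖z‖ ≤ 1 ∧ mob l q z = z := by
  by_cases hq0 : q = 0
  · exact ⟨0, by simp, by rw [mob_zero, hq0]⟩
  have hl0 : l ≠ 0 := norm_ne_zero_iff.1 (by rw [hl]; norm_num)
  have hcq : conj q ≠ 0 := by simpa using hq0
  obtain ⟨r, hr⟩ := IsAlgClosed.exists_pow_nat_eq (discrim (conj q * l) (1 - l) (-q)) two_pos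
  have hroot := (quadratic_eq_zero_iff (mul_ne_zero hcq hl0) (by rw [← hr, sq]) _).2
    (Or.inl (rfl : (-(1 - l) + r) / (2 * (conj q * l)) = _))
  set z := (-(1 - l) + r) / (2 * (conj q * l))
  have key : ∀ z : ℂ, ‖z‖ ≤ 1 → conj q * l * (z * z) + (1 - l) * z + -q = 0 → mob l q z = z := by
    intro z hz h
    rw [mob, div_eq_iff (mob_denom_ne_zero hl hq hz)]
    grind
  rcases le_or_gt ‖z‖ 1 with h | h
  · grind
  have hz0 : z ≠ 0 := norm_pos_iff.1 (one_pos.trans h)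
  have hn : ‖-q / (conj q * l * z)‖ ≤ 1 := by
    rw [norm_div, norm_mul, norm_mul, norm_neg, RCLike.norm_conj, hl, mul_one]
    have := norm_pos_iff.2 hq0
    rw [div_le_one (by positivity)]
    nlinarith
  refine ⟨_, hn, key _ hn ?_⟩
  field_simp
  grind

/-- The map of a disk is not invariant under any automorphism: by `exists_iterate_eq_id` such an
automorphism is elliptic, and at its fixed point the map is locally injective. -/
lemma mob_eq_id_of_invariant [T2Space S] {u : Q.DiskMap} (hext : Q.ExtendsToClosedDisk u)
    {l q : ℂ} (hl : ‖l‖ = 1) (hq : ‖q‖ < 1)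
    (h : ∀ w : ℂ, ‖w‖ < 1 → extend u.1 (mob l q w) = extend u.1 w) : l = 1 ∧ q = 0 := by
  have hm : Set.MapsTo (mob l q) 𝔹 𝔹 := fun w hw =>
    mem_ball_zero_iff.2 (norm_mob_lt_one hl hq (mem_ball_zero_iff.1 hw))
  have han : AnalyticOnNhd ℂ (mob l q) 𝔹 := fun w hw =>
    analyticAt_mob hl hq (mem_ball_zero_iff.1 hw).le
  obtain ⟨z, hz, hfix⟩ := exists_mob_fixed hl hq
  rcases hz.lt_or_eq with hz1 | hz1
  · have hzb : z ∈ 𝔹 := mem_ball_zero_iff.2 hz1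
    obtain ⟨N, hN, hinj⟩ := (DiskMap.projOn u).eventually_ne hzb
    have hev : mob l q =ᶠ[𝓝 z] id := by
      have h3 : ∀ᶠ w in 𝓝 z, mob l q w ∈ N :=
        (han z hzb).continuousAt (by rw [hfix]; exact hN)
      filter_upwards [h3, hN, isOpen_ball.mem_nhds hzb] with w h4 h5 h6
      exact hinj _ h4 _ h5 (h w (mem_ball_zero_iff.1 h6))
    have hid := han.eqOn_of_preconnected_of_eventuallyEq (fun _ _ => analyticAt_id)
      (convex_ball _ _).isPreconnected hzb hev
    have h0 : q = 0 := by rw [← mob_zero l q]; exact hid (by simp)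
    have h1 : mob l q (1 / 2) = 1 / 2 := hid (by simp; norm_num)
    refine ⟨?_, h0⟩
    rw [h0] at h1
    simpa [mob] using h1
  · by_contra hcon
    have hq0 : q ≠ 0 := by
      rintro rfl
      have hz0 : z ≠ 0 := norm_ne_zero_iff.1 (by rw [hz1]; norm_num)
      simp only [mob, map_zero, zero_mul, add_zero, div_one] at hfix
      grind
    obtain ⟨μ, hμ, β, hβ, haff⟩ := exists_affine_of_mob_fixed hl hq hz1 hfix hq0
    obtain ⟨k, hk, hid⟩ := exists_iterate_eq_id hext han.differentiableOn hm h
    have hit : ∀ n : ℕ, ∀ w : ℂ, ‖w‖ < 1 → 1 / ((mob l q)^[n] w - z)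
        = μ ^ n * (1 / (w - z)) + β * ∑ j ∈ Finset.range n, (μ : ℂ) ^ j := fun n => by
      induction n with
      | zero => intro w _; simp
      | succ n ih =>
        intro w hw
        rw [Function.iterate_succ_apply, ih _ (norm_mob_lt_one hl hq hw), haff w hw,
          Finset.sum_range_succ]
        ring
    have e0 := hit k 0 (by simp)
    have e1 := hit k (z / 2) (by rw [norm_div, hz1]; norm_num)
    rw [hid _ (by simp)] at e0
    rw [hid _ (by rw [norm_div, hz1]; norm_num)] at e1
    have hz0 : z ≠ 0 := norm_ne_zero_iff.1 (by rw [hz1]; norm_num)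
    have e2 : (1 : ℂ) / (z / 2 - z) = -2 / z := by
      rw [show z / 2 - z = -(z / 2) by ring]; field_simp
    rw [e2] at e1
    rw [zero_sub] at e0
    have e3 : (μ : ℂ) ^ k = 1 := by
      have : (1 - (μ : ℂ) ^ k) * (1 / z) = 0 := by
        have e4 : (1 : ℂ) / -z = -(1 / z) := by rw [div_neg]
        rw [e4] at e0
        linear_combination e0 - e1
      have := (mul_eq_zero.1 this).resolve_right (one_div_ne_zero hz0)
      linear_combination -this
    have e5 : μ = 1 := (pow_eq_one_iff_of_nonneg hμ.le (show k ≠ 0 by omega)).1 (by exact_mod_cast e3)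
    rw [e3, one_mul, e5] at e0
    have e6 : β * (k : ℂ) = 0 := by simpa using e0
    rcases mul_eq_zero.1 e6 with h | h
    · exact hβ h
    · have : k = 0 := by exact_mod_cast h
      omega

/-! ### Maps near a given map -/

section NearbyMaps

/-- The Möbius function with value `q`, derivative `d` at `0` and pole at `1 / k`. -/
def nf (q d k w : ℂ) : ℂ := q + d * w / (1 - k * w)

lemma nf_zero (q d k : ℂ) : nf q d k 0 = q := by simp [nf]

/-- The matrix of `nf q d k`. -/
def nfGL (q k : ℂ) {d : ℂ} (hd : d ≠ 0) : GL (Fin 2) ℂ :=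
  mkGL (d - q * k) q (-k) 1 (by convert hd using 1; ring)

lemma moebiusRel_nf {q d k w : ℂ} (hd : d ≠ 0) (h : 1 - k * w ≠ 0) :
    MoebiusRel (nfGL q k hd) w (nf q d k w) := by
  rw [nfGL, moebiusRel_mkGL, nf]
  grind

lemma eq_nf_of_moebiusRel {A : GL (Fin 2) ℂ} (h0 : A 1 1 ≠ 0) {w v : ℂ} (h : MoebiusRel A w v) :
    1 - -(A 1 0 / A 1 1) * w ≠ 0 ∧ v = nf (A 0 1 / A 1 1)
      ((A 0 0 * A 1 1 - A 0 1 * A 1 0) / A 1 1 ^ 2) (-(A 1 0 / A 1 1)) w := by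
  obtain ⟨h1, rfl⟩ := h
  have h2 : 1 - -(A 1 0 / A 1 1) * w = (A 1 0 * w + A 1 1) / A 1 1 := by field_simp; ring
  refine ⟨by rw [h2]; exact div_ne_zero h1 h0, ?_⟩
  rw [nf, h2, div_div_eq_mul_div, div_add_div _ _ h0 h1, div_eq_div_iff h1 (mul_ne_zero h0 h1)]
  grind

/-- A Möbius function given in normal form is determined by its values at `0` and `± r`. -/
lemma nf_parameters {q d k : ℂ} {r : ℝ} (hr : 0 < r) (hd : d ≠ 0) (h1 : 1 - k * r ≠ 0)
    (h2 : 1 - k * (-r) ≠ 0) :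
    d = 2 * (nf q d k r - q) * (nf q d k (-r) - q) / (r * ((nf q d k (-r) - q) - (nf q d k r - q)))
    ∧ k = -((nf q d k r - q) + (nf q d k (-r) - q)) /
      (r * ((nf q d k (-r) - q) - (nf q d k r - q))) := by
  have hr0 : (r : ℂ) ≠ 0 := by exact_mod_cast hr.ne'
  have h2' : 1 + k * r ≠ 0 := by rwa [mul_neg, sub_neg_eq_add] at h2
  have e1 : nf q d k r - q = d * r / (1 - k * r) := by rw [nf]; ring
  have e2 : nf q d k (-r) - q = -(d * r) / (1 + k * r) := by
    rw [nf, mul_neg, mul_neg, sub_neg_eq_add]; ring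
  grind

/-- The constraints on a Möbius function in normal form that make it close to the identity. -/
lemma norm_nf_sub_le {q d k w : ℂ} {ε : ℝ} (hε : ε ≤ 1 / 4) (hq : ‖q‖ ≤ ε) (hd : ‖d - 1‖ ≤ ε)
    (hk : ‖k‖ ≤ ε) (hw : ‖w‖ ≤ 1) : 1 - k * w ≠ 0 ∧ ‖nf q d k w - w‖ ≤ 4 * ε := by
  have hkw : ‖k * w‖ ≤ ε := by rw [norm_mul]; nlinarith [norm_nonneg k, norm_nonneg w]
  have h1 : 3 / 4 ≤ ‖1 - k * w‖ := by
    have := norm_sub_norm_le (1 : ℂ) (k * w)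
    rw [norm_one] at this; linarith
  have h2 : 1 - k * w ≠ 0 := norm_pos_iff.1 (by linarith)
  refine ⟨h2, ?_⟩
  have h3 : nf q d k w - w = q + w * ((d - 1) + k * w) / (1 - k * w) := by
    have : d * w / (1 - k * w) = w + w * ((d - 1) + k * w) / (1 - k * w) := by grind
    rw [nf, this]; ring
  have h4 : ‖w * ((d - 1) + k * w) / (1 - k * w)‖ ≤ 3 * ε := by
    rw [norm_div, norm_mul, div_le_iff₀ (by linarith)]
    have h5 : ‖(d - 1) + k * w‖ ≤ 2 * ε := (norm_add_le _ _).trans (by linarith)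
    have : ‖w‖ * ‖(d - 1) + k * w‖ ≤ 1 * (2 * ε) := mul_le_mul hw h5 (norm_nonneg _) zero_le_one
    nlinarith [norm_nonneg q]
  rw [h3]
  exact (norm_add_le _ _).trans (by linarith)

lemma concaveOn_herm {A : GL (Fin 2) ℂ} (h : ‖A 1 0‖ ≤ ‖A 0 0‖) :
    ConcaveOn ℝ Set.univ (herm A) := by
  have h1 : ConvexOn ℝ Set.univ (fun w : ℂ => ‖w‖ ^ 2) :=
    convexOn_univ_norm.pow (fun _ _ => norm_nonneg _) 2
  have h2 : 0 ≤ ‖A 0 0‖ ^ 2 - ‖A 1 0‖ ^ 2 := by nlinarith [norm_nonneg (A 1 0), norm_nonneg (A 0 0)]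
  have h3 := (h1.smul h2).neg
  set b := conj (A 1 1) * A 1 0 - conj (A 0 1) * A 0 0
  set f : ℂ →ₗ[ℝ] ℝ := Complex.reLm ∘ₗ LinearMap.mulLeft ℝ (2 * b)
  have h4 : ConcaveOn ℝ Set.univ f := f.concaveOn convex_univ
  have h5 := (h4.add h3).add_const (‖A 1 1‖ ^ 2 - ‖A 0 1‖ ^ 2)
  refine h5.congr fun w _ => ?_
  rw [herm_eq]
  have : f w = 2 * (b * w).re := by
    simp only [f, LinearMap.comp_apply, LinearMap.mulLeft_apply, Complex.reLm_coe, mul_assoc]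
    simp
  simp only [Pi.add_apply, Pi.neg_apply, this, smul_eq_mul]
  ring

instance : LocallyCompactSpace 𝔻 := isOpenEmbedding_coe_unitDisc.locallyCompactSpace

lemma continuousAt_uncurry_extend (u : C(𝔻, S)) {w : ℂ} (hw : ‖w‖ < 1) :
    ContinuousAt (fun p : C(𝔻, S) × ℂ => extend p.1 p.2) (u, w) := by
  have h := (IsOpenEmbedding.id (X := C(𝔻, S))).prodMap isOpenEmbedding_coe_unitDisc
  refine (h.continuousAt_iff (g := fun p : C(𝔻, S) × ℂ => extend p.1 p.2)
    (x := (u, Complex.UnitDisc.mk w hw))).1 ?_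
  have : (fun p : C(𝔻, S) × ℂ => extend p.1 p.2) ∘ Prod.map id ((↑) : 𝔻 → ℂ)
      = fun p => p.1 p.2 := by
    ext p; simp
  rw [this]
  fun_prop

/-- A condition on the graph of a map over a compact disk is preserved under small perturbations
if it is locally so. -/
lemma eventually_forall_extend {u : C(𝔻, S)} {r : ℝ} (hr : r < 1) {R : ℂ × S → Prop}
    (h : ∀ w, ‖w‖ ≤ r → ∀ᶠ z in 𝓝 (w, extend u w), R z) :
    ∀ᶠ v in 𝓝 u, ∀ w, ‖w‖ ≤ r → R (w, extend v w) := by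
  have := (isCompact_closedBall (0 : ℂ) r).eventually_forall_of_forall_eventually
    (x₀ := u) (P := fun v w => R (w, extend v w)) fun w hw => by
      rw [mem_closedBall_zero_iff] at hw
      exact (continuousAt_snd.prodMk (continuousAt_uncurry_extend u (hw.trans_lt hr))).eventually
        (h w hw)
  simp_all

/-- Maps close to `u` factor locally through `u` by a Möbius function close to the identity. -/
lemma eventually_eq_nf (u : Q.DiskMap) {ε : ℝ} (hε : 0 < ε) :
    ∀ᶠ v : Q.DiskMap in 𝓝 u, ∃ q d k : ℂ, ‖q‖ ≤ ε ∧ ‖d - 1‖ ≤ ε ∧ ‖k‖ ≤ ε ∧ d ≠ 0 ∧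
      ∀ᶠ w in 𝓝 0, extend v.1 w = extend u.1 (nf q d k w) := by
  obtain ⟨hc, e, he, hse, A, hA⟩ := DiskMap.projOn u 0 (by simp)
  obtain ⟨ρ, hρ, hball⟩ := eventually_nhds_iff_ball.1
    (hA.and ((hc.eventually (e.open_source.mem_nhds hse)).and
      (isOpen_ball.mem_nhds (show (0 : ℂ) ∈ 𝔹 by simp))))
  set r := ρ / 2 with hr
  have hr0 : 0 < r := by positivity
  have hrball : ∀ w : ℂ, ‖w‖ ≤ r → w ∈ ball (0 : ℂ) ρ := fun w hw =>
    mem_ball_zero_iff.2 (by linarith)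
  have hr1 : r < 1 := by
    have := (hball r (hrball _ (by rw [norm_real, norm_of_nonneg hr0.le]))).2.2
    rwa [dist_zero_right, norm_real, norm_of_nonneg hr0.le] at this
  -- the inverse of `u` near `u 0`
  set σ : S → ℂ := fun x => (adj A 0 0 * e x + adj A 0 1) / (adj A 1 0 * e x + adj A 1 1) with hσ
  have hσu : ∀ w : ℂ, ‖w‖ ≤ r → adj A 1 0 * e (extend u.1 w) + adj A 1 1 ≠ 0 ∧
      σ (extend u.1 w) = w := fun w hw => by
    have := (hball w (hrball w hw)).1.inv
    exact ⟨this.1, this.2.symm⟩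
  have hσc : ∀ w : ℂ, ‖w‖ ≤ r → ContinuousAt σ (extend u.1 w) := fun w hw => by
    have h1 := e.continuousAt (hball w (hrball w hw)).2.1
    have h2 := (hσu w hw).1
    simp only [hσ]
    fun_prop (disch := assumption)
  set s := r / 2 with hs
  have hs0 : 0 < s := by positivity
  -- a neighbourhood in which the parameters are small
  have hF : ContinuousAt (fun z : ℂ × ℂ × ℂ => (z.1, 2 * (z.2.1 - z.1) * (z.2.2 - z.1) /
      (s * ((z.2.2 - z.1) - (z.2.1 - z.1))), -((z.2.1 - z.1) + (z.2.2 - z.1)) /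
      (s * ((z.2.2 - z.1) - (z.2.1 - z.1))))) (0, (s : ℂ), (-s : ℂ)) := by
    have hs' : (s : ℂ) ≠ 0 := by exact_mod_cast hs0.ne'
    have : (s : ℂ) * ((-s - 0) - (s - 0)) ≠ 0 := by
      have : (s : ℂ) * ((-s - 0) - (s - 0)) = -2 * s ^ 2 := by ring
      rw [this]; simpa using hs'
    fun_prop (disch := assumption)
  have hF0 := hF.tendsto
  dsimp only at hF0
  have hs0' : (s : ℂ) ≠ 0 := by exact_mod_cast hs0.ne'
  have e1 : 2 * ((s : ℂ) - 0) * (-s - 0) / (s * ((-s - 0) - (s - 0))) = 1 := by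
    rw [div_eq_one_iff_eq (by ring_nf; simpa using hs0')]; ring
  have e2 : -(((s : ℂ) - 0) + (-s - 0)) / (s * ((-s - 0) - (s - 0))) = 0 := by simp
  rw [e1, e2] at hF0
  clear e1 e2
  have hnear : closedBall (0 : ℂ) ε ×ˢ closedBall (1 : ℂ) ε ×ˢ
      closedBall (0 : ℂ) ε ∈ 𝓝 ((0 : ℂ), (1 : ℂ), (0 : ℂ)) :=
    prod_mem_nhds (Metric.closedBall_mem_nhds _ hε)
      (prod_mem_nhds (Metric.closedBall_mem_nhds _ hε) (Metric.closedBall_mem_nhds _ hε))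
  obtain ⟨η, hη, hηb⟩ := Metric.mem_nhds_iff.1 (hF0 hnear)
  set δ := min η r with hδ
  have hδ0 : 0 < δ := lt_min hη hr0
  have hopen := eventually_forall_extend (u := u.1) hr1 (R := fun z => z.2 ∈ e.source ∧
    adj A 1 0 * e z.2 + adj A 1 1 ≠ 0 ∧ ‖σ z.2 - z.1‖ < δ) fun w hw => by
      have hs : ContinuousAt (Prod.snd : ℂ × S → S) (w, extend u.1 w) := continuousAt_snd
      have h1 := e.continuousAt (hball w (hrball w hw)).2.1
      refine (hs.eventually (e.open_source.mem_nhds (hball w (hrball w hw)).2.1)).and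
        ((hs.eventually (((h1.const_mul _).add_const _).eventually_ne (hσu w hw).1)).and ?_)
      have h2 : ContinuousAt (fun z : ℂ × S => ‖σ z.2 - z.1‖) (w, extend u.1 w) :=
        ((ContinuousAt.comp (f := Prod.snd) (x := (w, extend u.1 w)) (g := σ) (hσc w hw) hs).sub continuousAt_fst).norm
      refine h2.eventually (gt_mem_nhds ?_)
      simp only [(hσu w hw).2, sub_self, norm_zero, hδ0]
  refine (continuous_subtype_val.continuousAt.eventually hopen).mono fun v hv => ?_
  obtain ⟨B, hB⟩ := ((DiskMap.projOn v).mono (ball_subset_ball hr1.le)).exists_moebius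
    (fun _ _ => analyticAt_id) (convex_ball (0 : ℂ) r).isPreconnected ⟨0, by simpa using hr0⟩ he
    fun w hw => (hv w (mem_ball_zero_iff.1 hw).le).1
  have hM : ∀ w : ℂ, ‖w‖ < r → MoebiusRel (adj A * B) w (σ (extend v.1 w)) := fun w hw =>
    (hB w (mem_ball_zero_iff.2 hw)).comp ⟨(hv w hw.le).2.1, rfl⟩
  have h11 : (adj A * B) 1 1 ≠ 0 := by
    have := (hM 0 (by simpa using hr0)).1
    rwa [mul_zero, zero_add] at this
  have hnf := fun w (hw : ‖w‖ < r) => eq_nf_of_moebiusRel h11 (hM w hw)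
  have hd0 := div_ne_zero (det_ne_zero_of_GL (adj A * B)) (pow_ne_zero 2 h11)
  generalize (adj A * B) 0 1 / (adj A * B) 1 1 = q at hnf
  generalize ((adj A * B) 0 0 * (adj A * B) 1 1 - (adj A * B) 0 1 * (adj A * B) 1 0) /
    (adj A * B) 1 1 ^ 2 = d at hnf hd0
  generalize -((adj A * B) 1 0 / (adj A * B) 1 1) = k at hnf
  have hsr : ‖(s : ℂ)‖ < r := by rw [norm_real, norm_of_nonneg hs0.le]; linarith
  have hsr' : ‖(-s : ℂ)‖ < r := by rwa [norm_neg]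
  have hclose : ∀ w : ℂ, ‖w‖ < r → ‖nf q d k w - w‖ < δ := fun w hw => by
    rw [← (hnf w hw).2]; exact (hv w hw.le).2.2
  obtain ⟨e1, e2⟩ := nf_parameters (q := q) hs0 hd0 (hnf _ hsr).1 (hnf _ hsr').1
  have hmem := hηb (a := (q, nf q d k s, nf q d k (-s))) (by
    rw [mem_ball, Prod.dist_eq, Prod.dist_eq]
    refine max_lt ?_ (max_lt ?_ ?_)
    · have := hclose 0 (by simpa using hr0)
      rw [nf_zero] at this
      rw [dist_eq_norm]; exact this.trans_le (min_le_left _ _)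
    · rw [dist_eq_norm]; exact (hclose _ hsr).trans_le (min_le_left _ _)
    · rw [dist_eq_norm]; exact (hclose _ hsr').trans_le (min_le_left _ _))
  simp only [Set.mem_preimage, Set.mem_prod, mem_closedBall_iff_norm, ← e1, ← e2, sub_zero] at hmem
  refine ⟨q, d, k, hmem.1, hmem.2.1, hmem.2.2, hd0, ?_⟩
  filter_upwards [ball_mem_nhds 0 hr0] with w hw
  rw [mem_ball_zero_iff] at hw
  rw [← (hnf w hw).2]
  have h1 : ‖σ (extend v.1 w)‖ < ρ := by
    have h2 := norm_add_le (σ (extend v.1 w) - w) w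
    rw [sub_add_cancel] at h2
    have h3 : ‖σ (extend v.1 w) - w‖ < δ := (hv w hw.le).2.2
    have h4 : δ ≤ r := min_le_right _ _
    linarith
  have h2 := hball _ (mem_ball_zero_iff.2 h1)
  refine e.injOn (hv w hw.le).1 h2.2.1 ?_
  exact MoebiusRel.left_unique (A := adj A) ⟨(hv w hw.le).2.1, rfl⟩ h2.1.inv

/-- If the values of the inverse of a Möbius function close to the identity avoid the open unit disk
at the points of `L`, then its image of the closed disk is in the collar except for points of `L`. -/
lemma nf_mem_collar {L : Set ℂ} (hL : ∀ a ∈ L, ‖a‖ = 1) {c ε : ℝ} (hc : 0 < c) (hc' : c ≤ 1 / 2)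
    (hε : ε ≤ c / 20) {q d k : ℂ} (hq : ‖q‖ ≤ ε) (hd : ‖d - 1‖ ≤ ε) (hk : ‖k‖ ≤ ε) (hd0 : d ≠ 0)
    (h : ∀ a ∈ L, herm (adj (nfGL q k hd0)) a ≤ 0) {w : ℂ} (hw : ‖w‖ ≤ 1)
    (hwL : nf q d k w ∉ L) : nf q d k w ∈ collar L c := by
  obtain ⟨h1, h2⟩ := norm_nf_sub_le (by linarith) hq hd hk hw
  have hrel := moebiusRel_nf (q := q) hd0 h1
  have hNy : 0 ≤ herm (adj (nfGL q k hd0)) (nf q d k w) := by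
    rcases hw.lt_or_eq with hw | hw
    · exact ((herm_pos_iff hrel.inv).2 hw).le
    · exact ((herm_eq_zero_iff hrel.inv).2 hw).ge
  set y := nf q d k w with hy
  have hy1 : ‖y‖ < 1 + c := by
    have := norm_add_le (y - w) w
    grind
  by_cases hyD : ‖y‖ < 1
  · exact Or.inl hyD
  rw [not_lt] at hyD
  set t := ‖y‖ with ht
  have ht0 : (t : ℂ) ≠ 0 := by
    have : t ≠ 0 := by linarith
    simp_all
  set ξ := y / (t : ℂ) with hξ
  have htn : ‖(t : ℂ)‖ = t := by rw [norm_real, norm_of_nonneg (by linarith)]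
  have hξ1 : ‖ξ‖ = 1 := by rw [hξ, norm_div, htn, ← ht, div_self (by linarith)]
  have hyξ : y - ξ = ((t - 1 : ℝ) : ℂ) * ξ := by rw [hξ]; push_cast; field_simp
  have hnyξ : ‖y - ξ‖ = t - 1 := by
    rw [hyξ, norm_mul, hξ1, norm_real, norm_of_nonneg (by linarith), mul_one]
  refine Or.inr ⟨ξ, hξ1, by rw [hnyξ]; linarith, fun a ha => ?_⟩
  have hNa := h a ha
  have e00 : adj (nfGL q k hd0) 0 0 = 1 := by simp [adj, nfGL, mkGL]
  have e01 : adj (nfGL q k hd0) 0 1 = -q := by simp [adj, nfGL, mkGL]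
  have e10 : adj (nfGL q k hd0) 1 0 = k := by simp [adj, nfGL, mkGL]
  have e11 : adj (nfGL q k hd0) 1 1 = d - q * k := by simp [adj, nfGL, mkGL]
  rw [herm_eq, e00, e01, e10, e11] at hNy hNa
  set m := conj (d - q * k) * k - conj (-q) * 1 with hm
  have hε0 : 0 ≤ ε := (norm_nonneg q).trans hq
  have hmn : ‖m‖ ≤ c / 8 := by
    have h3 : ‖d - q * k‖ ≤ 1 + 2 * ε := by
      have h4 : d - q * k = (d - 1) + 1 + -(q * k) := by ring
      have h5 : ‖q * k‖ ≤ ε := by rw [norm_mul]; nlinarith [norm_nonneg k, norm_nonneg q]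
      rw [h4]
      refine (norm_add₃_le).trans ?_
      rw [norm_neg, norm_one]; linarith
    have h6 : ‖m‖ ≤ ‖d - q * k‖ * ‖k‖ + ‖q‖ := by
      refine (norm_sub_le _ _).trans ?_
      rw [norm_mul, mul_one, RCLike.norm_conj, RCLike.norm_conj, norm_neg]
    nlinarith [norm_nonneg k, norm_nonneg (d - q * k)]
  have hre : (m * y).re - (m * a).re ≤ c / 8 * ((t - 1) + ‖ξ - a‖) := by
    rw [← sub_re, ← mul_sub]
    refine (re_le_norm _).trans ?_
    rw [norm_mul]
    have : ‖y - a‖ ≤ (t - 1) + ‖ξ - a‖ := by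
      rw [← hnyξ, ← sub_add_sub_cancel y ξ a]; exact norm_add_le _ _
    exact mul_le_mul hmn this (norm_nonneg _) (by positivity)
  rw [norm_one, hL a ha] at hNa
  rw [norm_one, ← ht] at hNy
  have hk2 : ‖k‖ ^ 2 ≤ 1 / 4 := by nlinarith [norm_nonneg k]
  have hpos : 0 < ‖ξ - a‖ := by
    rw [norm_pos_iff, sub_ne_zero]
    rintro rfl
    have h7 : t - 1 ≤ 0 := by
      rw [sub_self, norm_zero, add_zero] at hre
      nlinarith [mul_nonneg (sub_nonneg.2 hyD) (sub_nonneg.2 hyD)]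
    have h8 : t = 1 := by linarith
    rw [h8] at hyξ
    apply hwL
    have : y = ξ := by simpa [sub_eq_zero] using hyξ
    rwa [this]
  rw [hnyξ]
  nlinarith [mul_nonneg (sub_nonneg.2 hyD) (sub_nonneg.2 hyD), mul_pos hc hpos,
    mul_nonneg (sub_nonneg.2 hyD) (sub_nonneg.2 hk2)]

variable [T2Space S] [IsManifold 𝓘(ℂ) ω S]

/-- A map that factors locally through `u` by a Möbius function `A` close to the identity factors
globally through the collar extension of `u`. The points of the circle which `A` sends to lean
points of `u` are the lean points of the map. -/
lemma Collar.near {u : Q.DiskMap} (C : Collar u) {v : Q.DiskMap} {ε : ℝ} (hε : ε ≤ C.c / 20)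
    {q d k : ℂ} (hq : ‖q‖ ≤ ε) (hd : ‖d - 1‖ ≤ ε) (hk : ‖k‖ ≤ ε) (hd0 : d ≠ 0)
    (h : ∀ᶠ w in 𝓝 0, extend v.1 w = extend u.1 (nf q d k w)) :
    (∀ w : ℂ, ‖w‖ < 1 → nf q d k w ∈ collar (leanSet u) C.c ∧ extend v.1 w = C.V (nf q d k w)) ∧
    ∀ ζ : ℂ, ‖ζ‖ = 1 → (ζ ∈ leanSet v ↔ nf q d k ζ ∈ leanSet u) := by
  have hc := C.c_pos
  have hc' := C.c_le
  have hεq : ε ≤ 1 / 4 := by linarith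
  set A := nfGL q k hd0 with hA
  have hden : ∀ w : ℂ, ‖w‖ ≤ 1 → 1 - k * w ≠ 0 := fun w hw => (norm_nf_sub_le hεq hq hd hk hw).1
  have hrel : ∀ w : ℂ, ‖w‖ ≤ 1 → MoebiusRel A w (nf q d k w) := fun w hw =>
    moebiusRel_nf hd0 (hden w hw)
  have hnfa : ∀ w : ℂ, ‖w‖ ≤ 1 → AnalyticAt ℂ (nf q d k) w := fun w hw => by
    have := hden w hw
    unfold nf
    fun_prop
  have hconc : ConcaveOn ℝ Set.univ (herm A) := by
    refine concaveOn_herm ?_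
    have e00 : A 0 0 = d - q * k := by simp [hA, nfGL, mkGL]
    have e10 : A 1 0 = -k := by simp [hA, nfGL, mkGL]
    rw [e00, e10, norm_neg]
    have h1 := norm_sub_norm_le (1 : ℂ) (-(d - 1) + q * k)
    rw [show 1 - (-(d - 1) + q * k) = d - q * k by ring, norm_one] at h1
    have h2 := norm_add_le (-(d - 1)) (q * k)
    rw [norm_neg, norm_mul] at h2
    nlinarith [norm_nonneg q, norm_nonneg k]
  -- the part of the disk which is mapped to the disk
  set W : Set ℂ := 𝔹 ∩ {w | w ∈ Set.univ ∧ 0 < herm A w} with hW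
  have hWc : Convex ℝ W := (convex_ball _ _).inter (hconc.convex_gt 0)
  have hWm : ∀ w ∈ W, ‖nf q d k w‖ < 1 := fun w hw =>
    (herm_pos_iff (hrel w (mem_ball_zero_iff.1 hw.1).le)).1 hw.2.2
  have h0A : 0 < herm A 0 := (herm_pos_iff (hrel 0 (by simp))).2 (by rw [nf_zero]; linarith)
  have h0W : (0 : ℂ) ∈ W := ⟨by simp, trivial, h0A⟩
  have hWu : Set.EqOn (extend v.1) (fun w => extend u.1 (nf q d k w)) W :=
    ((DiskMap.holOn v).mono Set.inter_subset_left).eqOn ((DiskMap.holOn u).comp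
      (fun w hw => hnfa w (mem_ball_zero_iff.1 hw.1).le)
      fun w hw => mem_ball_zero_iff.2 (hWm w hw)) hWc.isPreconnected h0W h
  have havoid : ∀ w : ℂ, ‖w‖ < 1 → nf q d k w ∉ leanSet u := by
    rintro w hw ⟨ha1, p, hp, hap⟩
    have hz : herm A w = 0 := (herm_eq_zero_iff (hrel w hw.le)).2 ha1
    have hseg : ∀ t : ℝ, 0 ≤ t → t < 1 → (t : ℂ) * w ∈ W := fun t ht0 ht1 => by
      refine ⟨?_, trivial, ?_⟩
      · rw [mem_ball_zero_iff, norm_mul, norm_real, norm_of_nonneg ht0]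
        nlinarith [norm_nonneg w]
      · have := hconc.2 (Set.mem_univ 0) (Set.mem_univ w) (sub_nonneg.2 ht1.le) ht0 (by ring)
        rw [smul_zero, zero_add, hz, smul_zero, add_zero, smul_eq_mul, real_smul] at this
        exact lt_of_lt_of_le (mul_pos (by linarith) h0A) this
    have ht : Tendsto (fun t : ℝ => (t : ℂ) * w) (𝓝[<] 1) (𝓝 w) := by
      have : Tendsto (fun t : ℝ => (t : ℂ) * w) (𝓝 1) (𝓝 (((1 : ℝ) : ℂ) * w)) :=
        (by fun_prop : Continuous fun t : ℝ => (t : ℂ) * w).tendsto 1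
      simpa using this.mono_left nhdsWithin_le_nhds
    have hev : ∀ᶠ t : ℝ in 𝓝[<] 1, (t : ℂ) * w ∈ W := by
      filter_upwards [Ioo_mem_nhdsLT (show (0 : ℝ) < 1 by norm_num)] with t ht
      exact hseg t ht.1.le ht.2
    refine hap.not_of_curve hp (F := 𝓝[<] (1 : ℝ)) (γ := fun t => nf q d k (t * w))
      (tendsto_nhdsWithin_iff.2 ⟨((hnfa w hw.le).continuousAt.tendsto.comp ht :),
        hev.mono fun t ht => mem_ball_zero_iff.2 (hWm _ ht)⟩)
      ((DiskMap.projOn v).notMem (mem_ball_zero_iff.2 hw))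
      (((continuousAt_extend v.1 hw).tendsto.comp ht).congr' (hev.mono fun t ht => hWu ht))
  have hherm : ∀ a ∈ leanSet u, herm (adj A) a ≤ 0 := fun a ha => by
    by_contra hcon
    rw [not_le] at hcon
    have h1 := moebiusRel_of_herm_pos hcon
    set w := (adj A 0 0 * a + adj A 0 1) / (adj A 1 0 * a + adj A 1 1)
    have hw := (herm_pos_iff h1).1 hcon
    refine havoid w hw ?_
    rwa [((hrel w hw.le).inv.left_unique h1)]
  have hcol := fun w => nf_mem_collar (L := leanSet u) (fun a ha => ha.1) hc hc' hε hq hd hk hd0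
    hherm (w := w)
  have hcolD : ∀ w : ℂ, ‖w‖ < 1 → nf q d k w ∈ collar (leanSet u) C.c := fun w hw =>
    hcol w hw.le (havoid w hw)
  have hVA : Set.EqOn (extend v.1) (fun w => C.V (nf q d k w)) 𝔹 := by
    refine (DiskMap.holOn v).eqOn ((C.proj.holOn fun _ _ => analyticAt_id).comp
      (fun w hw => hnfa w (mem_ball_zero_iff.1 hw).le) fun w hw => hcolD w (mem_ball_zero_iff.1 hw))
      (convex_ball _ _).isPreconnected (by simp) (s0 := 0) ?_
    have h1 : ∀ᶠ w in 𝓝 (0 : ℂ), ‖nf q d k w‖ < 1 :=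
      (hnfa 0 (by simp)).continuousAt.norm.eventually (gt_mem_nhds (by simp only [nf_zero]; linarith))
    filter_upwards [h, h1] with w hw hw1
    rw [hw, C.eq _ hw1]
  refine ⟨fun w hw => ⟨hcolD w hw, hVA (mem_ball_zero_iff.2 hw)⟩, fun ζ hζ => ⟨?_, ?_⟩⟩
  · rintro ⟨-, p, hp, hlean⟩
    by_contra hcon
    have hmem := hcol ζ hζ.le hcon
    have hVc := (C.proj _ hmem).1
    have hne := neBot_nhdsWithin_ball hζ.le
    refine hlean.not_of_curve hp (F := 𝓝[𝔹] ζ) (γ := fun w => w) tendsto_id (C.proj.notMem hmem) ?_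
    refine (((hVc.comp (hnfa ζ hζ.le).continuousAt).tendsto.mono_left nhdsWithin_le_nhds).congr' ?_ :
      Tendsto _ (𝓝[𝔹] ζ) _)
    filter_upwards [self_mem_nhdsWithin] with w hw
    exact (hVA hw).symm
  · rintro ⟨ha1, p, hp, hap⟩
    refine ⟨hζ, p, hp, ?_⟩
    have h1 : Tendsto (nf q d k) (𝓝[𝔹] ζ) (𝓝[collar (leanSet u) C.c] (nf q d k ζ)) :=
      tendsto_nhdsWithin_iff.2 ⟨(hnfa ζ hζ.le).continuousAt.tendsto.mono_left nhdsWithin_le_nhds,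
        eventually_nhdsWithin_of_forall fun w hw => hcolD w (mem_ball_zero_iff.1 hw)⟩
    refine ((C.tendsto _ ha1 p hp hap).comp h1).congr' ?_
    filter_upwards [self_mem_nhdsWithin] with w hw
    exact (hVA hw).symm

end NearbyMaps

/-! ### The space of maximal disks is Hausdorff -/

lemma tendsto_extend {X : Type*} {l : Filter X} {v : X → Q.DiskMap} {u : Q.DiskMap}
    (hv : Tendsto v l (𝓝 u)) {w : X → ℂ} {w0 : ℂ} (hw₀ : ‖w0‖ < 1) (hw : Tendsto w l (𝓝 w0)) :
    Tendsto (fun n => extend (v n).1 (w n)) l (𝓝 (extend u.1 w0)) :=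
  (continuousAt_uncurry_extend u.1 hw₀).tendsto.comp
    (((continuous_subtype_val.tendsto u).comp hv).prodMk_nhds hw)

/-- The group of automorphisms of the disk acts properly: reparametrizations of maps converging to
`u` can only converge to a reparametrization of `u`. -/
lemma exists_mob_of_tendsto [T2Space S] [IsManifold 𝓘(ℂ) ω S] {u u' : Q.DiskMap} (C : Collar u)
    {X : Type*} (𝒰 : Ultrafilter X) {v : X → Q.DiskMap}
    (hv : Tendsto v 𝒰 (𝓝 u)) {l q : X → ℂ} (hl : ∀ n, ‖l n‖ = 1) (hq : ∀ n, ‖q n‖ < 1)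
    (hv' : Tendsto (fun n => (v n).mob (hl n) (hq n)) 𝒰 (𝓝 u')) :
    ∃ (l0 q0 : ℂ) (hl : ‖l0‖ = 1) (hq : ‖q0‖ < 1), u' = u.mob hl hq ∧
      Tendsto l 𝒰 (𝓝 l0) ∧ Tendsto q 𝒰 (𝓝 q0) := by
  obtain ⟨q0, hq₀, hqlim⟩ := (isCompact_closedBall (0 : ℂ) 1).ultrafilter_le_nhds (𝒰.map q)
    (le_principal_iff.2 (show ∀ᶠ n in (𝒰 : Filter X), q n ∈ _ from
      Eventually.of_forall fun n => mem_closedBall_zero_iff.2 (hq n).le))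
  obtain ⟨l0, hl₀, hllim⟩ := (isCompact_sphere (0 : ℂ) 1).ultrafilter_le_nhds (𝒰.map l)
    (le_principal_iff.2 (show ∀ᶠ n in (𝒰 : Filter X), l n ∈ _ from
      Eventually.of_forall fun n => mem_sphere_zero_iff_norm.2 (hl n)))
  rw [mem_closedBall_zero_iff] at hq₀
  rw [mem_sphere_zero_iff_norm] at hl₀
  have hqlim : Tendsto q 𝒰 (𝓝 q0) := hqlim
  have hllim : Tendsto l 𝒰 (𝓝 l0) := hllim
  have hlim' : ∀ w : ℂ, ‖w‖ < 1 →
      Tendsto (fun n => extend (v n).1 (mob (l n) (q n) w)) 𝒰 (𝓝 (extend u'.1 w)) := fun w hw =>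
    (tendsto_extend hv' hw tendsto_const_nhds).congr fun n => extend_mob _ _ _ hw
  rcases hq₀.lt_or_eq with hq₁ | hq₁
  · refine ⟨l0, q0, hl₀, hq₁, DiskMap.ext_of_extend fun w hw => ?_, hllim, hqlim⟩
    rw [extend_mob _ _ _ hw]
    refine tendsto_nhds_unique (hlim' w hw) (tendsto_extend hv (norm_mob_lt_one hl₀ hq₁ hw) ?_)
    have hden := mob_denom_ne_zero hl₀ hq₁ hw.le
    unfold mob
    exact ((hllim.mul_const w).add hqlim).div ((((Complex.continuous_conj.tendsto _).comp
      hqlim).mul hllim).mul_const w |>.const_add 1) hden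
  -- if the centres tend to the unit circle, then the limit map is constant
  · exfalso
    obtain ⟨x, hx⟩ : ∃ x, Tendsto C.V (𝓝[collar (leanSet u) C.c] q0) (𝓝 x) := by
      by_cases h : q0 ∈ leanSet u
      · obtain ⟨-, p, hp, h⟩ := h
        exact ⟨p, C.tendsto _ hq₁ p hp h⟩
      · have hc := C.c_pos
        refine ⟨C.V q0, (C.proj q0 (Or.inr ⟨q0, hq₁, by simpa, fun a ha => ?_⟩)).1.tendsto.mono_left
          nhdsWithin_le_nhds⟩
        rw [sub_self, norm_zero]
        have : q0 - a ≠ 0 := fun h0 => h (by rwa [sub_eq_zero.1 h0])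
        positivity
    refine not_const_diskMap u' (x := x) fun w hw => tendsto_nhds_unique (hlim' w hw) ?_
    have hmw : Tendsto (fun n => mob (l n) (q n) w) 𝒰 (𝓝[𝔹] q0) :=
      tendsto_of_tendsto_map_zero (F := fun n => mob (l n) (q n))
        (fun n z hz => (analyticAt_mob (hl n) (hq n)
          (mem_ball_zero_iff.1 hz).le).differentiableAt.differentiableWithinAt)
        (fun n z hz => mem_ball_zero_iff.2 (norm_mob_lt_one (hl n) (hq n) (mem_ball_zero_iff.1 hz)))
        hq₁ (by simpa only [mob_zero] using hqlim) hw
    have hfac : ∀ ε > 0, ∀ᶠ n in (𝒰 : Filter X), ∃ y ∈ collar (leanSet u) C.c,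
        ‖y - mob (l n) (q n) w‖ ≤ ε ∧ extend (v n).1 (mob (l n) (q n) w) = C.V y := fun ε hε => by
      have hc := C.c_pos
      have hc' := C.c_le
      filter_upwards [hv.eventually (eventually_eq_nf u
        (show 0 < min (ε / 4) (C.c / 20) by positivity))] with n hn
      obtain ⟨q', d, k, h1, h2, h3, h4, h5⟩ := hn
      have hw' := norm_mob_lt_one (hl n) (hq n) hw
      obtain ⟨h6, h7⟩ := (C.near (min_le_right _ _) h1 h2 h3 h4 h5).1 _ hw'
      refine ⟨_, h6, ?_, h7⟩
      refine (norm_nf_sub_le ((min_le_right _ _).trans (by linarith)) h1 h2 h3 hw'.le).2.trans ?_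
      have := min_le_left (ε / 4) (C.c / 20)
      linarith
    intro N hN
    obtain ⟨M, hM, hMN⟩ := mem_nhdsWithin_iff_exists_mem_nhds_inter.1 (hx hN)
    obtain ⟨ρ, hρ, hρM⟩ := Metric.mem_nhds_iff.1 hM
    rw [mem_map]
    filter_upwards [hfac (ρ / 2) (by positivity), (hmw.mono_right nhdsWithin_le_nhds).eventually
      (ball_mem_nhds q0 (half_pos hρ))] with n h1 h2
    obtain ⟨y, h3, h4, h5⟩ := h1
    rw [Set.mem_preimage, h5]
    refine hMN ⟨hρM ?_, h3⟩
    have h6 := dist_triangle y (mob (l n) (q n) w) q0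
    rw [dist_eq_norm y (mob _ _ _)] at h6
    rw [mem_ball]
    linarith

/-- The action of the automorphisms of the disk on maps with a collar is proper: the automorphisms
that relate maps near `u` and `u'` have a limit along an ultrafilter, which relates `u` and `u'`. -/
lemma exists_mob_of_frequently [T2Space S] [IsManifold 𝓘(ℂ) ω S] {u u' : Q.DiskMap}
    (C : Collar u) {T : Set (ℂ × ℂ)} (h : ∃ᶠ p in 𝓝 (u, u'), ∃ (l q : ℂ) (hl : ‖l‖ = 1)
      (hq : ‖q‖ < 1), p.2 = p.1.mob hl hq ∧ (l, q) ∈ T) :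
    ∃ (l q : ℂ) (hl : ‖l‖ = 1) (hq : ‖q‖ < 1), u' = u.mob hl hq ∧ (l, q) ∈ closure T := by
  obtain ⟨𝒰, h𝒰'⟩ := exists_ultrafilter_iff.2 (frequently_iff_neBot.1 h)
  obtain ⟨h𝒰, hev⟩ := le_inf_iff.1 h𝒰'
  rw [le_principal_iff] at hev
  have hex : ∀ p : Q.DiskMap × Q.DiskMap, ∃ (l q : ℂ) (hl : ‖l‖ = 1) (hq : ‖q‖ < 1),
      (∃ (l q : ℂ) (hl : ‖l‖ = 1) (hq : ‖q‖ < 1), p.2 = p.1.mob hl hq ∧ (l, q) ∈ T) →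
        p.2 = p.1.mob hl hq ∧ (l, q) ∈ T := fun p => by
    by_cases hp : ∃ (l q : ℂ) (hl : ‖l‖ = 1) (hq : ‖q‖ < 1), p.2 = p.1.mob hl hq ∧ (l, q) ∈ T
    · grind
    · exact ⟨1, 0, by simp, by simp, fun h => absurd h hp⟩
  choose l q hl hq hlq using hex
  have hfst : Tendsto Prod.fst (𝒰 : Filter (Q.DiskMap × Q.DiskMap)) (𝓝 u) :=
    (continuous_fst.tendsto (u, u')).mono_left h𝒰
  have hsnd : Tendsto Prod.snd (𝒰 : Filter (Q.DiskMap × Q.DiskMap)) (𝓝 u') :=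
    (continuous_snd.tendsto (u, u')).mono_left h𝒰
  obtain ⟨l0, q0, hl₀, hq₀, h1, h2, h3⟩ := exists_mob_of_tendsto C 𝒰 hfst hl hq
    (hsnd.congr' (by filter_upwards [hev] with p hp using (hlq p hp).1))
  exact ⟨l0, q0, hl₀, hq₀, h1, mem_closure_of_tendsto (h2.prodMk_nhds h3)
    (by filter_upwards [hev] with p hp using (hlq p hp).2)⟩

lemma continuous_mob {l q : ℂ} (hl : ‖l‖ = 1) (hq : ‖q‖ < 1) :
    Continuous fun u : Q.DiskMap => u.mob hl hq := by
  have hc : Continuous (mobEquiv hl hq) := by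
    rw [isOpenEmbedding_coe_unitDisc.isInducing.continuous_iff, continuous_iff_continuousAt]
    intro w
    exact ContinuousAt.comp (g := mob l q) (analyticAt_mob hl hq w.norm_lt_one.le).continuousAt
      isOpenEmbedding_coe_unitDisc.continuous.continuousAt
  refine Continuous.subtype_mk ?_ _
  convert (ContinuousMap.continuous_precomp (⟨_, hc⟩ : C(𝔻, 𝔻))).comp
    (continuous_subtype_val (p := Q.IsProjective)) using 1
  ext u w
  exact mob_apply u hl hq w

/-- The fibres are the orbits of a group which acts by homeomorphisms. -/
lemma isOpenMap_toDisk : IsOpenMap Q.toDisk := fun O hO => by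
  change IsOpen (Q.toDisk ⁻¹' (Q.toDisk '' O))
  have : Q.toDisk ⁻¹' (Q.toDisk '' O) = ⋃ (l : ℂ) (q : ℂ) (hl : ‖l‖ = 1) (hq : ‖q‖ < 1),
      (fun u : Q.DiskMap => u.mob hl hq) ⁻¹' O := by
    ext u
    simp only [Set.mem_preimage, Set.mem_image, Set.mem_iUnion]
    constructor
    · rintro ⟨v, hv, hvu⟩
      obtain ⟨l, q, hl, hq, rfl⟩ := exists_eq_mob_of_toDisk_eq hvu
      grind
    · rintro ⟨l, q, hl, hq, h⟩
      exact ⟨_, h, toDisk_mob u hl hq⟩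
  rw [this]
  exact isOpen_iUnion fun l => isOpen_iUnion fun q => isOpen_iUnion fun hl => isOpen_iUnion fun hq =>
    hO.preimage (continuous_mob hl hq)

/-- The space of maximal disks is Hausdorff. -/
lemma t2Space_maxDisk [T2Space S] [IsManifold 𝓘(ℂ) ω S] (hcusp : ∀ p ∈ P, Nonempty (CuspModel Q p))
    (hext : ∀ (x : Q.MaxDisk) (u : Q.DiskMap), Q.toDisk u = x.1 → Q.ExtendsToClosedDisk u) :
    T2Space Q.MaxDisk := by
  refine ⟨fun x y hxy => ?_⟩
  obtain ⟨u, hu⟩ := Quotient.exists_rep x.1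
  obtain ⟨u', hu'⟩ := Quotient.exists_rep y.1
  have hu : Q.toDisk u = x.1 := hu
  have hu' : Q.toDisk u' = y.1 := hu'
  obtain ⟨C⟩ := exists_collar hcusp (hext x u hu)
  suffices h : ∃ O ∈ 𝓝 u, ∃ O' ∈ 𝓝 u', ∀ v ∈ O, ∀ v' ∈ O', Q.toDisk v ≠ Q.toDisk v' by
    obtain ⟨O, hO, O', hO', h⟩ := h
    refine ⟨Subtype.val ⁻¹' (Q.toDisk '' interior O), Subtype.val ⁻¹' (Q.toDisk '' interior O'),
      (isOpenMap_toDisk _ isOpen_interior).preimage continuous_subtype_val,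
      (isOpenMap_toDisk _ isOpen_interior).preimage continuous_subtype_val,
      ⟨u, mem_interior_iff_mem_nhds.2 hO, hu⟩, ⟨u', mem_interior_iff_mem_nhds.2 hO', hu'⟩, ?_⟩
    rw [Set.disjoint_left]
    rintro z ⟨v, hv, hvz⟩ ⟨v', hv', hvz'⟩
    exact h v (interior_subset hv) v' (interior_subset hv') (hvz.trans hvz'.symm)
  by_contra hcon
  push Not at hcon
  obtain ⟨l, q, hl, hq, h, -⟩ := exists_mob_of_frequently C (u' := u') (T := Set.univ) fun hev => by
    rw [nhds_prod_eq] at hev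
    obtain ⟨O, hO, O', hO', hsub⟩ := mem_prod_iff.1 hev
    obtain ⟨v, hv, v', hv', h⟩ := hcon O hO O' hO'
    obtain ⟨l, q, hl, hq, hlq⟩ := exists_eq_mob_of_toDisk_eq h.symm
    exact hsub (Set.mk_mem_prod hv hv') ⟨l, q, hl, hq, hlq, trivial⟩
  apply hxy
  apply Subtype.ext
  rw [← hu, ← hu', h, toDisk_mob]

/-! ### Normal families -/

section Normality

/-- A continuous solution `F` of `g ∘ F = h` with analytic `h` is analytic where `g` is analytic and
locally injective. -/
lemma analyticAt_of_comp_eq {F g h : ℂ → ℂ} {w0 : ℂ} (hF : ∀ᶠ w in 𝓝 w0, ContinuousAt F w)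
    (hg : AnalyticAt ℂ g (F w0)) {N : Set ℂ} (hN : N ∈ 𝓝 (F w0)) (hinj : Set.InjOn g N)
    (hh : AnalyticAt ℂ h w0) (heq : ∀ᶠ w in 𝓝 w0, g (F w) = h w) : AnalyticAt ℂ F w0 := by
  have hF0 := hF.self_of_nhds
  rcases hh.eventually_eq_or_eventually_ne (analyticAt_const (v := h w0)) with hc | hne
  · refine (analyticAt_const (v := F w0)).congr ?_
    filter_upwards [hc, heq, hF0 hN] with w h1 h2 h3
    exact (hinj h3 (mem_of_mem_nhds hN) (by rw [h2, h1, heq.self_of_nhds])).symm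
  have hd : ∀ᶠ z in 𝓝[≠] (F w0), deriv g z ≠ 0 := by
    rcases hg.deriv.eventually_eq_zero_or_eventually_ne_zero with h0 | h0
    · exfalso
      obtain ⟨r, hr, hball⟩ := eventually_nhds_iff_ball.1 ((h0.and hg.eventually_analyticAt).and hN)
      have hx : F w0 + (r / 2 : ℝ) ∈ ball (F w0) r := by
        rw [mem_ball_iff_norm, add_sub_cancel_left, norm_real, norm_of_nonneg (by positivity)]
        linarith
      have hconst := isOpen_ball.is_const_of_deriv_eq_zero (convex_ball (F w0) r).isPreconnected
        (fun z hz => (hball z hz).1.2.differentiableAt.differentiableWithinAt)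
        (fun z hz => (hball z hz).1.1) hx (mem_ball_self hr)
      have := hinj (hball _ hx).2 (hball _ (mem_ball_self hr)).2 hconst
      simp_all
    · exact h0
  refine Complex.analyticAt_of_differentiable_on_punctured_nhds_of_continuousAt ?_ hF0
  have hFne : ∀ᶠ w in 𝓝[≠] w0, F w ≠ F w0 := by
    filter_upwards [hne, heq.filter_mono nhdsWithin_le_nhds] with w h1 h2 h3
    exact h1 (by rw [← h2, h3, heq.self_of_nhds])
  have htend : Tendsto F (𝓝[≠] w0) (𝓝[≠] (F w0)) :=
    tendsto_nhdsWithin_iff.2 ⟨hF0.tendsto.mono_left nhdsWithin_le_nhds, hFne⟩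
  filter_upwards [htend.eventually hd, (hF0.eventually hg.eventually_analyticAt).filter_mono
    nhdsWithin_le_nhds, hF.filter_mono nhdsWithin_le_nhds,
    heq.eventually_nhds.filter_mono nhdsWithin_le_nhds,
    hh.eventually_analyticAt.filter_mono nhdsWithin_le_nhds] with w h1 h2 h3 h4 h5
  have hs := h2.hasStrictDerivAt
  have hl := (hs.hasStrictFDerivAt_equiv h1).eventually_left_inverse
  have hi := (hs.to_localInverse h1).hasDerivAt.differentiableAt
  rw [h4.self_of_nhds] at hi
  refine (hi.comp w h5.differentiableAt).congr_of_eventuallyEq ?_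
  filter_upwards [h3.eventually hl, h4] with w' h6 h7
  grind

variable [T2Space S] [CompactSpace S] [IsManifold 𝓘(ℂ) ω S]

lemma holOn_of_mdifferentiableOn {ϖ : ℂ → S} {W : Set ℂ} (hW : IsOpen W)
    (h : MDifferentiableOn 𝓘(ℂ) 𝓘(ℂ) ϖ W) : HolOn ϖ W := by
  have hd : ∀ w ∈ W, MDifferentiableAt 𝓘(ℂ) 𝓘(ℂ) ϖ w := fun w hw =>
    (h w hw).mdifferentiableAt (hW.mem_nhds hw)
  refine fun w hw => ⟨(hd w hw).continuousAt, fun e he hwe => ?_⟩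
  have hev : ∀ᶠ w' in 𝓝 w, w' ∈ W ∧ ϖ w' ∈ e.source :=
    Filter.Eventually.and (hW.mem_nhds hw) ((hd w hw).continuousAt (e.open_source.mem_nhds hwe))
  rw [Complex.analyticAt_iff_eventually_differentiableAt]
  filter_upwards [hev] with w' hw'
  have he1 : e ∈ IsManifold.maximalAtlas 𝓘(ℂ) 1 S :=
    IsManifold.maximalAtlas_subset_of_le (by simp) he
  exact mdifferentiableAt_iff_differentiableAt.1
    ((mdifferentiableAt_of_mem_maximalAtlas he1 hw'.2).comp w' (hd w' hw'.1))

/-- Holomorphic maps from the disk lift to the universal covering. -/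
lemma exists_holomorphic_lift {ϖ : ℂ → S} (hϖ : HolOn ϖ 𝔹)
    (hcov : IsCoveringMapOn (fun w : 𝔻 => ϖ w) Pᶜ) {g : ℂ → S} (hg : HolOn g 𝔹)
    (hgP : ∀ w ∈ 𝔹, g w ∈ Pᶜ) {z0 : 𝔻} (hz₀ : ϖ z0 = g 0) :
    ∃ F : ℂ → ℂ, DifferentiableOn ℂ F 𝔹 ∧ Set.MapsTo F 𝔹 𝔹 ∧ F 0 = z0 ∧ ∀ w ∈ 𝔹, ϖ (F w) = g w := by
  have hcv : Convex ℝ 𝔹 := convex_ball _ _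
  have : ContractibleSpace 𝔹 := hcv.contractibleSpace ⟨0, by simp⟩
  have : LocallyPathConnectedSpace 𝔹 := isOpen_ball.locallyPathConnectedSpace
  obtain ⟨Φ, ⟨hΦ0, hΦ⟩, -⟩ := hcov.existsUnique_continuousMap_lifts
    (A := 𝔹) ⟨fun w => g w, hg.continuousOn.domRestrict⟩
    (a₀ := ⟨0, by simp⟩) (e₀ := z0) hz₀ (fun a => hgP a a.2)
  classical
  set F : ℂ → ℂ := fun w => if h : w ∈ 𝔹 then Φ ⟨w, h⟩ else 0 with hF
  have hFw : ∀ (w : ℂ) (h : w ∈ 𝔹), F w = Φ ⟨w, h⟩ := fun w h => dif_pos h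
  have hFc : ContinuousOn F 𝔹 := by
    rw [continuousOn_iff_continuous_domRestrict]
    have : (ball (0 : ℂ) 1).domRestrict F = fun w => (Φ w : ℂ) := by grind
    rw [this]
    fun_prop
  have hFm : Set.MapsTo F 𝔹 𝔹 := fun w hw => by
    rw [hFw w hw]; exact mem_ball_zero_iff.2 (Φ _).norm_lt_one
  have hFg : ∀ w ∈ 𝔹, ϖ (F w) = g w := fun w hw => by rw [hFw w hw]; exact congrFun hΦ ⟨w, hw⟩
  refine ⟨F, fun w hw => ?_, hFm, by rw [hFw 0 (by simp), hΦ0], hFg⟩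
  set e := chartAt ℂ (g w) with he
  have hmem : g w ∈ e.source := mem_chart_source ℂ _
  have hatl : e ∈ IsManifold.maximalAtlas 𝓘(ℂ) ω S := IsManifold.chart_mem_maximalAtlas _
  have hloc := hcov.isLocalHomeomorphOn (.mk (F w) (mem_ball_zero_iff.1 (hFm hw))) (by
    change ϖ (F w) ∈ Pᶜ
    grind)
  obtain ⟨f, hf, hfe⟩ := hloc
  have hN := isOpenEmbedding_coe_unitDisc.isOpenMap _ f.open_source
  have hFN : F w ∈ ((↑) : 𝔻 → ℂ) '' f.source := ⟨_, hf, rfl⟩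
  have hN' := hϖ.continuousOn.isOpen_inter_preimage isOpen_ball e.open_source
  refine (analyticAt_of_comp_eq (g := fun z => e (ϖ z)) (h := fun w => e (g w))
    (N := ((↑) : 𝔻 → ℂ) '' f.source ∩ (𝔹 ∩ ϖ ⁻¹' e.source))
    ?_ ((hϖ _ (hFm hw)).2 e hatl (by rw [hFg w hw]; exact hmem))
    ((hN.inter hN').mem_nhds ⟨hFN, hFm hw, by rw [Set.mem_preimage, hFg w hw]; exact hmem⟩) ?_
    ((hg w hw).2 e hatl hmem) ?_).differentiableAt.differentiableWithinAt
  · filter_upwards [isOpen_ball.mem_nhds hw] with w' hw'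
    exact hFc.continuousAt (isOpen_ball.mem_nhds hw')
  · rintro z ⟨⟨z, hz1, rfl⟩, -, hz2⟩ z' ⟨⟨z', hz1', rfl⟩, -, hz2'⟩ h
    have h1 : ϖ z = ϖ z' := e.injOn hz2 hz2' h
    have h2 : z = z' := f.injOn hz1 hz1' (by rw [← hfe]; exact h1)
    rw [h2]
  · filter_upwards [isOpen_ball.mem_nhds hw] with w' hw'
    rw [hFg w' hw']

/-- Normality of holomorphic maps to a hyperbolic surface: a family with values in a
compact set at the centre of the disk has continuous limits, without values in `P`. -/
lemma exists_limit_of_holOn (hyp : UniformizedByDisk S P) {K : Set S} (hK : IsCompact K)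
    (hKP : K ⊆ Pᶜ) {X : Type*} (𝒰 : Ultrafilter X) {g : X → ℂ → S}
    (hg : ∀ n, HolOn (g n) 𝔹)
    (hgP : ∀ n, ∀ w ∈ 𝔹, g n w ∈ Pᶜ) (h0 : ∀ n, g n 0 ∈ K) :
    ∃ G : ℂ → S, ∀ w ∈ 𝔹, G w ∉ P ∧ ∀ N ∈ 𝓝 (G w), ∃ δ > 0,
      ∀ᶠ n in (𝒰 : Filter X), ∀ w' ∈ ball w δ, g n w' ∈ N := by
  obtain ⟨ϖ, hϖm, hran, hcov⟩ := hyp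
  have hϖ := holOn_of_mdifferentiableOn isOpen_ball hϖm
  have hopen : IsOpenMap (fun w : 𝔻 => ϖ w) := by
    refine (isLocalHomeomorph_iff_isLocalHomeomorphOn_univ.2 ?_).isOpenMap
    have h := hcov.isLocalHomeomorphOn
    rwa [← hran, Set.preimage_range] at h
  obtain ⟨r, hr⟩ := hK.elim_directed_cover
    (fun r : Set.Iio (1 : ℝ) => (fun w : 𝔻 => ϖ w) '' {w : 𝔻 | ‖(w : ℂ)‖ < r})
    (fun r => hopen _ (isOpen_lt (by fun_prop) continuous_const))
    (fun x hx => by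
      obtain ⟨w, rfl⟩ := (hran ▸ hKP hx : x ∈ Set.range _)
      obtain ⟨r, h1, h2⟩ := exists_between w.norm_lt_one
      exact Set.mem_iUnion.2 ⟨⟨r, h2⟩, w, h1, rfl⟩)
    (directed_of_isDirected_le fun r r' h => Set.image_mono fun w hw => lt_of_lt_of_le (α := ℝ) hw h)
  have hz : ∀ n, ∃ z : 𝔻, ‖(z : ℂ)‖ < r ∧ ϖ z = g n 0 := fun n => by grind
  choose z hz1 hz2 using hz
  choose F hFd hFm hF0 hFg using fun n => exists_holomorphic_lift hϖ hcov (hg n) (hgP n) (hz2 n)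
  have hlim : ∀ w : ℂ, ∃ y : ℂ, w ∈ 𝔹 → ‖y‖ < 1 ∧ Tendsto (fun n => F n w) 𝒰 (𝓝 y) := fun w => by
    by_cases hw : w ∈ 𝔹
    swap
    · exact ⟨0, fun h => absurd h hw⟩
    have hw1 := mem_ball_zero_iff.1 hw
    have hr0 : 0 < 1 - r.1 ^ 2 := by
      obtain ⟨n⟩ : Nonempty X := nonempty_of_neBot (𝒰 : Filter X)
      have h1 : 0 ≤ r.1 := (norm_nonneg _).trans (hz1 n).le
      have h2 : r.1 < 1 := r.2
      nlinarith
    have hb : ∀ n, (1 - r.1 ^ 2) * (1 - ‖w‖) ^ 2 / 4 ≤ 1 - ‖F n w‖ ^ 2 := fun n => by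
      obtain ⟨y, hy1, hy2⟩ := exists_eq_mob_map_zero (hFd n) (hFm n) hw1
      have hr0 := hz1 n
      rw [← hF0] at hr0
      have h1 := norm_mob_sq norm_one (mem_ball_zero_iff.1 (hFm n (by simp : (0 : ℂ) ∈ _)))
        (hy1.trans hw1.le)
      rw [← hy2] at h1
      have h2 : ‖1 + conj (F n 0) * 1 * y‖ ≤ 2 := by
        refine (norm_add_le _ _).trans ?_
        rw [norm_one, norm_mul, mul_one, RCLike.norm_conj]
        have := mul_le_mul (hr0.le.trans (Set.mem_Iio.1 r.2).le) (hy1.trans hw1.le)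
          (norm_nonneg _) zero_le_one
        linarith
      have h3 : ‖1 + conj (F n 0) * 1 * y‖ ^ 2 ≤ 4 := by nlinarith [norm_nonneg (1 + conj (F n 0) * 1 * y)]
      have h4 : (1 - r.1 ^ 2) * (1 - ‖w‖) ^ 2 ≤ (1 - ‖F n 0‖ ^ 2) * (1 - ‖y‖ ^ 2) :=
        mul_le_mul (by nlinarith [norm_nonneg (F n 0)])
          (by nlinarith [norm_nonneg y, norm_nonneg w]) (by positivity)
          (by nlinarith [norm_nonneg (F n 0), Set.mem_Iio.1 r.2])
      have h5 : 0 ≤ 1 - ‖F n w‖ ^ 2 := by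
        have := mem_ball_zero_iff.1 (hFm n hw)
        nlinarith [norm_nonneg (F n w)]
      nlinarith [mul_le_mul_of_nonneg_left h3 h5]
    obtain ⟨y, -, hy⟩ := (isCompact_closedBall (0 : ℂ) 1).ultrafilter_le_nhds (𝒰.map fun n => F n w)
      (le_principal_iff.2 (show ∀ᶠ n in (𝒰 : Filter X), F n w ∈ _ from
        Eventually.of_forall fun n => ball_subset_closedBall (hFm n hw)))
    have hy : Tendsto (fun n => F n w) 𝒰 (𝓝 y) := hy
    refine ⟨y, fun _ => ⟨?_, hy⟩⟩
    have h1 := ge_of_tendsto' ((hy.norm.pow 2).const_sub 1) hb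
    have h2 : 0 < (1 - r.1 ^ 2) * (1 - ‖w‖) ^ 2 / 4 := by
      have : 0 < 1 - ‖w‖ := by linarith
      positivity
    nlinarith [norm_nonneg y]
  choose F' hF' using hlim
  refine ⟨fun w => ϖ (F' w), fun w hw => ⟨?_, fun N hN => ?_⟩⟩
  · have : ϖ (F' w) ∈ Set.range fun w : 𝔻 => ϖ w := ⟨.mk _ (hF' w hw).1, rfl⟩
    rw [hran] at this
    exact this
  · have h1 := (hϖ _ (mem_ball_zero_iff.2 (hF' w hw).1)).1 hN
    obtain ⟨ε, hε, hεN⟩ := Metric.mem_nhds_iff.1 h1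
    have hw1 := mem_ball_zero_iff.1 hw
    set R := 1 - ‖w‖ with hR
    have hR0 : 0 < R := by linarith
    have hsub : ball w R ⊆ 𝔹 := Metric.ball_subset_ball' (by rw [dist_zero_right]; linarith)
    refine ⟨min R (ε * R / 4), by positivity, ?_⟩
    filter_upwards [(hF' w hw).2.eventually (ball_mem_nhds _ (half_pos hε))] with n hn w' hw'
    have hw'R := ball_subset_ball (min_le_left _ _) hw'
    rw [← hFg n w' (hsub hw'R)]
    apply hεN
    have h2 := Complex.dist_le_div_mul_dist_of_mapsTo_ball (R₂ := 2) ((hFd n).mono hsub) (fun x hx => by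
      have h3 := mem_ball_zero_iff.1 (hFm n (hsub hx))
      have h4 := mem_ball_zero_iff.1 (hFm n hw)
      rw [mem_closedBall_iff_norm]
      exact (norm_sub_le _ _).trans (by linarith)) hw'R
    have h5 : dist w' w < ε * R / 4 := lt_of_lt_of_le hw' (min_le_right _ _)
    have h6 : 2 / R * dist w' w < ε / 2 := by rw [div_mul_eq_mul_div, div_lt_iff₀ hR0]; linarith
    have h7 := dist_triangle (F n w') (F n w) (F' w)
    rw [mem_ball]
    linarith

end Normality

/-! ### Limits of disks that lean on two punctures -/

section Compactness

variable [T2Space S] [IsManifold 𝓘(ℂ) ω S]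

/-- The map `u` does not lean on the punctures at `σ` if it factors, along the radius that ends
at `σ`, through the interior of another disk. -/
lemma not_leansAt_of_factor {u v : Q.DiskMap} {g : ℂ → ℂ} {σ : ℂ} (hσ : ‖σ‖ = 1)
    (hg : ∀ t : ℝ, 0 ≤ t → t ≤ 1 → AnalyticAt ℂ g (t * σ) ∧ ‖g (t * σ)‖ < 1)
    (h : ∀ᶠ w in 𝓝 0, extend u.1 w = extend v.1 (g w)) {p : S} (hp : p ∈ P) :
    ¬ LeansAt u σ p := fun hlean => by
  set W : Set ℂ := (fun t : ℝ => (t : ℂ) * σ) '' Set.Ico 0 1 with hW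
  have hc : Continuous fun t : ℝ => (t : ℂ) * σ := by fun_prop
  have hWc : IsPreconnected W := (convex_Ico (0 : ℝ) 1).isPreconnected.image _ hc.continuousOn
  have hmem : ∀ t : ℝ, t ∈ Set.Ico (0 : ℝ) 1 → (t : ℂ) * σ ∈ 𝔹 := fun t ht => by
    rw [mem_ball_zero_iff, norm_mul, hσ, norm_real, norm_of_nonneg ht.1, mul_one]
    grind
  have heq : Set.EqOn (extend u.1) (fun w => extend v.1 (g w)) W := by
    refine HolOn.eqOn ((DiskMap.holOn u).mono ?_) ((DiskMap.holOn v).comp (W' := W) ?_ ?_) hWc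
      (s0 := 0) ⟨0, by simp, by simp⟩ h
    · grind
    · rintro _ ⟨t, ht, rfl⟩; exact (hg t ht.1 ht.2.le).1
    · rintro _ ⟨t, ht, rfl⟩; exact mem_ball_zero_iff.2 (hg t ht.1 ht.2.le).2
  have hg1 := hg 1 zero_le_one le_rfl
  rw [ofReal_one, one_mul] at hg1
  have ht : Tendsto (fun t : ℝ => (t : ℂ) * σ) (𝓝[<] 1) (𝓝 σ) := by
    simpa using (hc.tendsto 1).mono_left nhdsWithin_le_nhds
  have hIco : ∀ᶠ t : ℝ in 𝓝[<] 1, t ∈ Set.Ico (0 : ℝ) 1 := Ico_mem_nhdsLT one_pos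
  refine hlean.not_of_curve hp (F := 𝓝[<] (1 : ℝ)) (γ := fun t : ℝ => (t : ℂ) * σ)
    (tendsto_nhdsWithin_iff.2 ⟨ht, hIco.mono hmem⟩)
    ((DiskMap.projOn v).notMem (mem_ball_zero_iff.2 hg1.2))
    ((((continuousAt_extend v.1 hg1.2).comp hg1.1.continuousAt).tendsto.comp ht).congr'
      (hIco.mono fun t ht => (heq ⟨t, ht, rfl⟩).symm))

/-- The disk leans on the punctures at `1` and at `-1`. -/
def LeansAtPair (u : Q.DiskMap) : Prop := 1 ∈ leanSet u ∧ -1 ∈ leanSet u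

/-- A disk that leans on the punctures at `1` and `-1` is not small at the centre. -/
lemma LeansAtPair.one_le {u v : Q.DiskMap} (hu : LeansAtPair u) {q d k : ℂ}
    (h : ∀ᶠ w in 𝓝 0, extend u.1 w = extend v.1 (nf q d k w)) : 1 ≤ ‖q‖ + ‖d‖ := by
  by_contra hcon
  rw [not_le] at hcon
  obtain ⟨σ, hσ, hσu, hk⟩ : ∃ σ : ℂ, ‖σ‖ = 1 ∧ σ ∈ leanSet u ∧ (k * σ).re ≤ 0 := by
    rcases le_total k.re 0 with h0 | h0
    · exact ⟨1, by simp, hu.1, by simpa⟩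
    · exact ⟨-1, by simp, hu.2, by simpa⟩
  obtain ⟨-, p, hp, hlean⟩ := hσu
  refine not_leansAt_of_factor hσ (g := nf q d k) (fun t ht0 ht1 => ?_) h hp hlean
  have h1 : 1 ≤ ‖1 - k * (t * σ)‖ := by
    refine le_trans ?_ (re_le_norm _)
    have : k * (t * σ) = (t : ℝ) * (k * σ) := by ring
    rw [sub_re, this, re_ofReal_mul, one_re]
    nlinarith
  have h2 : 1 - k * (t * σ) ≠ 0 := norm_pos_iff.1 (by linarith)
  refine ⟨by unfold nf; fun_prop (disch := assumption), ?_⟩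
  refine (norm_add_le _ _).trans_lt ?_
  have h3 : ‖d * (t * σ) / (1 - k * (t * σ))‖ ≤ ‖d‖ := by
    rw [norm_div, norm_mul, norm_mul, hσ, norm_real, norm_of_nonneg ht0, div_le_iff₀ (by linarith)]
    nlinarith [norm_nonneg d]
  linarith

/-- The limit behaviour of a family of projective maps near a point: in a projective coordinate
the maps are Möbius functions without pole in a common neighbourhood, and their parameters converge. -/
lemma exists_limit_nf [CompactSpace S] {X : Type*} {𝒰 : Ultrafilter X} {g : X → ℂ → S}
    {G : ℂ → S} (hg : ∀ n, Q.ProjOn id (g n) 𝔹) {w : ℂ}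
    (hw : w ∈ 𝔹)
    (hG : ∀ w ∈ 𝔹, G w ∉ P ∧ ∀ N ∈ 𝓝 (G w), ∃ δ > 0,
      ∀ᶠ n in (𝒰 : Filter X), ∀ w' ∈ ball w δ, g n w' ∈ N) :
    ∃ e ∈ Q.charts, G w ∈ e.source ∧ ∃ δ > 0, ∃ (q d k : X → ℂ) (d0 k0 : ℂ),
      Tendsto q 𝒰 (𝓝 (e (G w))) ∧ Tendsto d 𝒰 (𝓝 d0) ∧
      (∀ᶠ n in (𝒰 : Filter X), ∀ y : ℂ, ‖y‖ < δ → g n (w + y) ∈ e.source ∧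
        e (g n (w + y)) = nf (q n) (d n) (k n) y) ∧
      ∀ y : ℂ, ‖y‖ < δ → G (w + y) ∈ e.source ∧ 1 - k0 * y ≠ 0 ∧
        e (G (w + y)) = nf (e (G w)) d0 k0 y := by
  obtain ⟨e, he, hwe⟩ := Q.cover (G w) (hG w hw).1
  obtain ⟨N, hN, hNc, hNe⟩ := exists_mem_nhds_isClosed_subset (e.open_source.mem_nhds hwe)
  obtain ⟨δ0, hδ₀, hev⟩ := (hG w hw).2 N hN
  have hlim : ∀ w' ∈ 𝔹, Tendsto (fun n => g n w') 𝒰 (𝓝 (G w')) := fun w' hw' M hM => by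
    obtain ⟨η, hη, h⟩ := (hG w' hw').2 M hM
    exact h.mono fun n hn => hn w' (mem_ball_self hη)
  set δ := min δ0 (1 - ‖w‖) with hδdef
  have hw1 := mem_ball_zero_iff.1 hw
  have hδ : 0 < δ := lt_min hδ₀ (by linarith)
  have hsub : ball w δ ⊆ 𝔹 := Metric.ball_subset_ball' (by
    rw [dist_zero_right]; linarith [min_le_right δ0 (1 - ‖w‖)])
  have hy1 : ∀ y : ℂ, ‖y‖ < δ → w + y ∈ ball w δ := fun y hy => by
    rwa [mem_ball_iff_norm, add_sub_cancel_left]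
  have hev' : ∀ᶠ n in (𝒰 : Filter X), ∀ y : ℂ, ‖y‖ < δ → g n (w + y) ∈ N := hev.mono fun n hn y hy =>
    hn _ (ball_subset_ball (min_le_left _ _) (hy1 y hy))
  have hGN : ∀ y : ℂ, ‖y‖ < δ → G (w + y) ∈ e.source := fun y hy =>
    hNe (hNc.mem_of_tendsto (hlim _ (hsub (hy1 y hy))) (hev'.mono fun n hn => hn y hy))
  have hex : ∀ n, ∃ q d k : ℂ, (∀ y : ℂ, ‖y‖ < δ → g n (w + y) ∈ N) → ∀ y : ℂ, ‖y‖ < δ →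
      1 - k * y ≠ 0 ∧ e (g n (w + y)) = nf q d k y := fun n => by
    by_cases hn : ∀ y : ℂ, ‖y‖ < δ → g n (w + y) ∈ N
    swap
    · exact ⟨0, 0, 0, fun h => absurd h hn⟩
    obtain ⟨B, hB⟩ := ((hg n).mono hsub).exists_moebius (fun _ _ => analyticAt_id)
      (convex_ball w δ).isPreconnected ⟨w, mem_ball_self hδ⟩ he fun z hz => hNe (by
        have := hn (z - w) (mem_ball_iff_norm.1 hz)
        rwa [add_sub_cancel] at this)
    have htr : ∀ y : ℂ, MoebiusRel (mkGL 1 w 0 1 (by simp)) y (w + y) := fun y => by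
      rw [moebiusRel_mkGL]; simp [add_comm]
    have hB' : ∀ y : ℂ, ‖y‖ < δ → MoebiusRel (B * mkGL 1 w 0 1 (by simp)) y (e (g n (w + y))) :=
      fun y hy => (htr y).comp (hB _ (hy1 y hy))
    have h0 := (hB' 0 (by simpa using hδ)).1
    rw [mul_zero, zero_add] at h0
    exact ⟨_, _, _, fun _ y hy => eq_nf_of_moebiusRel h0 (hB' y hy)⟩
  choose q d k hqdk using hex
  have hk : ∀ᶠ n in (𝒰 : Filter X), ‖k n‖ ≤ 1 / δ := hev'.mono fun n hn => by
    by_contra hcon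
    rw [not_le, div_lt_iff₀ hδ] at hcon
    have hk0 : k n ≠ 0 := by rintro h0; rw [h0, norm_zero, zero_mul] at hcon; linarith
    refine (hqdk n hn (k n)⁻¹ ?_).1 ?_
    · rw [norm_inv, inv_lt_iff_one_lt_mul₀ (norm_pos_iff.2 hk0), mul_comm]; exact hcon
    · rw [mul_inv_cancel₀ hk0, sub_self]
  obtain ⟨k0, hk₀, hklim⟩ := (isCompact_closedBall (0 : ℂ) (1 / δ)).ultrafilter_le_nhds (𝒰.map k)
    (le_principal_iff.2 (show ∀ᶠ n in (𝒰 : Filter X), k n ∈ _ from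
      hk.mono fun n hn => mem_closedBall_zero_iff.2 hn))
  have hklim : Tendsto k 𝒰 (𝓝 k0) := hklim
  have hk₀y : ∀ y : ℂ, ‖y‖ < δ → 1 - k0 * y ≠ 0 := fun y hy h0 => by
    have h1 : ‖k0 * y‖ = 1 := by rw [← sub_eq_zero.1 h0, norm_one]
    rw [norm_mul] at h1
    rw [mem_closedBall_zero_iff, le_div_iff₀ hδ] at hk₀
    have : 0 < ‖k0‖ := by
      rcases (norm_nonneg k0).eq_or_lt with h | h
      · rw [← h, zero_mul] at h1; norm_num at h1
      · exact h
    nlinarith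
  have helim : ∀ y : ℂ, ‖y‖ < δ →
      Tendsto (fun n => e (g n (w + y))) 𝒰 (𝓝 (e (G (w + y)))) := fun y hy =>
    (e.continuousAt (hGN y hy)).tendsto.comp (hlim _ (hsub (hy1 y hy)))
  have hq : Tendsto q 𝒰 (𝓝 (e (G w))) := by
    have := helim 0 (by simpa using hδ)
    rw [add_zero] at this
    refine this.congr' (hev'.mono fun n hn => ?_)
    have h1 := (hqdk n hn 0 (by simpa using hδ)).2
    rwa [add_zero, nf_zero] at h1
  set y0 : ℂ := ((δ / 2 : ℝ) : ℂ) with hy₀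
  have hy₀δ : ‖y0‖ < δ := by rw [hy₀, norm_real, norm_of_nonneg (by positivity)]; linarith
  have hy₀0 : y0 ≠ 0 := by rw [hy₀]; exact_mod_cast (half_pos hδ).ne'
  have hd : Tendsto d 𝒰 (𝓝 ((e (G (w + y0)) - e (G w)) * (1 - k0 * y0) / y0)) := by
    refine ((((helim y0 hy₀δ).sub hq).mul ((hklim.mul_const y0).const_sub 1)).div_const y0).congr'
      (hev'.mono fun n hn => ?_)
    obtain ⟨h1, h2⟩ := hqdk n hn y0 hy₀δ
    rw [h2, nf, add_sub_cancel_left, div_mul_cancel₀ _ h1, mul_div_cancel_right₀ _ hy₀0]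
  refine ⟨e, he, hwe, δ, hδ, q, d, k, _, k0, hq, hd,
    hev'.mono fun n hn y hy => ⟨hNe (hn y hy), (hqdk n hn y hy).2⟩,
    fun y hy => ⟨hGN y hy, hk₀y y hy, tendsto_nhds_unique (helim y hy) ?_⟩⟩
  refine Tendsto.congr' (hev'.mono fun n hn => (hqdk n hn y hy).2.symm) ?_
  exact hq.add ((hd.mul_const y).div ((hklim.mul_const y).const_sub 1) (hk₀y y hy))

/-- Disks that lean on the punctures at `1` and `-1`, with centres in a compact set outside of the
punctures, have a limit, which is a maximal disk. -/
lemma exists_limit_of_leansAtPair [CompactSpace S] (hyp : UniformizedByDisk S P) {K : Set S}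
    (hK : IsCompact K) (hKP : K ⊆ Pᶜ) {X : Type*} (𝒰 : Ultrafilter X) {u : X → Q.DiskMap}
    (hu : ∀ n, LeansAtPair (u n)) (h0 : ∀ n, extend (u n).1 0 ∈ K) :
    ∃ v : Q.DiskMap, Tendsto u 𝒰 (𝓝 v) ∧ IsMaximal v := by
  obtain ⟨G, hG⟩ := exists_limit_of_holOn hyp hK hKP 𝒰 (fun n => DiskMap.holOn (u n))
    (fun n w hw => (DiskMap.projOn (u n)).notMem hw) h0
  have hGc : ∀ w ∈ 𝔹, ContinuousAt G w := fun w hw N hN => by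
    obtain ⟨M, hM, hMc, hMN⟩ := exists_mem_nhds_isClosed_subset hN
    obtain ⟨δ, hδ, hev⟩ := (hG w hw).2 M hM
    rw [mem_map]
    filter_upwards [ball_mem_nhds w hδ, isOpen_ball.mem_nhds hw] with w' h1 h2
    refine hMN (hMc.mem_of_tendsto (b := (𝒰 : Filter X)) (f := fun n => extend (u n).1 w') ?_
      (hev.mono fun n hn => hn w' h1))
    intro M' hM'
    obtain ⟨η, hη, h⟩ := (hG w' h2).2 M' hM'
    exact h.mono fun n hn => hn w' (mem_ball_self hη)
  have hloc := fun w hw => exists_limit_nf (fun n => DiskMap.projOn (u n)) (w := w) hw hG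
  -- near each point the limit is either projective or constant
  set A : Set ℂ := {w | ∃ e ∈ Q.charts, ∃ B : GL (Fin 2) ℂ, ∀ᶠ w' in 𝓝 w,
    G w' ∈ e.source ∧ MoebiusRel B w' (e (G w'))} with hA
  have hAo : IsOpen A := isOpen_iff_mem_nhds.2 fun w ⟨e, he, B, hB⟩ =>
    hB.eventually_nhds.mono fun w' h => ⟨e, he, B, h⟩
  have hnf : ∀ w : ℂ, ∀ e ∈ Q.charts, ∀ δ > 0, ∀ d k : ℂ, d ≠ 0 →
      (∀ y : ℂ, ‖y‖ < δ → G (w + y) ∈ e.source ∧ 1 - k * y ≠ 0 ∧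
        e (G (w + y)) = nf (e (G w)) d k y) → w ∈ A := fun w e he δ hδ d k hd h => by
    refine ⟨e, he, nfGL (e (G w)) k hd * mkGL 1 (-w) 0 1 (by simp), ?_⟩
    filter_upwards [ball_mem_nhds w hδ] with w' hw'
    obtain ⟨h1, h2, h3⟩ := h (w' - w) (mem_ball_iff_norm.1 hw')
    rw [add_sub_cancel] at h1 h3
    refine ⟨h1, MoebiusRel.comp (w := w' - w) ?_ ?_⟩
    · rw [moebiusRel_mkGL]; simp [sub_eq_add_neg]
    · rw [h3]; exact moebiusRel_nf hd h2
  have h0A : (0 : ℂ) ∈ A := by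
    obtain ⟨e, he, hse, δ, hδ, q, d, k, d0, k0, hq, hd, hev, hlim⟩ := hloc 0 (by simp)
    refine hnf 0 e he δ hδ d0 k0 ?_ hlim
    obtain ⟨ρ, hρ, hρe⟩ := Metric.isOpen_iff.1 e.open_target _ (e.map_source hse)
    have hm : ∀ w ∈ 𝔹, e (G 0) + ρ * w ∈ e.target := fun w hw => hρe (by
      rw [mem_ball_iff_norm, add_sub_cancel_left, norm_mul, norm_real, norm_of_nonneg hρ.le]
      nlinarith [mem_ball_zero_iff.1 hw])
    have hρ0 : (ρ : ℂ) ≠ 0 := by exact_mod_cast hρ.ne'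
    -- a small disk centred at the limit of the centres
    have hv : Q.ProjOn id (fun w => e.symm (e (G 0) + ρ * w)) 𝔹 := fun w hw =>
      ⟨ContinuousAt.comp (f := fun w => e (G 0) + ρ * w) (e.continuousAt_symm (hm w hw)) (by fun_prop),
        e, he, e.map_target (hm w hw), mkGL ρ (e (G 0)) 0 1 (by simpa using hρ0), by
          filter_upwards [isOpen_ball.mem_nhds hw] with w' hw'
          rw [moebiusRel_mkGL, e.right_inv (hm w' hw')]
          simp [add_comm]⟩
    have hle : ∀ᶠ n in (𝒰 : Filter X), 1 ≤ ‖(q n - e (G 0)) / ρ‖ + ‖d n / ρ‖ := by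
      have hq0 : Tendsto (fun n => (q n - e (G 0)) / ρ) 𝒰 (𝓝 0) := by
        have := (hq.sub_const (e (G 0))).div_const (ρ : ℂ)
        rwa [sub_self, zero_div] at this
      filter_upwards [hev, hq0.norm.eventually (gt_mem_nhds (show ‖(0 : ℂ)‖ < 1 by simp))] with n hn hn1
      refine (hu n).one_le (v := Q.diskMap _ hv) (k := k n) ?_
      have hc : ContinuousAt (nf ((q n - e (G 0)) / ρ) (d n / ρ) (k n)) 0 := by
        have : (1 : ℂ) - k n * 0 ≠ 0 := by simp
        unfold nf
        fun_prop (disch := assumption)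
      filter_upwards [ball_mem_nhds 0 hδ, hc.norm.eventually
        (gt_mem_nhds (show ‖nf _ _ _ 0‖ < 1 by rwa [nf_zero]))] with y hy hy1
      obtain ⟨h1, h2⟩ := hn y (mem_ball_zero_iff.1 hy)
      rw [zero_add] at h1 h2
      rw [extend_diskMap hv hy1, ← e.left_inv h1, h2]
      congr 1
      simp only [nf]; field_simp; ring
    have hle' := ge_of_tendsto ((((hq.sub_const (e (G 0))).div_const (ρ : ℂ)).norm).add
      (hd.div_const (ρ : ℂ)).norm) hle
    rw [sub_self, zero_div, norm_zero, zero_add] at hle'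
    rintro rfl
    rw [zero_div, norm_zero] at hle'
    linarith
  have hproj : 𝔹 ⊆ A := fun w hw => by
    by_contra hwA
    set A' : Set ℂ := {w | ∀ᶠ w' in 𝓝 w, G w' = G w} with hA'
    have hA'o : IsOpen A' := by
      refine isOpen_iff_mem_nhds.2 fun z hz => ?_
      filter_upwards [hz.eventually_nhds, hz] with z' h1 h2
      exact h1.mono fun y hy => hy.trans h2.symm
    have hcov : ∀ z ∈ 𝔹, z ∈ A ∪ A' := fun z hz => by
      obtain ⟨e, he, hse, δ, hδ, -, -, -, d0, k0, -, -, -, hlim⟩ := hloc z hz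
      by_cases hd₀ : d0 = 0
      · refine Or.inr ?_
        filter_upwards [ball_mem_nhds z hδ] with z' hz'
        obtain ⟨h1, -, h2⟩ := hlim (z' - z) (mem_ball_iff_norm.1 hz')
        rw [add_sub_cancel] at h1 h2
        exact e.injOn h1 hse (by rw [h2, hd₀, nf, zero_mul, zero_div, add_zero])
      · exact Or.inl (hnf z e he δ hδ d0 k0 hd₀ hlim)
    obtain ⟨z, -, ⟨e, he, B, hB⟩, hz⟩ := (convex_ball 0 1).isPreconnected A A' hAo hA'o hcov
      ⟨0, by simp, h0A⟩ ⟨w, hw, (hcov w hw).resolve_left hwA⟩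
    obtain ⟨r, hr, hball⟩ := eventually_nhds_iff_ball.1 (hB.and hz)
    have h1 := hball z (mem_ball_self hr)
    have hz' : z + (r / 2 : ℝ) ∈ ball z r := by
      rw [mem_ball_iff_norm, add_sub_cancel_left, norm_real, norm_of_nonneg (by positivity)]
      linarith
    have h2 := hball _ hz'
    have h3 := h2.1.2
    rw [h2.2] at h3
    have := h3.left_unique h1.1.2
    rw [add_eq_left, Complex.ofReal_eq_zero] at this
    linarith
  have hGproj : Q.ProjOn id G 𝔹 := fun w hw => by
    obtain ⟨e, he, B, hB⟩ := hproj hw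
    exact ⟨hGc w hw, e, he, hB.self_of_nhds.1, B, hB.mono fun _ h => h.2⟩
  set v := Q.diskMap G hGproj with hv
  have hlim : Tendsto u 𝒰 (𝓝 v) := by
    rw [tendsto_subtype_rng, ContinuousMap.tendsto_nhds_compactOpen]
    intro K' hK' O hO hvO
    have hcov : ∀ w ∈ K', ∃ N ∈ 𝓝[K'] w, ∀ᶠ n in (𝒰 : Filter X), Set.MapsTo (u n).1 N O := by
      intro w hw
      obtain ⟨δ, hδ, hev⟩ := (hG w (mem_ball_zero_iff.2 w.norm_lt_one)).2 O (hO.mem_nhds (hvO hw))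
      refine ⟨_, mem_nhdsWithin_of_mem_nhds (isOpenEmbedding_coe_unitDisc.continuous.continuousAt
        (ball_mem_nhds _ hδ)), hev.mono fun n hn w' hw' => ?_⟩
      rw [← extend_coe]
      exact hn _ hw'
    exact hK'.induction_on (p := fun s => ∀ᶠ n in (𝒰 : Filter X), Set.MapsTo (u n).1 s O)
      (Eventually.of_forall fun n => Set.mapsTo_empty _ _)
      (fun s t hst h => h.mono fun n hn => hn.mono_left hst)
      (fun s t h1 h2 => (h1.and h2).mono fun n hn => hn.1.union hn.2) hcov
  refine ⟨v, hlim, isMaximal_of_herm fun v' B hpos hB => ?_⟩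
  have key : ∀ σ : ℂ, ‖σ‖ = 1 → (∀ n, σ ∈ leanSet (u n)) → herm B σ = 0 := fun σ hσ hun => by
    have hnb := neBot_nhdsWithin_ball hσ.le
    have hnn : 0 ≤ herm B σ := by
      refine ge_of_tendsto (((continuous_herm B).tendsto σ).mono_left
        (nhdsWithin_le_nhds (s := 𝔹))) ?_
      filter_upwards [self_mem_nhdsWithin] with w hw
      exact (hpos w (mem_ball_zero_iff.1 hw)).le
    by_contra hne
    have hposσ := lt_of_le_of_ne hnn (Ne.symm hne)
    have hc : Continuous fun t : ℝ => (t : ℂ) * σ := by fun_prop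
    obtain ⟨η, hη, hthick⟩ := (isCompact_Icc.image hc : IsCompact ((fun t : ℝ => (t : ℂ) * σ) ''
      Set.Icc 0 1)).exists_thickening_subset_open (isOpen_lt continuous_const (continuous_herm B)) (by
        rintro _ ⟨t, ht, rfl⟩
        rcases ht.2.lt_or_eq with h1 | h1
        · refine hpos _ ?_
          rw [norm_mul, hσ, mul_one, norm_real, norm_of_nonneg ht.1]; exact h1
        · simpa [h1] using hposσ)
    obtain ⟨n, q, d, k, h1, h2, h3, h4, h5⟩ := (hlim.eventually (eventually_eq_nf v
      (show 0 < min (η / 5) (1 / 4) by positivity))).exists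
    obtain ⟨-, p, hp, hlean⟩ := hun n
    have hgan : ∀ z : ℂ, 0 < herm B z → AnalyticAt ℂ
        (fun w => (B 0 0 * w + B 0 1) / (B 1 0 * w + B 1 1)) z := fun z hz => by
      have := (moebiusRel_of_herm_pos hz).1
      fun_prop (disch := assumption)
    refine not_leansAt_of_factor hσ (v := v') (g := fun w =>
      (B 0 0 * nf q d k w + B 0 1) / (B 1 0 * nf q d k w + B 1 1)) (fun t ht0 ht1 => ?_) ?_ hp hlean
    · have htσ : ‖(t : ℂ) * σ‖ ≤ 1 := by rwa [norm_mul, hσ, mul_one, norm_real, norm_of_nonneg ht0]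
      obtain ⟨h6, h7⟩ := norm_nf_sub_le (min_le_right _ _) h1 h2 h3 htσ
      have h8 : 0 < herm B (nf q d k (t * σ)) := by
        refine hthick (Metric.mem_thickening_iff.2 ⟨_, ⟨t, ⟨ht0, ht1⟩, rfl⟩, ?_⟩)
        rw [dist_eq_norm]
        linarith [min_le_left (η / 5) (1 / 4)]
      refine ⟨AnalyticAt.fun_comp (f := nf q d k) (hgan _ h8) ?_,
        (herm_pos_iff (moebiusRel_of_herm_pos h8)).1 h8⟩
      unfold nf
      fun_prop (disch := assumption)
    · have hc0 : ContinuousAt (nf q d k) 0 := by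
        have : (1 : ℂ) - k * 0 ≠ 0 := by simp
        unfold nf
        fun_prop (disch := assumption)
      have h9 : ‖nf q d k 0‖ < 1 := by rw [nf_zero]; linarith [min_le_right (η / 5) (1 / 4)]
      filter_upwards [h5, hc0.norm.eventually (gt_mem_nhds h9)] with w h10 h11
      obtain ⟨y, h12, h13⟩ := hB _ h11
      rw [h10, h13, h12.2]
  exact ⟨key 1 (by simp) fun n => (hu n).1, key (-1) (by simp) fun n => (hu n).2⟩

end Compactness

/-! ### Finiteness of the set of vertices -/

section Vertices

variable [T2Space S] [IsManifold 𝓘(ℂ) ω S]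

/-- The projective structures of the theorem: finitely many punctures, each of which has a
cuspidal model, on a surface covered by the unit disk, and such that the maximal disks extend
continuously to the closed disk. -/
class Tame (Q : ProjectiveStructure S P) : Prop where
  finite : P.Finite
  cusp : ∀ p ∈ P, Nonempty (CuspModel Q p)
  unif : UniformizedByDisk S P
  ext : ∀ u : Q.DiskMap, IsMaximal u → Q.ExtendsToClosedDisk u

lemma IsMaximal.collar [Tame Q] {u : Q.DiskMap} (h : IsMaximal u) : Nonempty (Collar u) :=
  exists_collar Tame.cusp (Tame.ext u h)

lemma LeansAtPair.isMaximal {u : Q.DiskMap} (h : LeansAtPair u) : IsMaximal u := by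
  refine isMaximal_of_two_le ?_
  have h1 : (1 : Circle) ∈ Q.leanPoints u := coe_mem_leanSet.1 (by simpa using h.1)
  have h2 : (-1 : Circle) ∈ Q.leanPoints u := coe_mem_leanSet.1 (by simpa using h.2)
  rw [← one_add_one_eq_two, ENat.add_one_le_iff (by simp), Set.one_lt_encard_iff]
  refine ⟨1, -1, h1, h2, fun h => ?_⟩
  have := congrArg (fun z : Circle => (z : ℂ).re) h
  norm_num at this

lemma mem_leanSet_mob {u : Q.DiskMap} {l q : ℂ} (hl : ‖l‖ = 1) (hq : ‖q‖ < 1) {a : ℂ}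
    (ha : ‖a‖ = 1) : a ∈ leanSet (u.mob hl hq) ↔ mob l q a ∈ leanSet u := by
  simp only [leanSet, Set.mem_ofPred_eq, ha, norm_mob_eq_one hl hq ha, true_and,
    leansAt_mob_iff hl hq ha.le]

lemma tendsto_add_stripEnd {a b a' b' y : ℝ} (ha : a' ≤ a + y) (hb : b + y ≤ b') :
    Tendsto (fun s : ℂ => s + y * I) (stripEnd a b) (stripEnd a' b') := by
  refine tendsto_inf.2 ⟨tendsto_comap_iff.2 ?_, tendsto_principal.2 ?_⟩
  · exact (tendsto_re_stripEnd a b).congr fun s => by simp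
  · filter_upwards [eventually_mem_halfStrip 0 a b] with s hs
    simp only [add_im, mul_im, ofReal_re, I_im, ofReal_im, I_re]
    constructor <;> linarith [hs.2.1, hs.2.2]

/-- The geodesic between the two points at which a disk leans on the punctures does not stay
close to the punctures. -/
lemma exists_compact_of_leansAtPair [CompactSpace S] [Tame Q] : ∃ K : Set S, IsCompact K ∧
    K ⊆ Pᶜ ∧ ∀ u : Q.DiskMap, LeansAtPair u → ∃ x : ℝ, extend u.1 (cay (x + π / 2 * I)) ∈ K := by
  have hpi := pi_pos
  obtain ⟨V, hV, hVd⟩ := (Tame.finite Q).t2_separation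
  have hM : ∀ p ∈ P, ∃ M : Set S, IsOpen M ∧ p ∈ M ∧ M ⊆ V p ∧
      ∃ K : CuspModel Q p, ∀ x ∈ M, x ∈ (chartAt ℂ p).source ∧
      ‖chartAt ℂ p x - chartAt ℂ p p‖ < Real.exp K.R := fun p hp => by
    obtain ⟨K⟩ := Tame.cusp (Q := Q) p hp
    obtain ⟨N, hN, hNo, hpN⟩ := eventually_nhds_iff.1 K.eventually_chart_ball
    exact ⟨N ∩ V p, hNo.inter (hV p).2, ⟨hpN, (hV p).1⟩, Set.inter_subset_right,
      K, fun x hx => hN x hx.1⟩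
  choose! M hMo hpM hMV hMK using hM
  refine ⟨(⋃ p ∈ P, M p)ᶜ, (isOpen_biUnion hMo).isClosed_compl.isCompact,
    Set.compl_subset_compl.2 fun p hp => Set.mem_biUnion hp (hpM p hp), fun u hu => ?_⟩
  by_contra hcon
  simp only [Set.mem_compl_iff, not_exists, not_not] at hcon
  have hdisj : ∀ p ∈ P, ∀ p' ∈ P, ∀ x, x ∈ M p → x ∈ M p' → p = p' := fun p hp p' hp' x h1 h2 =>
    hVd.elim hp hp' (Set.not_disjoint_iff.2 ⟨x, hMV p hp h1, hMV p' hp' h2⟩)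
  set U : ℂ → S := fun s => extend u.1 (cay s) with hU
  have hUp := projOn_strip u
  have hUc : ContinuousOn U (strip π) := fun s hs => (hUp s hs).1.continuousWithinAt
  have hmid : ∀ x : ℝ, (x : ℂ) + π / 2 * I ∈ strip π := fun x => by
    constructor <;> simp <;> linarith
  have hcc : Continuous fun x : ℝ => U (x + π / 2 * I) := hUc.comp_continuous (by fun_prop) hmid
  -- by connectedness only one puncture is involved
  obtain ⟨p, hp, hp0⟩ := Set.mem_iUnion₂.1 (hcon 0)
  have hline : ∀ x : ℝ, U (x + π / 2 * I) ∈ M p := by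
    have hcl : IsClopen {x : ℝ | U (x + π / 2 * I) ∈ M p} := by
      refine ⟨⟨?_⟩, (hMo p hp).preimage hcc⟩
      have : {x : ℝ | U (x + π / 2 * I) ∈ M p}ᶜ =
          ⋃ p' ∈ P \ {p}, {x : ℝ | U (x + π / 2 * I) ∈ M p'} := by
        ext x
        simp only [Set.mem_compl_iff, Set.mem_ofPred_eq, Set.mem_iUnion, Set.mem_sdiff,
          Set.mem_singleton_iff, exists_prop]
        constructor
        · intro h
          obtain ⟨p', hp', h'⟩ := Set.mem_iUnion₂.1 (hcon x)
          exact ⟨p', ⟨hp', fun h0 => h (h0 ▸ h')⟩, h'⟩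
        · rintro ⟨p', ⟨hp', hne⟩, h'⟩ h
          exact hne (hdisj p' hp' p hp _ h' h)
      rw [this]
      exact isOpen_biUnion fun p' hp' => (hMo p' hp'.1).preimage hcc
    intro x
    have h : x ∈ {x : ℝ | U (x + π / 2 * I) ∈ M p} := by rw [hcl.eq_univ ⟨0, hp0⟩]; trivial
    exact h
  obtain ⟨-, p1, hp1, h1⟩ := hu.1
  obtain ⟨-, p2, hp2, h2⟩ := hu.2
  rw [leansAt_one_iff] at h1
  rw [leansAt_neg_one_iff] at h2
  obtain ⟨R1, hR1⟩ := eventually_stripEnd.1 (h1.eventually ((hMo p1 hp1).mem_nhds (hpM p1 hp1)))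
  obtain ⟨R2, hR2⟩ := eventually_stripEnd.1 (h2.eventually ((hMo p2 hp2).mem_nhds (hpM p2 hp2)))
  have hmem : ∀ R x : ℝ, R < x → (x : ℂ) + π / 2 * I ∈ halfStrip R 0 π :=
    fun R x h => ⟨by simpa using h, hmid x⟩
  obtain rfl : p1 = p := hdisj _ hp1 _ hp _ (hR1 _ (hmem R1 (R1 + 1) (lt_add_one _))) (hline _)
  obtain rfl : p2 = p1 := by
    refine hdisj _ hp2 _ hp _ (hR2 _ (hmem R2 (R2 + 1) (lt_add_one _))) ?_
    have := hline (-(R2 + 1))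
    have e : (π * I - (((R2 + 1 : ℝ) : ℂ) + π / 2 * I))
        = ((-(R2 + 1) : ℝ) : ℂ) + π / 2 * I := by push_cast; ring
    rw [e]
    exact this
  -- a tube around the geodesic
  set O := strip π ∩ U ⁻¹' M p2 with hO
  have hOo : IsOpen O := hUc.isOpen_inter_preimage (isOpen_strip _) (hMo _ hp)
  set R := max R1 R2
  have hseg : Continuous fun x : ℝ => (x : ℂ) + π / 2 * I := by fun_prop
  obtain ⟨η, hη, hthick⟩ := ((isCompact_Icc (a := -R) (b := R)).image
    hseg).exists_thickening_subset_open hOo (by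
      rintro _ ⟨x, -, rfl⟩
      exact ⟨hmid x, hline x⟩)
  set η' := min η (π / 4) with hη'
  have hη0 : 0 < η' := by positivity
  have hη2 : η' ≤ π / 4 := min_le_right _ _
  have htube : ∀ s : ℂ, π / 2 - η' < s.im → s.im < π / 2 + η' → U s ∈ M p2 := fun s hs1 hs2 => by
    rcases lt_or_ge R s.re with h | h
    · exact hR1 s ⟨(le_max_left _ _).trans_lt h, by linarith, by linarith⟩
    rcases lt_or_ge s.re (-R) with h' | h'
    · have := hR2 (π * I - s) ⟨by simp; linarith [le_max_right R1 R2],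
        by simp; linarith, by simp; linarith⟩
      rwa [sub_sub_cancel] at this
    · refine (hthick (Metric.mem_thickening_iff.2 ⟨_, ⟨s.re, ⟨h', h⟩, rfl⟩, ?_⟩)).2
      have e : s - (s.re + π / 2 * I) = ((s.im - π / 2 : ℝ) : ℂ) * I := by
        apply Complex.ext <;> simp
      rw [dist_eq_norm, e, norm_mul, Complex.norm_I, mul_one, norm_real, norm_eq_abs, abs_lt]
      constructor <;> linarith [min_le_left η (π / 4)]
  have hsub : {s : ℂ | π / 2 - η' < s.im ∧ s.im < π / 2 + η'} ⊆ strip π :=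
    fun s hs => ⟨by linarith [hs.1], by linarith [hs.2]⟩
  obtain ⟨κ, hκ⟩ := hMK p2 hp
  refine κ.not_tendsto_both_ends hp (show π / 2 - η' < π / 2 + η' by linarith) (hUp.mono hsub)
    (fun s hs1 hs2 => hκ _ (htube s hs1 hs2)) ?_ ?_
  · exact h1.mono_left (inf_le_inf_left _ (principal_mono.2 hsub))
  · refine (h2.comp (tendsto_add_stripEnd (y := π) ?_ ?_)).congr fun s => ?_
    · linarith
    · linarith
    · simp only [Function.comp_apply]
      congr 2; ring

lemma cay_pi_half : cay (π / 2 * I) = 0 := by rw [cay, exp_pi_half, sub_self, zero_div]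

/-- The translation of the disk along the geodesic between `-1` and `1`. -/
def ProjectiveStructure.DiskMap.trans (u : Q.DiskMap) (r : ℝ) : Q.DiskMap :=
  u.mob (l := 1) (by simp) (abs_tanh_lt_one r)

lemma extend_trans (u : Q.DiskMap) (r : ℝ) {s : ℂ} (hs : s ∈ strip π) :
    extend (u.trans r).1 (cay s) = extend u.1 (cay (s + r)) := by
  rw [DiskMap.trans, extend_mob _ _ _ (norm_cay_lt_one hs.1 hs.2),
    cay_add_real (by linarith [hs.1, pi_pos]) (by linarith [hs.2, pi_pos])]

lemma mob_real_one {r : ℝ} (hr : ‖(r : ℂ)‖ < 1) : mob 1 r 1 = 1 ∧ mob 1 r (-1) = -1 := by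
  have h1 := mob_denom_ne_zero (l := 1) (by simp) hr (w := 1) (by simp)
  have h2 := mob_denom_ne_zero (l := 1) (by simp) hr (w := -1) (by simp)
  simp only [mob, conj_ofReal] at h1 h2 ⊢
  grind

lemma LeansAtPair.trans {u : Q.DiskMap} (h : LeansAtPair u) (r : ℝ) : LeansAtPair (u.trans r) := by
  obtain ⟨h1, h2⟩ := mob_real_one (abs_tanh_lt_one r)
  refine ⟨(mem_leanSet_mob _ _ (by simp)).2 ?_, (mem_leanSet_mob _ _ (by simp)).2 ?_⟩
  · rw [h1]; exact h.1
  · rw [h2]; exact h.2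

lemma LeansAtPair.three_le_iff {u : Q.DiskMap} (h : LeansAtPair u) :
    3 ≤ (Q.leanPoints u).encard ↔ ∃ ζ ∈ leanSet u, ζ ≠ 1 ∧ ζ ≠ -1 := by
  have hpair : ({1, -1} : Set ℂ).encard = 2 := Set.encard_pair (by norm_num)
  have hcard : (leanSet u).encard = (Q.leanPoints u).encard := by
    rw [leanSet_eq]; exact Function.Injective.encard_image (fun a b h => Circle.ext h) _
  rw [← hcard]
  constructor
  · intro h3
    by_contra hcon
    push Not at hcon
    have hsub : leanSet u ⊆ {1, -1} := fun z hz => by grind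
    have := h3.trans (Set.encard_le_encard hsub)
    rw [hpair] at this
    norm_num at this
  · rintro ⟨ζ, hζ, h1, h2⟩
    have h3 : ({ζ, 1, -1} : Set ℂ).encard = 3 := by
      rw [Set.encard_insert_of_notMem (by simp [h1, h2]), hpair]; norm_num
    rw [← h3]
    refine Set.encard_le_encard ?_
    rintro z (rfl | rfl | rfl)
    exacts [hζ, h.1, h.2]

/-- There are finitely many disks that lean on the punctures at least three times. -/
lemma finite_vertices [CompactSpace S] [Tame Q] :
    {x : Q.Disk | ∃ u : Q.DiskMap, Q.toDisk u = x ∧ 3 ≤ (Q.leanPoints u).encard}.Finite := by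
  by_contra hinf
  rw [← Set.Infinite] at hinf
  set X := {x : Q.Disk | ∃ u : Q.DiskMap, Q.toDisk u = x ∧ 3 ≤ (Q.leanPoints u).encard} with hX
  have : Infinite X := hinf.to_subtype
  obtain ⟨K, hK, hKP, hKu⟩ := exists_compact_of_leansAtPair (Q := Q)
  have hrep : ∀ x : X, ∃ u : Q.DiskMap, Q.toDisk u = x ∧ LeansAtPair u ∧ extend u.1 0 ∈ K ∧
      ∃ ζ : ℂ, ‖ζ‖ = 1 ∧ ζ ≠ 1 ∧ ζ ≠ -1 ∧ ζ ∈ leanSet u := by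
    rintro ⟨x, u, rfl, hu⟩
    have hu3 := hu
    obtain ⟨a, b, ha, hb, hab⟩ := Set.one_lt_encard_iff.1 (lt_of_lt_of_le (by norm_num) hu)
    obtain ⟨l, q, hl, hq, h1, h2⟩ := exists_mob_pair a.norm_coe b.norm_coe
      (fun h => hab (Circle.ext h))
    have hu' : LeansAtPair (u.mob hl hq) :=
      ⟨(mem_leanSet_mob _ _ (by simp)).2 (h1 ▸ coe_mem_leanSet.2 ha),
        (mem_leanSet_mob _ _ (by simp)).2 (h2 ▸ coe_mem_leanSet.2 hb)⟩
    obtain ⟨r, hr⟩ := hKu _ hu'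
    refine ⟨(u.mob hl hq).trans r, (toDisk_mob _ _ _).trans (toDisk_mob _ _ _), hu'.trans r, ?_, ?_⟩
    · have := extend_trans (u.mob hl hq) r (s := π / 2 * I)
        (by constructor <;> simp <;> linarith [pi_pos])
      rw [cay_pi_half] at this
      rwa [this, add_comm]
    · refine ((hu'.trans r).three_le_iff.1 ?_).imp fun ζ h => ⟨h.1.1, h.2.1, h.2.2, h.1⟩
      rw [DiskMap.trans, encard_leanPoints_mob, encard_leanPoints_mob]; exact hu3
  choose u hux hup huK ζ hζ hζ1 hζ2 hζu using hrep
  set 𝒰 := hyperfilter X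
  obtain ⟨v, hv, hmax⟩ := exists_limit_of_leansAtPair (Tame.unif Q) hK hKP 𝒰 hup huK
  obtain ⟨C⟩ := hmax.collar
  have hc := C.c_pos
  -- near `v` there is only one disk with three leaning points
  have hall : ∀ᶠ n in (𝒰 : Filter X), Q.toDisk (u n) = Q.toDisk v := by
    filter_upwards [hv.eventually (eventually_eq_nf v (show 0 < C.c / 20 by positivity))] with n hn
    obtain ⟨q, d, k, h1, h2, h3, hd0, h4⟩ := hn
    obtain ⟨h5, h6⟩ := C.near le_rfl h1 h2 h3 hd0 h4
    set A := nfGL q k hd0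
    have hrel : ∀ w : ℂ, ‖w‖ ≤ 1 → MoebiusRel A w (nf q d k w) := fun w hw =>
      moebiusRel_nf hd0 (norm_nf_sub_le (by linarith [C.c_le]) h1 h2 h3 hw).1
    have hz : ∀ σ : ℂ, ‖σ‖ = 1 → σ ∈ leanSet (u n) → herm A σ = 0 := fun σ h7 h8 =>
      (herm_eq_zero_iff (hrel σ h7.le)).2 ((h6 σ h7).1 h8).1
    have e1 := hz 1 (by simp) (hup n).1
    have e2 := hz (-1) (by simp) (hup n).2
    have e3 := hz _ (hζ n) (hζu n)
    have e4 : 0 < herm A 0 := (herm_pos_iff (hrel 0 (by simp))).2 (by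
      rw [nf_zero]; linarith [C.c_le])
    rw [herm_eq] at e1 e2 e3 e4
    simp only [mul_one, norm_one, one_pow, mul_neg, norm_neg, neg_re, mul_zero,
      zero_re, norm_zero, add_zero, ne_eq, OfNat.ofNat_ne_zero, not_false_eq_true,
      zero_pow, hζ n] at e1 e2 e3 e4
    have hy : conj (A 1 1) * A 1 0 - conj (A 0 1) * A 0 0 = 0 := by
      set y := conj (A 1 1) * A 1 0 - conj (A 0 1) * A 0 0
      have hre : y.re = 0 := by linarith
      rw [mul_re, hre] at e3
      have hmul : y.im * (ζ n).im = 0 := by linarith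
      refine Complex.ext hre ((mul_eq_zero.1 hmul).resolve_right fun h => ?_)
      have h7 := sq_norm (ζ n)
      rw [hζ, normSq_apply, h] at h7
      rcases mul_eq_zero.1 (show ((ζ n).re - 1) * ((ζ n).re + 1) = 0 by linarith) with h8 | h8
      · exact hζ1 n (Complex.ext (by simpa [sub_eq_zero] using h8) (by simpa using h))
      · exact hζ2 n (Complex.ext (by simpa using eq_neg_of_add_eq_zero_left h8) (by simpa using h))
    rw [hy, zero_re] at e1
    obtain ⟨l, q', hl, hq', hmob⟩ := exists_mob_of_herm e4 rfl (by linarith) (sub_eq_zero.1 hy)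
    have heq : u n = v.mob hl hq' := DiskMap.ext_of_extend fun w hw => by
      have h7 := hmob w _ (hrel w hw.le)
      rw [(h5 w hw).2, extend_mob _ _ _ hw, h7, C.eq _ (norm_mob_lt_one hl hq' hw)]
    rw [heq, toDisk_mob]
  obtain ⟨n, hn⟩ := hall.exists
  have hne : ∀ᶠ m in (𝒰 : Filter X), m ≠ n :=
    hyperfilter_le_cofinite (Set.finite_singleton n).compl_mem_cofinite
  obtain ⟨m, hm, hmn⟩ := (hall.and hne).exists
  exact hmn (Subtype.ext (by rw [← hux m, ← hux n, hm, hn]))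

end Vertices

/-! ### Extensions in strip coordinates -/

section Flows

lemma eq_one_or_of_im_eq_zero {ζ : ℂ} (hζ : ‖ζ‖ = 1) (h : ζ.im = 0) : ζ = 1 ∨ ζ = -1 := by
  have h1 := sq_norm ζ
  rw [hζ, normSq_apply, h] at h1
  rcases mul_eq_zero.1 (show (ζ.re - 1) * (ζ.re + 1) = 0 by linarith) with h2 | h2
  · exact Or.inl (Complex.ext (by simpa [sub_eq_zero] using h2) (by simpa using h))
  · exact Or.inr (Complex.ext (by simpa using eq_neg_of_add_eq_zero_left h2) (by simpa using h))

/-- The open lower and upper half circles in the coordinate of the strip. -/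
lemma exists_cay_of_norm_eq_one {ζ : ℂ} (hζ : ‖ζ‖ = 1) :
    (ζ.im < 0 → ∃ s : ℂ, s.im = 0 ∧ cay s = ζ) ∧ (0 < ζ.im → ∃ s : ℂ, s.im = π ∧ cay s = ζ) := by
  have hne : ζ.im ≠ 0 → ζ ≠ 1 ∧ ζ ≠ -1 := fun h =>
    ⟨by rintro rfl; simp at h, by rintro rfl; simp at h⟩
  have him : (stripLog ζ).im = ((1 + ζ) / (1 - ζ)).arg + π / 2 := by
    rw [stripLog, add_im, log_im]; simp
  have h1 := sq_norm ζ
  rw [hζ, normSq_apply] at h1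
  have hre : ((1 + ζ) / (1 - ζ)).re = 0 := by
    rw [div_re, ← add_div]
    simp only [add_re, sub_re, add_im, sub_im, one_re, one_im]
    grind
  have him2 : ((1 + ζ) / (1 - ζ)).im = 2 * ζ.im / normSq (1 - ζ) := by
    rw [Complex.div_im, ← sub_div]
    simp only [add_re, sub_re, add_im, sub_im, one_re, one_im]
    ring
  have hpos : ζ.im ≠ 0 → 0 < normSq (1 - ζ) := fun h => normSq_pos.2 (sub_ne_zero.2 (hne h).1.symm)
  constructor
  · intro h
    refine ⟨stripLog ζ, ?_, cay_stripLog (hne h.ne).1 (hne h.ne).2⟩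
    rw [him, Complex.arg_eq_neg_pi_div_two_iff.2 ⟨hre, ?_⟩]
    · ring
    · rw [him2]; exact div_neg_of_neg_of_pos (by linarith) (hpos h.ne)
  · intro h
    refine ⟨stripLog ζ, ?_, cay_stripLog (hne h.ne').1 (hne h.ne').2⟩
    rw [him, Complex.arg_eq_pi_div_two_iff.2 ⟨hre, ?_⟩]
    · ring
    · rw [him2]; exact div_pos (by linarith) (hpos h.ne')

lemma projOn_add {U : ℂ → S} {W W' : Set ℂ} (hU : Q.ProjOn exp U W) (z : ℂ)
    (hW : ∀ s ∈ W', s + z ∈ W) : Q.ProjOn exp (fun s => U (s + z)) W' :=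
  (hU.comp (g := fun s => s + z) (fun _ _ => by fun_prop) hW).change fun s _ =>
    ⟨mkGL (exp z) 0 0 1 (by simp), Eventually.of_forall fun s' => by
      rw [moebiusRel_mkGL]; simp [exp_add, mul_comm]⟩

lemma projOn_sub {U : ℂ → S} {W W' : Set ℂ} (hU : Q.ProjOn exp U W) (z : ℂ)
    (hW : ∀ s ∈ W', z - s ∈ W) : Q.ProjOn exp (fun s => U (z - s)) W' :=
  (hU.comp (g := fun s => z - s) (fun _ _ => by fun_prop) hW).change fun s _ =>
    ⟨mkGL 0 (exp z) 1 0 (by simp), Eventually.of_forall fun s' => by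
      rw [moebiusRel_mkGL]; simp [exp_sub]⟩

/-- `U` extends the map `u`, in the coordinate of the strip, to a strip of width `b`. -/
structure StripExt (u : Q.DiskMap) (b : ℝ) (U : ℂ → S) : Prop where
  le : π ≤ b
  proj : Q.ProjOn exp U (strip b)
  eq : ∀ s ∈ strip π, U s = extend u.1 (cay s)

variable {u : Q.DiskMap} {b b' : ℝ} {U U' : ℂ → S}

lemma StripExt.holOn (E : StripExt u b U) : HolOn U (strip b) := E.proj.holOn fun s _ => by fun_prop

lemma mem_strip_add {b θ : ℝ} {s : ℂ} : s + θ * I ∈ strip b ↔ 0 < s.im + θ ∧ s.im + θ < b := by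
  simp [strip]

/-- The disk in the strip of height `θ` above the one of `u`. -/
def StripExt.shift (E : StripExt u b U) {θ : ℝ} (h0 : 0 ≤ θ) (h1 : π + θ ≤ b) : Q.DiskMap :=
  Q.ofStrip (fun s => U (s + θ * I)) (projOn_add E.proj _ fun _ hs =>
    mem_strip_add.2 ⟨by linarith [hs.1], by linarith [hs.2]⟩)

lemma StripExt.extend_shift (E : StripExt u b U) {θ : ℝ} (h0 : 0 ≤ θ) (h1 : π + θ ≤ b)
    {s : ℂ} (hs : s ∈ strip π) :
    extend (E.shift h0 h1).1 (cay s) = U (s + θ * I) := extend_ofStrip_cay _ hs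

lemma DiskMap.ext_of_strip {u v : Q.DiskMap}
    (h : ∀ s ∈ strip π, extend u.1 (cay s) = extend v.1 (cay s)) : u = v :=
  DiskMap.ext_of_extend fun w hw => by
    have := h _ (im_stripLog hw)
    rwa [cay_stripLog (ne_of_norm_lt_one hw).1 (ne_of_norm_lt_one hw).2] at this

lemma pi_half_mem_strip : (π / 2 * I : ℂ) ∈ strip π := by
  constructor <;> simp <;> linarith [pi_pos]

/-- A disk given by a map of the strip that is continuous at the boundary point `s` does not lean
on the punctures there. -/
lemma not_leansAt_ofStrip [T2Space S] (hU : Q.ProjOn exp U (strip π)) {s : ℂ}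
    (h0 : 0 ≤ s.im) (h1 : s.im ≤ π) (hc : ContinuousAt U s) (hs : U s ∉ P) :
    cay s ∉ leanSet (Q.ofStrip U hU) := by
  rintro ⟨-, p, hp, hlean⟩
  have hpi := pi_pos
  set γ : ℝ → ℂ := fun t => s + t * ((π / 2 - s.im : ℝ) : ℂ) * I
  have hγ : Tendsto γ (𝓝[>] 0) (𝓝 s) := by
    have : Continuous γ := by fun_prop
    simpa [γ] using (this.tendsto 0).mono_left nhdsWithin_le_nhds
  have hm : ∀ᶠ t in 𝓝[>] (0 : ℝ), γ t ∈ strip π := by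
    filter_upwards [Ioo_mem_nhdsGT one_pos] with t ht
    have him : (γ t).im = s.im + t * (π / 2 - s.im) := by simp [γ]
    refine ⟨?_, ?_⟩ <;> rw [him] <;> nlinarith [ht.1, ht.2]
  have hcay : ContinuousAt cay s := (analyticAt_cay (by linarith) (by linarith)).continuousAt
  refine hlean.not_of_curve hp (γ := fun t => cay (γ t))
    (tendsto_nhdsWithin_iff.2 ⟨hcay.tendsto.comp hγ, hm.mono fun t ht =>
      mem_ball_zero_iff.2 (norm_cay_lt_one ht.1 ht.2)⟩) hs ?_
  exact (hc.tendsto.comp hγ).congr' (hm.mono fun t ht => (extend_ofStrip_cay hU ht).symm)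

lemma StripExt.notMem_leanSet [T2Space S] (E : StripExt u b U) {θ : ℝ} (h0 : 0 ≤ θ)
    (h1 : π + θ ≤ b) {ζ : ℂ} (h : 0 < θ ∧ ζ.im < 0 ∨ π + θ < b ∧ 0 < ζ.im) :
    ζ ∉ leanSet (E.shift h0 h1) := fun hζ => by
  have key : ∀ s : ℂ, 0 ≤ s.im → s.im ≤ π → s + θ * I ∈ strip b → cay s ≠ ζ := by
    rintro s h2 h3 h4 rfl
    exact not_leansAt_ofStrip _ h2 h3 (ContinuousAt.comp (f := fun s => s + θ * I)
      (E.proj _ h4).1 (by fun_prop)) (E.proj.notMem h4) hζ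
  have hpi := pi_pos
  rcases h with ⟨h2, h3⟩ | ⟨h2, h3⟩
  · obtain ⟨s, hs, hsζ⟩ := (exists_cay_of_norm_eq_one hζ.1).1 h3
    exact key s hs.ge (by linarith) (mem_strip_add.2 ⟨by linarith, by linarith⟩) hsζ
  · obtain ⟨s, hs, hsζ⟩ := (exists_cay_of_norm_eq_one hζ.1).2 h3
    exact key s (by linarith) hs.le (mem_strip_add.2 ⟨by linarith, by linarith⟩) hsζ

variable [T2Space S] [IsManifold 𝓘(ℂ) ω S]

lemma StripExt.eqOn (E : StripExt u b U) (E' : StripExt u b' U') :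
    Set.EqOn U U' (strip (min b b')) := by
  refine HolOn.eqOn (s0 := π / 2 * I) (E.holOn.mono fun s hs => ?_)
    (E'.holOn.mono fun s hs => ?_) (convex_strip _).isPreconnected ?_ ?_
  · exact ⟨hs.1, hs.2.trans_le (min_le_left _ _)⟩
  · exact ⟨hs.1, hs.2.trans_le (min_le_right _ _)⟩
  · exact ⟨pi_half_mem_strip.1, pi_half_mem_strip.2.trans_le (le_min E.le E'.le)⟩
  · filter_upwards [(isOpen_strip _).mem_nhds pi_half_mem_strip] with s hs
    rw [E.eq s hs, E'.eq s hs]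

/-- A projective map on a wide strip that tends to a puncture at the end of the strip
`0 < Im s < π` does so on the whole strip, by its normal form at the puncture. -/
lemma tendsto_stripEnd_of_projOn [Tame Q] {a c : ℝ} (ha : a ≤ 0) (hc : π ≤ c)
    (hU : Q.ProjOn exp U {s | a < s.im ∧ s.im < c}) {p : S} (hp : p ∈ P)
    (h : Tendsto U (stripEnd 0 π) (𝓝 p)) : Tendsto U (stripEnd a c) (𝓝 p) := by
  obtain ⟨K⟩ := Tame.cusp (Q := Q) p hp
  have hpi := pi_pos
  have hsub : ∀ R, halfStrip R 0 π ⊆ {s | a < s.im ∧ s.im < c} := fun R s hs =>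
    ⟨ha.trans_lt hs.2.1, hs.2.2.trans_le hc⟩
  obtain ⟨R, UP, h1, h2, h3⟩ := K.exists_extension hp (hU.mono (hsub 0)) h
    (M := max c (-a)) (hc.trans (le_max_left _ _))
  have hin : ∀ s : ℂ, a < s.im ∧ s.im < c → -max c (-a) < s.im ∧ s.im < max c (-a) := fun s hs =>
    ⟨by linarith [le_max_right c (-a)], hs.2.trans_le (le_max_left _ _)⟩
  have hs₀ : ((R + 1 : ℝ) : ℂ) + π / 2 * I ∈ halfStrip R 0 π :=
    ⟨by simp, by simpa using by linarith, by simpa using by linarith⟩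
  have heq : Set.EqOn UP U (halfStrip R a c) := by
    refine HolOn.eqOn (s0 := ((R + 1 : ℝ) : ℂ) + π / 2 * I)
      ((h1.mono fun s hs => ?_).holOn fun s _ => by fun_prop)
      ((hU.mono fun s hs => hs.2).holOn fun s _ => by fun_prop)
      (convex_halfStrip _ _ _).isPreconnected ⟨hs₀.1, hsub _ hs₀⟩ ?_
    · exact ⟨hs.1, hin s hs.2⟩
    · filter_upwards [(isOpen_halfStrip _ _ _).mem_nhds hs₀] with s hs using h3 s hs
  refine Tendsto.congr' ?_ (h2.mono_left (inf_le_inf_left _ (principal_mono.2 hin)))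
  exact (eventually_mem_halfStrip R a c).mono heq

/-- The strip maps of disks that lean on the punctures at `1` and `-1` tend to punctures at both
ends. -/
lemma StripExt.ends [Tame Q] (E : StripExt u b U) (hu : LeansAtPair u) :
    (∃ p ∈ P, Tendsto U (stripEnd 0 b) (𝓝 p)) ∧
      ∃ p ∈ P, Tendsto (fun s => U (b * I - s)) (stripEnd 0 b) (𝓝 p) := by
  obtain ⟨⟨-, p1, hp1, h1⟩, -, p2, hp2, h2⟩ := hu
  rw [leansAt_one_iff] at h1
  rw [leansAt_neg_one_iff] at h2
  have hin : ∀ᶠ s in stripEnd 0 π, s ∈ strip π :=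
    (eventually_mem_halfStrip 0 0 π).mono fun s hs => hs.2
  refine ⟨⟨p1, hp1, tendsto_stripEnd_of_projOn le_rfl E.le E.proj hp1
    (h1.congr' (hin.mono fun s hs => (E.eq s hs).symm))⟩, p2, hp2, ?_⟩
  have h3 := tendsto_stripEnd_of_projOn (U := fun s => U (π * I - s))
    (a := π - b) (c := π) (by linarith [E.le]) le_rfl (projOn_sub E.proj _ fun s hs =>
      ⟨by simpa using hs.2, by simpa using by linarith [hs.1]⟩) hp2
    (h2.congr' (hin.mono fun s hs => (E.eq _ ⟨by simpa using hs.2, by simpa using hs.1⟩).symm))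
  refine (h3.comp (tendsto_add_stripEnd (y := π - b) (by linarith) (by linarith))).congr fun s => ?_
  simp only [Function.comp_apply]
  congr 1; push_cast; ring

lemma StripExt.leansAtPair [Tame Q] (E : StripExt u b U) (hu : LeansAtPair u) {θ : ℝ}
    (h0 : 0 ≤ θ) (h1 : π + θ ≤ b) : LeansAtPair (E.shift h0 h1) := by
  obtain ⟨⟨p1, hp1, h2⟩, p2, hp2, h3⟩ := E.ends hu
  refine ⟨⟨by simp, p1, hp1, leansAt_one_iff.2 ?_⟩, by simp, p2, hp2, leansAt_neg_one_iff.2 ?_⟩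
  · refine (h2.comp (tendsto_add_stripEnd (y := θ) (by linarith) (by linarith))).congr' ?_
    filter_upwards [eventually_mem_halfStrip 0 0 π] with s hs
    exact (E.extend_shift h0 h1 hs.2).symm
  · refine (h3.comp (tendsto_add_stripEnd (y := b - π - θ) (by linarith) (by linarith))).congr' ?_
    filter_upwards [eventually_mem_halfStrip 0 0 π] with s hs
    rw [E.extend_shift h0 h1 ⟨by simpa using hs.2.2, by simpa using hs.2.1⟩, Function.comp_apply]
    congr 1; push_cast; ring

/-- An extension of a shifted disk continues the extension of the disk. -/
lemma StripExt.glue (E : StripExt u b U) {θ : ℝ} (h0 : 0 ≤ θ) (h1 : π + θ ≤ b)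
    (E' : StripExt (E.shift h0 h1) b' U') : ∃ V, StripExt u (θ + b') V := by
  have hpi := pi_pos
  have hb' := E'.le
  set E2 : Q.ProjOn exp (fun s => U' (s + ((-θ : ℝ) : ℂ) * I))
      {s | θ < s.im ∧ s.im < θ + b'} := projOn_add E'.proj _ fun s hs =>
    mem_strip_add.2 ⟨by linarith [hs.1], by linarith [hs.2]⟩ with hE₂
  have hov : ∀ s : ℂ, θ < s.im → s.im < π + θ →
      U' (s + ((-θ : ℝ) : ℂ) * I) = U s := fun s h2 h3 => by
    have h4 : s + ((-θ : ℝ) : ℂ) * I ∈ strip π := mem_strip_add.2 ⟨by linarith, by linarith⟩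
    rw [E'.eq _ h4, E.extend_shift h0 h1 h4]
    simp
  refine ⟨fun s => if s.im < π + θ then U s else U' (s + ((-θ : ℝ) : ℂ) * I),
    by linarith, fun s hs => ?_, fun s hs => ?_⟩
  · rcases lt_or_ge s.im (π + θ) with h | h
    · refine ((E.proj.mono (W' := {s}) (Set.singleton_subset_iff.2 ⟨hs.1, by linarith⟩)).congr
        ?_) s rfl
      rintro _ rfl
      filter_upwards [(isOpen_lt continuous_im continuous_const).mem_nhds h] with s' h'
      simp [*]
    · refine ((E2.mono (W' := {s}) (Set.singleton_subset_iff.2 ⟨by linarith, hs.2⟩)).congr ?_) s rfl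
      rintro _ rfl
      filter_upwards [(isOpen_lt continuous_const continuous_im).mem_nhds
        (show θ < Complex.im _ by linarith)] with s' h'
      grind
  · rw [if_pos (by linarith [hs.2]), E.eq s hs]

/-- A disk leans on the punctures at no point of the open upper half circle. -/
def UpperFree (u : Q.DiskMap) : Prop := ∀ a ∈ leanSet u, a.im ≤ 0

/-- The displacement by `δ` is dominated by `(cay s).im`, hence by the distance to `±1`: points just
above the strip lie in the collar, whose width at the leaning points shrinks linearly. -/
lemma norm_cay_sub_le {s : ℂ} {δ : ℝ} (hs : s.im = π) (h0 : 0 ≤ δ) (h1 : δ ≤ 1 / 2) :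
    ‖cay (s + δ * I) - cay s‖ ≤ 2 * δ * (cay s).im ∧ 0 < (cay s).im := by
  have hpi := pi_gt_three
  set t := Real.exp s.re
  have ht : 0 < t := exp_pos _
  have hE : exp s = -t := by
    rw [← Complex.re_add_im s, hs, exp_add, exp_pi_mul_I]
    simp [t]
  have hn1 := exp_add_I_ne_zero (s := s) (by linarith) (by linarith)
  have hn2 := exp_add_I_ne_zero (s := s + δ * I) (by simp; linarith) (by simp; linarith)
  have hE2 : exp (s + δ * I) = -t * exp (I * δ) := by rw [exp_add, hE, mul_comm I]
  have him : (cay s).im = 2 * t / (t ^ 2 + 1) := by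
    rw [cay, hE, Complex.div_im]
    simp [normSq_apply]
    ring
  have hsin : sin δ ≤ 1 / 2 := (sin_le h0).trans h1
  have hN1 : ‖exp s + I‖ ^ 2 = t ^ 2 + 1 := by rw [sq_norm, hE, normSq_apply]; simp; ring
  have hN2 : (t ^ 2 + 1) / 2 ≤ ‖exp (s + δ * I) + I‖ ^ 2 := by
    rw [sq_norm, hE2, mul_comm I, exp_mul_I, normSq_apply,
      ← Complex.ofReal_cos, ← Complex.ofReal_sin]
    simp
    rw [Complex.cos_ofReal_re, Complex.sin_ofReal_re]
    nlinarith [Real.sin_sq_add_cos_sq δ, sq_nonneg (t - 1)]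
  have hsub : (cay (s + δ * I) - cay s) * ((exp (s + δ * I) + I) *
      (exp s + I)) = -(2 * I * t * (exp (I * δ) - 1)) := by
    rw [cay, cay, div_sub_div _ _ hn2 hn1, div_mul_cancel₀ _ (mul_ne_zero hn2 hn1), hE2, hE]
    ring
  have hnorm := congrArg norm hsub
  rw [norm_neg, norm_mul, norm_mul, norm_mul, norm_mul, norm_mul, Complex.norm_I, norm_real,
    norm_of_nonneg ht.le, Complex.norm_two, mul_one] at hnorm
  have hexp : ‖exp (I * δ) - 1‖ ≤ δ := by
    simpa [norm_of_nonneg h0, abs_of_nonneg h0] using Real.norm_exp_I_mul_ofReal_sub_one_le (x := δ)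
  have hprod : (t ^ 2 + 1) / 2 ≤ ‖exp (s + δ * I) + I‖ * ‖exp s + I‖ := by
    refine abs_le_of_sq_le_sq' ?_ (by positivity) |>.2
    rw [mul_pow, hN1]
    nlinarith [sq_nonneg t]
  refine ⟨?_, by rw [him]; positivity⟩
  rw [him, ← mul_div_assoc, le_div_iff₀ (by positivity)]
  nlinarith [norm_nonneg (cay (s + δ * I) - cay s)]

/-- A disk that leans on the punctures at no point of the open upper half circle extends to a
larger strip. -/
lemma UpperFree.exists_stripExt (h : UpperFree u) (C : Collar u) :
    ∃ b > π, ∃ U, StripExt u b U := by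
  have hpi := pi_gt_three
  have hc := C.c_pos
  have hc' := C.c_le
  refine ⟨π + C.c / 4, by linarith, fun s => C.V (cay s), by linarith, ?_, fun s hs =>
    C.eq _ (norm_cay_lt_one hs.1 hs.2)⟩
  have hlt : ∀ s ∈ strip (π + C.c / 4), -(π / 2) < s.im ∧ s.im < 3 * π / 2 :=
    fun s hs => ⟨by linarith [hs.1], by linarith [hs.2]⟩
  refine (C.proj.comp (g := cay) (W' := strip (π + C.c / 4))
    (fun s hs => (analyticAt_cay (hlt s hs).1 (hlt s hs).2).continuousAt) fun s hs => ?_).change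
    fun s hs => ⟨cayGL, ?_⟩
  · rcases lt_or_ge s.im π with h1 | h1
    · exact Or.inl (norm_cay_lt_one hs.1 h1)
    set δ := s.im - π
    have hδ : δ < C.c / 4 := by linarith [hs.2]
    have hs' : (s - δ * I).im = π := by simp [δ]
    obtain ⟨h2, h3⟩ := norm_cay_sub_le hs' (by linarith) (show δ ≤ 1 / 2 by linarith)
    rw [sub_add_cancel] at h2
    set ξ := cay (s - δ * I)
    have hξ : ‖ξ‖ = 1 := norm_cay_eq_one (by rw [hs', Real.sin_pi]) (by linarith) (by linarith)
    have h4 : ‖cay s - ξ‖ < C.c * ξ.im := by nlinarith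
    refine Or.inr ⟨ξ, hξ, h4.trans_le ?_, fun a ha => h4.trans_le ?_⟩
    · have := (le_abs_self _).trans (abs_im_le_norm ξ)
      nlinarith
    · have h5 := (le_abs_self _).trans (abs_im_le_norm (ξ - a))
      rw [sub_im] at h5
      have := h a ha
      nlinarith
  · filter_upwards [(isOpen_strip _).mem_nhds hs] with s' hs'
    exact moebiusRel_cay (hlt s' hs').1 (hlt s' hs').2

/-- A disk that leans on the punctures at `1` and `-1` does not extend to arbitrarily wide strips:
seen from the middle, the extensions would have a constant limit. -/
lemma LeansAtPair.exists_bound [CompactSpace S] [Tame Q] (hu : LeansAtPair u) :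
    ∃ B : ℝ, ∀ b U, StripExt u b U → b ≤ B := by
  by_contra hcon
  push Not at hcon
  have hpi := pi_pos
  choose b U hE hb using fun n : ℕ => hcon (2 * n + π)
  obtain ⟨K, hK, hKP, hKu⟩ := exists_compact_of_leansAtPair (Q := Q)
  have h1 : ∀ n : ℕ, π + n ≤ b n := fun n => by linarith [hb n, Nat.cast_nonneg (α := ℝ) n]
  choose x hx using fun n => hKu _ ((hE n).leansAtPair hu (Nat.cast_nonneg n) (h1 n))
  set v : ℕ → Q.DiskMap := fun n => ((hE n).shift (Nat.cast_nonneg n) (h1 n)).trans (x n) with hv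
  have hvs : ∀ n, ∀ s ∈ strip π, extend (v n).1 (cay s) = U n (s + x n + n * I) := fun n s hs => by
    have h2 : s + x n ∈ strip π := by simpa [strip] using hs
    rw [hv, extend_trans _ _ hs, StripExt.extend_shift _ _ _ h2]
    simp
  have hv0 : ∀ n, extend (v n).1 0 ∈ K := fun n => by
    have h2 := extend_trans ((hE n).shift (Nat.cast_nonneg n) (h1 n)) (x n) pi_half_mem_strip
    rw [cay_pi_half] at h2
    rw [hv, h2, add_comm]
    exact hx n
  set g : ℕ → ℂ → S := fun n w => U n (n * w + (π / 2 * I + x n + n * I))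
  have hgm : ∀ n : ℕ, ∀ w ∈ 𝔹, n * w + (π / 2 * I + x n + n * I) ∈ strip (b n) := fun n w hw => by
    have h2 := abs_lt.1 ((abs_im_le_norm w).trans_lt (mem_ball_zero_iff.1 hw))
    have h3 : (0 : ℝ) ≤ n := Nat.cast_nonneg n
    have him : (n * w + (π / 2 * I + x n + n * I)).im = n * w.im + π / 2 + n := by simp; ring
    constructor <;> rw [him] <;> nlinarith [hb n]
  have hg0 : ∀ n, g n 0 ∈ K := fun n => by
    have := hv0 n
    rw [← cay_pi_half, hvs n _ pi_half_mem_strip] at this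
    simpa [g] using this
  obtain ⟨G, hG⟩ := exists_limit_of_holOn (Tame.unif Q) hK hKP (hyperfilter ℕ) (g := g)
    (fun n => (hE n).holOn.comp (fun w _ => by fun_prop) (hgm n))
    (fun n w hw => (hE n).proj.notMem (hgm n w hw)) hg0
  obtain ⟨v0, hv₀, -⟩ := exists_limit_of_leansAtPair (Tame.unif Q) hK hKP (hyperfilter ℕ) (u := v)
    (fun n => ((hE n).leansAtPair hu _ (h1 n)).trans _) hv0
  refine not_const_diskMap v0 (x := G 0) fun w hw => ?_
  refine tendsto_nhds_unique (tendsto_extend hv₀ hw tendsto_const_nhds) fun N hN => ?_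
  obtain ⟨δ, hδ, hev⟩ := (hG 0 (by simp)).2 N hN
  set s := stripLog w
  have hlarge : ∀ᶠ n : ℕ in hyperfilter ℕ, ‖s - π / 2 * I‖ / δ < n :=
    (tendsto_natCast_atTop_atTop.eventually_gt_atTop _).filter_mono Nat.hyperfilter_le_atTop
  rw [mem_map]
  filter_upwards [hev, hlarge] with n hn h2
  have hn0 : (0 : ℝ) < n := lt_of_le_of_lt (by positivity) h2
  have hnc : (n : ℂ) ≠ 0 := by exact_mod_cast hn0.ne'
  have h3 := hn ((s - π / 2 * I) / n) (by
    rw [mem_ball_zero_iff, norm_div, Complex.norm_natCast, div_lt_iff₀ hn0]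
    linarith [(div_lt_iff₀ hδ).1 h2])
  have h4 := hvs n s (im_stripLog hw)
  rw [cay_stripLog (ne_of_norm_lt_one hw).1 (ne_of_norm_lt_one hw).2] at h4
  rw [Set.mem_preimage, h4]
  convert h3 using 2
  rw [mul_div_cancel₀ _ hnc]
  ring

end Flows

/-! ### The flow of a disk with two leaning points -/

section Flows

variable [T2Space S] [IsManifold 𝓘(ℂ) ω S] {u : Q.DiskMap}

/-- The largest strip to which the map `u` extends. The disks in the strip of width `π` which
moves upwards from the one of `u` to the top form an edge of the graph of maximal disks. -/
structure Flow (u : Q.DiskMap) where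
  Θ : ℝ
  U : ℂ → S
  pos : 0 < Θ
  ext : StripExt u (π + Θ) U
  top : ∃ ζ ∈ leanSet (ext.shift pos.le le_rfl), 0 < ζ.im

lemma LeansAtPair.exists_flow [CompactSpace S] [Tame Q] (hu : LeansAtPair u)
    (hf : UpperFree u) : Nonempty (Flow u) := by
  obtain ⟨C⟩ := hu.isMaximal.collar
  obtain ⟨b0, hb₀, U0, E0⟩ := hf.exists_stripExt C
  obtain ⟨B, hB⟩ := hu.exists_bound
  set T := {b : ℝ | ∃ U, StripExt u b U}
  have hT : BddAbove T := ⟨B, fun b ⟨U, h⟩ => hB b U h⟩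
  set m := sSup T
  have hm : π < m := hb₀.trans_le (le_csSup hT ⟨U0, E0⟩)
  have hdown : ∀ b : ℝ, ∃ U, π ≤ b → b < m → StripExt u b U := fun b => by
    by_cases h : π ≤ b ∧ b < m
    · obtain ⟨b', ⟨U, E⟩, hbb'⟩ := exists_lt_of_lt_csSup (s := T) ⟨b0, U0, E0⟩ h.2
      exact ⟨U, fun _ _ => ⟨h.1, E.proj.mono fun s hs => ⟨hs.1, hs.2.trans hbb'⟩, E.eq⟩⟩
    · exact ⟨U0, fun h1 h2 => absurd ⟨h1, h2⟩ h⟩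
  choose W hW using hdown
  set β : ℂ → ℝ := fun s => (max π s.im + m) / 2
  have hβ : ∀ s ∈ strip m, StripExt u (β s) (W (β s)) ∧ s.im < β s := fun s hs => by
    have h1 : max π s.im < m := max_lt hm hs.2
    grind
  have E : StripExt u m fun s => W (β s) s := by
    refine ⟨hm.le, fun s hs => ?_, fun s hs => ?_⟩
    · obtain ⟨h1, h2⟩ := hβ s hs
      refine ((h1.proj.mono (W' := {s}) (Set.singleton_subset_iff.2 ⟨hs.1, h2⟩)).congr ?_) s rfl
      intro s₁ hs₁
      obtain rfl : s = s₁ := Eq.symm hs₁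
      filter_upwards [(isOpen_strip m).mem_nhds hs, (isOpen_strip (β s)).mem_nhds
        (show s ∈ strip (β s) from ⟨hs.1, h2⟩)] with s' h3 h4
      obtain ⟨h5, h6⟩ := hβ s' h3
      exact h1.eqOn h5 ⟨h3.1, lt_min h4.2 h6⟩
    · exact (hβ s ⟨hs.1, hs.2.trans hm⟩).1.eq s hs
  have hΘ : 0 < m - π := by linarith
  rw [show m = π + (m - π) by ring] at E
  refine ⟨⟨m - π, _, hΘ, E, ?_⟩⟩
  by_contra hcon
  have hp := E.leansAtPair hu hΘ.le le_rfl
  obtain ⟨C'⟩ := hp.isMaximal.collar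
  obtain ⟨b, hb, U, E'⟩ := UpperFree.exists_stripExt
    (fun a ha => not_lt.1 fun h => hcon ⟨a, ha, h⟩) C'
  have := le_csSup hT (E.glue hΘ.le le_rfl E')
  linarith

namespace Flow

variable {b : ℝ} {U' : ℂ → S} (F : Flow u) (t : unitInterval)

lemma mul_le : π + t * F.Θ ≤ π + F.Θ := by nlinarith [F.pos, t.2.2]

/-- The disks of an edge. -/
def disk : Q.DiskMap := F.ext.shift (θ := t * F.Θ) (mul_nonneg t.2.1 F.pos.le) (F.mul_le t)

lemma extend_disk {s : ℂ} (hs : s ∈ strip π) :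
    extend (F.disk t).1 (cay s) = F.U (s + ((t * F.Θ : ℝ) : ℂ) * I) :=
  F.ext.extend_shift _ _ hs

lemma disk_zero : F.disk 0 = u := DiskMap.ext_of_strip fun s hs => by
  rw [F.extend_disk 0 hs, ← F.ext.eq s hs]; simp

lemma leansAtPair [Tame Q] (hu : LeansAtPair u) : LeansAtPair (F.disk t) := F.ext.leansAtPair hu _ _

variable {t}

lemma notMem_of_pos (ht : 0 < t) {ζ : ℂ} (hζ : ζ.im < 0) : ζ ∉ leanSet (F.disk t) :=
  F.ext.notMem_leanSet _ _ (Or.inl ⟨mul_pos (show (0 : ℝ) < t from ht) F.pos, hζ⟩)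

lemma notMem_of_lt (ht : t < 1) {ζ : ℂ} (hζ : 0 < ζ.im) : ζ ∉ leanSet (F.disk t) :=
  F.ext.notMem_leanSet _ _ (Or.inr ⟨by
    have : (t : ℝ) < 1 := ht
    nlinarith [F.pos], hζ⟩)

lemma leanSet_disk [Tame Q] (hu : LeansAtPair u) (h0 : 0 < t) (h1 : t < 1) :
    leanSet (F.disk t) = {1, -1} := by
  ext ζ
  constructor
  · intro h
    refine eq_one_or_of_im_eq_zero h.1 (le_antisymm ?_ ?_)
    · exact not_lt.1 fun h' => F.notMem_of_lt h1 h' h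
    · exact not_lt.1 fun h' => F.notMem_of_pos h0 h' h
  · rintro (rfl | rfl)
    exacts [(F.leansAtPair t hu).1, (F.leansAtPair t hu).2]

lemma exists_mem_top : ∃ ζ ∈ leanSet (F.disk 1), 0 < ζ.im := by
  obtain ⟨ζ, h1, h2⟩ := F.top
  have : F.disk 1 = F.ext.shift F.pos.le le_rfl := by simp only [disk, Set.Icc.coe_one, one_mul]
  grind

lemma continuous_disk : Continuous F.disk := by
  refine Continuous.subtype_mk (ContinuousMap.continuous_of_continuous_uncurry _ ?_) _
  have hc : Continuous fun x : unitInterval × 𝔻 => stripLog x.2 + ((x.1 * F.Θ : ℝ) : ℂ) * I := by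
    have : Continuous fun w : 𝔻 => stripLog w := continuous_iff_continuousAt.2 fun w =>
      ContinuousAt.comp' (f := fun w : 𝔻 => (w : ℂ))
        (analyticAt_stripLog_of_lt w.norm_lt_one).continuousAt
        Complex.UnitDisc.continuous_coe.continuousAt
    exact (this.comp continuous_snd).add (by fun_prop)
  refine F.ext.holOn.continuousOn.comp_continuous hc fun x => mem_strip_add.2 ?_
  obtain ⟨h1, h2⟩ := im_stripLog x.2.norm_lt_one
  have := F.mul_le x.1
  have := mul_nonneg x.1.2.1 F.pos.le
  grind

/-- The strip of a flow is the largest one. -/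
lemma le_of_ext (E : StripExt u b U') : b ≤ π + F.Θ ∧ Set.EqOn U' F.U (strip b) := by
  have h := E.eqOn F.ext
  suffices hb : b ≤ π + F.Θ by rw [min_eq_left hb] at h; exact ⟨hb, h⟩
  by_contra! hb
  rw [min_eq_right hb.le] at h
  obtain ⟨ζ, h1, h2⟩ := F.top
  refine E.notMem_leanSet F.pos.le hb.le (Or.inr ⟨hb, h2⟩) ?_
  convert h1 using 2
  refine DiskMap.ext_of_strip fun s hs => ?_
  rw [E.extend_shift _ _ hs, F.ext.extend_shift _ _ hs]
  exact h (mem_strip_add.2 ⟨by linarith [hs.1, F.pos], by linarith [hs.2]⟩)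

end Flow

end Flows

section Automorphisms

variable {l q l' q' : ℂ}

lemma exists_mob_comp (hl : ‖l‖ = 1) (hq : ‖q‖ < 1) (hl' : ‖l'‖ = 1) (hq' : ‖q'‖ < 1) :
    ∃ l2 q2, ‖l2‖ = 1 ∧ ‖q2‖ < 1 ∧ ∀ w : ℂ, ‖w‖ ≤ 1 → mob l2 q2 w = mob l q (mob l' q' w) := by
  have hD := mob_denom_ne_zero hl hq hq'.le
  set D := 1 + conj q * l * q' with hDdef
  have hD' : conj D ≠ 0 := (map_ne_zero _).2 hD
  have h1 : conj D * l = l + q * conj q' := by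
    rw [hDdef]; simp only [map_add, map_mul, map_one, conj_conj]
    linear_combination q * conj q' * conj_mul_self_of_norm hl
  refine ⟨l * l' * conj D / D, mob l q q', ?_, norm_mob_lt_one hl hq hq', fun w hw => ?_⟩
  · rw [norm_div, norm_mul, norm_mul, hl, hl', RCLike.norm_conj, one_mul, one_mul,
      div_self (norm_ne_zero_iff.2 hD)]
  have h2 := mob_denom_ne_zero hl' hq' hw
  have h3 := mob_denom_ne_zero hl hq (norm_mob_le_one hl' hq' hw)
  have h4 : conj (mob l q q') * (l * l' * conj D / D) = (conj q' * l' + conj q * l * l') / D := by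
    rw [mob, ← hDdef, map_div₀, div_mul_div_comm, ← div_div, div_left_inj' hD, div_eq_iff hD']
    simp only [map_add, map_mul]
    linear_combination conj D * conj q' * l' * conj_mul_self_of_norm hl
  have h5 : (1 + conj q' * l' * w) * (1 + conj q * l * mob l' q' w) =
      D + (conj q' * l' + conj q * l * l') * w := by
    rw [mob, mul_add, mul_one, ← mul_div_assoc, mul_div_cancel₀ _ h2]; ring
  have h6 : D + (conj q' * l' + conj q * l * l') * w ≠ 0 := h5 ▸ mul_ne_zero h2 h3
  have h7 : mob l q (mob l' q' w) = (l * (l' * w + q') + q * (1 + conj q' * l' * w)) /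
      (D + (conj q' * l' + conj q * l * l') * w) := by
    have h10 : (1 + conj q' * l' * w) * mob l' q' w = l' * w + q' := mul_div_cancel₀ _ h2
    rw [← h5, mob, div_eq_div_iff h3 (mul_ne_zero h2 h3)]
    linear_combination l * (1 + conj q * l * mob l' q' w) * h10
  have h8 : 1 + conj (mob l q q') * (l * l' * conj D / D) * w =
      (D + (conj q' * l' + conj q * l * l') * w) / D := by
    rw [h4]; field_simp
  have h9 : l * l' * conj D / D * w + mob l q q' =
      (l * (l' * w + q') + q * (1 + conj q' * l' * w)) / D := by
    rw [mob, ← hDdef, div_mul_eq_mul_div, ← add_div]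
    congr 1
    linear_combination l' * w * h1
  rw [h7, mob, h8, h9, div_div_div_cancel_right₀ hD]

/-- The automorphisms that preserve the pair of points `1` and `-1`. -/
lemma mob_fix_pair (hl : ‖l‖ = 1) (hq : ‖q‖ < 1) {σ : ℂ} (hσ : σ = 1 ∨ σ = -1)
    (h1 : mob l q 1 = σ) (h2 : mob l q (-1) = -σ) : l = σ ∧ ∃ x : ℝ, q = x := by
  have hd1 := mob_denom_ne_zero hl hq (w := 1) (by simp)
  have hd2 := mob_denom_ne_zero hl hq (w := -1) (by simp)
  rw [mob, div_eq_iff hd1] at h1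
  rw [mob, div_eq_iff hd2] at h2
  have h3 : l = σ := by linear_combination (h1 - h2) / 2
  refine ⟨h3, q.re, (Complex.conj_eq_iff_re.1 ?_).symm⟩
  grind

lemma exists_tanh {x : ℝ} (hx : ‖(x : ℂ)‖ < 1) : ∃ r : ℝ, x = (Real.exp r - 1) / (Real.exp r + 1) := by
  rw [norm_real, norm_eq_abs, abs_lt] at hx
  have h1 : 0 < 1 - x := by linarith
  refine ⟨Real.log ((1 + x) / (1 - x)), ?_⟩
  rw [Real.exp_log (div_pos (by linarith) h1)]
  grind

variable [T2Space S] [IsManifold 𝓘(ℂ) ω S]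

lemma eq_trans_of_fix (u : Q.DiskMap) (hl : ‖l‖ = 1) (hq : ‖q‖ < 1) {σ : ℂ}
    (h1 : mob l q 1 = σ) (h2 : mob l q (-1) = -σ) :
    (σ = 1 → ∃ r, u.mob hl hq = u.trans r) ∧
    (σ = -1 → ∃ r, u.mob hl hq = (u.mob norm_neg_one (by simp : ‖(0 : ℂ)‖ < 1)).trans r) := by
  constructor
  · rintro rfl
    obtain ⟨rfl, x, rfl⟩ := mob_fix_pair hl hq (Or.inl rfl) h1 h2
    obtain ⟨r, rfl⟩ := exists_tanh hq
    exact ⟨r, rfl⟩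
  · rintro rfl
    obtain ⟨rfl, x, rfl⟩ := mob_fix_pair hl hq (Or.inr rfl) h1 h2
    obtain ⟨r, hr⟩ := exists_tanh (x := -x) (by simpa using hq)
    refine ⟨r, DiskMap.ext_of_extend fun w hw => ?_⟩
    rw [extend_mob _ _ _ hw, DiskMap.trans, extend_mob _ _ _ hw, extend_mob _ _ _
      (norm_mob_lt_one (by simp) (abs_tanh_lt_one r) hw), mob_neg_one_zero, ← hr]
    congr 1
    simp only [mob, conj_ofReal]
    push_cast
    grind

lemma trans_trans (u : Q.DiskMap) (r r' : ℝ) : (u.trans r).trans r' = u.trans (r + r') :=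
  DiskMap.ext_of_strip fun s hs => by
    rw [extend_trans _ _ hs, extend_trans _ _ (by simpa [strip] using hs), extend_trans _ _ hs]
    push_cast; congr 2; ring

lemma trans_zero (u : Q.DiskMap) : u.trans 0 = u :=
  DiskMap.ext_of_strip fun s hs => by rw [extend_trans _ _ hs]; simp

lemma mob_mob_inv (u : Q.DiskMap) (hl : ‖l‖ = 1) (hq : ‖q‖ < 1) :
    (u.mob hl hq).mob (norm_conj_eq_one hl) (norm_inv_center hl hq) = u :=
  DiskMap.ext_of_extend fun w hw => by
    rw [extend_mob _ _ _ hw, extend_mob _ _ _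
      (norm_mob_lt_one (norm_conj_eq_one hl) (norm_inv_center hl hq) hw), mob_inv' hl hq hw.le]

/-- Two automorphisms differ by an automorphism. -/
lemma exists_mob_eq_mob (hl : ‖l‖ = 1) (hq : ‖q‖ < 1) (hl' : ‖l'‖ = 1) (hq' : ‖q'‖ < 1) :
    ∃ (l2 q2 : ℂ) (hl₂ : ‖l2‖ = 1) (hq2 : ‖q2‖ < 1),
      (∀ w : ℂ, ‖w‖ ≤ 1 → mob l q w = mob l' q' (mob l2 q2 w)) ∧
      ∀ u : Q.DiskMap, u.mob hl hq = (u.mob hl' hq').mob hl₂ hq2 := by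
  obtain ⟨l2, q2, h1, h2, h3⟩ := exists_mob_comp (norm_conj_eq_one hl') (norm_inv_center hl' hq') hl hq
  have h4 : ∀ w : ℂ, ‖w‖ ≤ 1 → mob l q w = mob l' q' (mob l2 q2 w) := fun w hw => by
    rw [h3 w hw, mob_inv' hl' hq' (norm_mob_le_one hl hq hw)]
  exact ⟨l2, q2, h1, h2, h4, fun u => DiskMap.ext_of_extend fun w hw => by
    rw [extend_mob _ _ _ hw, extend_mob _ _ _ hw, extend_mob _ _ _ (norm_mob_lt_one h1 h2 hw),
      h4 w hw.le]⟩

lemma mob_inj_of_eq {u : Q.DiskMap} (hext : Q.ExtendsToClosedDisk u) (hl : ‖l‖ = 1)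
    (hq : ‖q‖ < 1) (hl' : ‖l'‖ = 1) (hq' : ‖q'‖ < 1) (h : u.mob hl hq = u.mob hl' hq') {w : ℂ}
    (hw : ‖w‖ ≤ 1) : mob l q w = mob l' q' w := by
  obtain ⟨l2, q2, h1, h2, h3⟩ := exists_mob_comp hl' hq' (norm_conj_eq_one hl) (norm_inv_center hl hq)
  obtain ⟨rfl, rfl⟩ := mob_eq_id_of_invariant hext h1 h2 fun z hz => by
    have h4 := norm_mob_lt_one (norm_conj_eq_one hl) (norm_inv_center hl hq) hz
    rw [h3 z hz.le, ← extend_mob u hl' hq' h4, ← h, extend_mob _ _ _ h4, mob_inv' hl hq hz.le]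
  have h5 := h3 _ (norm_mob_le_one hl hq hw)
  rw [mob_inv hl hq hw] at h5
  rw [← h5]
  simp [mob]

end Automorphisms

/-! ### The cyclic order of the leaning points -/

section CyclicOrder

lemma exists_angle (a b : Circle) : ∃ θ : ℝ, 0 < θ ∧ θ ≤ 2 * π ∧ b = a * Circle.exp θ := by
  have h1 := neg_pi_lt_arg ((a⁻¹ * b : Circle) : ℂ)
  have h2 := arg_le_pi ((a⁻¹ * b : Circle) : ℂ)
  have h3 : b = a * Circle.exp (Complex.arg ((a⁻¹ * b : Circle) : ℂ)) := by
    rw [Circle.exp_arg, mul_inv_cancel_left]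
  rcases lt_or_ge 0 (Complex.arg ((a⁻¹ * b : Circle) : ℂ)) with h | h
  · grind
  · exact ⟨_ + 2 * π, by linarith, by linarith, by
      rw [Circle.exp_add, Circle.exp_two_pi, mul_one]; exact h3⟩

lemma angle_unique {θ θ' : ℝ} (h1 : 0 < θ) (h2 : θ ≤ 2 * π) (h1' : 0 < θ')
    (h2' : θ' ≤ 2 * π) (h : Circle.exp θ = Circle.exp θ') : θ = θ' := by
  obtain ⟨m, hm⟩ := Circle.exp_eq_exp.1 h
  have hpi := pi_pos
  have h3 : (m : ℝ) < 1 := by nlinarith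
  have h4 : (-1 : ℝ) < m := by nlinarith
  obtain rfl : m = 0 := by
    have h3' : m < 1 := by exact_mod_cast h3
    have h4' : -1 < m := by exact_mod_cast h4
    omega
  simp [*]

variable {L : Set Circle} {a b c : Circle}

lemma exists_isNext (hL : L.Finite) (ha : a ∈ L) : ∃ b, IsNext L a b := by
  choose θ h1 h2 h3 using exists_angle a
  obtain ⟨b, hb, hmin⟩ := hL.exists_minimalFor θ L ⟨a, ha⟩
  refine ⟨b, ha, hb, θ b, h1 b, h2 b, h3 b, fun θ' h4 h5 h6 => ?_⟩
  have h7 := angle_unique h4 (h5.le.trans (h2 b)) (h1 _) (h2 _) (mul_left_cancel (h3 (a * Circle.exp θ')))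
  grind

lemma IsNext.unique (h : IsNext L a b) (h' : IsNext L a c) : b = c := by
  obtain ⟨-, hb, φ, h1, h2, rfl, h3⟩ := h
  obtain ⟨-, hc, ψ, h4, h5, rfl, h6⟩ := h'
  grind

lemma IsNext.unique_left (h : IsNext L a c) (h' : IsNext L b c) : a = b := by
  obtain ⟨ha, -, φ, h1, h2, rfl, h3⟩ := h
  obtain ⟨hb, -, ψ, h4, h5, h6, h7⟩ := h'
  rcases lt_trichotomy φ ψ with h | rfl | h
  · refine absurd ha ?_
    have : a = b * Circle.exp (ψ - φ) := by
      rw [Circle.exp_sub, ← mul_div_assoc, ← h6, mul_div_cancel_right]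
    grind
  · simp_all
  · refine absurd hb ?_
    have : b = a * Circle.exp (φ - ψ) := by
      rw [Circle.exp_sub, ← mul_div_assoc, h6, mul_div_cancel_right]
    grind

lemma IsNext.ne (h : IsNext L a b) (hL : 2 ≤ L.encard) : a ≠ b := by
  rintro rfl
  obtain ⟨-, -, φ, h1, h2, h3, h4⟩ := h
  have h5 : φ = 2 * π := angle_unique h1 h2 (by positivity) le_rfl (by simp_all)
  obtain ⟨c, hc, hca⟩ := (Set.one_lt_encard_iff_nontrivial.1
    (lt_of_lt_of_le (by norm_num) hL)).exists_ne a
  obtain ⟨θ, h6, h7, rfl⟩ := exists_angle a c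
  grind

/-- The successor map of a finite subset of the circle is transitive. -/
lemma subset_of_isNext (hL : L.Finite) {A : Set Circle} (ha : a ∈ L) (haA : a ∈ A)
    (hA : ∀ c ∈ A, ∀ b, IsNext L c b → b ∈ A) : L ⊆ A := fun x hx => by
  choose θ h1 h2 h3 using fun c => exists_angle c x
  -- the element of `A` from which the angle to `x` is smallest
  obtain ⟨c, ⟨hcA, hcL⟩, hmin⟩ := (hL.inter_of_right A).exists_minimalFor θ _ ⟨a, haA, ha⟩
  obtain ⟨b, hb⟩ := exists_isNext hL hcL
  have hbA := hA c hcA b hb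
  obtain ⟨-, hbL, φ, h4, h5, h6, h7⟩ := hb
  rcases lt_trichotomy φ (θ c) with h | h | h
  · have h8 : x = b * Circle.exp (θ c - φ) := by
      rw [h6, Circle.exp_sub, mul_assoc, mul_div_cancel, ← h3]
    have h9 := angle_unique (by linarith) (by linarith [h2 c]) (h1 b) (h2 b)
      (mul_left_cancel (h8.symm.trans (h3 b)))
    grind
  · grind
  · grind

/-- A real number that is negative if `c` lies on the open counterclockwise arc from `a` to `b`. -/
def ccw (a c b : ℂ) : ℝ := ((a - c) * (c - b) * (b - a) / (a * c * b)).im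

lemma ccw_exp {a : ℂ} (ha : a ≠ 0) (θ φ : ℝ) : ccw a (a * exp (θ * I)) (a * exp (φ * I)) =
      8 * (sin (θ / 2) * sin ((θ - φ) / 2) * sin (φ / 2)) := by
  have hs : ∀ x : ℝ, exp ((x / 2 : ℝ) * I) - (exp ((x / 2 : ℝ) * I))⁻¹
      = 2 * I * (sin (x / 2) : ℂ) := fun x => by
    rw [← exp_neg, Complex.ofReal_sin, Complex.sin, ← neg_mul]
    linear_combination (exp (((x / 2 : ℝ) : ℂ) * I) - exp (-((x / 2 : ℝ) : ℂ) * I)) * I_sq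
  have e1 := hs θ
  have e2 := hs φ
  have e3 := hs (θ - φ)
  have hx := exp_ne_zero ((θ / 2 : ℝ) * I)
  have hy := exp_ne_zero ((φ / 2 : ℝ) * I)
  have h1 : ((((θ - φ) / 2 : ℝ) : ℂ) * I) = (θ / 2 : ℝ) * I - (φ / 2 : ℝ) * I := by push_cast; ring
  have h2 : ∀ x : ℝ, exp (x * I) = exp ((x / 2 : ℝ) * I) ^ 2 :=
    fun x => by rw [← Complex.exp_nat_mul]; congr 1; push_cast; ring
  rw [h1, exp_sub] at e3
  rw [ccw, h2 θ, h2 φ]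
  generalize exp ((θ / 2 : ℝ) * I) = x at *
  generalize exp ((φ / 2 : ℝ) * I) = y at *
  have key : (a - a * x ^ 2) * (a * x ^ 2 - a * y ^ 2) * (a * y ^ 2 - a) / (a * (a * x ^ 2) * (a * y ^ 2))
      = -((x - x⁻¹) * (x / y - (x / y)⁻¹) * (y - y⁻¹)) := by
    field_simp
    ring
  rw [key, e1, e2, e3]
  have : -(2 * I * (sin (θ / 2) : ℂ) * (2 * I * (sin ((θ - φ) / 2) : ℂ)) *
      (2 * I * (sin (φ / 2) : ℂ))) = ((8 * (sin (θ / 2) * sin ((θ - φ) / 2) *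
      sin (φ / 2)) : ℝ) : ℂ) * I := by
    push_cast
    linear_combination (-8 * Complex.sin (θ / 2) * Complex.sin ((θ - φ) / 2) * Complex.sin (φ / 2) *
      I) * I_sq
  rw [this, Complex.im_ofReal_mul, I_im, mul_one]

/-- The cyclic order of the circle in terms of the orientation of triples of points. -/
lemma isNext_iff (hab : a ≠ b) : IsNext L a b ↔ a ∈ L ∧ b ∈ L ∧ ∀ c ∈ L, 0 ≤ ccw a c b := by
  obtain ⟨φ, h1, h2, hb⟩ := exists_angle a b
  have h2' : φ < 2 * π := lt_of_le_of_ne h2 (by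
    rintro rfl
    simp_all)
  have hsin := Real.sin_pos_of_pos_of_lt_pi (x := φ / 2) (by linarith) (by linarith)
  have hccw : ∀ θ : ℝ, ccw a (a * Circle.exp θ : Circle) b =
      8 * (sin (θ / 2) * sin ((θ - φ) / 2) * sin (φ / 2)) := fun θ => by
    rw [hb, Circle.coe_mul, Circle.coe_mul, Circle.coe_exp, Circle.coe_exp, ccw_exp a.coe_ne_zero]
  refine and_congr_right fun _ => and_congr_right fun _ => ⟨?_, fun h => ⟨φ, h1, h2, hb, ?_⟩⟩
  · rintro ⟨φ', h3, h4, h5, h6⟩ c hc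
    obtain rfl := angle_unique h1 h2 h3 h4 (mul_left_cancel (hb.symm.trans h5))
    obtain ⟨θ, h7, h8, rfl⟩ := exists_angle a c
    have h9 : φ ≤ θ := not_lt.1 fun h => h6 θ h7 h hc
    rw [hccw]
    have s1 := Real.sin_nonneg_of_nonneg_of_le_pi (x := θ / 2) (by linarith) (by linarith)
    have s2 := Real.sin_nonneg_of_nonneg_of_le_pi (x := (θ - φ) / 2) (by linarith) (by linarith)
    positivity
  · intro θ h3 h4 h5
    have h6 := h _ h5
    rw [hccw] at h6
    have s1 := Real.sin_pos_of_pos_of_lt_pi (x := θ / 2) (by linarith) (by linarith)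
    have s2 := Real.sin_neg_of_neg_of_neg_pi_lt (x := (θ - φ) / 2) (by linarith) (by linarith)
    have := mul_neg_of_neg_of_pos (mul_neg_of_pos_of_neg s1 s2) hsin
    linarith

/-- Automorphisms of the disk preserve the orientation of triples of points of the circle. -/
lemma exists_ccw_mob {l q : ℂ} (hl : ‖l‖ = 1) (hq : ‖q‖ < 1) {a b c : ℂ} (ha : ‖a‖ = 1)
    (hb : ‖b‖ = 1) (hc : ‖c‖ = 1) : ∃ k > 0, ccw (mob l q a) (mob l q c) (mob l q b) = k * ccw a c b := by
  have hmob : ∀ z : ℂ, ‖z‖ = 1 → mob l q z = l * z * conj (1 + conj q * l * z) / (1 + conj q * l * z) :=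
    fun z hz => by
      rw [mob]; congr 1
      simp only [map_add, map_mul, map_one, conj_conj]
      linear_combination -q * conj z * z * conj_mul_self_of_norm hl - q * conj_mul_self_of_norm hz
  have hda := mob_denom_ne_zero hl hq ha.le
  have hdb := mob_denom_ne_zero hl hq hb.le
  have hdc := mob_denom_ne_zero hl hq hc.le
  have hne : ∀ z : ℂ, ‖z‖ = 1 → z ≠ 0 := fun z hz => norm_ne_zero_iff.1 (hz ▸ one_ne_zero)
  have ha0 := hne a ha
  have hb0 := hne b hb
  have hc0 := hne c hc
  have hl0 := hne l hl
  have hr : 1 - conj q * q = ((1 - normSq q : ℝ) : ℂ) := by push_cast; rw [normSq_eq_conj_mul_self]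
  have hr0 : 0 < 1 - normSq q := by rw [normSq_eq_norm_sq]; nlinarith [norm_nonneg q]
  set A := 1 + conj q * l * a with hA
  set B := 1 + conj q * l * b with hB
  set C := 1 + conj q * l * c with hC
  have hA' : conj A ≠ 0 := (map_ne_zero _).2 hda
  have hB' : conj B ≠ 0 := (map_ne_zero _).2 hdb
  have hC' : conj C ≠ 0 := (map_ne_zero _).2 hdc
  refine ⟨(1 - normSq q) ^ 3 / (normSq A * normSq B * normSq C), ?_, ?_⟩
  · have := normSq_pos.2 hda
    have := normSq_pos.2 hdb
    have := normSq_pos.2 hdc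
    positivity
  rw [ccw, ccw, mob_sub_mob hl hq ha.le hc.le, mob_sub_mob hl hq hc.le hb.le,
    mob_sub_mob hl hq hb.le ha.le, hmob a ha, hmob b hb, hmob c hc, ← Complex.im_ofReal_mul, hr]
  congr 1
  push_cast
  simp only [normSq_eq_conj_mul_self]
  simp only [← hA, ← hB, ← hC]
  generalize conj A = A' at *
  generalize conj B = B' at *
  generalize conj C = C' at *
  generalize (1 - conj q * q) = r
  clear_value A B C
  field_simp

end CyclicOrder

section Corners

variable {u : Q.DiskMap} {l q : ℂ}

lemma isNext_mob (hl : ‖l‖ = 1) (hq : ‖q‖ < 1) {a b : Circle} (hab : a ≠ b) :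
    IsNext (Q.leanPoints (u.mob hl hq)) a b ↔
      IsNext (Q.leanPoints u) (mobCircle hl hq a) (mobCircle hl hq b) := by
  rw [isNext_iff hab, isNext_iff ((mobCircle hl hq).injective.ne hab), leanPoints_mob,
    Set.mem_preimage, Set.mem_preimage]
  have key : ∀ c, 0 ≤ ccw (mobCircle hl hq a) (mobCircle hl hq c) (mobCircle hl hq b) ↔
      0 ≤ ccw a c b := fun c => by
    obtain ⟨k, hk, h⟩ := exists_ccw_mob hl hq a.norm_coe b.norm_coe c.norm_coe
    rw [coe_mobCircle, coe_mobCircle, coe_mobCircle, h, mul_nonneg_iff_of_pos_left hk]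
  refine and_congr_right fun _ => and_congr_right fun _ => ⟨fun h c hc => ?_, fun h c hc =>
    (key c).1 (h _ hc)⟩
  obtain ⟨c, rfl⟩ := (mobCircle hl hq).surjective c
  simp [*]

lemma one_ne_neg_one : (1 : Circle) ≠ -1 := fun h => by
  have := congrArg (fun z : Circle => (z : ℂ).re) h
  norm_num at this

lemma isNext_one_neg_one : IsNext (Q.leanPoints u) 1 (-1) ↔ LeansAtPair u ∧ UpperFree u := by
  rw [isNext_iff one_ne_neg_one, ← coe_mem_leanSet, ← coe_mem_leanSet, LeansAtPair, and_assoc]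
  simp only [Circle.coe_one, Circle.coe_neg]
  refine and_congr_right fun _ => and_congr_right fun _ => ?_
  have key : ∀ c : ℂ, ‖c‖ = 1 → ccw 1 c (-1) = -4 * c.im := fun c hc => by
    have hc0 : c ≠ 0 := norm_ne_zero_iff.1 (hc ▸ one_ne_zero)
    have h1 : (1 - c) * (c - -1) * (-1 - 1) / (1 * c * -1) = 2 * (conj c - c) := by
      rw [div_eq_iff (by simpa using hc0)]
      linear_combination 2 * conj_mul_self_of_norm hc
    rw [ccw, h1]
    simp; ring
  constructor
  · intro h a ha
    have := h ⟨a, mem_sphere_zero_iff_norm.2 ha.1⟩ (coe_mem_leanSet.1 ha)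
    rw [key _ ha.1] at this
    linarith
  · intro h c hc
    have := h c (coe_mem_leanSet.2 hc)
    rw [key c c.norm_coe]
    linarith

/-- A map that represents a vertex, with `1` and `-1` consecutive points at which it leans on the
punctures. -/
structure IsCorner (u : Q.DiskMap) : Prop where
  next : IsNext (Q.leanPoints u) 1 (-1)
  three : 3 ≤ (Q.leanPoints u).encard

lemma IsCorner.leansAtPair (h : IsCorner u) : LeansAtPair u := (isNext_one_neg_one.1 h.next).1

lemma IsCorner.upperFree (h : IsCorner u) : UpperFree u := (isNext_one_neg_one.1 h.next).2

end Corners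

/-! ### Darts -/

section Darts

variable [T2Space S] [IsManifold 𝓘(ℂ) ω S]

lemma IsMaximal.finite_leanPoints [Tame Q] {u : Q.DiskMap} (h : IsMaximal u) :
    (Q.leanPoints u).Finite := by
  obtain ⟨C⟩ := h.collar
  have := C.finite
  rw [leanSet_eq] at this
  exact this.of_finite_image fun a _ b _ h => Circle.ext h

lemma isMaximal_of_three_le {u : Q.DiskMap} (h : 3 ≤ (Q.leanPoints u).encard) : IsMaximal u :=
  isMaximal_of_two_le (le_trans (by norm_num) h)

/-- The pairs of a vertex and a point at which its representative leans on the punctures,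
numbered, each of them with an automorphism that takes `1` to this point and `-1` to the next. -/
structure DartSystem (Q : ProjectiveStructure S P) where
  n : ℕ
  vertex : Fin n → Q.Disk
  l : Fin n → ℂ
  q : Fin n → ℂ
  norm_l : ∀ d, ‖l d‖ = 1
  norm_q : ∀ d, ‖q d‖ < 1
  corner : ∀ d, IsCorner ((Quotient.out (vertex d)).mob (norm_l d) (norm_q d))
  inj : ∀ d d', vertex d = vertex d' →
    mobCircle (norm_l d) (norm_q d) 1 = mobCircle (norm_l d') (norm_q d') 1 → d = d'
  surj : ∀ y : Q.Disk, 3 ≤ (Q.leanPoints (Quotient.out y)).encard →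
    ∀ a ∈ Q.leanPoints (Quotient.out y), ∃ d, vertex d = y ∧ mobCircle (norm_l d) (norm_q d) 1 = a

lemma exists_dartSystem [CompactSpace S] [Tame Q] : Nonempty (DartSystem Q) := by
  set T : Set (Q.Disk × Circle) := {z | 3 ≤ (Q.leanPoints (Quotient.out z.1)).encard ∧
    z.2 ∈ Q.leanPoints (Quotient.out z.1)}
  have hV : {x : Q.Disk | 3 ≤ (Q.leanPoints (Quotient.out x)).encard}.Finite :=
    finite_vertices.subset fun x hx => ⟨Quotient.out x, Quotient.out_eq x, hx⟩
  have hT : T.Finite := by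
    refine (hV.biUnion fun x hx => ((isMaximal_of_three_le hx).finite_leanPoints.image
      (Prod.mk x))).subset ?_
    rintro ⟨x, a⟩ ⟨h1, h2⟩
    simp [*]
  have := hT.to_subtype
  have e := (Finite.equivFin T).symm
  have hex : ∀ z : T, ∃ (l q : ℂ) (hl : ‖l‖ = 1) (hq : ‖q‖ < 1),
      IsCorner ((Quotient.out z.1.1).mob hl hq) ∧ mobCircle hl hq 1 = z.1.2 := by
    rintro ⟨⟨x, a⟩, h3, ha⟩
    obtain ⟨b, hb⟩ := exists_isNext (isMaximal_of_three_le h3).finite_leanPoints ha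
    obtain ⟨l, q, hl, hq, h1, h2⟩ := exists_mob_pair a.norm_coe b.norm_coe fun h =>
      hb.ne (le_trans (by norm_num) h3) (Circle.ext h)
    have e1 : mobCircle hl hq 1 = a := Circle.ext (by simpa [coe_mobCircle] using h1)
    have e2 : mobCircle hl hq (-1) = b := Circle.ext (by simpa [coe_mobCircle] using h2)
    exact ⟨l, q, hl, hq, ⟨(isNext_mob hl hq one_ne_neg_one).2 (by rwa [e1, e2]), by
      rwa [encard_leanPoints_mob]⟩, e1⟩
  choose l q hl hq hc ha using hex
  exact ⟨⟨_, fun d => (e d).1.1, fun d => l (e d), fun d => q (e d), fun d => hl _, fun d => hq _,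
    fun d => hc _, fun d d' h1 h2 => by
      rw [ha, ha] at h2
      exact e.injective (Subtype.ext (Prod.ext h1 h2)),
    fun y h3 a h => by
      obtain ⟨d, hd⟩ := e.surjective ⟨(y, a), h3, h⟩
      exact ⟨d, by rw [hd], by rw [ha, hd]⟩⟩⟩

namespace DartSystem

variable (D : DartSystem Q)

/-- The corner that represents a dart. -/
def rep (d : Fin D.n) : Q.DiskMap := (Quotient.out (D.vertex d)).mob (D.norm_l d) (D.norm_q d)

/-- The point at which the representative of the vertex leans on the punctures. -/
def start (d : Fin D.n) : Circle := mobCircle (D.norm_l d) (D.norm_q d) 1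

/-- The point that follows `D.start d`. -/
def finish (d : Fin D.n) : Circle := mobCircle (D.norm_l d) (D.norm_q d) (-1)

lemma toDisk_rep (d : Fin D.n) : Q.toDisk (D.rep d) = D.vertex d :=
  (toDisk_mob _ _ _).trans (Quotient.out_eq _)

lemma isCorner (d : Fin D.n) : IsCorner (D.rep d) := D.corner d

lemma isNext (d : Fin D.n) :
    IsNext (Q.leanPoints (Quotient.out (D.vertex d))) (D.start d) (D.finish d) :=
  (isNext_mob _ _ one_ne_neg_one).1 (D.isCorner d).next

lemma three_le (d : Fin D.n) : 3 ≤ (Q.leanPoints (Quotient.out (D.vertex d))).encard := by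
  rw [← encard_leanPoints_mob _ (D.norm_l d) (D.norm_q d)]
  exact (D.isCorner d).three

lemma exists_of_isCorner {v : Q.DiskMap} (hv : IsCorner v) : ∃ d r, v = (D.rep d).trans r := by
  obtain ⟨l, q, hl, hq, h⟩ := exists_eq_mob_of_toDisk_eq (v := Quotient.out (Q.toDisk v))
    (Quotient.out_eq (Q.toDisk v)).symm
  have h3 : 3 ≤ (Q.leanPoints (Quotient.out (Q.toDisk v))).encard := by
    rw [← encard_leanPoints_mob _ hl hq, ← h]; exact hv.three
  have hn : IsNext (Q.leanPoints (Quotient.out (Q.toDisk v))) (mobCircle hl hq 1)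
      (mobCircle hl hq (-1)) := (isNext_mob hl hq one_ne_neg_one).1 (h ▸ hv.next)
  obtain ⟨d, hd1, hd2⟩ := D.surj _ h3 _ hn.1
  obtain ⟨l2, q2, hl₂, hq2, h4, h5⟩ := exists_mob_eq_mob (Q := Q) hl hq (D.norm_l d) (D.norm_q d)
  have hfinish : D.finish d = mobCircle hl hq (-1) := by
    have := D.isNext d
    rw [hd1, start, hd2] at this
    exact this.unique hn
  -- the two automorphisms agree at `1` and at `-1`
  have key : ∀ σ : Circle, mobCircle (D.norm_l d) (D.norm_q d) σ = mobCircle hl hq σ →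
      mob l2 q2 σ = σ := fun σ hσ => by
    have h6 : mobCircle (D.norm_l d) (D.norm_q d) (mobCircle hl₂ hq2 σ) =
        mobCircle (D.norm_l d) (D.norm_q d) σ :=
      hσ.symm ▸ Circle.ext (h4 σ σ.norm_coe.le).symm
    exact congrArg Subtype.val ((mobCircle (D.norm_l d) (D.norm_q d)).injective h6)
  obtain ⟨r, hr⟩ := (eq_trans_of_fix (D.rep d) hl₂ hq2 (σ := 1) (by simpa using key 1 hd2)
    (by simpa using key (-1) hfinish)).1 rfl
  exact ⟨d, r, by rw [← hr, rep, hd1, ← h5]; exact h⟩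

lemma eq_of_trans [Tame Q] {d d' : Fin D.n} {r : ℝ} (h : D.rep d = (D.rep d').trans r) :
    d = d' := by
  have hv : D.vertex d = D.vertex d' := by
    rw [← D.toDisk_rep d, h, ← D.toDisk_rep d', DiskMap.trans, toDisk_mob]
  refine D.inj d d' hv (Circle.ext ?_)
  obtain ⟨l2, q2, hl₂, hq2, h4⟩ := exists_mob_comp (D.norm_l d') (D.norm_q d') (l' := 1) (by simp)
    (abs_tanh_lt_one r)
  have h5 : (Quotient.out (D.vertex d')).mob (D.norm_l d) (D.norm_q d) =
      (Quotient.out (D.vertex d')).mob hl₂ hq2 := by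
    rw [← hv]
    refine h.trans (DiskMap.ext_of_extend fun w hw => ?_)
    rw [DiskMap.trans, extend_mob _ _ _ hw, rep, extend_mob _ _ _ (norm_mob_lt_one
      (by simp) (abs_tanh_lt_one r) hw), extend_mob _ _ _ hw, h4 w hw.le, hv]
  have h6 := mob_inj_of_eq (Tame.ext _ (isMaximal_of_three_le (D.three_le d'))) _ _ hl₂ hq2 h5
    (w := 1) (by simp)
  rw [h4 1 (by simp), (mob_real_one (abs_tanh_lt_one r)).1] at h6
  assumption

lemma exists_next (d : Fin D.n) : ∃ d', D.vertex d' = D.vertex d ∧ D.start d' = D.finish d :=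
  D.surj _ (D.three_le d) _ (D.isNext d).2.1

lemma next_bijective : Function.Bijective fun d => (D.exists_next d).choose := by
  refine Finite.injective_iff_bijective.1 fun d d' (h : Exists.choose _ = Exists.choose _) => ?_
  obtain ⟨h1, h2⟩ := (D.exists_next d).choose_spec
  obtain ⟨h3, h4⟩ := (D.exists_next d').choose_spec
  rw [h] at h1 h2
  have hv := h1.symm.trans h3
  refine D.inj d d' hv ?_
  have h5 := D.isNext d
  rw [hv, ← h2, h4] at h5
  exact h5.unique_left (D.isNext d')

/-- The cyclic order of the darts of a vertex. -/
def next : Equiv.Perm (Fin D.n) := Equiv.ofBijective _ D.next_bijective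

lemma vertex_next (d : Fin D.n) : D.vertex (D.next d) = D.vertex d :=
  (D.exists_next d).choose_spec.1

lemma start_next (d : Fin D.n) : D.start (D.next d) = D.finish d := (D.exists_next d).choose_spec.2

lemma next_induction [Tame Q] {p : Fin D.n → Prop} {d d' : Fin D.n} (hp : p d)
    (h : ∀ e, p e → p (D.next e)) (hv : D.vertex d' = D.vertex d) : p d' := by
  have hL := (isMaximal_of_three_le (D.three_le d)).finite_leanPoints
  have hsub := subset_of_isNext hL (A := {c | ∃ e, D.vertex e = D.vertex d ∧ D.start e = c ∧ p e})
    (D.isNext d).1 ⟨d, rfl, rfl, hp⟩ (by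
      rintro _ ⟨e, h1, rfl, h2⟩ b hb
      refine ⟨D.next e, (D.vertex_next e).trans h1, ?_, h e h2⟩
      rw [D.start_next]
      have := D.isNext e
      rw [h1] at this
      exact this.unique hb)
  have hd' := (D.isNext d').1
  rw [hv] at hd'
  obtain ⟨e, h1, h2, h3⟩ := hsub hd'
  rwa [D.inj d' e (hv.trans h1.symm) h2.symm]

variable [CompactSpace S] [Tame Q]

/-- The edge of a dart. -/
def flow (d : Fin D.n) : Flow (D.rep d) :=
  Classical.choice ((D.isCorner d).leansAtPair.exists_flow (D.isCorner d).upperFree)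

/-- The edge of `d`, traversed in the opposite direction, begins like the edge of `u`. -/
def Rev {u : Q.DiskMap} (F : Flow u) (d : Fin D.n) (r : ℝ) : Prop := StripExt (D.rep d) (π + F.Θ)
    fun s => F.U (((π + F.Θ : ℝ) : ℂ) * I + r - s)

end DartSystem

lemma IsCorner.le_of_projOn {u : Q.DiskMap} (h : IsCorner u) {V : ℂ → S} {a : ℝ}
    (hV : Q.ProjOn exp V {s | a < s.im ∧ s.im < π})
    (heq : ∀ s ∈ strip π, V s = extend u.1 (cay s)) : 0 ≤ a := by
  by_contra! ha
  obtain ⟨ζ, h1, h2, h3⟩ := h.leansAtPair.three_le_iff.1 h.three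
  have h4 : ζ.im < 0 := lt_of_le_of_ne (h.upperFree ζ h1) fun h5 =>
    (eq_one_or_of_im_eq_zero h1.1 h5).elim h2 h3
  obtain ⟨s, hs, rfl⟩ := (exists_cay_of_norm_eq_one h1.1).1 h4
  have hV' := hV.mono (W' := strip π) fun s hs => ⟨ha.trans hs.1, hs.2⟩
  have hu : u = Q.ofStrip V hV' := DiskMap.ext_of_strip fun s hs => by
    rw [extend_ofStrip_cay _ hs, heq s hs]
  have hsm : s ∈ {s : ℂ | a < s.im ∧ s.im < π} := ⟨hs ▸ ha, hs ▸ pi_pos⟩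
  rw [hu] at h1
  exact not_leansAt_ofStrip hV' hs.ge (hs ▸ pi_pos.le) (hV s hsm).1 (hV.notMem hsm) h1

lemma LeansAtPair.neg {u : Q.DiskMap} (h : LeansAtPair u) :
    LeansAtPair (u.mob norm_neg_one (by simp : ‖(0 : ℂ)‖ < 1)) := by
  refine ⟨(mem_leanSet_mob _ _ (by simp)).2 ?_, (mem_leanSet_mob _ _ (by simp)).2 ?_⟩ <;>
    rw [mob_neg_one_zero]
  · exact h.2
  · rw [neg_neg]; exact h.1

lemma extend_neg {u : Q.DiskMap} {s : ℂ} (hs : s ∈ strip π) :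
    extend (u.mob norm_neg_one (by simp : ‖(0 : ℂ)‖ < 1)).1 (cay s) =
      extend u.1 (cay (π * I - s)) := by
  rw [extend_mob _ _ _ (norm_cay_lt_one hs.1 hs.2), mob_neg_one_zero, cay_pi_sub]

lemma pi_sub_mem_strip {s : ℂ} {r : ℝ} (hs : s ∈ strip π) : π * I + r - s ∈ strip π :=
  ⟨by simpa using hs.2, by simpa using hs.1⟩

lemma Flow.isCorner_top [Tame Q] {u : Q.DiskMap} (hu : LeansAtPair u) (F : Flow u) :
    IsCorner ((F.disk 1).mob norm_neg_one (by simp : ‖(0 : ℂ)‖ < 1)) := by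
  have h := (F.leansAtPair 1 hu).neg
  refine ⟨isNext_one_neg_one.2 ⟨h, fun a ha => ?_⟩, h.three_le_iff.2 ?_⟩
  · rw [mem_leanSet_mob _ _ ha.1, mob_neg_one_zero] at ha
    by_contra! h1
    exact F.notMem_of_pos zero_lt_one (by simpa using h1) ha
  · obtain ⟨ζ, h1, h2⟩ := F.exists_mem_top
    refine ⟨-ζ, (mem_leanSet_mob _ _ (by rw [norm_neg, h1.1])).2 ?_, ?_, ?_⟩
    · rwa [mob_neg_one_zero, neg_neg]
    · rintro h3; rw [neg_eq_iff_eq_neg.1 h3] at h2; simp at h2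
    · rintro h3; rw [neg_injective h3] at h2; simp at h2

namespace DartSystem

variable (D : DartSystem Q) [CompactSpace S] [Tame Q]

lemma exists_rev {u : Q.DiskMap} (hu : LeansAtPair u) (F : Flow u) : ∃ d r, D.Rev F d r := by
  obtain ⟨d, r, hr⟩ := D.exists_of_isCorner (F.isCorner_top hu)
  refine ⟨d, r, by linarith [F.pos], projOn_sub F.ext.proj _ fun s hs => ?_, fun s hs => ?_⟩
  · exact ⟨by simpa using hs.2, by simpa using hs.1⟩
  have hs' : s + (-r : ℝ) ∈ strip π := by simpa [strip] using hs
  have h1 : D.rep d = ((F.disk 1).mob norm_neg_one (by simp : ‖(0 : ℂ)‖ < 1)).trans (-r) := by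
    rw [hr, trans_trans, add_neg_cancel, trans_zero]
  rw [h1, extend_trans _ _ hs, extend_neg hs', F.extend_disk 1 (by
    simpa using pi_sub_mem_strip (r := 0) hs')]
  congr 1
  push_cast
  ring

variable {D}

lemma Rev.unique {u : Q.DiskMap} {F : Flow u} {d d' : Fin D.n} {r r' : ℝ} (h : D.Rev F d r)
    (h' : D.Rev F d' r') : d = d' := by
  refine D.eq_of_trans (r := r' - r) (DiskMap.ext_of_strip fun s hs => ?_)
  rw [extend_trans _ _ hs, ← h.eq s hs, ← h'.eq _ (by simpa [strip] using hs)]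
  congr 1; push_cast; ring

lemma Rev.symm {d d' : Fin D.n} {r : ℝ} (h : D.Rev (D.flow d) d' r) :
    (D.flow d').Θ = (D.flow d).Θ ∧ D.Rev (D.flow d') d r := by
  obtain ⟨h1, h2⟩ := (D.flow d').le_of_ext h
  have hU : ∀ s ∈ strip (π + (D.flow d).Θ), (D.flow d').U
      (((π + (D.flow d).Θ : ℝ) : ℂ) * I + r - s) = (D.flow d).U s := fun s hs => by
    rw [← h2 ⟨by simpa using hs.2, by simpa using hs.1⟩]
    simp
  have hpi := pi_pos
  have hΘ := (D.flow d).pos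
  have h3 : ∀ s ∈ strip π, (D.flow d').U (((π + (D.flow d).Θ : ℝ) : ℂ) * I + r - s)
      = extend (D.rep d).1 (cay s) := fun s hs => by
    rw [hU s ⟨hs.1, by linarith [hs.2]⟩, (D.flow d).ext.eq s hs]
  have h4 : 0 ≤ (D.flow d).Θ - (D.flow d').Θ := (D.isCorner d).le_of_projOn
    (projOn_sub (D.flow d').ext.proj _ fun s hs => ⟨by simp; linarith [hs.2], by
      simp; linarith [hs.1]⟩) h3
  have h5 : (D.flow d').Θ = (D.flow d).Θ := by linarith
  refine ⟨h5, ?_⟩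
  rw [Rev, h5]
  exact ⟨by linarith, projOn_sub (D.flow d').ext.proj _ fun s hs =>
    ⟨by simpa using hs.2, by rw [h5]; simpa using hs.1⟩, h3⟩

lemma Rev.disk {u : Q.DiskMap} {F : Flow u} {d : Fin D.n} {r : ℝ} (h : D.Rev F d r)
    {t t' : unitInterval} (ht : (1 - t : ℝ) * F.Θ = t' * (D.flow d).Θ) :
    (F.disk t).mob norm_neg_one (by simp : ‖(0 : ℂ)‖ < 1) = ((D.flow d).disk t').trans r := by
  refine DiskMap.ext_of_strip fun s hs => ?_
  have hs' : s + (r : ℂ) ∈ strip π := by simpa [strip] using hs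
  obtain ⟨h1, h2⟩ := (D.flow d).le_of_ext h
  rw [extend_neg hs, F.extend_disk t (by simpa using pi_sub_mem_strip (r := 0) hs),
    extend_trans _ _ hs, (D.flow d).extend_disk t' hs', ← ht, ← h2]
  · dsimp only
    congr 1; push_cast; ring
  · refine mem_strip_add.2 ⟨?_, ?_⟩ <;> simp only [add_im, ofReal_im, add_zero]
    · nlinarith [hs.1, t.2.2, F.pos]
    · nlinarith [hs.2, t.2.1, F.pos]

/-- An edge does not coincide with its reverse: a half turn of the strip has a fixed point. -/
lemma not_rev_self (d : Fin D.n) (r : ℝ) : ¬ D.Rev (D.flow d) d r := fun h => by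
  obtain ⟨h1, h2⟩ := (D.flow d).le_of_ext h
  set c := ((π + (D.flow d).Θ : ℝ) : ℂ) * I + r with hc
  have hb : 0 < π + (D.flow d).Θ := add_pos pi_pos (D.flow d).pos
  have him : (c / 2).im = (π + (D.flow d).Θ) / 2 := by simp [*]
  have hm : c / 2 ∈ strip (π + (D.flow d).Θ) := ⟨by rw [him]; linarith, by rw [him]; linarith⟩
  obtain ⟨N, hN, hinj⟩ := (D.flow d).ext.proj.eventually_ne hm
  have ht1 : Tendsto (fun ε : ℝ => c / 2 + ε) (𝓝 0) (𝓝 (c / 2)) := by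
    have : Continuous fun ε : ℝ => c / 2 + ε := by fun_prop
    simpa using this.tendsto 0
  have ht2 : Tendsto (fun ε : ℝ => c - (c / 2 + ε)) (𝓝 0) (𝓝 (c / 2)) := by
    have := ht1.const_sub c
    grind
  have hev := (ht1.eventually (Filter.Eventually.and hN ((isOpen_strip _).mem_nhds hm))).and
    (ht2.eventually hN)
  obtain ⟨ε, ⟨⟨h3, h5⟩, h4⟩, h6⟩ := ((hev.filter_mono nhdsWithin_le_nhds).and
    (self_mem_nhdsWithin (s := Set.Ioi (0 : ℝ)))).exists
  have h7 := congrArg norm (hinj _ h3 _ h4 (h2 h5).symm)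
  rw [norm_exp, norm_exp, Real.exp_eq_exp] at h7
  have h8 : (c - (c / 2 + ε)).re = (c / 2).re - ε := by
    rw [show c - (c / 2 + ε) = c / 2 - ε by ring]; simp
  rw [h8] at h7
  simp only [add_re, ofReal_re] at h7
  linarith

end DartSystem

end Darts

/-! ### The graph of maximal disks -/

section Graph

variable [T2Space S] [IsManifold 𝓘(ℂ) ω S] [CompactSpace S] [Tame Q]

namespace DartSystem

variable (D : DartSystem Q)

lemma exists_rev_flow (d : Fin D.n) : ∃ d' r, D.Rev (D.flow d) d' r :=
  D.exists_rev (D.isCorner d).leansAtPair _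

lemma involutive_rev : Function.Involutive fun d => (D.exists_rev_flow d).choose := fun d => by
  obtain ⟨r, h⟩ := (D.exists_rev_flow d).choose_spec
  obtain ⟨r', h'⟩ := (D.exists_rev_flow (D.exists_rev_flow d).choose).choose_spec
  exact h'.unique h.symm.2

/-- The fat graph of the maximal disks. -/
def graph : FatGraph where
  Dart := Fin D.n
  finite := inferInstance
  rev := D.involutive_rev.toPerm
  rev_rev := D.involutive_rev
  rev_ne d h := by
    obtain ⟨r, h'⟩ := (D.exists_rev_flow d).choose_spec
    rw [show (D.exists_rev_flow d).choose = d from h] at h'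
    exact D.not_rev_self d r h'
  next := D.next

lemma rev_graph (d : Fin D.n) : ∃ r, D.Rev (D.flow d) (D.graph.rev d) r :=
  (D.exists_rev_flow d).choose_spec

/-- The disks of the edges. -/
def edge (x : Σ _ : Fin D.n, unitInterval) : Q.MaxDisk := ⟨Q.toDisk ((D.flow x.1).disk x.2),
    ((D.flow x.1).leansAtPair x.2 (D.isCorner x.1).leansAtPair).isMaximal⟩

lemma edge_zero (d : Fin D.n) : (D.edge ⟨d, 0⟩).1 = D.vertex d :=
  (congrArg Q.toDisk (Flow.disk_zero _)).trans (D.toDisk_rep d)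

lemma rev_disk (d : Fin D.n) (t : unitInterval) :
    ∃ r, ((D.flow d).disk t).mob norm_neg_one (by simp : ‖(0 : ℂ)‖ < 1) =
      ((D.flow (D.graph.rev d)).disk (unitInterval.symm t)).trans r := by
  obtain ⟨r, h⟩ := D.rev_graph d
  exact ⟨r, h.disk (by rw [h.symm.1, unitInterval.coe_symm_eq])⟩

lemma edge_glue {x y : Σ _ : Fin D.n, unitInterval} (h : D.graph.Glue x y) :
    D.edge x = D.edge y := by
  refine Subtype.ext ?_
  rcases h with ⟨d, t⟩ | ⟨d⟩
  · obtain ⟨r, h⟩ := D.rev_disk d t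
    exact (toDisk_mob _ _ _).symm.trans ((congrArg Q.toDisk h).trans (toDisk_mob _ _ _))
  · exact (D.edge_zero d).trans ((D.vertex_next d).symm.trans (D.edge_zero _).symm)

lemma three_le_disk_iff (d : Fin D.n) (t : unitInterval) :
    3 ≤ (Q.leanPoints ((D.flow d).disk t)).encard ↔ t = 0 ∨ t = 1 := by
  have hp := (D.isCorner d).leansAtPair
  constructor
  · intro h
    by_contra! hcon
    obtain ⟨ζ, h1, h2, h3⟩ := ((D.flow d).leansAtPair t hp).three_le_iff.1 h
    rw [(D.flow d).leanSet_disk hp (unitInterval.pos_iff_ne_zero.2 hcon.1)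
      (unitInterval.lt_one_iff_ne_one.2 hcon.2)] at h1
    grind
  · rintro (rfl | rfl)
    · rw [Flow.disk_zero]; exact (D.isCorner d).three
    · obtain ⟨ζ, h1, h2⟩ := (D.flow d).exists_mem_top
      exact ((D.flow d).leansAtPair 1 hp).three_le_iff.2
        ⟨ζ, h1, by rintro rfl; simp at h2, by rintro rfl; simp at h2⟩

lemma exists_zero {x : Σ _ : Fin D.n, unitInterval}
    (h : 3 ≤ (Q.leanPoints ((D.flow x.1).disk x.2)).encard) :
    ∃ e : Fin D.n, Quot.mk D.graph.Glue x = Quot.mk D.graph.Glue ⟨e, 0⟩ := by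
  obtain ⟨d, t⟩ := x
  rcases (D.three_le_disk_iff d t).1 h with rfl | rfl
  · exact ⟨d, rfl⟩
  · exact ⟨D.graph.rev d, (Quot.sound (FatGraph.Glue.flip (G := D.graph) d 1)).trans (by simp)⟩

/-- If a disk of one edge is a translate of a disk of another edge which is higher up, then the
corner of the first edge extends downwards. -/
lemma le_of_disk_eq {d d' : Fin D.n} {t t' : unitInterval} {r : ℝ}
    (h : (D.flow d).disk t = ((D.flow d').disk t').trans r) :
    t' * (D.flow d').Θ ≤ t * (D.flow d).Θ ∧
      (t' * (D.flow d').Θ = t * (D.flow d).Θ → D.rep d = (D.rep d').trans r) := by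
  set F := D.flow d
  set F' := D.flow d'
  have hpi := pi_pos
  set ρ := t' * F'.Θ - t * F.Θ with hρ
  have h1 : ρ ≤ F'.Θ := by nlinarith [t'.2.2, t.2.1, F.pos, F'.pos]
  suffices key : 0 ≤ ρ → Q.ProjOn exp (fun s => F'.U (s + (r + ρ * I)))
      {s | -ρ < s.im ∧ s.im < π} ∧ ∀ s ∈ strip π,
        F'.U (s + (r + ρ * I)) = extend (D.rep d).1 (cay s) by
    refine ⟨not_lt.1 fun h2 => ?_, fun h2 => DiskMap.ext_of_strip fun s hs => ?_⟩
    · obtain ⟨h3, h4⟩ := key (by linarith)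
      linarith [(D.isCorner d).le_of_projOn h3 h4]
    · have h3 : ρ = 0 := by rw [hρ, h2, sub_self]
      rw [← (key h3.ge).2 s hs, extend_trans _ _ hs, ← F'.ext.eq _ (by simpa [strip] using hs), h3]
      simp
  intro h0
  set b := min (π + F.Θ) (π + F'.Θ - ρ)
  have hb : π ≤ b := le_min (by linarith [F.pos]) (by linarith)
  have hm : ∀ s : ℂ, -ρ < s.im → s.im < π + F'.Θ - ρ →
      s + (r + ρ * I) ∈ strip (π + F'.Θ) := fun s h2 h3 =>
    ⟨by simp; linarith, by simp; linarith⟩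
  have heq : Set.EqOn (fun s => F'.U (s + (r + ρ * I))) F.U (strip b) := by
    refine HolOn.eqOn (s0 := π / 2 * I + ((t * F.Θ : ℝ) : ℂ) * I)
      (F'.ext.holOn.comp (fun s _ => by fun_prop) fun s hs => ?_)
      (F.ext.holOn.mono fun s hs => ⟨hs.1, hs.2.trans_le (min_le_left _ _)⟩)
      (convex_strip _).isPreconnected ?_ ?_
    · exact hm s (by linarith [hs.1]) (hs.2.trans_le (min_le_right _ _))
    · have h2 := mul_nonneg t.2.1 F.pos.le
      have h3 : t * F.Θ ≤ F.Θ := mul_le_of_le_one_left F.pos.le t.2.2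
      have h4 : t' * F'.Θ ≤ F'.Θ := mul_le_of_le_one_left F'.pos.le t'.2.2
      have him : (π / 2 * I : ℂ).im = π / 2 := by simp
      refine mem_strip_add.2 ⟨?_, lt_min ?_ ?_⟩ <;> rw [him] <;> linarith
    · have hc : ContinuousAt (fun s : ℂ => s - ((t * F.Θ : ℝ) : ℂ) * I)
          (π / 2 * I + ((t * F.Θ : ℝ) : ℂ) * I) := by fun_prop
      have h2 := hc.preimage_mem_nhds (t := strip π) (by
        rw [add_sub_cancel_right]; exact (isOpen_strip _).mem_nhds pi_half_mem_strip)
      filter_upwards [h2] with s hs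
      have h3 := F.extend_disk t hs
      rw [h, extend_trans _ _ hs, F'.extend_disk t' (by simpa [strip] using hs),
        sub_add_cancel] at h3
      rw [← h3]
      congr 1; rw [hρ]; push_cast; ring
  refine ⟨projOn_add F'.ext.proj _ fun s hs => hm s hs.1 (by linarith [hs.2]), fun s hs => ?_⟩
  rw [← F.ext.eq s hs]
  exact heq ⟨hs.1, hs.2.trans_le hb⟩

lemma eq_of_disk_eq {d d' : Fin D.n} {t t' : unitInterval} {r : ℝ}
    (h : (D.flow d).disk t = ((D.flow d').disk t').trans r) :
    (⟨d, t⟩ : Σ _ : Fin D.n, unitInterval) = ⟨d', t'⟩ := by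
  obtain ⟨h1, h2⟩ := D.le_of_disk_eq h
  obtain ⟨h3, -⟩ := D.le_of_disk_eq (r := -r) (d := d') (d' := d) (t := t') (t' := t) (by
    rw [h, trans_trans, add_neg_cancel, trans_zero])
  have h4 := le_antisymm h1 h3
  obtain rfl := D.eq_of_trans (h2 h4)
  rw [Subtype.ext (mul_right_cancel₀ (D.flow d).pos.ne' h4)]

lemma edge_injective {x y : Σ _ : Fin D.n, unitInterval} (h : D.edge x = D.edge y) :
    Quot.mk D.graph.Glue x = Quot.mk D.graph.Glue y := by
  have hd := congrArg Subtype.val h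
  by_cases hx : 3 ≤ (Q.leanPoints ((D.flow x.1).disk x.2)).encard
  · obtain ⟨e, he⟩ := D.exists_zero hx
    obtain ⟨e', he'⟩ := D.exists_zero (x := y) (by rwa [← encard_leanPoints_congr hd])
    have hE : ∀ {z z'}, Quot.mk D.graph.Glue z = Quot.mk D.graph.Glue z' → D.edge z = D.edge z' :=
      fun h => congrArg (Quot.lift D.edge fun _ _ => D.edge_glue) h
    have hv : D.vertex e' = D.vertex e := (D.edge_zero e').symm.trans ((congrArg Subtype.val
      ((hE he').symm.trans (h.symm.trans (hE he)))).trans (D.edge_zero e))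
    rw [he, he']
    exact D.next_induction (p := fun e' => Quot.mk D.graph.Glue ⟨e, 0⟩ = Quot.mk D.graph.Glue ⟨e', 0⟩)
      rfl (fun e'' h => h.trans (Quot.sound (FatGraph.Glue.vertex (G := D.graph) e''))) hv
  obtain ⟨d, t⟩ := x
  obtain ⟨d', t'⟩ := y
  have hy : ¬ 3 ≤ (Q.leanPoints ((D.flow d').disk t')).encard := by
    rwa [← encard_leanPoints_congr hd]
  rw [three_le_disk_iff, not_or] at hx hy
  obtain ⟨l, q, hl, hq, hlq⟩ := exists_eq_mob_of_toDisk_eq hd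
  have hp := (D.flow d).leansAtPair t (D.isCorner d).leansAtPair
  have hset := (D.flow d').leanSet_disk (D.isCorner d').leansAtPair
    (unitInterval.pos_iff_ne_zero.2 hy.1) (unitInterval.lt_one_iff_ne_one.2 hy.2)
  simp only at hlq
  rw [hlq, LeansAtPair, mem_leanSet_mob _ _ (by simp), mem_leanSet_mob _ _ (by simp), hset] at hp
  have hne : mob l q 1 ≠ mob l q (-1) := fun h => one_ne_neg_one
    ((mobCircle hl hq).injective (Circle.ext (by simpa [coe_mobCircle] using h)))
  have hσ : mob l q (-1) = -mob l q 1 := by grind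
  obtain ⟨h1, h2⟩ := eq_trans_of_fix ((D.flow d').disk t') hl hq rfl hσ
  rcases hp.1 with h3 | h3
  · obtain ⟨r, hr⟩ := h1 h3
    rw [D.eq_of_disk_eq (hlq.trans hr)]
  · obtain ⟨r, hr⟩ := h2 h3
    obtain ⟨r', hr'⟩ := D.rev_disk d' t'
    rw [hr', trans_trans] at hr
    rw [D.eq_of_disk_eq (hlq.trans hr)]
    exact (Quot.sound (FatGraph.Glue.flip (G := D.graph) d' t')).symm

lemma edge_surjective : Function.Surjective D.edge := by
  rintro ⟨x, hx⟩
  obtain ⟨u, rfl⟩ := Quotient.exists_rep x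
  have hmax : IsMaximal u := hx
  obtain ⟨C⟩ := hmax.collar
  have h2 := C.two_le_encard (Tame.ext u hmax) hmax
  by_cases h3 : 3 ≤ (Q.leanPoints u).encard
  · have hout : 3 ≤ (Q.leanPoints (Quotient.out (Q.toDisk u))).encard := by
      rwa [encard_leanPoints_congr (Quotient.out_eq (Q.toDisk u))]
    obtain ⟨a, ha⟩ := Set.encard_pos.1 (lt_of_lt_of_le (by norm_num) hout)
    obtain ⟨d, hd, -⟩ := D.surj _ hout a ha
    exact ⟨⟨d, 0⟩, Subtype.ext ((D.edge_zero d).trans hd)⟩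
  obtain ⟨a, b, ha, hb, hab⟩ := Set.one_lt_encard_iff.1 (lt_of_lt_of_le (by norm_num) h2)
  obtain ⟨l, q, hl, hq, h4, h5⟩ := exists_mob_pair a.norm_coe b.norm_coe fun h => hab (Circle.ext h)
  set v := u.mob hl hq
  have hv : LeansAtPair v := ⟨(mem_leanSet_mob _ _ (by simp)).2 (h4 ▸ coe_mem_leanSet.2 ha),
    (mem_leanSet_mob _ _ (by simp)).2 (h5 ▸ coe_mem_leanSet.2 hb)⟩
  have hfree : UpperFree v := fun ζ hζ => by
    by_contra! him
    refine h3 (encard_leanPoints_mob u hl hq ▸ hv.three_le_iff.2 ⟨ζ, hζ, ?_, ?_⟩) <;>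
    · rintro rfl; simp at him
  obtain ⟨F⟩ := hv.exists_flow hfree
  obtain ⟨d, r, h⟩ := D.exists_rev hv F
  have hle := ((D.flow d).le_of_ext h).1
  have hd := (D.flow d).pos
  refine ⟨⟨d, ⟨F.Θ / (D.flow d).Θ, by have := F.pos; positivity, by
    rw [div_le_one hd]; linarith⟩⟩, Subtype.ext ?_⟩
  have h6 := h.disk (t := 0) (t' := ⟨F.Θ / (D.flow d).Θ, by have := F.pos; positivity, by
    rw [div_le_one hd]; linarith⟩) (by simp [div_mul_cancel₀ _ hd.ne'])
  have h7 := congrArg Q.toDisk h6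
  rw [DiskMap.trans, toDisk_mob, toDisk_mob, F.disk_zero, toDisk_mob] at h7
  exact h7.symm

/-- The graph is homeomorphic to the space of maximal disks. -/
lemma exists_homeo : ∃ h : D.graph.Realization ≃ₜ Q.MaxDisk,
    ∀ d t, h (D.graph.point d t) = D.edge ⟨d, t⟩ := by
  have := t2Space_maxDisk (Q := Q) Tame.cusp fun x u h => Tame.ext u (by
    rw [IsMaximal, h]; exact x.2)
  let f : D.graph.Realization → Q.MaxDisk := Quot.lift D.edge fun _ _ => D.edge_glue
  have hc : Continuous f := continuous_quot_lift _ (continuous_sigma fun d =>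
    ((continuous_quotient_mk'.comp (D.flow d).continuous_disk).subtype_mk _))
  have : CompactSpace (Σ _ : D.graph.Dart, unitInterval) :=
    inferInstanceAs (CompactSpace (Σ _ : Fin D.n, unitInterval))
  have : CompactSpace D.graph.Realization := Quot.compactSpace
  have hb : Function.Bijective f := by
    constructor
    · rintro ⟨x⟩ ⟨y⟩ h
      exact D.edge_injective h
    · intro y
      obtain ⟨x, hx⟩ := D.edge_surjective y
      exact ⟨Quot.mk _ x, hx⟩
  exact ⟨Continuous.homeoOfEquivCompactToT2 (f := Equiv.ofBijective f hb) hc, fun _ _ => rfl⟩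

lemma leanPoints_disk (d : Fin D.n) {t : unitInterval} (h0 : 0 < t) (h1 : t < 1) :
    Q.leanPoints ((D.flow d).disk t) = {1, -1} := by
  ext ζ
  rw [← coe_mem_leanSet, (D.flow d).leanSet_disk (D.isCorner d).leansAtPair h0 h1]
  simp only [Set.mem_insert_iff, Set.mem_singleton_iff, Circle.ext_iff, Circle.coe_one,
    Circle.coe_neg]

lemma isDiskModel {h : D.graph.Realization ≃ₜ Q.MaxDisk}
    (hh : ∀ d t, h (D.graph.point d t) = D.edge ⟨d, t⟩) : IsDiskModel Q D.graph h := by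
  have hz : ∀ d (x : Q.MaxDisk), h (D.graph.point d 0) = x ↔ D.vertex d = x.1 := fun d x => by
    rw [hh, Subtype.ext_iff]; exact Eq.congr_left (D.edge_zero d)
  refine ⟨fun x u hu => ⟨?_, fun h3 => ?_⟩, fun x u hu ⟨d0, hd₀⟩ => ?_⟩
  · rintro ⟨d, hd⟩
    rw [hz, ← hu, ← Quotient.out_eq (D.vertex d)] at hd
    exact encard_leanPoints_congr hd ▸ D.three_le d
  · obtain ⟨⟨d, t⟩, hd⟩ := D.edge_surjective x
    have h4 : Q.toDisk ((D.flow d).disk t) = Q.toDisk u := (congrArg Subtype.val hd).trans hu.symm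
    obtain ⟨e, he⟩ := D.exists_zero (x := ⟨d, t⟩) (by rwa [encard_leanPoints_congr h4])
    exact ⟨e, (congrArg h he).symm.trans ((hh d t).trans hd)⟩
  obtain ⟨l, q, hl, hq, hw⟩ := exists_eq_mob_of_toDisk_eq (u := Quotient.out x.1) (v := u)
    ((Quotient.out_eq x.1).trans hu.symm)
  have hL : ∀ a, a ∈ Q.leanPoints (Quotient.out x.1) ↔ mobCircle hl hq a ∈ Q.leanPoints u :=
    fun a => by rw [hw, leanPoints_mob]; rfl
  have hnext : ∀ d : Fin D.n, mobCircle hl hq (D.start (D.graph.next d)) =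
      mobCircle hl hq (D.finish d) := fun d => congrArg _ (D.start_next d)
  refine ⟨fun d => mobCircle hl hq (D.start d), ⟨fun d hd => ?_, fun d hd d' hd' h => ?_,
    fun a ha => ?_⟩, fun d hd => ?_, fun d hd O hO U hU V hV => ?_⟩
  · rw [Set.mem_ofPred_eq, hz] at hd
    exact (hL _).1 (hd ▸ (D.isNext d).1)
  · rw [Set.mem_ofPred_eq, hz] at hd hd'
    exact D.inj d d' (hd.trans hd'.symm) ((mobCircle hl hq).injective h)
  · obtain ⟨b, rfl⟩ := (mobCircle hl hq).surjective a
    obtain ⟨d, hd1, hd2⟩ := D.surj x.1 ((hz d0 x).1 hd₀ ▸ D.three_le d0) b ((hL b).2 ha)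
    exact ⟨d, (hz d x).2 hd1, congrArg _ hd2⟩
  · rw [hz] at hd
    have h1 := D.isNext d
    have h2 := h1.ne (le_trans (by norm_num) (D.three_le d))
    rw [hd, hw, isNext_mob hl hq h2] at h1
    change IsNext _ _ (mobCircle hl hq (D.start (D.graph.next d)))
    rwa [hnext d]
  · rw [hz] at hd
    set ψ : Q.DiskMap → Q.DiskMap := fun v =>
      (v.mob (norm_conj_eq_one (D.norm_l d)) (norm_inv_center (D.norm_l d) (D.norm_q d))).mob
        (norm_conj_eq_one hl) (norm_inv_center hl hq) with hψ
    have h0 : ψ (D.rep d) = u := by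
      simp only [hψ, rep]
      rw [mob_mob_inv, hd, hw, mob_mob_inv]
    have hc : Tendsto (fun t => ψ ((D.flow d).disk t)) (𝓝[>] 0) (𝓝 u) := by
      have hψc : Continuous fun t => ψ ((D.flow d).disk t) :=
        (continuous_mob (norm_conj_eq_one hl) (norm_inv_center hl hq)).comp ((continuous_mob (norm_conj_eq_one (D.norm_l d))
          (norm_inv_center (D.norm_l d) (D.norm_q d))).comp (D.flow d).continuous_disk)
      have h1 := hψc.tendsto 0
      rw [Flow.disk_zero, h0] at h1
      exact h1.mono_left nhdsWithin_le_nhds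
    filter_upwards [hc hO, Ioo_mem_nhdsGT (show (0 : unitInterval) < 1 from zero_lt_one)] with t ht ht1
    have hset : Q.leanPoints (ψ ((D.flow d).disk t)) =
        {mobCircle hl hq (D.start d), mobCircle hl hq (D.finish d)} := by
      simp only [hψ]
      rw [leanPoints_mob, leanPoints_mob, D.leanPoints_disk d ht1.1 ht1.2]
      ext ζ
      have e1 : mobCircle (norm_conj_eq_one hl) (norm_inv_center hl hq) ζ =
          (mobCircle hl hq).symm ζ := rfl
      have e2 : ∀ ζ, mobCircle (norm_conj_eq_one (D.norm_l d)) (norm_inv_center (D.norm_l d)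
        (D.norm_q d)) ζ = (mobCircle (D.norm_l d) (D.norm_q d)).symm ζ := fun _ => rfl
      simp only [Set.mem_preimage, Set.mem_insert_iff, Set.mem_singleton_iff, e1, e2,
        Equiv.symm_apply_eq, start, finish]
    refine ⟨_, ht, ?_, _, mem_of_mem_nhds hU, _, mem_of_mem_nhds hV, ?_, ?_⟩
    · rw [hh]
      simp only [hψ, toDisk_mob, edge]
    · change mobCircle hl hq (D.start d) ≠ mobCircle hl hq (D.start (D.graph.next d))
      rw [hnext d]
      exact (mobCircle hl hq).injective.ne ((D.isNext d).ne (le_trans (by norm_num) (D.three_le d)))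
    · rw [hset, ← hnext d]

end DartSystem

end Graph

/-! ### Uniqueness of the fat graph structure -/

section Uniqueness

namespace FatGraph

variable (G : FatGraph)

lemma continuous_point (d : G.Dart) : Continuous (G.point d) :=
  continuous_quot_mk.comp (continuous_sigmaMk (σ := fun _ : G.Dart => unitInterval))

lemma point_rev (d : G.Dart) (t : unitInterval) :
    G.point (G.rev d) (unitInterval.symm t) = G.point d t :=
  (Quot.sound (Glue.flip d t)).symm

lemma point_next (d : G.Dart) : G.point (G.next d) 0 = G.point d 0 :=
  (Quot.sound (Glue.vertex d)).symm

lemma exists_point_le (x : G.Realization) :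
    ∃ (d : G.Dart) (t : unitInterval), (t : ℝ) ≤ 1 / 2 ∧ x = G.point d t := by
  obtain ⟨⟨d, t⟩, rfl⟩ := Quot.exists_rep x
  rcases le_total (t : ℝ) (1 / 2) with h | h
  · exact ⟨d, t, h, rfl⟩
  · exact ⟨G.rev d, unitInterval.symm t, by rw [unitInterval.coe_symm_eq]; linarith,
      (G.point_rev d t).symm⟩

open scoped Classical in
/-- The tent function of a set of darts which is invariant under reversal: the distance from the
vertices on the edges in this set, and zero on the other edges. -/
def tent (A : Set G.Dart) (hA : ∀ d, G.rev d ∈ A ↔ d ∈ A) : G.Realization → ℝ :=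
  Quot.lift (fun z => if z.1 ∈ A then min (z.2 : ℝ) (1 - z.2) else 0) fun z z' h => by
    rcases h with ⟨d, t⟩ | ⟨d⟩
    · grind
    · simp

variable {G} {A : Set G.Dart} {hA : ∀ d, G.rev d ∈ A ↔ d ∈ A}

lemma continuous_tent : Continuous (G.tent A hA) := by
  refine continuous_quot_lift _ (continuous_sigma fun d => ?_)
  by_cases h : d ∈ A
  · simp only [h, if_true]; fun_prop
  · simp only [h, if_false]; fun_prop

open scoped Classical in
lemma tent_pos_iff {d : G.Dart} {t : unitInterval} :
    0 < G.tent A hA (G.point d t) ↔ d ∈ A ∧ 0 < t ∧ t < 1 := by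
  change 0 < (if d ∈ A then min (t : ℝ) (1 - t) else 0) ↔ _
  split_ifs with h
  · simp [*]
  · simp [h]

lemma point_eq_zero {d e : G.Dart} {t : unitInterval} (h : G.point d t = G.point e 0) :
    t = 0 ∨ t = 1 := by
  have h1 := tent_pos_iff (A := Set.univ) (hA := by simp) (d := d) (t := t)
  rw [h, tent_pos_iff] at h1
  by_contra! hcon
  exact lt_irrefl _ (h1.2 ⟨trivial, unitInterval.pos_iff_ne_zero.2 hcon.1,
    unitInterval.lt_one_iff_ne_one.2 hcon.2⟩).2.1

/-- A path which avoids the vertices stays on the same edge. -/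
lemma mem_of_path {f : unitInterval → G.Realization} (hf : Continuous f)
    (hv : ∀ t, 0 < t → t < 1 → ∀ e, f t ≠ G.point e 0) {s t : unitInterval}
    (hs : 0 < s ∧ s < 1) (ht : 0 < t ∧ t < 1) {d e : G.Dart} {s' t' : unitInterval}
    (h : f s = G.point d s') (h' : f t = G.point e t') : e = d ∨ e = G.rev d := by
  set A : Set G.Dart := {e | e = d ∨ e = G.rev d}
  have hA : ∀ e, G.rev e ∈ A ↔ e ∈ A := fun e => by
    simp only [A, Set.mem_ofPred_eq, G.rev.injective.eq_iff]
    exact or_comm.trans (or_congr Iff.rfl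
      ⟨fun h => h ▸ (G.rev_rev e).symm, fun h => h ▸ G.rev_rev d⟩)
  have hpos : ∀ r, 0 < r → r < 1 → ∀ e r', f r = G.point e r' → 0 < r' ∧ r' < 1 :=
    fun r h0 h1 e r' her => by
      refine ⟨unitInterval.pos_iff_ne_zero.2 ?_, unitInterval.lt_one_iff_ne_one.2 ?_⟩
      · grind
      · rintro rfl
        rw [← unitInterval.symm_zero, ← G.rev_rev e, point_rev] at her
        grind
  by_contra hne
  have hA' : ∀ e, G.rev e ∈ Aᶜ ↔ e ∈ Aᶜ := fun e => not_congr (hA e)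
  have hpre := (isPreconnected_Ioo (a := (0 : unitInterval)) (b := 1))
    {r | 0 < G.tent A hA (f r)} {r | 0 < G.tent Aᶜ hA' (f r)}
    (isOpen_lt continuous_const (continuous_tent.comp hf))
    (isOpen_lt continuous_const (continuous_tent.comp hf)) (fun r hr => by
      obtain ⟨⟨e, r'⟩, her⟩ := Quot.exists_rep (f r)
      have hr' := hpos r hr.1 hr.2 e r' her.symm
      simp only [Set.mem_union, Set.mem_ofPred_eq, ← her]
      by_cases he : e ∈ A
      · exact Or.inl (tent_pos_iff.2 ⟨he, hr'⟩)
      · exact Or.inr (tent_pos_iff.2 ⟨he, hr'⟩))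
    ⟨s, hs, by
      simp only [Set.mem_ofPred_eq, h]
      exact tent_pos_iff.2 ⟨Or.inl rfl, hpos s hs.1 hs.2 _ _ h⟩⟩
    ⟨t, ht, by
      simp only [Set.mem_ofPred_eq, h']
      exact tent_pos_iff.2 ⟨hne, hpos t ht.1 ht.2 _ _ h'⟩⟩
  obtain ⟨r, -, h1, h2⟩ := hpre
  obtain ⟨⟨e, r'⟩, her⟩ := Quot.exists_rep (f r)
  simp only [Set.mem_ofPred_eq, ← her] at h1 h2
  exact (tent_pos_iff.1 h2).1 (tent_pos_iff.1 h1).1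

end FatGraph

variable [T2Space S] [IsManifold 𝓘(ℂ) ω S]

lemma exists_nhds_mob_ne {a b : Circle} (h : a ≠ b) : ∃ N ∈ 𝓝 ((1, 0) : ℂ × ℂ), ∃ U ∈ 𝓝 a,
    ∃ V ∈ 𝓝 b, ∀ z ∈ N, ∀ x ∈ U, ∀ y ∈ V, mob z.1 z.2 y ≠ x := by
  have h1 : Tendsto (fun z : (ℂ × ℂ) × Circle × Circle => mob z.1.1 z.1.2 z.2.2 - z.2.1)
      (𝓝 ((1, 0), a, b)) (𝓝 (b - a)) := by
    have h2 : ContinuousAt (fun z : (ℂ × ℂ) × Circle × Circle =>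
        (z.1.1 * z.2.2 + z.1.2) / (1 + conj z.1.2 * z.1.1 * z.2.2) - z.2.1) ((1, 0), a, b) := by
      refine ContinuousAt.sub (ContinuousAt.div (by fun_prop) ?_ (by simp)) (by fun_prop)
      fun_prop
    simpa [ContinuousAt, mob] using h2
  have h2 := h1.eventually_ne (sub_ne_zero.2 fun h' => h (Circle.ext h').symm)
  rw [nhds_prod_eq] at h2
  obtain ⟨N, hN, W, hW, h3⟩ := mem_prod_iff.1 h2
  rw [nhds_prod_eq] at hW
  obtain ⟨U, hU, V, hV, h4⟩ := mem_prod_iff.1 hW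
  exact ⟨N, hN, U, hU, V, hV, fun z hz x hx y hy h5 =>
    h3 (Set.mk_mem_prod hz (h4 (Set.mk_mem_prod hx hy))) (sub_eq_zero.2 h5)⟩

/-- Near a vertex, a maximal disk that leans on the punctures at two points determines the corner
of the vertex at which it lies. -/
lemma exists_nhds_toDisk_ne [Tame Q] {u : Q.DiskMap} (h3 : 3 ≤ (Q.leanPoints u).encard)
    {a a' b b' : Circle} (ha : IsNext (Q.leanPoints u) a a') (hb : IsNext (Q.leanPoints u) b b')
    (hab : a ≠ b) : ∃ O ∈ 𝓝 u, ∃ U ∈ 𝓝 a, ∃ U' ∈ 𝓝 a', ∃ V ∈ 𝓝 b, ∃ V' ∈ 𝓝 b', ∀ v ∈ O, ∀ v' ∈ O,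
      ∀ x ∈ U, ∀ x' ∈ U', ∀ y ∈ V, ∀ y' ∈ V', y ≠ y' → Q.leanPoints v = {x, x'} →
        Q.leanPoints v' = {y, y'} → Q.toDisk v ≠ Q.toDisk v' := by
  have hmax := isMaximal_of_three_le h3
  obtain ⟨C⟩ := hmax.collar
  obtain ⟨N1, hN₁, U, hU, V, hV, h1⟩ := exists_nhds_mob_ne hab
  -- if the corners were exchanged, then there would be no third point
  obtain ⟨N2, hN₂, U2, hU2, U', hU', V2, hV₂, V', hV', h2⟩ : ∃ N ∈ 𝓝 ((1, 0) : ℂ × ℂ),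
      ∃ U ∈ 𝓝 a, ∃ U' ∈ 𝓝 a', ∃ V ∈ 𝓝 b, ∃ V' ∈ 𝓝 b', ∀ z ∈ N, ∀ x ∈ U, ∀ x' ∈ U', ∀ y ∈ V,
        ∀ y' ∈ V', mob z.1 z.2 y ≠ x' ∨ mob z.1 z.2 y' ≠ x := by
    by_cases hba : a' = b
    · have hab' : a ≠ b' := by
        rintro rfl
        subst hba
        have h4 := subset_of_isNext (A := {a, a'}) hmax.finite_leanPoints ha.1 (by simp) (by
            rintro c (rfl | rfl) d hd
            · exact Or.inr (hd.unique ha)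
            · exact Or.inl (hd.unique hb))
        have h5 := h3.trans (Set.encard_le_encard h4)
        rw [Set.encard_pair hab] at h5
        exact absurd h5 (by norm_num)
      obtain ⟨N, hN, U, hU, V, hV, h⟩ := exists_nhds_mob_ne hab'
      exact ⟨N, hN, U, hU, _, univ_mem, _, univ_mem, V, hV, fun z hz x hx _ _ _ _ y hy =>
        Or.inr (h z hz x hx y hy)⟩
    · obtain ⟨N, hN, U, hU, V, hV, h⟩ := exists_nhds_mob_ne hba
      exact ⟨N, hN, _, univ_mem, U, hU, V, hV, _, univ_mem, fun z hz _ _ x hx y hy _ _ =>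
        Or.inl (h z hz x hx y hy)⟩
  by_contra! hcon
  obtain ⟨l, q, hl, hq, h4, h5⟩ := exists_mob_of_frequently C (u' := u) (T := (N1 ∩ N2)ᶜ)
    fun hev => by
      rw [nhds_prod_eq] at hev
      obtain ⟨O, hO, O', hO', hsub⟩ := mem_prod_iff.1 hev
      obtain ⟨v, hv, v', hv', x, hx, x', hx', y, hy, y', hy', hne, e1, e2, e3⟩ :=
        hcon (O ∩ O') (inter_mem hO hO') (U ∩ U2) (inter_mem hU hU2) U' hU' (V ∩ V2)
          (inter_mem hV hV₂) V' hV'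
      obtain ⟨l, q, hl, hq, rfl⟩ := exists_eq_mob_of_toDisk_eq e3.symm
      refine hsub (Set.mk_mem_prod hv.1 hv'.2) ⟨l, q, hl, hq, rfl, fun hN => ?_⟩
      rw [leanPoints_mob, e1] at e2
      have hy1 : mobCircle hl hq y ∈ ({x, x'} : Set Circle) := e2.symm.subset (Or.inl rfl)
      have hy2 : mobCircle hl hq y' ∈ ({x, x'} : Set Circle) := e2.symm.subset (Or.inr rfl)
      rcases hy1 with hy1 | hy1
      · exact h1 _ hN.1 x hx.1 y hy.1 (congrArg Subtype.val hy1)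
      rcases hy2 with hy2 | hy2
      · exact (h2 _ hN.2 x hx.2 x' hx' y hy.2 y' hy').elim (· (congrArg Subtype.val hy1))
          (· (congrArg Subtype.val hy2))
      · exact hne ((mobCircle hl hq).injective (hy1.trans hy2.symm))
  obtain ⟨rfl, rfl⟩ := mob_eq_id_of_invariant (Tame.ext u hmax) hl hq fun w hw => by
    rw [← extend_mob u hl hq hw, ← h4]
  rw [closure_compl, Set.mem_compl_iff, mem_interior_iff_mem_nhds] at h5
  exact h5 (inter_mem hN₁ hN₂)

variable [CompactSpace S] [Tame Q] {G G' : FatGraph} {h : G.Realization ≃ₜ Q.MaxDisk}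
  {h' : G'.Realization ≃ₜ Q.MaxDisk}

lemma t2Space_maxDisk_of_tame : T2Space Q.MaxDisk :=
  t2Space_maxDisk (Q := Q) Tame.cusp fun x u h => Tame.ext u (by rw [IsMaximal, h]; exact x.2)

/-- The dart lies at the corner of `u` from `a` to the next point `a'`: its disks are represented
by maps near `u` that lean on the punctures at two points near `a` and `a'`. -/
def AtCorner (h : G.Realization ≃ₜ Q.MaxDisk) (u : Q.DiskMap) (d : G.Dart) (a a' : Circle) : Prop :=
  IsNext (Q.leanPoints u) a a' ∧ ∀ O ∈ 𝓝 u, ∀ U ∈ 𝓝 a, ∀ V ∈ 𝓝 a',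
    ∀ᶠ t in 𝓝[>] (0 : unitInterval), ∃ v ∈ O, Q.toDisk v = (h (G.point d t)).1 ∧
      ∃ b ∈ U, ∃ c ∈ V, b ≠ c ∧ Q.leanPoints v = {b, c}

lemma IsDiskModel.vertex_iff (H : IsDiskModel Q G h) (H' : IsDiskModel Q G' h') (x : Q.MaxDisk) :
    (∃ d, h (G.point d 0) = x) ↔ ∃ d, h' (G'.point d 0) = x := by
  rw [H.vertices x _ (Quotient.out_eq _), H'.vertices x _ (Quotient.out_eq _)]

lemma IsDiskModel.ne_vertex (H : IsDiskModel Q G h) (H' : IsDiskModel Q G' h') {d : G.Dart}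
    {t : unitInterval} (h0 : 0 < t) (h1 : t < 1) (e : G'.Dart) :
    h (G.point d t) ≠ h' (G'.point e 0) := fun he => by
  obtain ⟨f, hf⟩ := (H.vertex_iff H' _).2 ⟨e, he.symm⟩
  exact (FatGraph.point_eq_zero (h.injective hf).symm).elim h0.ne' h1.ne

/-- Darts of two models at the same corner have the same germ. -/
lemma AtCorner.eventually (H : IsDiskModel Q G h) (H' : IsDiskModel Q G' h') {x : Q.MaxDisk}
    {u : Q.DiskMap} (hu : Q.toDisk u = x.1) {d : G.Dart} {a a' : Circle} (hd : h (G.point d 0) = x)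
    (ha : AtCorner h u d a a') {d' : G'.Dart} {α : G'.Dart → Circle}
    (hα : ∀ e, h' (G'.point e 0) = x → AtCorner h' u e (α e) (α (G'.next e)) ∧ (a = α e → e = d')) :
    ∀ᶠ t in 𝓝[>] (0 : unitInterval), ∃ s : unitInterval, (s : ℝ) < 1 / 2 ∧
      h (G.point d t) = h' (G'.point d' s) := by
  have := t2Space_maxDisk_of_tame (Q := Q)
  by_contra hcon
  obtain ⟨𝒰, h𝒰'⟩ := exists_ultrafilter_iff.2 (frequently_iff_neBot.1 (not_eventually.1 hcon))
  obtain ⟨h𝒰, hev⟩ := le_inf_iff.1 h𝒰'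
  rw [le_principal_iff] at hev
  have hIoo : Set.Ioo (0 : unitInterval) 1 ∈ (𝒰 : Filter unitInterval) :=
    h𝒰 (Ioo_mem_nhdsGT zero_lt_one)
  choose e τ hτ he using fun t => G'.exists_point_le (h'.symm (h (G.point d t)))
  have he' : ∀ t, h (G.point d t) = h' (G'.point (e t) (τ t)) := fun t => h'.symm_apply_eq.1 (he t)
  have := G'.finite
  obtain ⟨e₀, he₀⟩ := Ultrafilter.eq_pure_of_finite (𝒰.map e)
  have hee : ∀ᶠ t in (𝒰 : Filter unitInterval), e t = e₀ := by
    have h1 : ({e₀} : Set G'.Dart) ∈ 𝒰.map e := by rw [he₀]; exact rfl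
    exact h1
  obtain ⟨τ0, -, hτ0⟩ := isCompact_univ.ultrafilter_le_nhds (𝒰.map τ) (by simp)
  have hτ0 : Tendsto τ 𝒰 (𝓝 τ0) := hτ0
  have hlim : h' (G'.point e₀ τ0) = x := by
    refine tendsto_nhds_unique (f := fun t => h (G.point d t)) (l := (𝒰 : Filter unitInterval)) ?_ ?_
    · refine (((h'.continuous.comp (G'.continuous_point e₀)).tendsto τ0).comp hτ0).congr' ?_
      filter_upwards [hee] with t ht
      rw [he' t, ht]; rfl
    · rw [← hd]
      exact ((h.continuous.comp (G.continuous_point d)).tendsto 0).mono_left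
        (h𝒰.trans nhdsWithin_le_nhds)
  obtain ⟨f, hf⟩ := (H.vertex_iff H' x).1 ⟨d, hd⟩
  obtain rfl : τ0 = 0 := by
    refine (FatGraph.point_eq_zero (h'.injective (hlim.trans hf.symm))).resolve_right ?_
    rintro rfl
    have h1 := le_of_tendsto ((continuous_subtype_val.tendsto _).comp hτ0) (Eventually.of_forall hτ)
    norm_num at h1
  obtain ⟨⟨hn, hgeo⟩, hinj⟩ := hα e₀ hlim
  have hne : a ≠ α e₀ := fun h1 => by
    have h2 := ((continuous_subtype_val.tendsto _).comp hτ0).eventually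
      (gt_mem_nhds (show ((0 : unitInterval) : ℝ) < 1 / 2 by norm_num))
    obtain ⟨t, h3, h4, h5⟩ := (h2.and (hee.and hev)).exists
    exact h5 ⟨τ t, h3, by rw [he' t, h4, hinj h1]⟩
  have hτ1 : Tendsto τ 𝒰 (𝓝[>] 0) := tendsto_nhdsWithin_iff.2 ⟨hτ0, by
    filter_upwards [hIoo] with t ht
    exact unitInterval.pos_iff_ne_zero.2 fun h0 => H.ne_vertex H' ht.1 ht.2 (e t) (h0 ▸ he' t)⟩
  obtain ⟨O, hO, U, hU, U', hU', V, hV, V', hV', hsep⟩ := exists_nhds_toDisk_ne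
    ((H.vertices x u hu).1 ⟨d, hd⟩) ha.1 hn hne
  obtain ⟨t, ⟨v, hv, h1, y, hy, z, hz, -, h2⟩, ⟨v', hv', h3, y', hy', z', hz', h4, h5⟩, h6⟩ :=
    (((ha.2 O hO U hU U' hU').filter_mono h𝒰).and
      ((hτ1.eventually (hgeo O hO V hV V' hV')).and hee)).exists
  exact hsep v hv v' hv' y hy z hz y' hy' z' hz' h4 h2 h5 (by rw [h1, h3, he' t, h6])

lemma IsDiskModel.exists_label (H : IsDiskModel Q G h) : ∃ a : Q.MaxDisk → G.Dart → Circle,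
    ∀ d x, h (G.point d 0) = x →
      Set.BijOn (a x) {d | h (G.point d 0) = x} (Q.leanPoints (Quotient.out x.1)) ∧
      AtCorner h (Quotient.out x.1) d (a x d) (a x (G.next d)) := by
  have hex : ∀ x, ∃ a : G.Dart → Circle, (∃ d, h (G.point d 0) = x) → _ := fun x => by
    by_cases hx : ∃ d, h (G.point d 0) = x
    · exact (H.cyclic x _ (Quotient.out_eq _) hx).imp fun a ha _ => ha
    · simp [*]
  choose a ha using hex
  exact ⟨a, fun d x hd => ⟨(ha x ⟨d, hd⟩).1, (ha x ⟨d, hd⟩).2.1 d hd, (ha x ⟨d, hd⟩).2.2 d hd⟩⟩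

/-- The fat graph structure of the space of maximal disks is unique. -/
lemma IsDiskModel.exists_equiv (H : IsDiskModel Q G h) (H' : IsDiskModel Q G' h') :
    ∃ φ : G.Dart ≃ G'.Dart,
      (∀ d, φ (G.rev d) = G'.rev (φ d)) ∧ (∀ d, φ (G.next d) = G'.next (φ d)) ∧
      ∀ d, ∀ᶠ t in 𝓝[>] (0 : unitInterval), ∃ s : unitInterval, (s : ℝ) < 1 / 2 ∧
        h (G.point d t) = h' (G'.point (φ d) s) := by
  obtain ⟨a, ha⟩ := H.exists_label
  obtain ⟨a', ha'⟩ := H'.exists_label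
  have hex : ∀ d, ∃ d', h' (G'.point d' 0) = h (G.point d 0) ∧
      a' (h (G.point d 0)) d' = a (h (G.point d 0)) d := fun d => by
    obtain ⟨f, hf⟩ := (H.vertex_iff H' _).1 ⟨d, rfl⟩
    exact (ha' f _ hf).1.surjOn ((ha d _ rfl).1.mapsTo rfl)
  choose φ hφ hφa using hex
  have key : ∀ {x d d'}, h (G.point d 0) = x → h' (G'.point d' 0) = x → a x d = a' x d' →
      d' = φ d := by
    rintro _ d d' rfl hd' h1
    exact (ha' d' _ hd').1.injOn hd' (hφ d) (h1.symm.trans (hφa d).symm)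
  have hinj : Function.Injective φ := fun d e hde => by
    have h1 : h (G.point d 0) = h (G.point e 0) := by rw [← hφ, hde, hφ]
    refine (ha d _ rfl).1.injOn rfl h1.symm ?_
    rw [← hφa d, h1, ← hφa e, hde]
  have hsurj : Function.Surjective φ := fun d' => by
    obtain ⟨f, hf⟩ := (H.vertex_iff H' _).2 ⟨d', rfl⟩
    obtain ⟨d, hd, h1⟩ := (ha f _ hf).1.surjOn ((ha' d' _ rfl).1.mapsTo rfl)
    exact ⟨d, (key hd rfl h1).symm⟩
  have hgerm : ∀ d, ∀ᶠ t in 𝓝[>] (0 : unitInterval), ∃ s : unitInterval, (s : ℝ) < 1 / 2 ∧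
      h (G.point d t) = h' (G'.point (φ d) s) := fun d =>
    (ha d _ rfl).2.eventually H H' (Quotient.out_eq _) rfl fun e he =>
      ⟨(ha' e _ he).2, fun h1 => key rfl he h1⟩
  refine ⟨Equiv.ofBijective φ ⟨hinj, hsurj⟩, fun d => ?_, fun d => ?_, hgerm⟩
  · have hIoo := Ioo_mem_nhdsGT (show (0 : unitInterval) < 1 from zero_lt_one)
    have : (𝓝[>] (0 : unitInterval)).NeBot := nhdsGT_neBot_of_exists_gt ⟨1, zero_lt_one⟩
    obtain ⟨t, ⟨s, -, h1⟩, h2⟩ := ((hgerm d).and hIoo).exists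
    obtain ⟨t', ⟨s', -, h3⟩, h4⟩ := ((hgerm (G.rev d)).and hIoo).exists
    rw [← G.point_rev, G.rev_rev] at h3
    refine (FatGraph.mem_of_path (f := fun t => h'.symm (h (G.point d t)))
      (h'.symm.continuous.comp (h.continuous.comp (G.continuous_point d)))
      (fun t h5 h6 e h7 => H.ne_vertex H' h5 h6 e (h'.symm_apply_eq.1 h7)) h2
      (t := unitInterval.symm t') ?_ (h'.symm_apply_eq.2 h1) (h'.symm_apply_eq.2 h3)).resolve_left
      fun h5 => G.rev_ne d (hinj h5)
    have h5 := h4.1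
    have h6 := h4.2
    rw [← Subtype.coe_lt_coe] at h5 h6
    constructor <;> rw [← Subtype.coe_lt_coe, unitInterval.coe_symm_eq] <;> simp at * <;> assumption
  · have h1 : h (G.point (G.next d) 0) = h (G.point d 0) := by rw [G.point_next]
    refine (key h1 ((congrArg h' (G'.point_next _)).trans (hφ d)) ?_).symm
    have h2 := (ha' (φ d) _ (hφ d)).2.1
    rw [hφa d] at h2
    exact (ha d _ rfl).2.1.unique h2

end Uniqueness

end ProjSurf

end

theorem mainTheorem3 {S : Type*} [TopologicalSpace S] [T2Space S] [CompactSpace S]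
    [ConnectedSpace S] [ChartedSpace ℂ S] [IsManifold 𝓘(ℂ) ω S]
    (P : Set S) (hP : P.Finite) (hyp : ProjSurf.UniformizedByDisk S P)
    (Q : ProjSurf.ProjectiveStructure S P) (hreg : Q.IsRegular)
    (hext : ∀ (x : Q.MaxDisk) (u : Q.DiskMap), Q.toDisk u = x.1 → Q.ExtendsToClosedDisk u) :
    -- a maximal disk leans on the punctures at a finite number of points, at least two
    (∀ (x : Q.MaxDisk) (u : Q.DiskMap), Q.toDisk u = x.1 →
      (Q.leanPoints u).Finite ∧ 2 ≤ (Q.leanPoints u).encard) ∧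
    -- the space of maximal disks is a fat graph
    (∃ (G : ProjSurf.FatGraph) (h : G.Realization ≃ₜ Q.MaxDisk), ProjSurf.IsDiskModel Q G h) ∧
    -- the fat graph structure is canonical
    (∀ (G G' : ProjSurf.FatGraph) (h : G.Realization ≃ₜ Q.MaxDisk)
      (h' : G'.Realization ≃ₜ Q.MaxDisk),
      ProjSurf.IsDiskModel Q G h → ProjSurf.IsDiskModel Q G' h' →
      ∃ φ : G.Dart ≃ G'.Dart,
        (∀ d, φ (G.rev d) = G'.rev (φ d)) ∧ (∀ d, φ (G.next d) = G'.next (φ d)) ∧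
        ∀ d, ∀ᶠ t in 𝓝[>] (0 : unitInterval),
          ∃ s : unitInterval, (s : ℝ) < 1 / 2 ∧ h (G.point d t) = h' (G'.point (φ d) s)) := by
  have : ProjSurf.Tame Q := ⟨hP, fun _ hp => ProjSurf.exists_cuspModel hP hreg hp, hyp,
    fun u hu => hext ⟨Q.toDisk u, hu⟩ u rfl⟩
  refine ⟨fun x u hu => ?_, ?_, fun G G' h h' H H' => H.exists_equiv H'⟩
  · have hmax : ProjSurf.IsMaximal u := by rw [ProjSurf.IsMaximal, hu]; exact x.2
    obtain ⟨C⟩ := hmax.collar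
    exact ⟨hmax.finite_leanPoints, C.two_le_encard (hext x u hu) hmax⟩
  · obtain ⟨D⟩ := ProjSurf.exists_dartSystem (Q := Q)
    obtain ⟨h, hh⟩ := D.exists_homeo
    exact ⟨D.graph, h, D.isDiskModel hh⟩
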